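/- For an integer $n\ge 0$ let Conjecture $\mathrm{B}_n$ be the following statement. Let $V$ be an $n$-dimensional projective variety over an algebraically closed field $k$ of characteristic zero, with only rational singularities and with $K_V$ linearly trivial ($K_V\sim 0$). Let $A\subseteq k$ be any finitely generated $\mathbb{Z}$-subalgebra and let $V_A$ be any model of $V$ over $A$, i.e. a flat scheme of finite type over $\operatorname{Spec} A$ together with an isomorphism $V_A\times_{\operatorname{Spec} A}\operatorname{Spec} k\cong V$ over $k$. Then there exists a dense subset $S\subseteq\operatorname{Spec} A$ consisting of closed points such that for every $s\in S$ the natural Frobenius action (induced by $a\mapsto a^p$ on $\mathcal{O}_{V_s}$, where $p$ is the characteristic of the finite field $\kappa(s)$) on $H^n(V_s,\mathcal{O}_{V_s})$ is bijective, where $V_s$ is the fibre of $V_A$ over $s$. Lemma. For every integer $n\ge 0$, Conjecture $\mathrm{B}_{n+1}$ implies Conjecture $\mathrm{B}_n$. -/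

import Mathlib

open CategoryTheory CategoryTheory.Limits AlgebraicGeometry TopologicalSpace

universe u

noncomputable section

namespace ConjB

/-! ### The structure sheaf as a sheaf of abelian groups, cohomology, Frobenius -/

/-- The structure sheaf of a scheme, regarded as a sheaf of abelian groups. -/
def structureAbSheaf (X : Scheme.{u}) :
    Sheaf (Opens.grothendieckTopology X) AddCommGrpCat.{u} :=
  (sheafCompose (Opens.grothendieckTopology X)
    (forget₂ CommRingCat.{u} RingCat.{u} ⋙ forget₂ RingCat.{u} AddCommGrpCat.{u})).obj X.sheaf

/-- The sheaf cohomology group `Hⁱ(X, 𝒪_X)` for the Zariski topology. -/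
abbrev cohomologyO (X : Scheme.{u}) (i : ℕ) : Type u :=
  CategoryTheory.Sheaf.H (structureAbSheaf X) i

lemma natCast_section_eq_zero {X : Scheme.{u}} {p : ℕ} (h : (p : Γ(X, ⊤)) = 0)
    (U : X.Opens) : (p : Γ(X, U)) = 0 := by
  have := congrArg (X.presheaf.map (homOfLE (le_top : U ≤ ⊤)).op).hom h
  simpa using this

/-- The `p`-th power map on a commutative ring in which the prime `p` is zero (the zero ring is
allowed), as an additive map. -/
def powAddHom (R : Type u) [CommRing R] (p : ℕ) (hp : p.Prime) (h : (p : R) = 0) : R →+ R where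
  toFun a := a ^ p
  map_zero' := zero_pow hp.ne_zero
  map_add' a b := by
    rw [add_pow_prime_eq hp, h]
    simp

/-- The Frobenius endomorphism `a ↦ a ^ p` of the structure sheaf of a scheme on which the
prime `p` is zero. -/
def frobeniusSheafHom (X : Scheme.{u}) (p : ℕ) (hp : p.Prime) (h : (p : Γ(X, ⊤)) = 0) :
    structureAbSheaf X ⟶ structureAbSheaf X where
  hom :=
    { app := fun U => AddCommGrpCat.ofHom
        (powAddHom Γ(X, U.unop) p hp (natCast_section_eq_zero h U.unop))
      naturality := fun U V f => by
        ext a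
        exact (map_pow (X.presheaf.map f).hom (show Γ(X, U.unop) from a) p).symm }

/-- The natural Frobenius action on `Hⁱ(X, 𝒪_X)`. -/
def frobeniusAction (X : Scheme.{u}) (p : ℕ) (hp : p.Prime) (h : (p : Γ(X, ⊤)) = 0) (i : ℕ) :
    cohomologyO X i →+ cohomologyO X i :=
  Sheaf.H.map (frobeniusSheafHom X p hp h) i

/-- On a scheme over a field of characteristic `p` the number `p` is zero. -/
lemma natCast_eq_zero_of_hom {X : Scheme.{u}} {K : CommRingCat.{u}} (q : X ⟶ Spec K) {p : ℕ}
    [CharP K p] : (p : Γ(X, ⊤)) = 0 := by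
  have h : (p : K) = 0 := CharP.cast_eq_zero K p
  rw [← map_natCast ((Scheme.ΓSpecIso K).inv ≫ q.appTop).hom p, h, map_zero]

/-! ### Projective varieties, rational singularities, the canonical divisor -/

attribute [local instance] MvPolynomial.gradedAlgebra

/-- The projective space `ℙᴺ` over `k`. -/
def projectiveSpace (k : Type u) [Field k] (N : ℕ) : Scheme.{u} :=
  Proj (MvPolynomial.homogeneousSubmodule (Fin (N + 1)) k)

/-- The structure morphism `ℙᴺ ⟶ Spec k`. -/
def projectiveSpaceHom (k : Type u) [Field k] (N : ℕ) :
    projectiveSpace k N ⟶ Spec (.of k) :=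
  Proj.toSpecZero (MvPolynomial.homogeneousSubmodule (Fin (N + 1)) k) ≫
    Spec.map (CommRingCat.ofHom
      (algebraMap k (MvPolynomial.homogeneousSubmodule (Fin (N + 1)) k 0)))

/-- `V` is a projective variety of dimension `n` over `k`: an integral closed subscheme of some
projective space. -/
structure IsProjectiveVariety {k : Type u} [Field k] {V : Scheme.{u}} (q : V ⟶ Spec (.of k))
    (n : ℕ) : Prop where
  integral : IsIntegral V
  projective : ∃ (N : ℕ) (i : V ⟶ projectiveSpace k N),
    IsClosedImmersion i ∧ i ≫ projectiveSpaceHom k N = q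
  dim : topologicalKrullDim V = n

instance pushforward_additive {X Y : TopCat.{u}} (f : X ⟶ Y) :
    (TopCat.Sheaf.pushforward AddCommGrpCat.{u} f).Additive where
  map_add := rfl

/-- The higher direct image `Rⁱπ_* 𝒪_Y`: the right derived functors of the pushforward of abelian
sheaves, applied to the structure sheaf. -/
def higherDirectImageO {Y V : Scheme.{u}} (π : Y ⟶ V) (i : ℕ) : TopCat.Sheaf AddCommGrpCat.{u} V :=
  ((TopCat.Sheaf.pushforward AddCommGrpCat.{u} π.base).rightDerived i).obj (structureAbSheaf Y)

/-- `π : Y ⟶ V` is a resolution of singularities of the `k`-variety `V`: `Y` is a smooth variety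
and `π` is proper and birational. -/
structure IsResolution {k : Type u} [Field k] {Y V : Scheme.{u}} (q : V ⟶ Spec (.of k))
    (π : Y ⟶ V) : Prop where
  integral : IsIntegral Y
  smooth : Smooth (π ≫ q)
  proper : IsProper π
  birational : ∃ U : V.Opens, (U : Set V).Nonempty ∧ IsIso (π ∣_ U)

/-- `V` has only rational singularities: there is a resolution `π : Y ⟶ V` with
`𝒪_V = π_* 𝒪_Y` (so that `V` is normal) and `Rⁱπ_* 𝒪_Y = 0` for all `i > 0`. -/
def HasRationalSingularities {k : Type u} [Field k] {V : Scheme.{u}} (q : V ⟶ Spec (.of k)) :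
    Prop :=
  ∃ (Y : Scheme.{u}) (π : Y ⟶ V), IsResolution q π ∧
    (∀ U : V.Opens, IsIso (π.app U)) ∧
    ∀ i : ℕ, 0 < i → IsZero (higherDirectImageO π i)

/-- For a field extension `K / k` and a subring `R` of `K`, the `R`-submodule of `⋀ⁿ Ω_{K/k}`
generated by the forms `da₁ ∧ ⋯ ∧ daₙ` with all `aⱼ ∈ R`. If `R` is a `k`-algebra, it is the image
of `⋀ⁿ Ω_{R/k}`. -/
def formLattice (k K : Type u) [Field k] [Field K] [Algebra k K] (R : Subring K) (n : ℕ) :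
    Submodule R (⋀[K]^n (Ω[K⁄k])) :=
  Submodule.span R
    (Set.range fun a : Fin n → R =>
      exteriorPower.ιMulti K n fun j => KaehlerDifferential.D k K (a j : K))

/-- The function field of an integral `k`-scheme as a `k`-algebra. -/
abbrev functionFieldAlgebra {k : Type u} [Field k] {V : Scheme.{u}} [IsIntegral V]
    (q : V ⟶ Spec (.of k)) : Algebra k V.functionField :=
  ((Scheme.ΓSpecIso (.of k)).inv ≫ q.appTop ≫ V.presheaf.germ ⊤ (genericPoint V) trivial).hom.toAlgebra

/-- The local ring `𝒪_{V,x}` as a subring of the function field. -/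
def localSubring (V : Scheme.{u}) [IsIntegral V] (x : V) : Subring V.functionField :=
  (algebraMap (V.presheaf.stalk x) V.functionField).range

/-- `K_V ∼ 0` for a normal variety `V` of dimension `n` over an algebraically closed field of
characteristic zero. The canonical divisors of `V` are the divisors `div ω` of the nonzero rational
`n`-forms `ω ∈ ⋀ⁿ Ω_{k(V)/k}`, and they form one linear equivalence class, so `K_V ∼ 0` says that
`div ω = 0` for some `ω`. At a point `x` of codimension one, where `V` is smooth over `k`, the
regular forms are the free `𝒪_{V,x}`-module of rank one `⋀ⁿ Ω_{𝒪_{V,x}/k}` inside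
`⋀ⁿ Ω_{k(V)/k}`, and the coefficient of `div ω` at `x` is zero if and only if `ω` generates it. -/
def IsCanonicalTrivial {k : Type u} [Field k] {V : Scheme.{u}} [IsIntegral V]
    (q : V ⟶ Spec (.of k)) (n : ℕ) : Prop :=
  letI := functionFieldAlgebra q
  ∃ ω : ⋀[V.functionField]^n (Ω[V.functionField⁄k]), ω ≠ 0 ∧
    ∀ x : V, ringKrullDim (V.presheaf.stalk x) = 1 →
      formLattice k V.functionField (localSubring V x) n =
        Submodule.span (localSubring V x) {ω}

/-! ### Models and the conjecture -/

/-- A model of the `k`-scheme `V` over a subring `A` of `k`: a flat scheme `X` of finite type over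
`Spec A` together with an isomorphism `X ×_A k ≅ V` over `k`. -/
structure Model {k : Type u} [Field k] {V : Scheme.{u}} (q : V ⟶ Spec (.of k))
    (A : Subalgebra ℤ k) where
  /-- the total space of the model -/
  X : Scheme.{u}
  /-- its structure morphism -/
  f : X ⟶ Spec (.of A)
  /-- the projection of `V ≅ X ×_A k` to `X` -/
  g : V ⟶ X
  locallyOfFiniteType : LocallyOfFiniteType f
  quasiCompact : QuasiCompact f
  flat : Flat f
  isPullback : IsPullback g q f (Spec.map (CommRingCat.ofHom (algebraMap A k)))

/-- The natural Frobenius action on `Hⁿ(X_s, 𝒪)` is bijective, where `X_s` is the fibre of `f` at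
`s`, a scheme over the residue field `κ(s)`; this includes that `κ(s)` has positive
characteristic. -/
def FrobeniusBijectiveAt {X T : Scheme.{u}} (f : X ⟶ T) (s : T) (n : ℕ) : Prop :=
  ∃ (p : ℕ) (hp : p.Prime) (_ : CharP (T.residueField s) p),
    Function.Bijective (frobeniusAction (f.fiber s) p hp
      (natCast_eq_zero_of_hom (f.fiberToSpecResidueField s)) n)

/-- Conjecture `B_n`: for every `n`-dimensional projective variety `V` with only rational
singularities and `K_V ∼ 0` over an algebraically closed field `k` of characteristic zero, and for
every model of `V` over a finitely generated `ℤ`-subalgebra `A` of `k`, there is a dense set of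
closed points `s` of `Spec A` at which the Frobenius action on `Hⁿ(V_s, 𝒪)` is bijective. -/
def ConjectureB (n : ℕ) : Prop :=
  ∀ (k : Type u) [Field k] [IsAlgClosed k] [CharZero k] (V : Scheme.{u}) [IsIntegral V]
    (q : V ⟶ Spec (.of k)),
    IsProjectiveVariety q n → HasRationalSingularities q → IsCanonicalTrivial q n →
    ∀ (A : Subalgebra ℤ k), A.FG → ∀ M : Model q A,
      ∃ S : Set (Spec (.of A)), (∀ s ∈ S, IsClosed {s}) ∧ Dense S ∧
        ∀ s ∈ S, FrobeniusBijectiveAt M.f s n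

end ConjB

end

/-! Multiply by a curve of genus one. Let E be the projective curve over ℤ glued from two copies of
y² = x⁴ + 1 along x ↦ 1/x, y ↦ y/x². If V satisfies the hypotheses of B_n, then V × E satisfies
those of B_{n+1}; if M is a model of V over A, then M × E is a model of V × E over the same A. The
dense set that B_{n+1} provides for M × E also serves for M, by a statement about each fibre T
separately: if Frobenius is bijective on Hⁿ⁺¹(T × E, 𝒪), then it is bijective on Hⁿ(T, 𝒪).

The statement about fibres is a Künneth argument. H⁰(E, 𝒪) consists of the constants and H¹(E, 𝒪) is
free of rank one on the class e of y/x, so Hⁿ⁺¹(T × E) is the sum of e ⊗ Hⁿ(T) and the pullback of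
Hⁿ⁺¹(T). Frobenius sends e ⊗ m to e ⊗ kF(m), where the integer k is the coefficient of y/x in
(y/x)^p. Hence injectivity on the product gives injectivity on Hⁿ(T). For surjectivity write a
preimage of e ⊗ m as e ⊗ m' plus the pullback of some n. Restriction to T × chart shows F(n) = 0, so
m = kF(m') = F(km'). The value of k, good reduction of E and vanishing of Hⁿ⁺¹(T) play no role, so
an arbitrary model, with fibres that need not be proper, and every residue characteristic are
covered. The algebra is `ChartSplitting.frobenius_transfer`, the geometry
`AbSheaf.frobenius_bijective_of_chartSplitting`. The inputs are the Mayer–Vietoris sequence of the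
two charts, the identification of Hⁿ(T × Spec C) with C ⊗ Hⁿ(T) (`flatBaseChange_bijective`), and
the explicit splitting `Quartic.chartSplitting`.

The hypotheses on V × E are checked in charts. E is the intersection of the quadrics X₁² = X₀X₂ and
X₃² = X₀² + X₂² in ℙ³, and a Segre map embeds the product (`exists_isClosedImmersion`). The
projection to V is smooth, since 2 is invertible; a rational resolution of V pulls back to one of
the product by flat base change (`hasRationalSingularities_of_isPullback`). If ω generates the
regular n-forms of V in codimension one, then dx/(2y) ∧ ω does so on the product
(`isCanonicalTrivial_of_isPullback`).

Cohomology over U is handled as Ext out of the free abelian sheaf on U. This covers Leray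
comparison, Mayer–Vietoris, vanishing on affine opens (`acyclic_of_isAffineOpen`) and base change by
one formalism of dimension shifting. -/

noncomputable section

/-! ### Free abelian sheaves on open sets. -/

namespace AbSheaf

open Abelian Opposite

variable {X Y : TopCat.{u}}

/-- Sheaves of abelian groups on a topological space. -/
abbrev AbSh (X : TopCat.{u}) := TopCat.Sheaf AddCommGrpCat.{u} X

instance abSh_hasExt (X : TopCat.{u}) : HasExt.{u} (AbSh X) := inferInstance

instance abSh_enoughInjectives (X : TopCat.{u}) : EnoughInjectives (AbSh X) := inferInstance

instance pullback_preservesFiniteLimits (f : X ⟶ Y) :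
    PreservesFiniteLimits (TopCat.Sheaf.pullback AddCommGrpCat.{u} f) :=
  Functor.sheafPullbackConstruction.preservesFiniteLimits _ _ _ _

instance pullback_preservesFiniteColimits (f : X ⟶ Y) :
    PreservesFiniteColimits (TopCat.Sheaf.pullback AddCommGrpCat.{u} f) :=
  PreservesColimits.preservesFiniteColimits _

instance pullback_additive (f : X ⟶ Y) :
    (TopCat.Sheaf.pullback AddCommGrpCat.{u} f).Additive :=
  Functor.additive_of_preserves_binary_products _

/-- The free abelian sheaf on an open subset. -/
def freeSh (U : Opens X) : AbSh X :=
  (presheafToSheaf (Opens.grothendieckTopology X) _).obj (yoneda.obj U ⋙ AddCommGrpCat.free)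

/-- Functoriality of `freeSh`. -/
def freeShMap {U V : Opens X} (h : U ≤ V) : freeSh U ⟶ freeSh V :=
  (presheafToSheaf (Opens.grothendieckTopology X) _).map
    (Functor.whiskerRight (yoneda.map (homOfLE h)) _)

/-- Opens form a poset, so the map of representables is injective; both the free group functor and
sheafification preserve monomorphisms. -/
instance {U V : Opens X} (h : U ≤ V) : Mono (freeShMap h) := by
  have : Mono (Functor.whiskerRight (yoneda.map (homOfLE h)) AddCommGrpCat.free) := by
    have (W : (Opens X)ᵒᵖ) : Mono ((Functor.whiskerRight (yoneda.map (homOfLE h))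
        AddCommGrpCat.free).app W) := by
      have : Mono ((yoneda.map (homOfLE h)).app W) := by
        rw [mono_iff_injective]
        intro a b _
        exact Subsingleton.elim (α := W.unop ⟶ U) a b
      exact inferInstanceAs (Mono (AddCommGrpCat.free.map ((yoneda.map (homOfLE h)).app W)))
    exact NatTrans.mono_of_mono_app _
  exact inferInstanceAs (Mono ((presheafToSheaf (Opens.grothendieckTopology X) _).map
    (Functor.whiskerRight (yoneda.map (homOfLE h)) AddCommGrpCat.free)))

/-- The canonical section of `freeSh U` over `U`. -/
def freeGen (U : Opens X) : (freeSh U).obj.obj (op U) :=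
  (toSheafify (Opens.grothendieckTopology X) (yoneda.obj U ⋙ AddCommGrpCat.free)).app (op U)
    (FreeAbelianGroup.of (𝟙 U))

lemma freeShMap_gen {U V : Opens X} (h : U ≤ V) :
    (freeShMap h).hom.app (op U) (freeGen U) =
      (freeSh V).obj.map (homOfLE h).op (freeGen V) := by
  unfold freeShMap freeGen
  have h1 := toSheafify_naturality (Opens.grothendieckTopology X)
    (Functor.whiskerRight (yoneda.map (homOfLE h)) AddCommGrpCat.free)
  have h2 := congrArg (fun t => t.app (op U) (FreeAbelianGroup.of (𝟙 U))) h1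
  have h3 := congrArg (fun t => t (FreeAbelianGroup.of (𝟙 V)))
    ((toSheafify (Opens.grothendieckTopology X)
      (yoneda.obj V ⋙ AddCommGrpCat.free)).naturality (homOfLE h).op)
  refine h2.symm.trans (Eq.trans ?_ h3)
  rfl

/-- Evaluation at the canonical section. -/
def evalGen (U : Opens X) (F : AbSh X) : (freeSh U ⟶ F) →+ F.obj.obj (op U) where
  toFun f := f.hom.app (op U) (freeGen U)
  map_zero' := rfl
  map_add' _ _ := rfl

lemma evalGen_comp (U : Opens X) {F G : AbSh X} (f : freeSh U ⟶ F) (g : F ⟶ G) :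
    evalGen U G (f ≫ g) = g.hom.app (op U) (evalGen U F f) := rfl

lemma evalGen_precomp {U V : Opens X} (h : U ≤ V) {F : AbSh X} (f : freeSh V ⟶ F) :
    evalGen U F (freeShMap h ≫ f) = F.obj.map (homOfLE h).op (evalGen V F f) := by
  change f.hom.app _ ((freeShMap h).hom.app (op U) (freeGen U)) = _
  rw [freeShMap_gen]
  exact congrArg (fun t => t (freeGen V)) (f.hom.naturality (homOfLE h).op)

/-- Composite of three universal properties: sheafification, free abelian groups, Yoneda. -/
lemma evalGen_bijective (U : Opens X) (F : AbSh X) : Function.Bijective (evalGen U F) := by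
  let e1 := (sheafificationAdjunction (Opens.grothendieckTopology X) AddCommGrpCat.{u}).homEquiv
    (yoneda.obj U ⋙ AddCommGrpCat.free) F
  let e2 := (AddCommGrpCat.adj.{u}.whiskerRight (Opens X)ᵒᵖ).homEquiv (yoneda.obj U) F.obj
  let e3 := yonedaEquiv (X := U) (F := F.obj ⋙ CategoryTheory.forget _)
  have : (evalGen U F : _ → _) = (e1.trans (e2.trans e3) : _ → _) := by
    funext f
    rfl
  rw [this]
  exact (e1.trans (e2.trans e3)).bijective

/-- Homomorphisms from `freeSh U` are sections over `U`. -/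
def homEquivSec (U : Opens X) (F : AbSh X) : (freeSh U ⟶ F) ≃+ F.obj.obj (op U) :=
  AddEquiv.ofBijective _ (evalGen_bijective U F)

/-- A section over the smaller open is a map out of its free sheaf, which extends along the
monomorphism into the free sheaf of the larger open. -/
lemma isFlasque_of_injective (I : AbSh X) [Injective I] : I.IsFlasque where
  epi {U V} i := by
    rw [AddCommGrpCat.epi_iff_surjective]
    intro s
    obtain ⟨f, rfl⟩ := (evalGen_bijective _ I).2 s
    refine ⟨evalGen U.unop I (Injective.factorThru f (freeShMap i.unop.le)), ?_⟩
    have := evalGen_precomp i.unop.le (Injective.factorThru f (freeShMap i.unop.le))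
    rw [Injective.comp_factorThru] at this
    exact this.symm

end AbSheaf

end

/-! ### Vanishing of Ext and the edge map of an adjunction. -/

noncomputable section

namespace AbSheaf

open Abelian Opposite

section ExtVanish

universe w v₁ u₁ v₂ u₂

variable {C : Type u₁} [Category.{v₁} C] [Abelian C] [HasExt.{w} C]
  {D : Type u₂} [Category.{v₂} D] [Abelian D] [HasExt.{w} D]

/-- All higher Ext groups from `A` to `F` vanish. -/
def ExtVanish (A F : C) : Prop := ∀ (i : ℕ) (x : Ext.{w} A F (i + 1)), x = 0

lemma ExtVanish.of_injective (A F : C) [Injective F] : ExtVanish A F :=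
  fun _ x => x.eq_zero_of_injective

lemma ExtVanish.of_iso {A B F G : C} (e : A ≅ B) (e' : F ≅ G) (h : ExtVanish A F) :
    ExtVanish B G := by
  intro i x
  have h0 := h i (((Ext.mk₀ e.hom).comp x (zero_add _)).comp (Ext.mk₀ e'.inv) (add_zero _))
  have h1 := congrArg (fun t => ((Ext.mk₀ e.inv).comp t (zero_add _)).comp (Ext.mk₀ e'.hom)
    (add_zero _)) h0
  simpa using h1

lemma ExtVanish.exists_lift {A : C} {S : ShortComplex C} (hS : S.ShortExact)
    (h : ExtVanish A S.X₁) (q : A ⟶ S.X₃) : ∃ r : A ⟶ S.X₂, r ≫ S.g = q := by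
  obtain ⟨y, hy⟩ := Ext.covariant_sequence_exact₃ A hS (Ext.mk₀ q) (zero_add 1) (h 0 _)
  obtain ⟨r, rfl⟩ := (Ext.mk₀_bijective _ _).2 y
  refine ⟨r, (Ext.mk₀_bijective _ _).1 ?_⟩
  simpa using hy

lemma ExtVanish.shift {A : C} {S : ShortComplex C} (hS : S.ShortExact)
    (h₁ : ExtVanish A S.X₁) (h₂ : ExtVanish A S.X₂) : ExtVanish A S.X₃ := by
  intro i x
  obtain ⟨y, rfl⟩ := Ext.covariant_sequence_exact₃ A hS x rfl (h₁ _ _)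
  rw [h₂ i y, Ext.zero_comp]

/-- An object inside an injective one, with the quotient. -/
def injSES [EnoughInjectives C] (F : C) : ShortComplex C :=
  ShortComplex.mk (Injective.ι F) (cokernel.π (Injective.ι F)) (cokernel.condition _)

omit [HasExt.{w} C] in
lemma injSES_shortExact [EnoughInjectives C] (F : C) : (injSES F).ShortExact where
  exact := ShortComplex.exact_cokernel _
  mono_f := inferInstanceAs (Mono (Injective.ι F))
  epi_g := inferInstanceAs (Epi (cokernel.π (Injective.ι F)))

instance [EnoughInjectives C] (F : C) : Injective (injSES F).X₂ :=
  inferInstanceAs (Injective (Injective.under F))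

/-- Dimension shifting. `Ext¹` is the obstruction to lifting maps through the quotient of an
injective, which `hl` excludes; `hs` keeps the class stable under passing to that quotient, so
higher degrees reduce to the first. -/
theorem ExtVanish.of_induction [EnoughInjectives C] (A : C) (P : C → Prop)
    (hl : ∀ F, P F → ∀ q : A ⟶ (injSES F).X₃, ∃ r, r ≫ (injSES F).g = q)
    (hs : ∀ F, P F → P (injSES F).X₃) : ∀ F, P F → ExtVanish A F := by
  intro F hF i
  induction i generalizing F with
  | zero =>
    intro x
    obtain ⟨y, rfl⟩ := Ext.covariant_sequence_exact₁ A (injSES_shortExact F) x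
      (Ext.eq_zero_of_injective _) rfl
    obtain ⟨q, rfl⟩ := (Ext.mk₀_bijective _ _).2 y
    obtain ⟨r, rfl⟩ := hl F hF q
    rw [← Ext.mk₀_comp_mk₀, Ext.comp_assoc _ _ _ (zero_add 0) (zero_add 1) (by simp)]
    simp
    rfl
  | succ i ih =>
    intro x
    obtain ⟨y, rfl⟩ := Ext.covariant_sequence_exact₁ A (injSES_shortExact F) x
      (Ext.eq_zero_of_injective _) rfl
    rw [ih _ (hs F hF) y, Ext.zero_comp]
    rfl

variable {L : C ⥤ D} {R : D ⥤ C} (adj : L ⊣ R) [L.Additive] [PreservesFiniteLimits L]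
  [PreservesFiniteColimits L]

/-- The edge map `Extⁿ(A, R G) → Extⁿ(L A, G)` of an adjunction with exact left adjoint. -/
def edge (A : C) (G : D) (n : ℕ) : Ext.{w} A (R.obj G) n →+ Ext.{w} (L.obj A) G n :=
  ((Ext.mk₀ (adj.counit.app G)).postcomp _ (add_zero n)).comp (L.mapExtAddHom A (R.obj G) n)

lemma edge_apply (A : C) (G : D) (n : ℕ) (x : Ext.{w} A (R.obj G) n) :
    edge adj A G n x =
      (x.mapExactFunctor L).comp (Ext.mk₀ (adj.counit.app G)) (add_zero n) := rfl

lemma edge_postcomp (A : C) {G H : D} (f : G ⟶ H) (n : ℕ) (x : Ext.{w} A (R.obj G) n) :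
    edge adj A H n (x.comp (Ext.mk₀ (R.map f)) (add_zero n)) =
      (edge adj A G n x).comp (Ext.mk₀ f) (add_zero n) := by
  rw [edge_apply, edge_apply, Ext.mapExactFunctor_comp, Ext.mapExactFunctor_mk₀,
    Ext.comp_assoc_of_third_deg_zero, Ext.comp_assoc_of_third_deg_zero, Ext.mk₀_comp_mk₀,
    Ext.mk₀_comp_mk₀]
  exact congrArg (fun t => (x.mapExactFunctor L).comp (Ext.mk₀ t) (add_zero n))
    (adj.counit_naturality f)

/-- In degree zero the edge map is the Hom-set bijection of the adjunction. -/
lemma edge_zero_bijective (A : C) (G : D) : Function.Bijective (edge.{w} adj A G 0) := by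
  have : (edge.{w} adj A G 0 : _ → _) =
      Ext.addEquiv₀.symm ∘ (adj.homEquiv A G).symm ∘ Ext.addEquiv₀ := by
    funext x
    obtain ⟨f, rfl⟩ := (Ext.mk₀_bijective _ _).2 x
    rw [edge_apply, Ext.mapExactFunctor_mk₀, Ext.mk₀_comp_mk₀]
    apply Ext.addEquiv₀.injective
    have h (X Y : D) (g : X ⟶ Y) : Ext.addEquiv₀ (Ext.mk₀.{w} g) = g :=
      (Ext.mk₀_bijective _ _).1 (by simp)
    have h' (X Y : C) (g : X ⟶ Y) : Ext.addEquiv₀ (Ext.mk₀.{w} g) = g :=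
      (Ext.mk₀_bijective _ _).1 (by simp)
    simp [h, h', Adjunction.homEquiv_counit]
  rw [this]
  exact (Ext.addEquiv₀.symm.bijective.comp (adj.homEquiv A G).symm.bijective).comp
    Ext.addEquiv₀.bijective

/-- The edge map is bijective for objects that are acyclic for the right adjoint. -/
theorem edge_bijective [EnoughInjectives D] [R.Additive] (P : D → Prop)
    (hR : ∀ G, P G → ((injSES G).map R).ShortExact)
    (hs : ∀ G, P G → P (injSES G).X₃) (A : C) (n : ℕ) :
    ∀ G, P G → Function.Bijective (edge.{w} adj A G n) := by
  induction n with
  | zero => exact fun G _ => edge_zero_bijective adj A G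
  | succ n ih =>
    intro G hG
    have hS := injSES_shortExact G
    have hRS := hR G hG
    -- A right adjoint of an exact functor preserves injectives, so the sequence after `R` can be
    -- used for dimension shifting as well.
    have hI : Injective ((injSES G).map R).X₂ :=
      Injective.injective_of_adjoint adj (injSES G).X₂
    let e : Ext.{w} (R.obj (injSES G).X₃) (R.obj (injSES G).X₁) 1 := hRS.extClass
    -- The counit is a morphism of short exact sequences; naturality of extension classes makes the
    -- edge map commute with the connecting maps.
    have he : (e.mapExactFunctor L).comp (Ext.mk₀ (adj.counit.app (injSES G).X₁)) (add_zero 1) =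
        (Ext.mk₀ (adj.counit.app (injSES G).X₃)).comp hS.extClass (zero_add 1) := by
      let φ : ((injSES G).map R).map L ⟶ injSES G :=
        { τ₁ := adj.counit.app _
          τ₂ := adj.counit.app _
          τ₃ := adj.counit.app _
          comm₁₂ := (adj.counit_naturality _).symm
          comm₂₃ := (adj.counit_naturality _).symm }
      have h1 : e.mapExactFunctor L = (hRS.map_of_exact L).extClass :=
        Ext.mapExactFunctor_extClass L hRS
      rw [h1]
      exact ShortComplex.ShortExact.extClass_naturality (hRS.map_of_exact L) hS φ
    have key : ∀ x : Ext.{w} A (R.obj (injSES G).X₃) n,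
        edge adj A (injSES G).X₁ (n + 1) (x.comp e rfl) =
          (edge adj A (injSES G).X₃ n x).comp hS.extClass rfl := by
      intro x
      rw [edge_apply, edge_apply, Ext.mapExactFunctor_comp,
        Ext.comp_assoc _ _ _ _ (add_zero 1) (by omega), he,
        Ext.comp_assoc _ _ _ _ (zero_add 1) (by omega)]
    -- On both sides the group in degree n + 1 is a cokernel of a map between groups in degree n,
    -- because higher Ext into an injective vanishes.
    refine AddMonoidHom.bijective_of_surjective_of_bijective_of_right_exact
      ((Ext.mk₀ ((injSES G).map R).g).postcomp A (add_zero n))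
      (hRS.extClass.postcomp A rfl)
      ((Ext.mk₀ (injSES G).g).postcomp (L.obj A) (add_zero n))
      (hS.extClass.postcomp (L.obj A) rfl)
      (edge adj A (injSES G).X₂ n) (edge adj A (injSES G).X₃ n) (edge adj A G (n + 1))
      ?_ ?_ ?_ ?_ ?_ (ih _ (hs G hG)) ?_ ?_
    · ext x
      exact (edge_postcomp adj A (injSES G).g n x).symm
    · ext x
      exact (key x).symm
    · exact (ShortComplex.ab_exact_iff_function_exact _).1
        (Ext.covariant_sequence_exact₃' A hRS n (n + 1) rfl)
    · exact (ShortComplex.ab_exact_iff_function_exact _).1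
        (Ext.covariant_sequence_exact₃' (L.obj A) hS n (n + 1) rfl)
    · cases n with
      | zero => exact (edge_zero_bijective adj A _).2
      | succ n => exact fun y => ⟨0, (Ext.eq_zero_of_injective y).symm ▸ map_zero _⟩
    · exact fun x => Ext.covariant_sequence_exact₁ A hRS x (Ext.eq_zero_of_injective _) rfl
    · exact fun x => Ext.covariant_sequence_exact₁ _ hS x (Ext.eq_zero_of_injective _) rfl

end ExtVanish

end AbSheaf

end

/-! ### Acyclic sheaves, Leray comparison and direct images. -/

noncomputable section

namespace AbSheaf

open Abelian Opposite

variable {X Y : TopCat.{u}}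

/-- All higher cohomology of `F` over `U` vanishes. -/
abbrev Acyclic (F : AbSh X) (U : Opens X) : Prop := ExtVanish.{u} (freeSh U) F

lemma Acyclic.surjective {S : ShortComplex (AbSh X)} (hS : S.ShortExact) {U : Opens X}
    (h : Acyclic S.X₁ U) : Function.Surjective (S.g.hom.app (op U)) := by
  intro s
  obtain ⟨q, rfl⟩ := (evalGen_bijective U S.X₃).2 s
  obtain ⟨r, rfl⟩ := h.exists_lift hS q
  exact ⟨evalGen U _ r, rfl⟩

lemma exists_lift_of_surjective {F G : AbSh X} (φ : F ⟶ G) {U : Opens X}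
    (h : Function.Surjective (φ.hom.app (op U))) (q : freeSh U ⟶ G) :
    ∃ r : freeSh U ⟶ F, r ≫ φ = q := by
  obtain ⟨s, hs⟩ := h (evalGen U G q)
  obtain ⟨r, rfl⟩ := (evalGen_bijective U F).2 s
  exact ⟨r, (evalGen_bijective U G).1 hs⟩

/-- Dimension shifting inside the flasque sheaves: the quotient of an injective by a flasque sheaf
is flasque, and sections lift to it. -/
lemma acyclic_of_isFlasque (F : AbSh X) (hF : F.IsFlasque) (U : Opens X) : Acyclic F U := by
  refine ExtVanish.of_induction _ (fun F => TopCat.Sheaf.IsFlasque F) ?_ ?_ F hF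
  · intro F hF q
    have : (injSES F).X₁.IsFlasque := hF
    have := TopCat.Sheaf.IsFlasque.epi_of_shortExact (U := U) (injSES_shortExact F)
    exact exists_lift_of_surjective _ ((AddCommGrpCat.epi_iff_surjective _).1 this) q
  · intro F hF
    have : (injSES F).X₁.IsFlasque := hF
    have : (injSES F).X₂.IsFlasque := isFlasque_of_injective _
    exact TopCat.Sheaf.IsFlasque.of_shortExact_of_isFlasque₁₂ (injSES_shortExact F)

lemma epi_of_basis {F G : AbSh X} (φ : F ⟶ G) {B : Set (Opens X)} (hB : Opens.IsBasis B)
    (h : ∀ W ∈ B, Function.Surjective (φ.hom.app (op W))) : Epi φ := by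
  rw [← TopCat.Sheaf.isLocallySurjective_iff_epi, TopCat.Presheaf.isLocallySurjective_iff]
  intro U t x hx
  obtain ⟨W, hW, hxW, hWU⟩ := Opens.isBasis_iff_nbhd.1 hB hx
  exact ⟨W, hWU, h W hW _, hxW⟩

/-- The map to the kernel sheaf is an epimorphism as soon as it is surjective on sections over a
basis. -/
lemma exact_of_basis (S : ShortComplex (AbSh X)) {B : Set (Opens X)} (hB : Opens.IsBasis B)
    (h : ∀ W ∈ B, ∀ x : freeSh W ⟶ S.X₂, x ≫ S.g = 0 → ∃ y, y ≫ S.f = x) : S.Exact := by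
  rw [S.exact_iff_epi_kernel_lift]
  refine epi_of_basis _ hB fun W hW s => ?_
  obtain ⟨k, rfl⟩ := (evalGen_bijective W _).2 s
  obtain ⟨y, hy⟩ := h W hW (k ≫ kernel.ι S.g) (by simp)
  refine ⟨evalGen W _ y, ?_⟩
  rw [← evalGen_comp]
  congr 1
  rw [← cancel_mono (kernel.ι S.g), ← hy]
  simp

instance (f : X ⟶ Y) : (TopCat.Sheaf.pushforward AddCommGrpCat.{u} f).Additive where

/-- The adjunction between inverse and direct image. -/
abbrev adj (f : X ⟶ Y) := TopCat.Sheaf.pullbackPushforwardAdjunction AddCommGrpCat.{u} f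

/-- The canonical map from a free sheaf to the inverse image of a free sheaf. -/
def pbFree (f : X ⟶ Y) (W : Opens Y) :
    freeSh ((Opens.map f).obj W) ⟶
      (TopCat.Sheaf.pullback AddCommGrpCat.{u} f).obj (freeSh W) :=
  (homEquivSec ((Opens.map f).obj W)
    ((TopCat.Sheaf.pullback AddCommGrpCat.{u} f).obj (freeSh W))).symm
      (((adj f).unit.app (freeSh W)).hom.app (op W) (freeGen W))

lemma evalGen_homEquivSec_symm (U : Opens X) (F : AbSh X) (s : F.obj.obj (op U)) :
    evalGen U F ((homEquivSec U F).symm s) = s := (homEquivSec U F).apply_symm_apply s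

lemma evalGen_pbFree (f : X ⟶ Y) (W : Opens Y) :
    evalGen ((Opens.map f).obj W) _ (pbFree f W) =
      ((adj f).unit.app (freeSh W)).hom.app (op W) (freeGen W) :=
  evalGen_homEquivSec_symm _ _ _

lemma evalGen_pbFree_comp (f : X ⟶ Y) (W : Opens Y) (G : AbSh X)
    (g : (TopCat.Sheaf.pullback AddCommGrpCat.{u} f).obj (freeSh W) ⟶ G) :
    evalGen _ G (pbFree f W ≫ g) = evalGen W _ ((adj f).homEquiv _ _ g) := by
  refine (evalGen_comp _ _ _).trans ((congrArg _ (evalGen_pbFree f W)).trans ?_)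
  rfl

/-- Both sheaves corepresent sections over f⁻¹W: one directly, the other through the adjunction with
direct image. -/
instance (f : X ⟶ Y) (W : Opens Y) : IsIso (pbFree f W) := by
  rw [isIso_iff_coyoneda_map_bijective]
  intro G
  refine (Function.Bijective.of_comp_iff' (evalGen_bijective _ G) _).1 ?_
  have : (fun g => evalGen _ G (pbFree f W ≫ g)) =
      evalGen W _ ∘ (adj f).homEquiv (freeSh W) G := by
    funext g
    exact evalGen_pbFree_comp f W G g
  change Function.Bijective (fun g => evalGen _ G (pbFree f W ≫ g))
  rw [this]
  exact (evalGen_bijective _ _).comp ((adj f).homEquiv _ _).bijective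

/-- The Leray comparison map `Hⁿ(W, f_* F) → Hⁿ(f⁻¹ W, F)`. -/
def leray (f : X ⟶ Y) (F : AbSh X) (W : Opens Y) (n : ℕ) :
    Ext.{u} (freeSh W) ((TopCat.Sheaf.pushforward AddCommGrpCat.{u} f).obj F) n →+
      Ext.{u} (freeSh ((Opens.map f).obj W)) F n :=
  ((Ext.mk₀ (pbFree f W)).precomp F (zero_add n)).comp (edge (adj f) (freeSh W) F n)

lemma mk₀_precomp_bijective {C : Type*} [Category C] [Abelian C] [HasExt.{u} C] {A B : C}
    (φ : A ⟶ B) [IsIso φ] (F : C) (n : ℕ) :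
    Function.Bijective ((Ext.mk₀.{u} φ).precomp F (zero_add n)) := by
  refine Function.bijective_iff_has_inverse.2
    ⟨(Ext.mk₀.{u} (inv φ)).precomp F (zero_add n), fun x => ?_, fun x => ?_⟩ <;> simp

lemma leray_apply (f : X ⟶ Y) (F : AbSh X) (W : Opens Y) (n : ℕ) (x) :
    leray f F W n x = (Ext.mk₀ (pbFree f W)).comp (edge (adj f) (freeSh W) F n x)
      (zero_add n) := rfl

lemma leray_postcomp (f : X ⟶ Y) {F G : AbSh X} (φ : F ⟶ G) (W : Opens Y) (n : ℕ) (x) :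
    leray f G W n (x.comp (Ext.mk₀ ((TopCat.Sheaf.pushforward AddCommGrpCat.{u} f).map φ))
      (add_zero n)) = (leray f F W n x).comp (Ext.mk₀ φ) (add_zero n) := by
  rw [leray_apply, leray_apply, edge_postcomp]
  exact (Ext.comp_assoc_of_third_deg_zero _ _ _ _).symm

lemma pushforward_shortExact (f : X ⟶ Y) {S : ShortComplex (AbSh X)} (hS : S.ShortExact)
    {B : Set (Opens Y)} (hB : Opens.IsBasis B)
    (h : ∀ W ∈ B, Function.Surjective (S.g.hom.app (op ((Opens.map f).obj W)))) :
    (S.map (TopCat.Sheaf.pushforward AddCommGrpCat.{u} f)).ShortExact := by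
  have : PreservesLimitsOfSize.{0, 0} (TopCat.Sheaf.pushforward AddCommGrpCat.{u} f) :=
    (adj f).rightAdjoint_preservesLimits
  have := hS.mono_f
  exact
    { exact := hS.exact.map_of_mono_of_preservesKernel _ inferInstance inferInstance
      mono_f := inferInstanceAs (Mono ((TopCat.Sheaf.pushforward AddCommGrpCat.{u} f).map S.f))
      epi_g := epi_of_basis _ hB h }

/-- Acyclicity over the inverse images of a basis replaces the vanishing of higher direct images: it
makes the direct image of the injective sequence exact and passes to the quotient. -/
theorem edge_pushforward_bijective (f : X ⟶ Y) (F : AbSh X) {B : Set (Opens Y)}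
    (hB : Opens.IsBasis B) (h : ∀ W ∈ B, Acyclic F ((Opens.map f).obj W)) (A : AbSh Y) (n : ℕ) :
    Function.Bijective (edge (adj f) A F n) := by
  refine edge_bijective (adj f) (fun G => ∀ W ∈ B, Acyclic G ((Opens.map f).obj W)) ?_ ?_ A n F h
  · intro G hG
    exact pushforward_shortExact f (injSES_shortExact G) hB
      fun W hW => Acyclic.surjective (injSES_shortExact G) (hG W hW)
  · exact fun G hG W hW => (hG W hW).shift (injSES_shortExact G) (.of_injective _ _)

theorem leray_bijective (f : X ⟶ Y) (F : AbSh X) {B : Set (Opens Y)}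
    (hB : Opens.IsBasis B) (h : ∀ W ∈ B, Acyclic F ((Opens.map f).obj W)) (W : Opens Y) (n : ℕ) :
    Function.Bijective (leray f F W n) :=
  (mk₀_precomp_bijective _ _ _).comp (edge_pushforward_bijective f F hB h _ n)

theorem acyclic_pushforward_iff (f : X ⟶ Y) (F : AbSh X) {B : Set (Opens Y)}
    (hB : Opens.IsBasis B) (h : ∀ W ∈ B, Acyclic F ((Opens.map f).obj W)) (W : Opens Y) :
    Acyclic ((TopCat.Sheaf.pushforward AddCommGrpCat.{u} f).obj F) W ↔
      Acyclic F ((Opens.map f).obj W) := by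
  have hb := fun n => leray_bijective f F hB h W n
  refine ⟨fun h' i x => ?_, fun h' i x =>
    (injective_iff_map_eq_zero _).1 (hb _).1 x (h' i _)⟩
  · obtain ⟨y, rfl⟩ := (hb _).2 x
    rw [h' i y, map_zero]

/-! ### Restriction to open subspaces -/

section Restriction

variable {j : X ⟶ Y} (hj : Topology.IsOpenEmbedding j)

/-- Restriction of abelian sheaves along an open embedding. -/
abbrev resOpen : AbSh Y ⥤ AbSh X := hj.sheafPullback AddCommGrpCat.{u}

lemma resOpen_shortExact {S : ShortComplex (AbSh Y)} (hS : S.ShortExact) :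
    ∃ h : (resOpen hj).map S.f ≫ (resOpen hj).map S.g = 0,
      (ShortComplex.mk _ _ h).ShortExact := by
  let e := hj.sheafPullbackIso AddCommGrpCat.{u}
  have h : (resOpen hj).map S.f ≫ (resOpen hj).map S.g = 0 := by
    rw [← Functor.map_comp, S.zero]
    rfl
  refine ⟨h, ShortComplex.shortExact_of_iso ?_
    (hS.map_of_exact (TopCat.Sheaf.pullback AddCommGrpCat.{u} j))⟩
  exact ShortComplex.isoMk (e.app _) (e.app _) (e.app _) (e.hom.naturality _).symm
    (e.hom.naturality _).symm

lemma isFlasque_resOpen (F : AbSh Y) [hF : F.IsFlasque] : ((resOpen hj).obj F).IsFlasque where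
  epi i := hF.epi (hj.functor.map i.unop).op

/-- Restriction is exact and an injective sheaf restricts to a flasque one, so dimension shifting on
Y can be followed on X. -/
lemma acyclic_of_resOpen (F : AbSh Y) (W : Opens X) (h : Acyclic ((resOpen hj).obj F) W) :
    Acyclic F (hj.functor.obj W) := by
  refine ExtVanish.of_induction _ (fun F => Acyclic ((resOpen hj).obj F) W) ?_ ?_ F h
  · intro F hF q
    obtain ⟨h0, hS⟩ := resOpen_shortExact hj (injSES_shortExact F)
    exact exists_lift_of_surjective (U := hj.functor.obj W) (injSES F).g
      (Acyclic.surjective hS hF) q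
  · intro F hF
    obtain ⟨h0, hS⟩ := resOpen_shortExact hj (injSES_shortExact F)
    have : ((injSES F).X₂).IsFlasque := isFlasque_of_injective _
    exact hF.shift hS (acyclic_of_isFlasque _ (isFlasque_resOpen hj _) W)

end Restriction

/-! ### Derived direct images -/

section Derived

variable (f : X ⟶ Y) {F : AbSh X} (I : InjectiveResolution F)

lemma adj_symm_zero {C D : Type*} [Category C] [Category D] [Preadditive C] [Preadditive D]
    {L : C ⥤ D} {R : D ⥤ C} (adj : L ⊣ R) [L.Additive] (A : C) (B : D) :
    (adj.homEquiv A B).symm 0 = 0 := by simp [Adjunction.homEquiv_counit]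

lemma adj_zero {C D : Type*} [Category C] [Category D] [Preadditive C] [Preadditive D]
    {L : C ⥤ D} {R : D ⥤ C} (adj : L ⊣ R) [R.Additive] (A : C) (B : D) :
    adj.homEquiv A B 0 = 0 := by simp [Adjunction.homEquiv_unit]

/-- The direct image of an injective resolution. -/
abbrev pushRes : CochainComplex (AbSh Y) ℕ :=
  ((TopCat.Sheaf.pushforward AddCommGrpCat.{u} f).mapHomologicalComplex _).obj I.cocomplex

lemma pushRes_exactAt (i : ℕ) :
    (pushRes f I).ExactAt i ↔
      IsZero (((TopCat.Sheaf.pushforward AddCommGrpCat.{u} f).rightDerived i).obj F) := by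
  rw [HomologicalComplex.exactAt_iff_isZero_homology]
  exact (I.isoRightDerivedObj (TopCat.Sheaf.pushforward AddCommGrpCat.{u} f) i).symm.isZero_iff

/-- By adjunction a cycle over a basic W is a map from the pulled-back free sheaf into the
resolution killed by the differential, that is, an Ext class of F over f⁻¹W. The class vanishes, so
the cycle is a boundary. -/
lemma pushRes_exactAt_of_acyclic {B : Set (Opens Y)} (hB : Opens.IsBasis B)
    (h : ∀ W ∈ B, Acyclic F ((Opens.map f).obj W)) (i : ℕ) :
    (pushRes f I).ExactAt (i + 1) := by
  rw [HomologicalComplex.exactAt_iff' _ i (i + 1) (i + 1 + 1) (by simp) (by simp)]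
  refine exact_of_basis _ hB fun W hW x hx => ?_
  let y := ((adj f).homEquiv _ _).symm x
  have hy : y ≫ I.cocomplex.d (i + 1) (i + 2) = 0 := by
    have := (adj f).homEquiv_naturality_right_symm x (I.cocomplex.d (i + 1) (i + 2))
    refine this.symm.trans ?_
    exact (congrArg _ hx).trans (adj_symm_zero (adj f) _ _)
  have hv : ExtVanish.{u} ((TopCat.Sheaf.pullback AddCommGrpCat.{u} f).obj (freeSh W)) F :=
    (h W hW).of_iso (asIso (pbFree f W)) (Iso.refl _)
  obtain ⟨g, hg⟩ := (I.extMk_eq_zero_iff y (i + 2) rfl hy i rfl).1 (hv i _)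
  refine ⟨(adj f).homEquiv _ _ g, ?_⟩
  refine ((adj f).homEquiv_naturality_right g (I.cocomplex.d i (i + 1))).symm.trans ?_
  rw [hg]
  exact ((adj f).homEquiv _ _).apply_symm_apply x

/-- If the higher direct images vanish, the direct image of an injective resolution is an
injective resolution. -/
def pushInjectiveResolution (h : ∀ i, (pushRes f I).ExactAt (i + 1)) :
    InjectiveResolution ((TopCat.Sheaf.pushforward AddCommGrpCat.{u} f).obj F) where
  cocomplex := pushRes f I
  injective n := Injective.injective_of_adjoint (adj f) (I.cocomplex.X n)
  ι := (CochainComplex.fromSingle₀Equiv _ _).symm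
    ⟨(TopCat.Sheaf.pushforward AddCommGrpCat.{u} f).map (I.ι.f 0), by
      have := I.ι_f_zero_comp_complex_d
      exact ((TopCat.Sheaf.pushforward AddCommGrpCat.{u} f).map_comp _ _).symm.trans
        ((congrArg _ this).trans (Functor.map_zero _ _ _))⟩
  quasiIso := ⟨fun n => by
    cases n
    · rw [CochainComplex.quasiIsoAt₀_iff, ShortComplex.quasiIso_iff_of_zeros]
      · have : PreservesLimitsOfSize.{0, 0} (TopCat.Sheaf.pushforward AddCommGrpCat.{u} f) :=
    (adj f).rightAdjoint_preservesLimits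
        refine (ShortComplex.exact_and_mono_f_iff_of_iso ?_).2
          ⟨I.exact₀.map_of_mono_of_preservesKernel
            (TopCat.Sheaf.pushforward AddCommGrpCat.{u} f) inferInstance inferInstance, ?_⟩
        · exact ShortComplex.isoMk (Iso.refl _) (Iso.refl _) (Iso.refl _)
            ((Category.id_comp _).trans
              ((CochainComplex.fromSingle₀Equiv_symm_apply_f_zero
                (C := pushRes f I) _ _).symm.trans (Category.comp_id _).symm))
            ((Category.id_comp _).trans (Category.comp_id _).symm)
        · exact inferInstanceAs (Mono ((TopCat.Sheaf.pushforward AddCommGrpCat.{u} f).map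
            (I.ι.f 0)))
      all_goals first
        | rfl
        | exact (congrArg (TopCat.Sheaf.pushforward AddCommGrpCat.{u} f).map
            (I.cocomplex.shape 0 0 (by simp))).trans (Functor.map_zero _ _ _)
    · rw [quasiIsoAt_iff_exactAt]
      · exact h _
      · apply CochainComplex.exactAt_succ_single_obj⟩

/-- The same adjunction read the other way: the pushed resolution now computes Ext into the direct
image, so vanishing downstairs bounds each cocycle upstairs. -/
lemma extVanish_of_pushRes_exactAt (h : ∀ i, (pushRes f I).ExactAt (i + 1)) (A : AbSh Y)
    (hA : ExtVanish.{u} A ((TopCat.Sheaf.pushforward AddCommGrpCat.{u} f).obj F)) :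
    ExtVanish.{u} ((TopCat.Sheaf.pullback AddCommGrpCat.{u} f).obj A) F := by
  intro i x
  obtain ⟨y, hy, rfl⟩ := I.extMk_surjective x (i + 2) rfl
  rw [I.extMk_eq_zero_iff y _ rfl hy i rfl]
  let J := pushInjectiveResolution f I h
  let x' : A ⟶ J.cocomplex.X (i + 1) := (adj f).homEquiv _ _ y
  have hx' : x' ≫ J.cocomplex.d (i + 1) (i + 2) = 0 := by
    refine ((adj f).homEquiv_naturality_right y (I.cocomplex.d (i + 1) (i + 2))).symm.trans ?_
    exact (congrArg _ hy).trans (adj_zero (adj f) _ _)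
  obtain ⟨g, hg⟩ := (J.extMk_eq_zero_iff x' (i + 2) rfl hx' i rfl).1 (hA i _)
  refine ⟨((adj f).homEquiv _ _).symm g, ?_⟩
  refine ((adj f).homEquiv_naturality_right_symm g (I.cocomplex.d i (i + 1))).symm.trans ?_
  refine (congrArg _ hg).trans ?_
  exact ((adj f).homEquiv _ _).symm_apply_apply y

end Derived

/-- This and its companion below translate between vanishing of the derived functors, in which
rational singularities are phrased, and acyclicity over inverse images, which is stable under base
change. -/
theorem acyclic_of_isZero_rightDerived (f : X ⟶ Y) (F : AbSh X)
    (h : ∀ i, 0 < i → IsZero (((TopCat.Sheaf.pushforward AddCommGrpCat.{u} f).rightDerived i).obj F))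
    (W : Opens Y) (hW : Acyclic ((TopCat.Sheaf.pushforward AddCommGrpCat.{u} f).obj F) W) :
    Acyclic F ((Opens.map f).obj W) := by
  let I := InjectiveResolution.of F
  exact (extVanish_of_pushRes_exactAt f I
    (fun i => (pushRes_exactAt f I _).2 (h _ i.succ_pos)) _ hW).of_iso
    (asIso (pbFree f W)).symm (Iso.refl _)

theorem isZero_rightDerived_of_acyclic (f : X ⟶ Y) (F : AbSh X) {B : Set (Opens Y)}
    (hB : Opens.IsBasis B) (h : ∀ W ∈ B, Acyclic F ((Opens.map f).obj W)) (i : ℕ) (hi : 0 < i) :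
    IsZero (((TopCat.Sheaf.pushforward AddCommGrpCat.{u} f).rightDerived i).obj F) := by
  obtain ⟨i, rfl⟩ := Nat.exists_eq_succ_of_ne_zero hi.ne'
  exact (pushRes_exactAt f (InjectiveResolution.of F) _).1 (pushRes_exactAt_of_acyclic f _ hB h i)

/-- The constant sheaf `ℤ` is the free sheaf on the whole space. -/
lemma nonempty_constantSheaf_iso (X : TopCat.{u}) :
    Nonempty ((constantSheaf (Opens.grothendieckTopology X) AddCommGrpCat.{u}).obj
      (AddCommGrpCat.of (ULift ℤ)) ≅ freeSh (⊤ : Opens X)) := by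
  let c : AbSh X := (constantSheaf (Opens.grothendieckTopology X) AddCommGrpCat.{u}).obj
      (AddCommGrpCat.of (ULift.{u} ℤ))
  let E (G : AbSh X) : (c ⟶ G) ≃ G.obj.obj (op ⊤) :=
    ((constantSheafAdj (Opens.grothendieckTopology X) AddCommGrpCat.{u}
      (Preorder.isTerminalTop (Opens X))).homEquiv _ G).trans
      (AddCommGrpCat.uliftZMultiplesAddEquiv _).toEquiv
  have hE {G H : AbSh X} (f : c ⟶ G) (g : G ⟶ H) : E H (f ≫ g) = g.hom.app (op ⊤) (E G f) := rfl
  let φ : freeSh (⊤ : Opens X) ⟶ c := (homEquivSec (⊤ : Opens X) c).symm (E c (𝟙 c))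
  have : IsIso φ := by
    rw [isIso_iff_coyoneda_map_bijective]
    intro G
    refine (Function.Bijective.of_comp_iff' (evalGen_bijective _ G) _).1 ?_
    have : (fun g => evalGen _ G (φ ≫ g)) = E G := by
      funext g
      refine (congrArg (g.hom.app (op ⊤)) (evalGen_homEquivSec_symm _ _ _)).trans ?_
      exact (hE _ _).symm.trans (by rw [Category.id_comp])
    change Function.Bijective (fun g => evalGen _ G (φ ≫ g))
    rw [this]
    exact (E G).bijective
  exact ⟨(asIso φ).symm⟩

end AbSheaf

end

/-! ### Mayer–Vietoris and vanishing of cohomology on affine opens. -/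

noncomputable section

namespace AbSheaf

open Abelian Opposite

variable {X Y : TopCat.{u}}

/-- Restriction of cohomology classes. -/
abbrev resExt {U V : Opens X} (h : U ≤ V) (F : AbSh X) (n : ℕ) :
    Ext.{u} (freeSh V) F n →+ Ext.{u} (freeSh U) F n :=
  (Ext.mk₀ (freeShMap h)).precomp F (zero_add n)

lemma freeShMap_comp {U V W : Opens X} (h : U ≤ V) (h' : V ≤ W) :
    freeShMap h ≫ freeShMap h' = freeShMap (h.trans h') := by
  apply (evalGen_bijective _ _).1
  rw [evalGen_precomp]
  change (freeSh W).obj.map _ ((freeShMap h').hom.app (op V) (freeGen V)) =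
    (freeShMap (h.trans h')).hom.app (op U) (freeGen U)
  rw [freeShMap_gen, freeShMap_gen]
  exact (congrArg (fun t => t (freeGen W))
    ((freeSh W).obj.map_comp (homOfLE h').op (homOfLE h).op)).symm

lemma freeShMap_refl (U : Opens X) : freeShMap (le_refl U) = 𝟙 (freeSh U) := by
  apply (evalGen_bijective _ _).1
  rw [← Category.comp_id (freeShMap _), evalGen_precomp]
  exact congrArg (fun t => t (freeGen U)) ((freeSh U).obj.map_id (op U))

lemma resExt_resExt {U V W : Opens X} (h : U ≤ V) (h' : V ≤ W) (F : AbSh X) (n : ℕ) (x) :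
    resExt h F n (resExt h' F n x) = resExt (h.trans h') F n x := by
  change (Ext.mk₀ _).comp ((Ext.mk₀ _).comp _ (zero_add n)) (zero_add n) =
    (Ext.mk₀ _).comp _ (zero_add n)
  rw [Ext.mk₀_comp_mk₀_assoc, freeShMap_comp]

lemma resExt_refl {U : Opens X} (F : AbSh X) (n : ℕ) (x) : resExt (le_refl U) F n x = x := by
  change (Ext.mk₀ _).comp _ (zero_add n) = _
  rw [freeShMap_refl, Ext.mk₀_id_comp]

/-- A sheaf has only one section over the empty set, so the identity of this free sheaf is zero. -/
lemma ext_freeSh_bot (F : AbSh X) (n : ℕ) (x : Ext.{u} (freeSh (⊥ : Opens X)) F n) : x = 0 := by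
  have h : 𝟙 (freeSh (⊥ : Opens X)) = 0 := by
    apply (evalGen_bijective _ _).1
    have := (AddCommGrpCat.isZero_iff_subsingleton).1
      ((isZero_zero _).of_iso ((freeSh (⊥ : Opens X)).isTerminalOfEmpty.uniqueUpToIso
        (isZero_zero _).isTerminal))
    exact Subsingleton.elim _ _
  rw [← Ext.mk₀_id_comp x, h, Ext.mk₀_zero, Ext.zero_comp]

lemma exists_injective_shortExact (F : AbSh X) :
    ∃ S : ShortComplex (AbSh X), S.ShortExact ∧ Injective S.X₂ ∧ F = S.X₁ :=
  ⟨injSES F, injSES_shortExact F, inferInstance, rfl⟩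

/-- A class of degree one comes from a section of a quotient of an injective sheaf, and such a
section lifts locally; higher degrees follow by shifting. -/
lemma exists_resExt_eq_zero {U : Opens X} (F : AbSh X) (n : ℕ) (x : Ext.{u} (freeSh U) F (n + 1))
    {p : X} (hp : p ∈ U) : ∃ (V : Opens X) (h : V ≤ U), p ∈ V ∧ resExt h F (n + 1) x = 0 := by
  induction n generalizing F with
  | zero =>
    obtain ⟨S, hS, hI, rfl⟩ := exists_injective_shortExact F
    obtain ⟨y, rfl⟩ := Ext.covariant_sequence_exact₁ _ hS x (Ext.eq_zero_of_injective _) rfl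
    obtain ⟨y, rfl⟩ := (Ext.mk₀_bijective _ _).2 y
    have hg := hS.epi_g
    rw [← TopCat.Sheaf.isLocallySurjective_iff_epi, TopCat.Presheaf.isLocallySurjective_iff] at hg
    obtain ⟨V, i, ⟨t, ht⟩, hV⟩ := hg U (evalGen U _ y) p hp
    refine ⟨V, i, hV, ?_⟩
    obtain ⟨r, rfl⟩ := (evalGen_bijective V _).2 t
    have hr : r ≫ S.g = freeShMap i ≫ y := by
      apply (evalGen_bijective V _).1
      rw [evalGen_precomp]
      exact ht
    change (Ext.mk₀ _).comp ((Ext.mk₀ _).comp _ (zero_add 1)) (zero_add 1) = 0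
    rw [Ext.mk₀_comp_mk₀_assoc, ← hr, ← Ext.mk₀_comp_mk₀_assoc,
      ShortComplex.ShortExact.comp_extClass, Ext.comp_zero]
  | succ n ih =>
    obtain ⟨S, hS, hI, rfl⟩ := exists_injective_shortExact F
    obtain ⟨y, rfl⟩ := Ext.covariant_sequence_exact₁ _ hS x (Ext.eq_zero_of_injective _) rfl
    obtain ⟨V, i, hV, hz⟩ := ih _ y
    refine ⟨V, i, hV, ?_⟩
    change (Ext.mk₀ _).comp _ (zero_add (n + 1)) = 0 at hz
    change (Ext.mk₀ _).comp _ (zero_add (n + 1 + 1)) = 0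
    rw [← Ext.comp_assoc _ _ _ (zero_add (n + 1)) rfl (by omega), hz, Ext.zero_comp]

/-- The Mayer–Vietoris short complex of free abelian sheaves. -/
abbrev mvSES (U V : Opens X) : ShortComplex (AbSh X) where
  X₁ := freeSh (U ⊓ V)
  X₂ := freeSh U ⊞ freeSh V
  X₃ := freeSh (U ⊔ V)
  f := biprod.lift (freeShMap (inf_le_left : U ⊓ V ≤ U)) (-freeShMap (inf_le_right : U ⊓ V ≤ V))
  g := biprod.desc (freeShMap (le_sup_left : U ≤ U ⊔ V)) (freeShMap (le_sup_right : V ≤ U ⊔ V))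
  zero := by simp [freeShMap_comp]

lemma mvSES_shortExact (U V : Opens X) : (mvSES U V).ShortExact :=
  (Opens.mayerVietorisSquare U V).shortComplex_shortExact

/-- A class vanishing on both opens is the coboundary of a class on the intersection, and
coboundaries of differences of restrictions are zero. -/
lemma mayerVietoris_eq_zero {U V : Opens X} (F : AbSh X) (n : ℕ)
    (x : Ext.{u} (freeSh (U ⊔ V)) F (n + 1)) (hU : resExt le_sup_left F _ x = 0)
    (hV : resExt le_sup_right F _ x = 0)
    (h : ∀ y : Ext.{u} (freeSh (U ⊓ V)) F n, ∃ a b,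
      y = resExt inf_le_left F n a - resExt inf_le_right F n b) : x = 0 := by
  have hS := mvSES_shortExact U V
  obtain ⟨y, hy⟩ := Ext.contravariant_sequence_exact₃ hS F x (by
    apply Ext.biprod_ext
    · rw [Ext.mk₀_comp_mk₀_assoc, Ext.comp_zero]
      simpa [mvSES] using hU
    · rw [Ext.mk₀_comp_mk₀_assoc, Ext.comp_zero]
      simpa [mvSES] using hV) (Nat.add_comm 1 n)
  obtain ⟨a, b, hab⟩ := h y
  have : y = (Ext.mk₀ (mvSES U V).f).comp
      ((Ext.mk₀ biprod.fst).comp a (zero_add n) + (Ext.mk₀ biprod.snd).comp b (zero_add n))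
        (zero_add n) := by
    rw [hab, Ext.comp_add, Ext.mk₀_comp_mk₀_assoc, Ext.mk₀_comp_mk₀_assoc]
    simp [mvSES, sub_eq_add_neg, Ext.mk₀_neg]
  rw [← hy, this, ← Ext.comp_assoc _ _ _ (add_zero 1) (zero_add n) (by omega),
    ShortComplex.ShortExact.extClass_comp, Ext.zero_comp]

section Affine

variable {S : Scheme.{u}}

open ConjB

/-- The structure sheaf as an object of the category of abelian sheaves. -/
def oSh (S : Scheme.{u}) : AbSh S.carrier := structureAbSheaf S

/-- Čech vanishing for two basic opens: with s = a/(fg)ⁿ and 1 = u fⁿ + v gⁿ one has s = av/fⁿ +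
au/gⁿ. -/
lemma exists_sub_eq_of_basicOpen {U : S.Opens} (hU : IsAffineOpen U) (f g : Γ(S, U))
    (h : IsCoprime f g) (s : Γ(S, S.basicOpen f ⊓ S.basicOpen g)) :
    ∃ (a : Γ(S, S.basicOpen f)) (b : Γ(S, S.basicOpen g)),
      s = S.presheaf.map (homOfLE inf_le_left).op a -
        S.presheaf.map (homOfLE inf_le_right).op b := by
  let W := S.basicOpen f ⊓ S.basicOpen g
  have hW : W ≤ U := inf_le_left.trans (S.basicOpen_le f)
  let r : Γ(S, U) →+* Γ(S, W) := (S.presheaf.map (homOfLE hW).op).hom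
  let rf : Γ(S, U) →+* Γ(S, S.basicOpen f) := (S.presheaf.map (homOfLE (S.basicOpen_le f)).op).hom
  let rg : Γ(S, U) →+* Γ(S, S.basicOpen g) := (S.presheaf.map (homOfLE (S.basicOpen_le g)).op).hom
  let qf : Γ(S, S.basicOpen f) →+* Γ(S, W) := (S.presheaf.map (homOfLE inf_le_left).op).hom
  let qg : Γ(S, S.basicOpen g) →+* Γ(S, W) := (S.presheaf.map (homOfLE inf_le_right).op).hom
  have hqf (x) : qf (rf x) = r x := by
    change (S.presheaf.map _ ≫ S.presheaf.map _).hom x = _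
    rw [← S.presheaf.map_comp]; rfl
  have hqg (x) : qg (rg x) = r x := by
    change (S.presheaf.map _ ≫ S.presheaf.map _).hom x = _
    rw [← S.presheaf.map_comp]; rfl
  have uf : IsUnit (rf f) := RingedSpace.isUnit_res_basicOpen _ f
  have ug : IsUnit (rg g) := RingedSpace.isUnit_res_basicOpen _ g
  obtain ⟨n, a, ha⟩ : ∃ (n : ℕ) (a : Γ(S, U)), s * r (f * g) ^ n = r a := by
    let := r.toAlgebra
    have : IsLocalization.Away (f * g) Γ(S, W) :=
      hU.isLocalization_of_eq_basicOpen (f * g) (homOfLE hW) (S.basicOpen_mul f g).symm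
    exact IsLocalization.Away.surj (f * g) s
  obtain ⟨u, v, huv⟩ := h.pow (m := n) (n := n)
  obtain ⟨a', ha'⟩ := ((uf.pow n).dvd : _ ∣ rf (a * v))
  obtain ⟨b', hb'⟩ := ((ug.pow n).dvd : _ ∣ rg (a * u))
  have wf : IsUnit (r f) := by rw [← hqf]; exact uf.map qf
  have wg : IsUnit (r g) := by rw [← hqg]; exact ug.map qg
  have ea : qf a' = s * r g ^ n * r v := by
    apply (wf.pow n).mul_left_cancel
    have := congrArg qf ha'
    rw [map_mul qf, map_pow, hqf, hqf, map_mul, ← ha, map_mul] at this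
    rw [← this]; ring
  have eb : qg b' = s * r f ^ n * r u := by
    apply (wg.pow n).mul_left_cancel
    have := congrArg qg hb'
    rw [map_mul qg, map_pow, hqg, hqg, map_mul, ← ha, map_mul] at this
    rw [← this]; ring
  refine ⟨a', -b', ?_⟩
  change s = qf a' - qg (-b')
  rw [map_neg, ea, eb]
  have := congrArg r huv
  simp only [map_add, map_mul, map_pow, map_one] at this
  linear_combination (-s) * this

lemma basicOpen_sup_eq_self {U : S.Opens} {f g : Γ(S, U)} (h : IsCoprime f g) :
    S.basicOpen f ⊔ S.basicOpen g = U := by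
  obtain ⟨u, v, huv⟩ := h
  refine le_antisymm (sup_le (S.basicOpen_le f) (S.basicOpen_le g)) ?_
  calc U = S.basicOpen (u * f + v * g) := by rw [huv, S.basicOpen_one]
    _ ≤ _ := (S.basicOpen_add_le _ _).trans (sup_le_sup
      ((S.basicOpen_mul _ _).trans_le inf_le_right) ((S.basicOpen_mul _ _).trans_le inf_le_right))

/-- Given a class on U, the functions f for which it dies on D(f) form an ideal, by Mayer–Vietoris.
Classes die locally, so this is the unit ideal. Induction on the degree disposes of the affine
overlaps. -/
theorem acyclic_of_isAffineOpen {U : S.Opens} (hU : IsAffineOpen U) :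
    Acyclic (oSh S) U := by
  intro i
  induction i using Nat.strong_induction_on generalizing U with
  | _ n ih =>
  have glue {U : S.Opens} (hU : IsAffineOpen U) (x : Ext.{u} (freeSh U) (oSh S) (n + 1))
      (f g : Γ(S, U)) (hfg : IsCoprime f g)
      (hf : resExt (S.basicOpen_le f) _ _ x = 0) (hg : resExt (S.basicOpen_le g) _ _ x = 0) :
      x = 0 := by
    have hsup : S.basicOpen f ⊔ S.basicOpen g = U := basicOpen_sup_eq_self hfg
    suffices key : ∀ y : Ext.{u} (freeSh (S.basicOpen f ⊓ S.basicOpen g)) (oSh S) n, ∃ a b,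
      y = resExt inf_le_left (oSh S) n a - resExt inf_le_right (oSh S) n b by
      revert hf hg key
      generalize_proofs h1 h2
      generalize S.basicOpen f = Uf at *
      generalize S.basicOpen g = Ug at *
      subst hsup
      exact fun hf hg key => mayerVietoris_eq_zero _ n x hf hg key
    intro y
    cases n with
    | zero =>
      obtain ⟨y, rfl⟩ := (Ext.mk₀_bijective _ _).2 y
      obtain ⟨a, b, hab⟩ := exists_sub_eq_of_basicOpen hU f g hfg (evalGen _ _ y)
      obtain ⟨a, rfl⟩ := (evalGen_bijective _ (oSh S)).2 a
      obtain ⟨b, rfl⟩ := (evalGen_bijective _ (oSh S)).2 b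
      refine ⟨Ext.mk₀ a, Ext.mk₀ b, ?_⟩
      change _ = (Ext.mk₀ _).comp _ (zero_add 0) - (Ext.mk₀ _).comp _ (zero_add 0)
      rw [Ext.mk₀_comp_mk₀, Ext.mk₀_comp_mk₀, sub_eq_add_neg, ← Ext.mk₀_neg, ← Ext.mk₀_add,
        ← sub_eq_add_neg]
      congr 1
      apply (evalGen_bijective _ (oSh S)).1
      rw [map_sub, evalGen_precomp, evalGen_precomp]
      exact hab
    | succ n =>
      refine ⟨0, 0, ?_⟩
      rw [map_zero, map_zero, sub_zero]
      refine ih n n.lt_succ_self ?_ y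
      rw [← S.basicOpen_mul]
      exact hU.basicOpen _
  intro x
  have mono {f g : Γ(S, U)} (h : S.basicOpen g ≤ S.basicOpen f)
      (hf : resExt (S.basicOpen_le f) _ _ x = 0) : resExt (S.basicOpen_le g) _ _ x = 0 := by
    rw [← resExt_resExt h (S.basicOpen_le f), hf, map_zero]
  let I : Ideal Γ(S, U) :=
    { carrier := {f | resExt (S.basicOpen_le f) _ _ x = 0}
      zero_mem' := by
        change resExt (S.basicOpen_le 0) _ _ x = 0
        rw [← resExt_resExt (S.basicOpen_zero U).le (bot_le : ⊥ ≤ U)]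
        exact (congrArg _ (ext_freeSh_bot _ _ _)).trans (map_zero _)
      add_mem' := by
        intro f g hf hg
        let φ : Γ(S, U) →+* Γ(S, S.basicOpen (f + g)) :=
          (S.presheaf.map (homOfLE (S.basicOpen_le (f + g))).op).hom
        have h1 : S.basicOpen (φ f) ≤ S.basicOpen f :=
          (S.basicOpen_res f _).trans_le inf_le_right
        have h2 : S.basicOpen (φ g) ≤ S.basicOpen g :=
          (S.basicOpen_res g _).trans_le inf_le_right
        -- On D(f + g) the sum is a unit, so the restrictions of f and g are coprime there.
        refine glue (hU.basicOpen _) _ (φ f) (φ g) ?_ ?_ ?_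
        · have hφ : IsUnit (φ (f + g)) := RingedSpace.isUnit_res_basicOpen _ (f + g)
          obtain ⟨c, hc⟩ := hφ.exists_left_inv
          exact ⟨c, c, by rw [← mul_add, ← map_add, hc]⟩
        · rw [resExt_resExt, ← resExt_resExt h1 (S.basicOpen_le f)]
          exact (congrArg _ hf).trans (map_zero _)
        · rw [resExt_resExt, ← resExt_resExt h2 (S.basicOpen_le g)]
          exact (congrArg _ hg).trans (map_zero _)
      smul_mem' := fun c f hf =>
        mono ((S.basicOpen_mul c f).trans_le inf_le_right) hf }
  -- Every point of U has a basic neighbourhood on which the class dies, so the basic opens of I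
  -- cover U.
  have hI : I = ⊤ := by
    rw [← Ideal.span_eq I, ← hU.self_le_iSup_basicOpen_iff]
    intro p hp
    obtain ⟨V, hV, hpV, hx⟩ := exists_resExt_eq_zero (oSh S) n x hp
    obtain ⟨f, hfV, hpf⟩ := hU.exists_basicOpen_le ⟨p, hpV⟩ hp
    refine Opens.mem_iSup.2 ⟨⟨f, ?_⟩, hpf⟩
    change resExt _ _ _ x = 0
    rw [← resExt_resExt hfV hV, hx, map_zero]
  have h1 : resExt (S.basicOpen_le 1) (oSh S) (n + 1) x = 0 := (hI ▸ Submodule.mem_top : 1 ∈ I)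
  have h2 : U ≤ S.basicOpen 1 := S.basicOpen_one.ge
  rw [← resExt_refl (oSh S) _ x, ← resExt_resExt h2 (S.basicOpen_le 1), h1, map_zero]

end Affine

end AbSheaf

end

/-! ### Base change maps on Ext with flat coefficients. -/

noncomputable section

namespace AbSheaf

open Abelian Opposite TensorProduct

section BaseChange

universe w v₁ u₁

variable {C : Type u₁} [Category.{v₁} C] [Abelian C] [HasExt.{w} C] {R : Type*} [CommRing R]

/-- `Ext A F n` as a module over a ring acting on `F`. -/
def ExtMod {F : C} (_ : R →+* End F) (A : C) (n : ℕ) : Type w := Ext.{w} A F n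

variable {F G : C} (ρ : R →+* End F)

instance (A : C) (n : ℕ) : AddCommGroup (ExtMod.{w} ρ A n) :=
  inferInstanceAs (AddCommGroup (Ext.{w} A F n))

instance (A : C) (n : ℕ) : Module R (ExtMod.{w} ρ A n) where
  smul r x := Ext.comp (show Ext.{w} A F n from x) (Ext.mk₀ (ρ r)) (add_zero n)
  one_smul x := by
    change Ext.comp (show Ext.{w} A F n from x) (Ext.mk₀ (ρ 1)) (add_zero n) = x
    rw [map_one]
    exact Ext.comp_mk₀_id _
  mul_smul r s x := by
    change Ext.comp (show Ext.{w} A F n from x) (Ext.mk₀ (ρ (r * s))) (add_zero n) =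
      Ext.comp (Ext.comp (show Ext.{w} A F n from x) (Ext.mk₀ (ρ s)) (add_zero n))
        (Ext.mk₀ (ρ r)) (add_zero n)
    rw [Ext.comp_assoc_of_third_deg_zero, Ext.mk₀_comp_mk₀, map_mul]
    rfl
  smul_zero r := Ext.zero_comp _ _ _ _ _
  smul_add r x y := Ext.add_comp _ _ _ _
  add_smul r s x := by
    change Ext.comp (show Ext.{w} A F n from x) (Ext.mk₀ (ρ (r + s))) (add_zero n) =
      Ext.comp (show Ext.{w} A F n from x) (Ext.mk₀ (ρ r)) (add_zero n) +
      Ext.comp (show Ext.{w} A F n from x) (Ext.mk₀ (ρ s)) (add_zero n)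
    rw [map_add, Ext.mk₀_add, Ext.comp_add]
  zero_smul x := by
    change Ext.comp (show Ext.{w} A F n from x) (Ext.mk₀ (ρ 0)) (add_zero n) = 0
    rw [map_zero, Ext.mk₀_zero, Ext.comp_zero]

/-- Precomposition with an element of `Ext` as a linear map. -/
def extModPre {A B : C} {m n k : ℕ} (α : Ext.{w} A B m) (h : m + n = k) :
    ExtMod.{w} ρ B n →ₗ[R] ExtMod.{w} ρ A k where
  toFun x := α.comp (show Ext.{w} B F n from x) h
  map_add' _ _ := Ext.comp_add _ _ _ _
  map_smul' r x := by
    exact (Ext.comp_assoc_of_third_deg_zero _ _ _ _).symm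

variable {N : Type*} [AddCommGroup N] [Module R N] (τ : N →+ (F ⟶ G))
  (hτ : ∀ (r : R) (c : N), τ (r • c) = ρ r ≫ τ c)

/-- The base change map `N ⊗ Ext A F n → Ext A G n` attached to an action of `R` on `F` and a
family of morphisms `F ⟶ G` parametrized by an `R`-module `N`. -/
def extBC (A : C) (n : ℕ) : N ⊗[R] ExtMod.{w} ρ A n →+ Ext.{w} A G n :=
  TensorProduct.liftAddHom
    { toFun c := (Ext.mk₀ (τ c)).postcomp A (add_zero n)
      map_zero' := by
        ext x
        rw [map_zero]
        change Ext.comp _ _ (add_zero n) = 0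
        rw [Ext.mk₀_zero, Ext.comp_zero]
      map_add' c d := by
        ext x
        rw [map_add]
        change Ext.comp (show Ext.{w} A F n from x) _ (add_zero n) =
          Ext.comp _ _ (add_zero n) + Ext.comp _ _ (add_zero n)
        rw [Ext.mk₀_add, Ext.comp_add] }
    (fun r c x => by
      change Ext.comp (show Ext.{w} A F n from x) (Ext.mk₀ (τ (r • c))) (add_zero n) =
        Ext.comp (Ext.comp (show Ext.{w} A F n from x) (Ext.mk₀ (ρ r)) (add_zero n))
          (Ext.mk₀ (τ c)) (add_zero n)
      rw [Ext.comp_assoc_of_third_deg_zero, Ext.mk₀_comp_mk₀, hτ])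

lemma extBC_tmul (A : C) (n : ℕ) (c : N) (x : ExtMod.{w} ρ A n) :
    extBC ρ τ hτ A n (c ⊗ₜ x) = Ext.comp (show Ext.{w} A F n from x) (Ext.mk₀ (τ c))
      (add_zero n) := rfl

lemma extBC_lTensor {A B : C} {m n k : ℕ} (α : Ext.{w} A B m) (h : m + n = k)
    (t : N ⊗[R] ExtMod.{w} ρ B n) :
    extBC ρ τ hτ A k ((extModPre ρ α h).lTensor N t) = α.comp (extBC ρ τ hτ B n t) h := by
  induction t with
  | zero => rw [map_zero, map_zero, map_zero, Ext.comp_zero]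
  | add x y hx hy => rw [map_add, map_add, hx, hy, map_add, Ext.comp_add]
  | tmul c x =>
    rw [LinearMap.lTensor_tmul, extBC_tmul, extBC_tmul]
    exact Ext.comp_assoc_of_third_deg_zero _ _ _ _

/-- The base change maps out of `A` are all bijective. -/
def ExtBCBijective (A : C) : Prop := ∀ n, Function.Bijective (extBC.{w} ρ τ hτ A n)

variable {ρ τ hτ}

lemma ExtBCBijective.biprod {A B : C} (hA : ExtBCBijective.{w} ρ τ hτ A)
    (hB : ExtBCBijective.{w} ρ τ hτ B) : ExtBCBijective.{w} ρ τ hτ (A ⊞ B) := by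
  intro n
  let p {A B : C} (f : A ⟶ B) := extModPre ρ (Ext.mk₀.{w} f) (zero_add n)
  have h4 : p (biprod.fst (X := A) (Y := B)) ∘ₗ p biprod.inl +
      p (biprod.snd (X := A) (Y := B)) ∘ₗ p biprod.inr = LinearMap.id := by
    have (x : Ext.{w} (A ⊞ B) F n) : (Ext.mk₀ biprod.fst).comp ((Ext.mk₀ biprod.inl).comp
        x (zero_add n)) (zero_add n) +
        (Ext.mk₀ biprod.snd).comp ((Ext.mk₀ biprod.inr).comp x (zero_add n)) (zero_add n) = x := by
      rw [Ext.mk₀_comp_mk₀_assoc, Ext.mk₀_comp_mk₀_assoc, ← Ext.add_comp, ← Ext.mk₀_add,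
        biprod.total, Ext.mk₀_id_comp]
    exact LinearMap.ext this
  refine ⟨(injective_iff_map_eq_zero _).2 fun t ht => ?_, fun y => ?_⟩
  · have h1 := extBC_lTensor ρ τ hτ (Ext.mk₀ (biprod.inl (X := A) (Y := B))) (zero_add n) t
    have h2 := extBC_lTensor ρ τ hτ (Ext.mk₀ (biprod.inr (X := A) (Y := B))) (zero_add n) t
    rw [ht, Ext.comp_zero] at h1 h2
    have h1 := (injective_iff_map_eq_zero _).1 (hA n).1 _ h1
    have h2 := (injective_iff_map_eq_zero _).1 (hB n).1 _ h2
    have h5 := congrArg (fun φ => LinearMap.lTensor N φ t) h4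
    simp only [LinearMap.lTensor_add, LinearMap.lTensor_comp, LinearMap.add_apply,
      LinearMap.comp_apply, LinearMap.lTensor_id, LinearMap.id_apply] at h5
    rw [← h5, h1, h2, map_zero, map_zero, add_zero]
  · obtain ⟨s, hs⟩ := (hA n).2 ((Ext.mk₀ biprod.inl).comp y (zero_add n))
    obtain ⟨t, ht⟩ := (hB n).2 ((Ext.mk₀ biprod.inr).comp y (zero_add n))
    refine ⟨(p biprod.fst).lTensor N s + (p biprod.snd).lTensor N t, ?_⟩
    rw [map_add, extBC_lTensor, extBC_lTensor, hs, ht, Ext.mk₀_comp_mk₀_assoc,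
      Ext.mk₀_comp_mk₀_assoc, ← Ext.add_comp, ← Ext.mk₀_add, biprod.total, Ext.mk₀_id_comp]

/-- Five lemma between the contravariant long exact sequences; flatness of N keeps the source
sequence exact after tensoring. -/
lemma ExtBCBijective.of_shortExact [Module.Flat R N] {S : ShortComplex C} (hS : S.ShortExact)
    (h₁ : ExtBCBijective.{w} ρ τ hτ S.X₁) (h₂ : ExtBCBijective.{w} ρ τ hτ S.X₂) :
    ExtBCBijective.{w} ρ τ hτ S.X₃ := by
  have ex₂ (n : ℕ) : Function.Exact (extModPre ρ (Ext.mk₀.{w} S.g) (zero_add n))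
      (extModPre ρ (Ext.mk₀.{w} S.f) (zero_add n)) :=
    (ShortComplex.ab_exact_iff_function_exact _).1 (Ext.contravariant_sequence_exact₂' hS F n)
  have ex₂' (n : ℕ) : Function.Exact ((Ext.mk₀.{w} S.g).precomp G (zero_add n))
      ((Ext.mk₀.{w} S.f).precomp G (zero_add n)) :=
    (ShortComplex.ab_exact_iff_function_exact _).1 (Ext.contravariant_sequence_exact₂' hS G n)
  intro n
  cases n with
  | zero =>
    -- In degree zero no term precedes, and left exactness of Hom replaces the connecting map.
    have := hS.epi_g
    have inj (H : C) : Function.Injective ((Ext.mk₀.{w} S.g).precomp H (zero_add 0)) := by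
      refine (injective_iff_map_eq_zero _).2 fun x hx => ?_
      obtain ⟨x, rfl⟩ := (Ext.mk₀_bijective _ _).2 x
      change (Ext.mk₀.{w} S.g).comp _ (zero_add 0) = 0 at hx
      rw [Ext.mk₀_comp_mk₀, Ext.mk₀_eq_zero_iff] at hx
      rw [Ext.mk₀_eq_zero_iff]
      exact zero_of_epi_comp _ hx
    refine AddMonoidHom.bijective_of_bijective_of_injective_of_left_exact
      ((extModPre ρ (Ext.mk₀.{w} S.g) (zero_add 0)).lTensor N).toAddMonoidHom
      ((extModPre ρ (Ext.mk₀.{w} S.f) (zero_add 0)).lTensor N).toAddMonoidHom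
      ((Ext.mk₀.{w} S.g).precomp G (zero_add 0)) ((Ext.mk₀.{w} S.f).precomp G (zero_add 0))
      (extBC ρ τ hτ S.X₃ 0) (extBC ρ τ hτ S.X₂ 0) (extBC ρ τ hτ S.X₁ 0) ?_ ?_
      (Module.Flat.lTensor_exact N (ex₂ 0)) (ex₂' 0) (h₂ 0) (h₁ 0).1
      (Module.Flat.lTensor_preserves_injective_linearMap _ (inj F)) (inj G)
    · exact AddMonoidHom.ext fun t => (extBC_lTensor ρ τ hτ _ _ t).symm
    · exact AddMonoidHom.ext fun t => (extBC_lTensor ρ τ hτ _ _ t).symm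
  | succ n =>
    have ex₁ : Function.Exact (extModPre ρ (Ext.mk₀.{w} S.f) (zero_add n))
        (extModPre ρ hS.extClass (Nat.add_comm 1 n)) :=
      (ShortComplex.ab_exact_iff_function_exact _).1
        (Ext.contravariant_sequence_exact₁' hS F n (n + 1) (Nat.add_comm 1 n))
    have ex₁' : Function.Exact ((Ext.mk₀.{w} S.f).precomp G (zero_add n))
        (hS.extClass.precomp G (Nat.add_comm 1 n)) :=
      (ShortComplex.ab_exact_iff_function_exact _).1
        (Ext.contravariant_sequence_exact₁' hS G n (n + 1) (Nat.add_comm 1 n))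
    have ex₃ : Function.Exact (extModPre ρ hS.extClass (Nat.add_comm 1 n))
        (extModPre ρ (Ext.mk₀.{w} S.g) (zero_add (n + 1))) :=
      (ShortComplex.ab_exact_iff_function_exact _).1
        (Ext.contravariant_sequence_exact₃' hS F n (n + 1) (Nat.add_comm 1 n))
    have ex₃' : Function.Exact (hS.extClass.precomp G (Nat.add_comm 1 n))
        ((Ext.mk₀.{w} S.g).precomp G (zero_add (n + 1))) :=
      (ShortComplex.ab_exact_iff_function_exact _).1
        (Ext.contravariant_sequence_exact₃' hS G n (n + 1) (Nat.add_comm 1 n))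
    refine AddMonoidHom.bijective_of_surjective_of_bijective_of_bijective_of_injective
      ((extModPre ρ (Ext.mk₀.{w} S.f) (zero_add n)).lTensor N).toAddMonoidHom
      ((extModPre ρ hS.extClass (Nat.add_comm 1 n)).lTensor N).toAddMonoidHom
      ((extModPre ρ (Ext.mk₀.{w} S.g) (zero_add (n + 1))).lTensor N).toAddMonoidHom
      ((extModPre ρ (Ext.mk₀.{w} S.f) (zero_add (n + 1))).lTensor N).toAddMonoidHom
      ((Ext.mk₀.{w} S.f).precomp G (zero_add n)) (hS.extClass.precomp G (Nat.add_comm 1 n))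
      ((Ext.mk₀.{w} S.g).precomp G (zero_add (n + 1)))
      ((Ext.mk₀.{w} S.f).precomp G (zero_add (n + 1)))
      (extBC ρ τ hτ S.X₂ n) (extBC ρ τ hτ S.X₁ n) (extBC ρ τ hτ S.X₃ (n + 1))
      (extBC ρ τ hτ S.X₂ (n + 1)) (extBC ρ τ hτ S.X₁ (n + 1)) ?_ ?_ ?_ ?_
      (Module.Flat.lTensor_exact N ex₁) (Module.Flat.lTensor_exact N ex₃)
      (Module.Flat.lTensor_exact N (ex₂ (n + 1))) ex₁' ex₃' (ex₂' (n + 1))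
      (h₂ n).2 (h₁ n) (h₂ (n + 1)) (h₁ (n + 1)).1
    all_goals exact AddMonoidHom.ext fun t => (extBC_lTensor ρ τ hτ _ _ t).symm

lemma ExtBCBijective.of_extVanish {A : C} (hF : ExtVanish.{w} A F) (hG : ExtVanish.{w} A G)
    (h : Function.Bijective (extBC.{w} ρ τ hτ A 0)) : ExtBCBijective.{w} ρ τ hτ A := by
  intro n
  cases n with
  | zero => exact h
  | succ n =>
    refine ⟨(injective_iff_map_eq_zero _).2 fun t _ => ?_, fun y => ⟨0, ?_⟩⟩
    · have : Subsingleton (ExtMod.{w} ρ A (n + 1)) :=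
        ⟨fun a b => (hF n a).trans (hF n b).symm⟩
      exact Subsingleton.elim _ _
    · rw [map_zero, hG n y]

lemma ExtBCBijective.extVanish {A : C} (hF : ExtVanish.{w} A F)
    (h : ExtBCBijective.{w} ρ τ hτ A) : ExtVanish.{w} A G := by
  intro n y
  obtain ⟨t, rfl⟩ := (h _).2 y
  have : Subsingleton (ExtMod.{w} ρ A (n + 1)) := ⟨fun a b => (hF n a).trans (hF n b).symm⟩
  rw [Subsingleton.elim t 0, map_zero]

end BaseChange

section Space

variable {X : TopCat.{u}} {F G : AbSh X} {R : Type*} [CommRing R] {ρ : R →+* End F}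
  {N : Type*} [AddCommGroup N] [Module R N] {τ : N →+ (F ⟶ G)}
  {hτ : ∀ (r : R) (c : N), τ (r • c) = ρ r ≫ τ c}

lemma extBCBijective_bot : ExtBCBijective.{u} ρ τ hτ (freeSh (⊥ : Opens X)) := by
  intro n
  have : Subsingleton (ExtMod.{u} ρ (freeSh (⊥ : Opens X)) n) :=
    ⟨fun a b => (ext_freeSh_bot F n a).trans (ext_freeSh_bot F n b).symm⟩
  exact ⟨fun _ _ _ => Subsingleton.elim _ _, fun y => ⟨0, (map_zero _).trans
    (ext_freeSh_bot G n y).symm⟩⟩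

lemma extBCBijective_sup [Module.Flat R N] {U V : Opens X}
    (hU : ExtBCBijective.{u} ρ τ hτ (freeSh U)) (hV : ExtBCBijective.{u} ρ τ hτ (freeSh V))
    (hUV : ExtBCBijective.{u} ρ τ hτ (freeSh (U ⊓ V))) :
    ExtBCBijective.{u} ρ τ hτ (freeSh (U ⊔ V)) :=
  by
  have h := ExtBCBijective.biprod hU hV
  have h2 := ExtBCBijective.of_shortExact (ρ := ρ) (τ := τ) (hτ := hτ) (mvSES_shortExact U V)
  exact h2 hUV h

/-- Mayer–Vietoris induction on the number of members, over all lists of that length: intersecting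
the head with the union of the tail gives another union of as many members of B as the tail has. -/
lemma extBCBijective_finset_sup [Module.Flat R N] (B : Set (Opens X))
    (hB : ∀ U ∈ B, ∀ V ∈ B, U ⊓ V ∈ B) (h : ∀ U ∈ B, ExtBCBijective.{u} ρ τ hτ (freeSh U)) :
    ∀ (l : List (Opens X)), (∀ U ∈ l, U ∈ B) →
      ExtBCBijective.{u} ρ τ hτ (freeSh (l.foldr (· ⊔ ·) ⊥)) := by
  suffices H : ∀ (n : ℕ) (l : List (Opens X)), l.length = n → (∀ U ∈ l, U ∈ B) →
      ExtBCBijective.{u} ρ τ hτ (freeSh (l.foldr (· ⊔ ·) ⊥)) from fun l => H _ l rfl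
  intro n
  induction n with
  | zero =>
    intro l hl _
    rw [List.length_eq_zero_iff.1 hl]
    exact extBCBijective_bot
  | succ n ih =>
    intro l hl hl'
    obtain ⟨U, l, rfl⟩ := List.exists_cons_of_length_eq_add_one hl
    have hl : l.length = n := by simpa using hl
    refine extBCBijective_sup (h U (hl' U (by simp))) (ih l hl fun V hV => hl' V (by simp [hV])) ?_
    have (l : List (Opens X)) : U ⊓ l.foldr (· ⊔ ·) ⊥ = (l.map (U ⊓ ·)).foldr (· ⊔ ·) ⊥ := by
      induction l with
      | nil => simp
      | cons V l ih => simpa [inf_sup_left] using congrArg (U ⊓ V ⊔ ·) ih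
    rw [this]
    refine ih _ (by simpa using hl) fun V hV => ?_
    obtain ⟨W, hW, rfl⟩ := List.mem_map.1 hV
    exact hB _ (hl' U (by simp)) _ (hl' W (by simp [hW]))

end Space

section Scheme

variable {S : Scheme.{u}} {F G : AbSh S.carrier} {R : Type*} [CommRing R] {ρ : R →+* End F}
  {N : Type*} [AddCommGroup N] [Module R N] {τ : N →+ (F ⟶ G)}
  {hτ : ∀ (r : R) (c : N), τ (r • c) = ρ r ≫ τ c}

/-- Two passes. Inside an affine open the basic opens are stable under intersection, giving all
quasi-compact opens contained in an affine; these in turn are stable under intersection by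
quasi-separatedness and give every quasi-compact open. -/
theorem extBCBijective_of_isCompact [QuasiSeparatedSpace S] [Module.Flat R N]
    (h : ∀ U : S.Opens, IsAffineOpen U → ExtBCBijective.{u} ρ τ hτ (freeSh U)) {U : S.Opens}
    (hU : IsCompact (U : Set S)) : ExtBCBijective.{u} ρ τ hτ (freeSh U) := by
  have key (B : Set S.Opens) (hB' : ∀ U ∈ B, ∀ V ∈ B, U ⊓ V ∈ B)
      (h : ∀ U ∈ B, ExtBCBijective.{u} ρ τ hτ (freeSh U)) (U : S.Opens)
      (hB : ∀ x ∈ U, ∃ V ∈ B, x ∈ V ∧ V ≤ U)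
      (hU : IsCompact (U : Set S)) : ExtBCBijective.{u} ρ τ hτ (freeSh U) := by
    obtain ⟨l, hl, rfl⟩ : ∃ l : List S.Opens, (∀ V ∈ l, V ∈ B) ∧ l.foldr (· ⊔ ·) ⊥ = U := by
      obtain ⟨t, ht⟩ := hU.elim_finite_subcover (fun V : {V : S.Opens // V ∈ B ∧ V ≤ U} =>
        (V.1 : Set S)) (fun V => V.1.isOpen) (fun x hx => by
          obtain ⟨V, hV, hxV, hVU⟩ := hB x hx
          exact Set.mem_iUnion.2 ⟨⟨V, hV, hVU⟩, hxV⟩)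
      have h1 : ∀ (l : List S.Opens), (∀ V ∈ l, V ≤ U) → l.foldr (· ⊔ ·) ⊥ ≤ U := by
        intro l
        induction l with
        | nil => simp
        | cons V l ih => exact fun h => sup_le (h V (by simp)) (ih fun W hW => h W (by simp [hW]))
      have h2 : ∀ (l : List S.Opens), ∀ V ∈ l, V ≤ l.foldr (· ⊔ ·) ⊥ := by
        intro l
        induction l with
        | nil => simp
        | cons V l ih =>
          intro W hW
          rcases List.mem_cons.1 hW with rfl | hW
          · exact le_sup_left
          · exact (ih W hW).trans le_sup_right
      refine ⟨t.toList.map (·.1), ?_, le_antisymm (h1 _ ?_) fun x hx => ?_⟩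
      · intro V hV
        obtain ⟨W, -, rfl⟩ := List.mem_map.1 hV
        exact W.2.1
      · intro V hV
        obtain ⟨W, -, rfl⟩ := List.mem_map.1 hV
        exact W.2.2
      · obtain ⟨V, hV⟩ := Set.mem_iUnion.1 (ht hx)
        obtain ⟨hVt, hxV⟩ := Set.mem_iUnion.1 hV
        exact h2 _ V.1 (List.mem_map.2 ⟨V, by simpa using hVt, rfl⟩) hxV
    exact extBCBijective_finset_sup B hB' h l hl
  have key' (V : S.Opens) (hV : IsAffineOpen V) (U : S.Opens) (hUV : U ≤ V)
      (hU : IsCompact (U : Set S)) : ExtBCBijective.{u} ρ τ hτ (freeSh U) := by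
    refine key {W | ∃ f : Γ(S, V), W = S.basicOpen f} ?_ ?_ U ?_ hU
    · rintro _ ⟨f, rfl⟩ _ ⟨g, rfl⟩
      exact ⟨f * g, (S.basicOpen_mul f g).symm⟩
    · rintro _ ⟨f, rfl⟩
      exact h _ (hV.basicOpen f)
    · intro x hx
      obtain ⟨f, hf, hxf⟩ := hV.exists_basicOpen_le ⟨x, hx⟩ (hUV hx)
      exact ⟨_, ⟨f, rfl⟩, hxf, hf⟩
  refine key {U | IsCompact (U : Set S) ∧ ∃ V, IsAffineOpen V ∧ U ≤ V} ?_
    (fun U ⟨hU, V, hV, hUV⟩ => key' V hV U hUV hU) U ?_ hU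
  · rintro U ⟨hU, V, hV, hUV⟩ U' ⟨hU', -⟩
    exact ⟨QuasiSeparatedSpace.inter_isCompact _ _ U.isOpen hU U'.isOpen hU', V, hV,
      inf_le_left.trans hUV⟩
  · intro x hx
    obtain ⟨V, hV, hxV, hVU⟩ := Opens.isBasis_iff_nbhd.1 S.isBasis_affineOpens hx
    exact ⟨V, ⟨IsAffineOpen.isCompact hV, V, hV, le_rfl⟩, hxV, hVU⟩

end Scheme

end AbSheaf
end

/-! ### Flat base change for cohomology of the structure sheaf. -/

noncomputable section

namespace AbSheaf

open Abelian Opposite TensorProduct ConjB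

lemma bijective_of_isPushout {R A B P : CommRingCat.{u}} {f : R ⟶ A} {g : R ⟶ B} {i : A ⟶ P}
    {j : B ⟶ P} (h : IsPushout f g i j) :
    letI := f.hom.toAlgebra
    letI := g.hom.toAlgebra
    ∀ φ : B ⊗[R] A →+ P, (∀ b a, φ (b ⊗ₜ a) = i a * j b) → Function.Bijective φ := by
  let := f.hom.toAlgebra
  let := g.hom.toAlgebra
  let := i.hom.toAlgebra
  let := j.hom.toAlgebra
  let := (f ≫ i).hom.toAlgebra
  have : IsScalarTower R A P := .of_algebraMap_eq fun x => rfl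
  have : IsScalarTower R B P := .of_algebraMap_eq fun x => congr($(h.w).hom x)
  have hp : Algebra.IsPushout R B A P := CommRingCat.isPushout_iff_isPushout.1 h.flip
  intro φ hφ
  have : (φ : _ → _) = Algebra.IsPushout.equiv R B A P := by
    funext t
    induction t with
    | zero => rw [map_zero, map_zero]
    | add x y hx hy => rw [map_add, map_add, hx, hy]
    | tmul b a =>
      rw [hφ, Algebra.IsPushout.equiv_tmul]
      exact mul_comm _ _
  rw [this]
  exact (Algebra.IsPushout.equiv R B A P).bijective

variable {X Y Z : Scheme.{u}}

/-- Multiplication by a global section. -/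
def mulSh (a : Γ(X, ⊤)) : oSh X ⟶ oSh X where
  hom :=
    { app := fun U => AddCommGrpCat.ofHom
        (AddMonoidHom.mulLeft (X.presheaf.map (homOfLE (le_top : U.unop ≤ ⊤)).op a))
      naturality := fun U V f => by
        ext s
        refine Eq.trans ?_ (map_mul (X.presheaf.map f).hom _ _).symm
        refine congrArg (· * (X.presheaf.map f).hom s) ?_
        change _ = (X.presheaf.map _ ≫ X.presheaf.map f) a
        rw [← X.presheaf.map_comp]
        rfl }

lemma mulSh_app (a : Γ(X, ⊤)) (U : X.Opens) (s : Γ(X, U)) :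
    (mulSh a).hom.app (op U) s = X.presheaf.map (homOfLE (le_top : U ≤ ⊤)).op a * s := rfl

lemma oSh_hom_ext {G : AbSh X.carrier} {f g : oSh X ⟶ G}
    (h : ∀ (U : X.Opens) (s : Γ(X, U)), f.hom.app (op U) s = g.hom.app (op U) s) : f = g := by
  apply ObjectProperty.hom_ext
  ext U s
  exact h U.unop s

/-- The action of global sections on the structure sheaf. -/
def mulShHom (X : Scheme.{u}) : Γ(X, ⊤) →+* End (oSh X) where
  toFun := mulSh
  map_one' := oSh_hom_ext fun U s => by
    rw [mulSh_app, map_one, one_mul]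
    rfl
  map_mul' a b := oSh_hom_ext fun U s => by
    change _ * s = _ * (_ * s)
    rw [map_mul, mul_assoc]
  map_zero' := oSh_hom_ext fun U s => by
    rw [mulSh_app, map_zero, zero_mul]
    rfl
  map_add' a b := oSh_hom_ext fun U s => by
    change _ * s = _ * s + _ * s
    rw [map_add, add_mul]

/-- The direct image functor on abelian sheaves attached to a morphism of schemes. -/
abbrev push (q : Z ⟶ Y) : AbSh Z.carrier ⥤ AbSh Y.carrier :=
  TopCat.Sheaf.pushforward AddCommGrpCat.{u} q.base

/-- The comorphism as a map of abelian sheaves. -/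
def pullSh (q : Z ⟶ Y) : oSh Y ⟶ (push q).obj (oSh Z) where
  hom :=
    { app := fun U => AddCommGrpCat.ofHom (q.app U.unop).hom.toAddMonoidHom
      naturality := fun U V f => by
        ext s
        exact congr($(q.naturality f).hom s) }

lemma mulSh_pullSh (q : Z ⟶ Y) (a : Γ(Y, ⊤)) :
    mulSh a ≫ pullSh q = pullSh q ≫ (push q).map (mulSh (q.appTop a)) :=
  oSh_hom_ext fun U s => by
    change q.app U (_ * s) = Z.presheaf.map _ (q.app ⊤ a) * q.app U s
    rw [map_mul]
    congr 1
    exact congr($(q.naturality (homOfLE (le_top : U ≤ ⊤)).op).hom a)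

section FlatBaseChange

variable {R C : CommRingCat.{u}} {φ : R ⟶ C} {q : Z ⟶ Y} {f : Y ⟶ Spec R} {g : Z ⟶ Spec C}

/-- Global functions coming from the base. -/
def baseHom (f : Y ⟶ Spec R) : R →+* Γ(Y, ⊤) := ((Scheme.ΓSpecIso R).inv ≫ f.appTop).hom

lemma baseHom_comp (H : CommSq q g f (Spec.map φ)) (r : R) :
    q.appTop (baseHom f r) = baseHom g (φ r) := by
  change ((Scheme.ΓSpecIso R).inv ≫ f.appTop ≫ q.appTop) r =
    (φ ≫ (Scheme.ΓSpecIso C).inv ≫ g.appTop) r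
  rw [Scheme.ΓSpecIso_inv_naturality_assoc, ← Scheme.Hom.comp_appTop, ← Scheme.Hom.comp_appTop,
    H.w]

/-- The action of the base ring on the structure sheaf. -/
def baseAct (f : Y ⟶ Spec R) : R →+* End (oSh Y) := (mulShHom Y).comp (baseHom f)

/-- The maps from the structure sheaf to the direct image of the structure sheaf of a base change,
parametrized by the functions on the new base. -/
def baseMap (q : Z ⟶ Y) (g : Z ⟶ Spec C) : C →+ (oSh Y ⟶ (push q).obj (oSh Z)) where
  toFun c := pullSh q ≫ (push q).map (mulShHom Z (baseHom g c))
  map_zero' := by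
    rw [map_zero, map_zero]
    exact (congrArg (pullSh q ≫ ·) ((push q).map_zero _ _)).trans comp_zero
  map_add' a b := by
    rw [map_add, map_add]
    exact (congrArg (pullSh q ≫ ·) ((push q).map_add)).trans (Preadditive.comp_add _ _ _ _ _ _)

lemma baseMap_smul (H : CommSq q g f (Spec.map φ)) (r : R) (c : C) :
    letI := φ.hom.toAlgebra
    baseMap q g (r • c) = baseAct f r ≫ baseMap q g c := by
  let := φ.hom.toAlgebra
  change pullSh q ≫ (push q).map (mulShHom Z (baseHom g (φ r * c))) =
    mulSh (baseHom f r) ≫ pullSh q ≫ (push q).map (mulShHom Z (baseHom g c))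
  rw [← Category.assoc, mulSh_pullSh, baseHom_comp H, Category.assoc, mul_comm, map_mul, map_mul]
  exact congrArg (pullSh q ≫ ·) ((push q).map_comp _ _)

lemma baseMap_app (U : Y.Opens) (c : C) (s : Γ(Y, U)) :
    (baseMap q g c).hom.app (op U) s =
      ((Scheme.ΓSpecIso C).inv ≫ g.appLE ⊤ (q ⁻¹ᵁ U) le_top) c * q.app U s := rfl

lemma baseAct_app (U : Y.Opens) (r : R) (s : Γ(Y, U)) :
    (baseAct f r).hom.app (op U) s =
      ((Scheme.ΓSpecIso R).inv ≫ f.appLE ⊤ U le_top) r * s := rfl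

/-- On an affine open both sides have no higher cohomology (for the direct image because q is
affine), and in degree zero the claim is that sections of the fibre product form a tensor product.
Mayer–Vietoris passes to quasi-compact opens. -/
theorem flatBaseChange_bijective [IsAffineHom q] [QuasiSeparatedSpace Y]
    (H : IsPullback q g f (Spec.map φ)) (hφ : φ.hom.Flat) :
    letI := φ.hom.toAlgebra
    ∀ {U : Y.Opens}, IsCompact (U : Set Y) →
      ExtBCBijective.{u} (F := oSh Y) (G := (push q).obj (oSh Z)) (baseAct f) (baseMap q g) (baseMap_smul H.toCommSq)
        (freeSh (X := Y.carrier) U) := by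
  let := φ.hom.toAlgebra
  have : Module.Flat R C := hφ
  intro U hU
  refine extBCBijective_of_isCompact (fun U hU => ?_) hU
  refine ExtBCBijective.of_extVanish (acyclic_of_isAffineOpen hU)
    ((acyclic_pushforward_iff _ _ Y.isBasis_affineOpens (fun W hW => ?_) _).2 ?_) ?_
  · exact acyclic_of_isAffineOpen (IsAffineOpen.preimage hW q)
  · exact acyclic_of_isAffineOpen (hU.preimage q)
  have hp := (isIso_pushoutSection_iff H (US := ⊤) (UT := ⊤) (UX := U) (UY := q ⁻¹ᵁ U)
    le_top le_top (by simp)).1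
    (isIso_pushoutSection_of_isAffineOpen H _ _ _ (isAffineOpen_top _) (isAffineOpen_top _) hU)
  have hp' : IsPushout ((Scheme.ΓSpecIso R).inv ≫ f.appLE ⊤ U le_top) φ (q.app U)
      ((Scheme.ΓSpecIso C).inv ≫ g.appLE ⊤ (q ⁻¹ᵁ U) le_top) := by
    refine hp.of_iso (Scheme.ΓSpecIso R) (Iso.refl _) (Scheme.ΓSpecIso C) (Iso.refl _) ?_ ?_ ?_ ?_
    · simp
    · simp only [Scheme.Hom.appLE]
      refine Eq.trans ?_ (Scheme.ΓSpecIso_naturality φ)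
      exact congrArg (· ≫ _) ((congrArg (_ ≫ ·) (CategoryTheory.Functor.map_id _ _)).trans
        (Category.comp_id _))
    · simp [Scheme.Hom.appLE_eq_app]
    · simp
  let := ((Scheme.ΓSpecIso R).inv ≫ f.appLE ⊤ U le_top).hom.toAlgebra
  have mk {F G : AbSh Y.carrier} (y : F ⟶ G) : Ext.addEquiv₀ (Ext.mk₀.{u} y) = y :=
    (Ext.mk₀_bijective _ _).1 (by simp)
  let A := freeSh (X := Y.carrier) U
  let σ : (A ⟶ oSh Y) → Γ(Y, U) := homEquivSec (X := Y.carrier) U (oSh Y)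
  let e : ExtMod.{u} (F := oSh Y) (baseAct f) A 0 ≃ₗ[R] Γ(Y, U) :=
    { (Ext.addEquiv₀.trans (homEquivSec (X := Y.carrier) U (oSh Y)) :
        Ext.{u} A (oSh Y) 0 ≃+ _) with
      map_smul' r x := by
        obtain ⟨x, rfl⟩ := (Ext.mk₀_bijective _ _).2 x
        change homEquivSec (X := Y.carrier) U (oSh Y) (Ext.addEquiv₀
          ((Ext.mk₀.{u} x).comp (Ext.mk₀ (baseAct f r)) (add_zero 0))) = _
        rw [Ext.mk₀_comp_mk₀, mk]
        refine (baseAct_app U r _).trans ?_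
        change _ = ((Scheme.ΓSpecIso R).inv ≫ f.appLE ⊤ U le_top).hom r *
          σ (Ext.addEquiv₀ (Ext.mk₀.{u} x))
        rw [mk]
        rfl }
  let E := (Ext.addEquiv₀.trans (homEquivSec (X := Y.carrier) U ((push q).obj (oSh Z))) :
        Ext.{u} A ((push q).obj (oSh Z)) 0 ≃+ _)
  let b := extBC.{u} (F := oSh Y) (G := (push q).obj (oSh Z)) (baseAct f) (baseMap q g)
    (baseMap_smul H.toCommSq) A 0
  -- After identifying Ext in degree zero with sections, the comparison map becomes c ⊗ a ↦ c ·
  -- q(a).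
  have key := bijective_of_isPushout hp' (E.toAddMonoidHom.comp
    (b.comp (e.symm.lTensor C).toLinearMap.toAddMonoidHom)) (fun c a => by
        obtain ⟨a, rfl⟩ := e.surjective a
        obtain ⟨a, rfl⟩ := (Ext.mk₀_bijective _ _).2 a
        change E (b (c ⊗ₜ e.symm (e (Ext.mk₀.{u} a)))) = _
        refine (congrArg (fun t => E (b (c ⊗ₜ t))) (e.symm_apply_apply _)).trans ?_
        change homEquivSec (X := Y.carrier) U _ (Ext.addEquiv₀
          ((Ext.mk₀.{u} a).comp (Ext.mk₀ (baseMap q g c)) (add_zero 0))) =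
            q.app U (homEquivSec (X := Y.carrier) U (oSh Y) (Ext.addEquiv₀ (Ext.mk₀.{u} a))) * _
        rw [Ext.mk₀_comp_mk₀, mk, mk]
        exact (baseMap_app U c _).trans (mul_comm (G := Γ(Z, q ⁻¹ᵁ U)) _ _))
  have h1 : Function.Bijective (b ∘ (e.symm.lTensor C)) :=
    (Function.Bijective.of_comp_iff' E.bijective _).1 key
  exact (Function.Bijective.of_comp_iff _ (e.symm.lTensor C).bijective).1 h1

end FlatBaseChange

end AbSheaf
end

/-! ### Direct images and acyclicity under flat base change. -/

noncomputable section

namespace AbSheaf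
open Abelian Opposite

/-- A version of dimension shifting in which the middle term need only be acyclic; it is applied to
restrictions of injective sheaves, which are known to be flasque. -/
theorem ExtVanish.of_induction' {C : Type*} [Category C] [Abelian C] [HasExt.{u} C]
    (A : C) (P : C → Prop)
    (h : ∀ F, P F → ∃ S : ShortComplex C, S.ShortExact ∧ Nonempty (S.X₁ ≅ F) ∧
      ExtVanish.{u} A S.X₂ ∧ (∀ q : A ⟶ S.X₃, ∃ r, r ≫ S.g = q) ∧ P S.X₃) :
    ∀ F, P F → ExtVanish.{u} A F := by
  intro F hF i
  induction i generalizing F with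
  | zero =>
    obtain ⟨S, hS, ⟨e⟩, h2, hl, h3⟩ := h F hF
    intro x
    let x' : Ext.{u} A S.X₁ 1 := x.comp (Ext.mk₀ e.inv) (add_zero _)
    have hx' : x' = 0 := by
      obtain ⟨y, hy⟩ := Ext.covariant_sequence_exact₁ A hS x' (h2 0 _) (zero_add 1)
      obtain ⟨q, rfl⟩ := (Ext.mk₀_bijective _ _).2 y
      obtain ⟨r, rfl⟩ := hl q
      rw [← hy, ← Ext.mk₀_comp_mk₀, Ext.comp_assoc _ _ _ (zero_add 0) (zero_add 1) (by simp)]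
      simp
    have := congrArg (fun t => Ext.comp t (Ext.mk₀ e.hom) (add_zero _)) hx'
    simpa [x'] using this
  | succ i ih =>
    obtain ⟨S, hS, ⟨e⟩, h2, hl, h3⟩ := h F hF
    intro x
    let x' : Ext.{u} A S.X₁ (i + 1 + 1) := x.comp (Ext.mk₀ e.inv) (add_zero _)
    have hx' : x' = 0 := by
      obtain ⟨y, hy⟩ := Ext.covariant_sequence_exact₁ A hS x' (h2 _ _) rfl
      rw [← hy, ih _ h3 y, Ext.zero_comp]
    have := congrArg (fun t => Ext.comp t (Ext.mk₀ e.hom) (add_zero _)) hx'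
    simpa [x'] using this

section

variable {X Y : TopCat.{u}} {j : X ⟶ Y} (hj : Topology.IsOpenEmbedding j)

theorem acyclic_resOpen_iff (F : AbSh Y) (W : Opens X) :
    Acyclic ((resOpen hj).obj F) W ↔ Acyclic F (hj.functor.obj W) := by
  refine ⟨acyclic_of_resOpen hj F W, fun h => ?_⟩
  refine ExtVanish.of_induction' _ (fun G => ∃ F : AbSh Y, Nonempty ((resOpen hj).obj F ≅ G) ∧
    Acyclic F (hj.functor.obj W)) ?_ _ ⟨F, ⟨Iso.refl _⟩, h⟩
  rintro G ⟨F, ⟨e⟩, hF⟩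
  obtain ⟨h0, hS⟩ := resOpen_shortExact hj (injSES_shortExact F)
  have : ((injSES F).X₂).IsFlasque := isFlasque_of_injective _
  refine ⟨_, hS, ⟨e⟩, acyclic_of_isFlasque _ (isFlasque_resOpen hj _) W, fun q => ?_,
    (injSES F).X₃, ⟨Iso.refl _⟩, hF.shift (injSES_shortExact F) (.of_injective _ _)⟩
  exact exists_lift_of_surjective ((resOpen hj).map (injSES F).g)
    (Acyclic.surjective (injSES_shortExact F) hF) q

end

/-- The structure sheaf of an open subscheme is the restriction of the structure sheaf. -/
def resOpenOSh {X Y : Scheme.{u}} (j : X ⟶ Y) [IsOpenImmersion j] :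
    (resOpen j.isOpenEmbedding).obj (oSh Y) ≅ oSh X where
  hom :=
    { hom :=
      { app := fun U => AddCommGrpCat.ofHom (j.appIso U.unop).hom.hom.toAddMonoidHom
        naturality := fun U V f => by
          ext s
          exact congr($(Scheme.Hom.appIso_hom_naturality j f).hom s) } }
  inv :=
    { hom :=
      { app := fun U => AddCommGrpCat.ofHom (j.appIso U.unop).inv.hom.toAddMonoidHom
        naturality := fun U V f => by
          ext s
          exact congr($(Scheme.Hom.appIso_inv_naturality j f).hom s) } }
  hom_inv_id := by
    apply ObjectProperty.hom_ext
    ext U s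
    exact congr($((j.appIso U.unop).hom_inv_id).hom s)
  inv_hom_id := oSh_hom_ext fun U s => by
    exact congr($((j.appIso U).inv_hom_id).hom s)

theorem acyclic_oSh_image_iff {X Y : Scheme.{u}} (j : X ⟶ Y) [IsOpenImmersion j]
    (W : X.Opens) : Acyclic (oSh X) W ↔ Acyclic (oSh Y) (j ''ᵁ W) :=
  ⟨fun h => (acyclic_resOpen_iff j.isOpenEmbedding _ _).1 (h.of_iso (Iso.refl _)
    (resOpenOSh j).symm), fun h => ((acyclic_resOpen_iff j.isOpenEmbedding _ _).2 h).of_iso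
      (Iso.refl _) (resOpenOSh j)⟩

section BaseChange

variable {Y V Y' W : Scheme.{u}} {π : Y ⟶ V} {pV : W ⟶ V} {π' : Y' ⟶ W} {pY : Y' ⟶ Y}

/-- The affine opens lying over an affine open. -/
abbrev affineOver (p : W ⟶ V) : Set W.Opens :=
  {D | IsAffineOpen D ∧ ∃ U : V.Opens, IsAffineOpen U ∧ D ≤ p ⁻¹ᵁ U}

lemma isBasis_affineOver (p : W ⟶ V) : Opens.IsBasis (affineOver p) := by
  rw [Opens.isBasis_iff_nbhd]
  intro U x hx
  obtain ⟨U', hU', hxU', -⟩ := Opens.isBasis_iff_nbhd.1 V.isBasis_affineOpens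
    (show p x ∈ (⊤ : V.Opens) from trivial)
  obtain ⟨D, hD, hxD, hDU⟩ := Opens.isBasis_iff_nbhd.1 W.isBasis_affineOpens
    (show x ∈ U ⊓ p ⁻¹ᵁ U' from ⟨hx, hxU'⟩)
  exact ⟨D, ⟨hD, U', hU', hDU.trans inf_le_right⟩, hxD, hDU.trans inf_le_left⟩

/-- Flat base change in degree zero on affine opens D over affine opens U: the pushout square of
sections turns an isomorphism on one side into one on the other. Such D form a basis. -/
theorem isIso_app_of_isPullback_of_flat [Flat pV] [QuasiCompact π] [QuasiSeparated π]
    (H : IsPullback pY π' π pV) (h : ∀ U : V.Opens, IsIso (π.app U)) (U : W.Opens) :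
    IsIso (π'.app U) := by
  have key : IsIso (pullSh π') := by
    refine TopCat.Sheaf.isIso_iff_isIso_basis (B := ((↑) : affineOver pV → W.Opens))
      (by rw [Subtype.range_coe]; exact isBasis_affineOver pV) ?_
    rintro ⟨D, hD, U, hU, hDU⟩
    have hY : pY ⁻¹ᵁ π ⁻¹ᵁ U ⊓ π' ⁻¹ᵁ D = π' ⁻¹ᵁ D := by
      rw [← Scheme.Hom.comp_preimage, H.w, Scheme.Hom.comp_preimage]
      exact inf_eq_right.2 (π'.preimage_mono hDU)
    have hp := (isIso_pushoutSection_iff H (US := U) (UT := D) (UX := π ⁻¹ᵁ U)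
      (UY := π' ⁻¹ᵁ D) hDU le_rfl hY.symm).1
      (isIso_pushoutSection_of_isQuasiSeparated_of_flat_right H _ _ _ hU hD
        (QuasiCompact.isCompact_preimage (f := π) _ U.isOpen hU.isCompact)
        (π.isQuasiSeparated_preimage hU.isQuasiSeparated))
    have := h U
    have h1 : IsIso (π.appLE U (π ⁻¹ᵁ U) le_rfl) := by
      rw [← Scheme.Hom.app_eq_appLE]; exact h U
    have h2 : IsIso (π'.app D) := by
      have := hp.isIso_inr_of_isIso
      rwa [Scheme.Hom.app_eq_appLE]
    change IsIso ((forget₂ CommRingCat.{u} RingCat.{u} ⋙ forget₂ RingCat.{u}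
      AddCommGrpCat.{u}).map (π'.app D))
    infer_instance
  have h1 : IsIso ((pullSh π').hom.app (op U)) := by
    have := @Functor.map_isIso _ _ _ _ _ _ (sheafToPresheaf _ _) (pullSh π') key
    exact inferInstanceAs (IsIso (((sheafToPresheaf _ _).map (pullSh π')).app (op U)))
  rw [ConcreteCategory.isIso_iff_bijective]
  exact (ConcreteCategory.isIso_iff_bijective ((pullSh π').hom.app (op U))).1 h1

/-- Over affine D → U the square is a flat base change of rings, so the higher cohomology of π'⁻¹D
is a tensor product of that of π⁻¹U, which vanishes. -/
theorem acyclic_preimage_of_isPullback_of_flat [Flat pV] [QuasiCompact π] [QuasiSeparated π]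
    (H : IsPullback pY π' π pV)
    (h : ∀ U : V.Opens, IsAffineOpen U → Acyclic (oSh Y) (π ⁻¹ᵁ U)) {D : W.Opens}
    (hD : D ∈ affineOver pV) : Acyclic (oSh Y') (π' ⁻¹ᵁ D) := by
  obtain ⟨hD, U, hU, hDU⟩ := hD
  have hY : pY ⁻¹ᵁ π ⁻¹ᵁ U ⊓ π' ⁻¹ᵁ D = π' ⁻¹ᵁ D := by
    rw [← Scheme.Hom.comp_preimage, H.w, Scheme.Hom.comp_preimage]
    exact inf_eq_right.2 (π'.preimage_mono hDU)
  have H1 := Scheme.Hom.isPullback_resLE H (US := U) (UT := D) (UX := π ⁻¹ᵁ U) hDU le_rfl hY.symm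
  let q := pY.resLE (π ⁻¹ᵁ U) (π' ⁻¹ᵁ D) (by rw [← hY]; exact inf_le_left)
  let g := π'.resLE D (π' ⁻¹ᵁ D) le_rfl ≫ hD.isoSpec.hom
  let f := π.resLE U (π ⁻¹ᵁ U) le_rfl ≫ hU.isoSpec.hom
  have H2 : IsPullback q g f (Spec.map (pV.appLE U D hDU)) := by
    refine .of_iso H1 (Iso.refl _) (Iso.refl _) hD.isoSpec hU.isoSpec ?_ ?_ ?_ ?_
    · simp [q]
    · simp [g]
    · simp [f]
    · simp [IsAffineOpen.isoSpec_hom]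
  have hq : IsAffineHom q := MorphismProperty.of_isPullback H2.flip inferInstance
  have hs : QuasiSeparatedSpace (π ⁻¹ᵁ U).toScheme :=
    isQuasiSeparated_iff_quasiSeparatedSpace _ (π ⁻¹ᵁ U).isOpen |>.1
      (π.isQuasiSeparated_preimage hU.isQuasiSeparated)
  have hc : IsCompact ((⊤ : (π ⁻¹ᵁ U).toScheme.Opens) : Set (π ⁻¹ᵁ U).toScheme) := by
    have := isCompact_iff_compactSpace.1
      (QuasiCompact.isCompact_preimage (f := π) _ U.isOpen hU.isCompact)
    exact @isCompact_univ (π ⁻¹ᵁ U).toScheme _ this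
  have h1 : Acyclic (oSh (π ⁻¹ᵁ U).toScheme) ⊤ := by
    rw [acyclic_oSh_image_iff (π ⁻¹ᵁ U).ι, Scheme.Opens.ι_image_top]
    exact h U hU
  let := (pV.appLE U D hDU).hom.toAlgebra
  have h2 := (flatBaseChange_bijective H2 (pV.flat_appLE hU hD _) hc).extVanish h1
  have h3 := (acyclic_pushforward_iff _ _ (Scheme.isBasis_affineOpens _) (fun W hW => ?_) _).1 h2
  · have h4 := (acyclic_oSh_image_iff (π' ⁻¹ᵁ D).ι _).1 h3
    exact (congrArg (fun W => Acyclic (oSh Y') W) (Scheme.Opens.ι_image_top _)).mp h4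
  · exact acyclic_of_isAffineOpen (IsAffineOpen.preimage hW q)

/-- The condition on π enters as well: it identifies the direct image of 𝒪 with 𝒪_V, which is
acyclic on affines, so that Leray gives acyclicity of 𝒪_Y over inverse images of affines. -/
theorem isZero_higherDirectImageO_of_isPullback_of_flat [Flat pV] [QuasiCompact π]
    [QuasiSeparated π] (H : IsPullback pY π' π pV) (h : ∀ U : V.Opens, IsIso (π.app U))
    (h' : ∀ i, 0 < i → IsZero (ConjB.higherDirectImageO π i)) (i : ℕ) (hi : 0 < i) :
    IsZero (ConjB.higherDirectImageO π' i) := by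
  refine isZero_rightDerived_of_acyclic _ _ (isBasis_affineOver pV) (fun D hD => ?_) i hi
  refine acyclic_preimage_of_isPullback_of_flat H (fun U hU => ?_) hD
  refine acyclic_of_isZero_rightDerived _ _ h' _ ?_
  have key : IsIso (pullSh π) := by
    refine TopCat.Sheaf.isIso_iff_isIso_basis (B := fun U : V.Opens => U)
      (by rw [Set.range_id']; exact Opens.isBasis_iff_nbhd.2 fun hx => ⟨_, trivial, hx, le_rfl⟩) ?_
    intro U
    have := h U
    change IsIso ((forget₂ CommRingCat.{u} RingCat.{u} ⋙ forget₂ RingCat.{u}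
      AddCommGrpCat.{u}).map (π.app U))
    infer_instance
  let e : oSh V ≅ (push π).obj (oSh Y) := @asIso _ _ _ _ (pullSh π) key
  exact (acyclic_of_isAffineOpen hU).of_iso (Iso.refl _) e

end BaseChange

end AbSheaf
end

/-! ### Functions on the charts of y² = x⁴ + 1. -/

noncomputable section

namespace Quartic
open Polynomial LaurentPolynomial
open scoped QuadraticAlgebra

/-- The coordinate ring of the affine curve `y² = x⁴ + 1`. -/
abbrev Chart (R : Type u) [CommRing R] : Type u := QuadraticAlgebra R[X] (X ^ 4 + 1) 0

/-- The coordinate ring of the part of the affine curve `y² = x⁴ + 1` where `x` is invertible. -/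
abbrev Overlap (R : Type u) [CommRing R] : Type u :=
  QuadraticAlgebra R[T;T⁻¹] (LaurentPolynomial.T 4 + 1) 0

section Chart

variable {R : Type u} [CommRing R]

/-- The function `x`. -/
def xC (R : Type u) [CommRing R] : Chart R := ⟨X, 0⟩

/-- The function `y`. -/
def yC (R : Type u) [CommRing R] : Chart R := ⟨0, 1⟩

lemma yC_sq : yC R ^ 2 = xC R ^ 4 + 1 := by
  apply QuadraticAlgebra.ext <;> simp [yC, xC, pow_succ]

/-- Constants. -/
def constC (R : Type u) [CommRing R] : R →+* Chart R :=
  (algebraMap R[X] (Chart R)).comp Polynomial.C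

variable {B : Type*} [CommRing B]

/-- Ring homomorphisms from the coordinate ring correspond to points of the curve. -/
def Chart.lift (φ : R →+* B) (x y : B) (h : y ^ 2 = x ^ 4 + 1) : Chart R →+* B where
  toFun z := eval₂ φ x z.re + eval₂ φ x z.im * y
  map_one' := by simp
  map_zero' := by simp
  map_add' a b := by simp; ring
  map_mul' a b := by
    simp only [QuadraticAlgebra.re_mul, QuadraticAlgebra.im_mul, eval₂_add, eval₂_mul, eval₂_pow,
      eval₂_X, eval₂_one, eval₂_zero]
    linear_combination (- eval₂ φ x a.im * eval₂ φ x b.im) * h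

variable (φ : R →+* B) (x y : B) (h : y ^ 2 = x ^ 4 + 1)

@[simp] lemma Chart.lift_x : Chart.lift φ x y h (xC R) = x := by simp [Chart.lift, xC]
@[simp] lemma Chart.lift_y : Chart.lift φ x y h (yC R) = y := by simp [Chart.lift, yC]
@[simp] lemma Chart.lift_const (r : R) : Chart.lift φ x y h (constC R r) = φ r := by
  simp [Chart.lift, constC]

@[ext 900] lemma Chart.hom_ext {f g : Chart R →+* B} (hc : f.comp (constC R) = g.comp (constC R))
    (hx : f (xC R) = g (xC R)) (hy : f (yC R) = g (yC R)) : f = g := by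
  have h1 : f.comp (algebraMap R[X] (Chart R)) = g.comp (algebraMap R[X] (Chart R)) :=
    Polynomial.ringHom_ext (fun a => congr($hc a)) hx
  ext z
  have : z = algebraMap R[X] (Chart R) z.re + algebraMap R[X] (Chart R) z.im * yC R := by
    apply QuadraticAlgebra.ext <;> simp [yC, QuadraticAlgebra.algebraMap_eq]
  rw [this, map_add, map_add, map_mul, map_mul, hy]
  exact congr($h1 z.re + $h1 z.im * _)

/-- Functoriality in the ring of constants. -/
def Chart.map {A : Type*} [CommRing A] (φ : R →+* A) : Chart R →+* Chart A :=
  Chart.lift ((constC A).comp φ) (xC A) (yC A) yC_sq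

/-- The equation has integral coefficients, so formation of the chart commutes with change of
constants; both sides represent pairs (x, y) on the curve. -/
lemma Chart.isPushout {R A : CommRingCat.{u}} (φ : R ⟶ A) :
    IsPushout φ (CommRingCat.ofHom (constC R)) (CommRingCat.ofHom (constC A))
      (CommRingCat.ofHom (Chart.map φ.hom)) := by
  refine ⟨⟨?_⟩, ⟨PushoutCocone.IsColimit.mk _ (fun s => CommRingCat.ofHom (Chart.lift s.inl.hom
    (s.inr (xC R)) (s.inr (yC R)) ?_)) ?_ ?_ ?_⟩⟩
  · ext1
    refine RingHom.ext fun r => ?_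
    simp [Chart.map]
  · have := congrArg s.inr.hom (yC_sq (R := R))
    simpa using this
  · intro s
    ext a
    simp
  · intro s
    have := s.condition
    ext1
    apply Chart.hom_ext
    · ext r
      simpa [Chart.map] using congr($(s.condition).hom r)
    · simp [Chart.map]
    · simp [Chart.map]
  · intro s m h1 h2
    ext1
    apply Chart.hom_ext
    · ext a
      simpa using congr($(h1).hom a)
    · simpa [Chart.map] using congr($(h2).hom (xC R))
    · simpa [Chart.map] using congr($(h2).hom (yC R))

end Chart

section Overlap

variable {R : Type u} [CommRing R]

/-- Restriction of functions to the overlap. -/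
def resX (R : Type u) [CommRing R] : Chart R →+* Overlap R where
  toFun z := ⟨toLaurent z.re, toLaurent z.im⟩
  map_one' := by apply QuadraticAlgebra.ext <;> simp
  map_zero' := by apply QuadraticAlgebra.ext <;> simp
  map_add' a b := by apply QuadraticAlgebra.ext <;> simp
  map_mul' a b := by apply QuadraticAlgebra.ext <;> simp

/-- The involution `x ↦ 1 / x`, `y ↦ y / x²` of the overlap. -/
def flip (R : Type u) [CommRing R] : Overlap R →+* Overlap R where
  toFun z := ⟨invert z.re, T (-2) * invert z.im⟩
  map_one' := by apply QuadraticAlgebra.ext <;> simp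
  map_zero' := by apply QuadraticAlgebra.ext <;> simp
  map_add' a b := by apply QuadraticAlgebra.ext <;> simp [mul_add]
  map_mul' a b := by
    have h1 : (T (-2) * T (-2) : R[T;T⁻¹]) = T (-4) := by rw [← T_add]; norm_num
    have h2 : (T 4 * T (-4) : R[T;T⁻¹]) = 1 := by rw [← T_add]; norm_num
    apply QuadraticAlgebra.ext
    · simp
      linear_combination (- (T 4 + 1) * invert a.im * invert b.im) * h1 -
        (invert a.im * invert b.im) * h2
    · simp
      ring

lemma flip_flip (z : Overlap R) : flip R (flip R z) = z := by
  have h : (T (-2) * T 2 : R[T;T⁻¹]) = 1 := by rw [← T_add]; norm_num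
  apply QuadraticAlgebra.ext
  · exact invert.symm_apply_apply z.re
  · have h1 : invert (invert z.im) = z.im := invert.symm_apply_apply z.im
    simp only [flip, RingHom.coe_mk, MonoidHom.coe_mk, OneHom.coe_mk, map_mul, invert_T, h1]
    rw [← mul_assoc, neg_neg, h, one_mul]

/-- The involution of the overlap as a ring isomorphism. -/
def flipEquiv (R : Type u) [CommRing R] : Overlap R ≃+* Overlap R :=
  RingEquiv.ofRingHom (flip R) (flip R) (RingHom.ext flip_flip) (RingHom.ext flip_flip)

lemma isLocalization_resX :
    letI := (resX R).toAlgebra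
    IsLocalization.Away (xC R) (Overlap R) := by
  let := (resX R).toAlgebra
  have hx (n : ℕ) : resX R (xC R ^ n) = ⟨T n, 0⟩ := by
    rw [map_pow]
    induction n with
    | zero => ext <;> simp
    | succ n ih =>
      rw [pow_succ, ih, Nat.cast_succ, T_add]
      apply QuadraticAlgebra.ext <;> simp [resX, xC, -T_mul]
  refine ⟨?_, ?_, ?_⟩
  · rintro ⟨_, n, rfl⟩
    refine IsUnit.of_mul_eq_one (⟨T (-n), 0⟩ : Overlap R) ?_
    change resX R (xC R ^ n) * _ = 1
    have : (T n * T (-n) : R[T;T⁻¹]) = 1 := by rw [← T_add]; simp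
    rw [hx]
    apply QuadraticAlgebra.ext
    · simpa [-T_mul] using this
    · simp [-T_mul]
  · intro z
    obtain ⟨m, f, hf⟩ := z.re.exists_T_pow
    obtain ⟨n, g, hg⟩ := z.im.exists_T_pow
    refine ⟨⟨⟨X ^ n * f, X ^ m * g⟩, ⟨xC R ^ (m + n), _, rfl⟩⟩, ?_⟩
    change z * resX R (xC R ^ (m + n)) = resX R _
    rw [hx, Nat.cast_add, T_add]
    apply QuadraticAlgebra.ext
    · simp [resX, hf, -T_mul]; ring
    · simp [resX, hg, -T_mul]; ring
  · intro a b hab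
    refine ⟨1, ?_⟩
    have h : resX R a = resX R b := hab
    have h1 := congrArg QuadraticAlgebra.re h
    have h2 := congrArg QuadraticAlgebra.im h
    have : a = b := by
      apply QuadraticAlgebra.ext
      · exact toLaurent_injective h1
      · exact toLaurent_injective h2
    rw [this]

lemma trunc_smul (r : R) (f : R[T;T⁻¹]) : trunc (r • f) = r • trunc f := by
  induction f using LaurentPolynomial.induction_on' with
  | add p q hp hq => rw [smul_add, map_add, map_add, hp, hq, smul_add]
  | C_mul_T n a =>
    have : r • (LaurentPolynomial.C a * T n) = LaurentPolynomial.C (r * a) * T n := by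
      rw [LaurentPolynomial.smul_eq_C_mul, map_mul, mul_assoc]
    rw [this, trunc_C_mul_T, trunc_C_mul_T]
    split_ifs <;> simp [smul_monomial]

lemma coeff_C_mul_T (a : R) (m n : ℤ) :
    (LaurentPolynomial.C a * T m : R[T;T⁻¹]).coeff n = if m = n then a else 0 := by
  rw [← single_eq_C_mul_T]
  exact Finsupp.single_apply

lemma coeff_T_mul (m n : ℤ) (f : R[T;T⁻¹]) : (T m * f).coeff n = f.coeff (n - m) := by
  induction f using LaurentPolynomial.induction_on' with
  | add p q hp hq => rw [mul_add, AddMonoidAlgebra.coeff_add, AddMonoidAlgebra.coeff_add,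
      Finsupp.add_apply, Finsupp.add_apply, hp, hq]
  | C_mul_T k a =>
    rw [mul_left_comm, ← T_add, coeff_C_mul_T, coeff_C_mul_T]
    congr 1
    exact propext (by omega)

lemma coeff_toLaurent_trunc (f : R[T;T⁻¹]) (n : ℤ) :
    (toLaurent (trunc f)).coeff n = if 0 ≤ n then f.coeff n else 0 := by
  induction f using LaurentPolynomial.induction_on' with
  | add p q hp hq =>
    rw [map_add, map_add, AddMonoidAlgebra.coeff_add, AddMonoidAlgebra.coeff_add,
      Finsupp.add_apply, Finsupp.add_apply, hp, hq]
    split_ifs <;> simp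
  | C_mul_T k a =>
    rw [trunc_C_mul_T, coeff_C_mul_T]
    split_ifs with h1 h2 h3 h4 h5
    · rw [toLaurent_C_mul_T, coeff_C_mul_T, Int.toNat_of_nonneg h1, if_pos h3]
    · rw [toLaurent_C_mul_T, coeff_C_mul_T, Int.toNat_of_nonneg h1, if_neg h3]
    · rw [toLaurent_C_mul_T, coeff_C_mul_T, Int.toNat_of_nonneg h1, if_neg (by omega)]
    · omega
    · simp
    · simp

lemma coeff_toLaurent_of_neg (p : R[X]) {n : ℤ} (h : n < 0) : (toLaurent p).coeff n = 0 := by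
  rw [← trunc_toLaurent p, coeff_toLaurent_trunc, if_neg (by omega)]

/-- The part of a function on the overlap that extends to the chart, without constant term. -/
def chartPart (R : Type u) [CommRing R] : Overlap R →ₗ[R] Chart R where
  toFun z := ⟨X * trunc (T (-1) * z.re), trunc z.im⟩
  map_add' a b := by apply QuadraticAlgebra.ext <;> simp [mul_add, -T_mul]
  map_smul' r a := by
    apply QuadraticAlgebra.ext <;> simp [trunc_smul, -T_mul]

/-- The constant term. -/
def constPart (R : Type u) [CommRing R] : Overlap R →ₗ[R] R where
  toFun z := z.re.coeff 0
  map_add' a b := by simp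
  map_smul' r a := by simp

/-- The coefficient of `y / x`. -/
def polarPart (R : Type u) [CommRing R] : Overlap R →ₗ[R] R where
  toFun z := z.im.coeff (-1)
  map_add' a b := by simp
  map_smul' r a := by simp

/-- The function `y / x`. -/
def yDivX (R : Type u) [CommRing R] : Overlap R := ⟨0, T (-1)⟩

lemma constPart_apply (z : Overlap R) : constPart R z = z.re.coeff 0 := rfl

lemma polarPart_apply (z : Overlap R) : polarPart R z = z.im.coeff (-1) := rfl

/-- Sort monomials. The affine chart supplies xⁿ and xⁿy for n ≥ 0; the chart at infinity supplies
xⁿ for n ≤ 0 and, since its second coordinate is y/x², xⁿy for n ≤ -2. Only y/x is missed, so H¹(𝒪)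
has rank one. -/
lemma overlap_decomposition (z : Overlap R) :
    z = resX R (chartPart R z) + flip R (resX R (chartPart R (flip R z))) + constPart R z • 1 +
      polarPart R z • yDivX R := by
  apply QuadraticAlgebra.ext
  · have h (f : R[T;T⁻¹]) : f = toLaurent (X * trunc (T (-1) * f)) +
        invert (toLaurent (X * trunc (T (-1) * invert f))) + f.coeff 0 • T 0 := by
      refine LaurentPolynomial.ext fun n => ?_
      simp only [map_mul, toLaurent_X, invert_T, AddMonoidAlgebra.coeff_add, Finsupp.add_apply,
        coeff_T_mul, coeff_toLaurent_trunc, invert_apply, AddMonoidAlgebra.coeff_smul,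
        Finsupp.smul_apply, T_apply, smul_eq_mul]
      rcases lt_trichotomy n 0 with hn | rfl | hn
      · rw [if_neg (by omega), if_pos (by omega), if_neg (by omega)]
        simp
      · simp
      · rw [if_pos (by omega), if_neg (by omega), if_neg (by omega)]
        simp
    simpa [chartPart, flip, resX, constPart_apply, yDivX, -T_mul] using h z.re
  · have h (f : R[T;T⁻¹]) : f = toLaurent (trunc f) +
        T (-2) * invert (toLaurent (trunc (T (-2) * invert f))) + f.coeff (-1) • T (-1) := by
      refine LaurentPolynomial.ext fun n => ?_
      simp only [AddMonoidAlgebra.coeff_add, Finsupp.add_apply,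
        coeff_T_mul, coeff_toLaurent_trunc, invert_apply, AddMonoidAlgebra.coeff_smul,
        Finsupp.smul_apply, T_apply, smul_eq_mul]
      rcases lt_trichotomy n (-1) with hn | rfl | hn
      · rw [if_neg (by omega), if_pos (by omega), if_neg (by omega)]
        simp
      · simp
      · rw [if_pos (by omega), if_neg (by omega), if_neg (by omega)]
        simp
    simpa [chartPart, flip, resX, polarPart_apply, yDivX, -T_mul] using h z.im

/-- Constants extend to both charts; they are split off into a separate summand so that they are not
counted twice. -/
lemma chartPart_resX (p : Chart R) :
    chartPart R (resX R p) = p - constPart R (resX R p) • 1 := by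
  apply QuadraticAlgebra.ext
  · apply toLaurent_injective
    refine LaurentPolynomial.ext fun n => ?_
    have h1 : (toLaurent ((resX R p).re.coeff 0 • (1 : R[X]))).coeff n =
        if 0 = n then (toLaurent p.re).coeff 0 else 0 := by
      rw [Polynomial.smul_eq_C_mul, mul_one, toLaurent_C, C_apply]
      simp [resX, eq_comm]
    simp only [QuadraticAlgebra.re_sub, QuadraticAlgebra.re_smul, QuadraticAlgebra.re_one, map_sub,
      AddMonoidAlgebra.coeff_sub, Finsupp.sub_apply, constPart_apply]
    rw [h1]
    simp only [chartPart, resX, LinearMap.coe_mk, AddHom.coe_mk, RingHom.coe_mk, MonoidHom.coe_mk,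
      OneHom.coe_mk, map_mul, toLaurent_X, coeff_T_mul, coeff_toLaurent_trunc]
    rcases lt_trichotomy n 0 with hn | rfl | hn
    · rw [if_neg (by omega), if_neg (by omega), coeff_toLaurent_of_neg _ hn, sub_zero]
    · simp
    · rw [if_pos (by omega), if_neg (by omega)]
      simp
  · simp [chartPart, resX, trunc_toLaurent]

lemma chartPart_flip_resX (p : Chart R) : chartPart R (flip R (resX R p)) = 0 := by
  apply QuadraticAlgebra.ext
  · apply toLaurent_injective
    refine LaurentPolynomial.ext fun n => ?_
    simp only [chartPart, flip, resX, LinearMap.coe_mk, AddHom.coe_mk, RingHom.coe_mk,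
      MonoidHom.coe_mk, OneHom.coe_mk, map_mul, toLaurent_X, coeff_T_mul, coeff_toLaurent_trunc,
      invert_apply, QuadraticAlgebra.re_zero, map_zero]
    split_ifs
    · exact coeff_toLaurent_of_neg _ (by omega)
    · rfl
  · apply toLaurent_injective
    refine LaurentPolynomial.ext fun n => ?_
    simp only [chartPart, flip, resX, LinearMap.coe_mk, AddHom.coe_mk, RingHom.coe_mk,
      MonoidHom.coe_mk, OneHom.coe_mk, coeff_T_mul, coeff_toLaurent_trunc,
      invert_apply, QuadraticAlgebra.im_zero, map_zero]
    split_ifs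
    · exact coeff_toLaurent_of_neg _ (by omega)
    · rfl

lemma constPart_flip (z : Overlap R) : constPart R (flip R z) = constPart R z := by
  simp [constPart_apply, flip]

lemma constPart_one : constPart R 1 = 1 := by
  have : (1 : R[T;T⁻¹]) = T 0 := T_zero.symm
  rw [constPart_apply, QuadraticAlgebra.re_one, this]
  simp [-T_zero]

lemma polarPart_yDivX : polarPart R (yDivX R) = 1 := by
  simp [polarPart_apply, yDivX]

lemma polarPart_resX (p : Chart R) : polarPart R (resX R p) = 0 :=
  coeff_toLaurent_of_neg _ (by norm_num)

lemma polarPart_flip_resX (p : Chart R) : polarPart R (flip R (resX R p)) = 0 := by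
  rw [polarPart_apply]
  simp only [flip, resX, RingHom.coe_mk, MonoidHom.coe_mk, OneHom.coe_mk, coeff_T_mul,
    invert_apply]
  exact coeff_toLaurent_of_neg _ (by norm_num)

end Overlap

end Quartic
end

/-! ### Schemes glued from two open subschemes. -/

noncomputable section

/-- A scheme covered by two open subschemes `Z₁`, `Z₂` with intersection `Z₁₂`. -/
structure IsTwoCover {Z Z₁ Z₂ Z₁₂ : Scheme.{u}} (i₁ : Z₁₂ ⟶ Z₁) (i₂ : Z₁₂ ⟶ Z₂) (j₁ : Z₁ ⟶ Z)
    (j₂ : Z₂ ⟶ Z) : Prop where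
  open₁ : IsOpenImmersion j₁
  open₂ : IsOpenImmersion j₂
  isPullback : IsPullback i₁ i₂ j₁ j₂
  cover : j₁.opensRange ⊔ j₂.opensRange = ⊤

namespace IsTwoCover

section

variable {X Y P : Scheme.{u}} (f : P ⟶ X) (g : P ⟶ Y) [IsOpenImmersion f] [IsOpenImmersion g]

instance {i j : WalkingSpan} (φ : i ⟶ j) : IsOpenImmersion ((span f g).map φ) := by
  rcases φ with _ | (_ | _)
  · exact inferInstanceAs (IsOpenImmersion ((span f g).map (𝟙 _)))
  · exact inferInstanceAs (IsOpenImmersion f)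
  · exact inferInstanceAs (IsOpenImmersion g)

instance : (span f g ⋙ Scheme.forget).IsLocallyDirected :=
  inferInstanceAs ((show WidePushoutShape WalkingPair ⥤ Scheme.{u} from span f g) ⋙
    Scheme.forget).IsLocallyDirected

instance : HasPushout f g := inferInstanceAs (HasColimit (span f g))

/-- Two schemes glued along an open subscheme. -/
lemma of_pushout : IsTwoCover f g (pushout.inl f g) (pushout.inr f g) where
  open₁ := inferInstanceAs (IsOpenImmersion (colimit.ι (span f g) WalkingSpan.left))
  open₂ := inferInstanceAs (IsOpenImmersion (colimit.ι (span f g) WalkingSpan.right))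
  isPullback := by
    have h1 : IsOpenImmersion (pushout.inl f g) :=
      inferInstanceAs (IsOpenImmersion (colimit.ι (span f g) WalkingSpan.left))
    have h2 : IsOpenImmersion (pushout.inr f g) :=
      inferInstanceAs (IsOpenImmersion (colimit.ι (span f g) WalkingSpan.right))
    refine (IsOpenImmersion.isPullback g f (pushout.inr f g) (pushout.inl f g)
      pushout.condition ?_).flip
    ext x
    constructor
    · rintro ⟨y, hy⟩
      obtain ⟨k, fi, fj, z, hz, hz'⟩ := (Scheme.IsLocallyDirected.ι_eq_ι_iff (span f g)
        (i := WalkingSpan.right) (j := WalkingSpan.left)).1 hy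
      cases k with
      | none =>
        have : fj = WalkingSpan.Hom.fst := Subsingleton.elim _ _
        subst this
        exact ⟨z, hz'⟩
      | some k => cases k <;> rcases fi with _ | _ <;> rcases fj with _ | _
    · rintro ⟨z, rfl⟩
      refine ⟨g z, ?_⟩
      have := congr($(pushout.condition (f := f) (g := g)) z)
      exact this.symm
  cover := by
    rw [eq_top_iff]
    intro x _
    obtain ⟨i, y, hy⟩ := Scheme.IsLocallyDirected.ι_jointly_surjective (span f g) x
    rcases i with _ | (_ | _)
    · left
      refine ⟨f y, ?_⟩
      have := congr($(colimit.w (span f g) WalkingSpan.Hom.fst) y)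
      exact this.trans hy
    · exact Or.inl ⟨y, hy⟩
    · exact Or.inr ⟨y, hy⟩

end

variable {Z Z₁ Z₂ Z₁₂ : Scheme.{u}} {i₁ : Z₁₂ ⟶ Z₁} {i₂ : Z₁₂ ⟶ Z₂} {j₁ : Z₁ ⟶ Z} {j₂ : Z₂ ⟶ Z}

lemma symm (h : IsTwoCover i₁ i₂ j₁ j₂) : IsTwoCover i₂ i₁ j₂ j₁ :=
  ⟨h.open₂, h.open₁, h.isPullback.flip, by rw [sup_comm, h.cover]⟩

lemma preimage_opensRange (h : IsTwoCover i₁ i₂ j₁ j₂) :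
    haveI := h.open₁; haveI := h.open₂
    haveI : IsOpenImmersion i₁ := MorphismProperty.of_isPullback h.isPullback.flip h.open₂
    j₁ ⁻¹ᵁ j₂.opensRange = i₁.opensRange := by
  have := h.open₁; have := h.open₂
  have : IsOpenImmersion i₁ := MorphismProperty.of_isPullback h.isPullback.flip h.open₂
  have := IsOpenImmersion.image_preimage_eq_preimage_image_of_isPullback h.isPullback.flip ⊤
  simpa using this.symm

lemma isOpenImmersion₁ (h : IsTwoCover i₁ i₂ j₁ j₂) : IsOpenImmersion i₁ :=
  MorphismProperty.of_isPullback h.isPullback.flip h.open₂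

lemma isOpenImmersion₂ (h : IsTwoCover i₁ i₂ j₁ j₂) : IsOpenImmersion i₂ :=
  h.symm.isOpenImmersion₁

/-- The two chart images cover the target, and their inverse images in the first chart are the chart
itself and the overlap, both affine. -/
lemma isAffineHom_of_isAffine (h : IsTwoCover i₁ i₂ j₁ j₂) [IsAffine Z₁] [IsAffine Z₂]
    [IsAffine Z₁₂] : IsAffineHom j₁ := by
  have := h.open₁
  have := h.open₂
  have := h.isOpenImmersion₁
  refine isAffineHom_of_forall_exists_isAffineOpen _ fun x => ?_
  have hx : x ∈ j₁.opensRange ⊔ j₂.opensRange := h.cover ▸ trivial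
  rcases hx with hx | hx
  · refine ⟨j₁.opensRange, hx, isAffineOpen_opensRange j₁, ?_⟩
    rw [Scheme.Hom.preimage_opensRange]
    exact isAffineOpen_top _
  · refine ⟨j₂.opensRange, hx, isAffineOpen_opensRange j₂, ?_⟩
    rw [h.preimage_opensRange]
    exact isAffineOpen_opensRange i₁

variable {Z' : Scheme.{u}} (f : Z' ⟶ Z)

/-- The base change of the overlap. -/
abbrev overlapMap (h : IsTwoCover i₁ i₂ j₁ j₂) :
    pullback (pullback.fst f j₁) (pullback.fst f j₂) ⟶ Z₁₂ :=
  h.isPullback.lift (pullback.fst _ _ ≫ pullback.snd f j₁) (pullback.snd _ _ ≫ pullback.snd f j₂)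
    (by rw [Category.assoc, Category.assoc, ← pullback.condition, ← pullback.condition,
      pullback.condition_assoc])

lemma baseChange (h : IsTwoCover i₁ i₂ j₁ j₂) :
    IsTwoCover (pullback.fst (pullback.fst f j₁) (pullback.fst f j₂)) (pullback.snd _ _)
      (pullback.fst f j₁) (pullback.fst f j₂) := by
  have := h.open₁
  have := h.open₂
  refine ⟨inferInstance, inferInstance, IsPullback.of_hasPullback _ _, ?_⟩
  rw [Scheme.Hom.opensRange_pullbackFst, Scheme.Hom.opensRange_pullbackFst,
    ← Scheme.Hom.preimage_sup, h.cover, Scheme.Hom.preimage_top]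

lemma isPullback_overlapMap (h : IsTwoCover i₁ i₂ j₁ j₂) :
    IsPullback (pullback.fst (pullback.fst f j₁) (pullback.fst f j₂)) (h.overlapMap f)
      (pullback.snd f j₁) i₁ := by
  have h1 := (IsPullback.of_hasPullback (pullback.fst f j₁) (pullback.fst f j₂)).paste_vert
    (IsPullback.of_hasPullback f j₂)
  refine .of_bot (v₂₁ := i₂) (v₂₂ := j₁) (h₃₁ := j₂) ?_ ?_ h.isPullback
  · rwa [IsPullback.lift_snd, ← pullback.condition]
  · rw [IsPullback.lift_fst]

/-- The open cover by two open subschemes. -/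
def openCover (h : IsTwoCover i₁ i₂ j₁ j₂) : Z.OpenCover :=
  .mkOfCovers (ULift.{u} Bool) (fun b => bif b.down then Z₁ else Z₂)
    (fun b => match b with
      | ⟨true⟩ => j₁
      | ⟨false⟩ => j₂)
    (fun x => by
      have hx : x ∈ (haveI := h.open₁; haveI := h.open₂; j₁.opensRange ⊔ j₂.opensRange) := by
        rw [h.cover]; trivial
      rcases hx with ⟨y, hy⟩ | ⟨y, hy⟩
      · exact ⟨⟨true⟩, y, hy⟩
      · exact ⟨⟨false⟩, y, hy⟩)
    (fun b => match b with
      | ⟨true⟩ => h.open₁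
      | ⟨false⟩ => h.open₂)

/-- A property of morphisms that is local on the source can be checked on two open subschemes. -/
lemma of_comp (P : MorphismProperty Scheme.{u}) [IsZariskiLocalAtSource P]
    (h : IsTwoCover i₁ i₂ j₁ j₂) {S : Scheme.{u}} {g : Z ⟶ S} (h₁ : P (j₁ ≫ g))
    (h₂ : P (j₂ ≫ g)) : P g := by
  rw [IsZariskiLocalAtSource.iff_of_openCover (P := P) h.openCover]
  rintro ⟨_ | _⟩
  · exact h₂
  · exact h₁

lemma compactSpace (h : IsTwoCover i₁ i₂ j₁ j₂) [CompactSpace Z₁] [CompactSpace Z₂] :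
    CompactSpace Z := by
  have : Finite h.openCover.I₀ := inferInstanceAs (Finite (ULift Bool))
  have (i : h.openCover.I₀) : CompactSpace (h.openCover.X i) := by
    rcases i with ⟨_ | _⟩ <;> assumption
  exact h.openCover.compactSpace

end IsTwoCover

/-! ### The genus one curve over a base ring. -/

namespace Quartic

variable (R : CommRingCat.{u})

instance : IsOpenImmersion (Spec.map (CommRingCat.ofHom (resX R))) :=
  letI := (resX R).toAlgebra
  haveI : IsLocalization.Away (xC R) (Overlap R) := isLocalization_resX
  IsOpenImmersion.of_isLocalization (xC (R : Type u))

/-- The involution of the overlap. -/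
def flipIso : CommRingCat.of (Overlap R) ≅ CommRingCat.of (Overlap R) :=
  (flipEquiv R).toCommRingCatIso

/-- Restriction from the chart at infinity. -/
abbrev resX' : Chart R →+* Overlap R := (flip R).comp (resX R)

instance : IsOpenImmersion (Spec.map (CommRingCat.ofHom (resX' R))) := by
  have : CommRingCat.ofHom (resX' R) = CommRingCat.ofHom (resX R) ≫ (flipIso R).hom := rfl
  rw [this, Spec.map_comp]
  infer_instance

/-- The curve of genus one with affine equation `y² = x⁴ + 1`. -/
def curve : Scheme.{u} :=
  pushout (Spec.map (CommRingCat.ofHom (resX R))) (Spec.map (CommRingCat.ofHom (resX' R)))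

/-- The affine chart. -/
def chart₁ : Spec (.of (Chart R)) ⟶ curve R := pushout.inl _ _

/-- The chart at infinity. -/
def chart₂ : Spec (.of (Chart R)) ⟶ curve R := pushout.inr _ _

lemma isTwoCover_curve : IsTwoCover (Spec.map (CommRingCat.ofHom (resX R)))
    (Spec.map (CommRingCat.ofHom (resX' R))) (chart₁ R) (chart₂ R) := .of_pushout _ _

lemma resX_const (r : R) : resX R (constC R r) = algebraMap R (Overlap R) r := by
  apply QuadraticAlgebra.ext
  · exact Polynomial.toLaurent_C r
  · exact map_zero _

lemma flip_const (r : R) : flip R (algebraMap R (Overlap R) r) = algebraMap R (Overlap R) r := by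
  apply QuadraticAlgebra.ext
  · exact LaurentPolynomial.invert.commutes r
  · exact (congrArg (_ * ·) (map_zero _)).trans (mul_zero _)

/-- The structure morphism of the curve. -/
def curveHom : curve R ⟶ Spec R :=
  pushout.desc (Spec.map (CommRingCat.ofHom (constC R))) (Spec.map (CommRingCat.ofHom (constC R)))
    (by
      rw [← Spec.map_comp, ← Spec.map_comp]
      congr 1
      ext1
      refine RingHom.ext fun r => ?_
      change resX R (constC R r) = flip R (resX R (constC R r))
      rw [resX_const, flip_const])

@[simp]
lemma chart₁_curveHom : chart₁ R ≫ curveHom R = Spec.map (CommRingCat.ofHom (constC R)) :=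
  pushout.inl_desc _ _ _

@[simp]
lemma chart₂_curveHom : chart₂ R ≫ curveHom R = Spec.map (CommRingCat.ofHom (constC R)) :=
  pushout.inr_desc _ _ _

instance : IsOpenImmersion (chart₁ R) := (isTwoCover_curve R).open₁
instance : IsOpenImmersion (chart₂ R) := (isTwoCover_curve R).open₂
instance : IsAffineHom (chart₁ R) := (isTwoCover_curve R).isAffineHom_of_isAffine
instance : IsAffineHom (chart₂ R) := (isTwoCover_curve R).symm.isAffineHom_of_isAffine

instance : CompactSpace (curve R) := (isTwoCover_curve R).compactSpace

instance : Flat (curveHom R) := by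
  have : Flat (Spec.map (CommRingCat.ofHom (constC R))) := by
    rw [HasRingHomProperty.Spec_iff (P := @Flat)]
    exact RingHom.flat_algebraMap_iff.2 (Module.Flat.trans R (Polynomial R) (Chart R))
  have : IsZariskiLocalAtSource @Flat.{u} := HasRingHomProperty.instIsZariskiLocalAtSource
  exact (isTwoCover_curve R).of_comp @Flat (by rwa [chart₁_curveHom]) (by rwa [chart₂_curveHom])

instance : LocallyOfFiniteType (curveHom R) := by
  have : LocallyOfFiniteType (Spec.map (CommRingCat.ofHom (constC R))) := by
    rw [HasRingHomProperty.Spec_iff (P := @LocallyOfFiniteType)]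
    have : Algebra.FiniteType R (Chart R) := .trans (S := Polynomial R) inferInstance inferInstance
    exact RingHom.finiteType_algebraMap.2 this
  have : IsZariskiLocalAtSource @LocallyOfFiniteType.{u} :=
    HasRingHomProperty.instIsZariskiLocalAtSource
  exact (isTwoCover_curve R).of_comp @LocallyOfFiniteType (by rwa [chart₁_curveHom])
    (by rwa [chart₂_curveHom])

instance : QuasiCompact (curveHom R) := inferInstance

end Quartic

end

/-! ### The Mayer–Vietoris sequence of direct images. -/

noncomputable section

namespace AbSheaf
open Abelian Opposite

lemma preimage_inf_opensRange {X Y : Scheme.{u}} (j : X ⟶ Y) [IsOpenImmersion j] (U : Y.Opens) :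
    j ⁻¹ᵁ (U ⊓ j.opensRange) = j ⁻¹ᵁ U := by
  rw [Scheme.Hom.preimage_inf, Scheme.Hom.preimage_opensRange, inf_top_eq]

lemma preimage_le_of_comp_eq {X Y Z : Scheme.{u}} {f : X ⟶ Y} {g : Y ⟶ Z} {h : X ⟶ Z}
    (e : f ≫ g = h) (U : Z.Opens) : h ⁻¹ᵁ U ≤ f ⁻¹ᵁ g ⁻¹ᵁ U := by
  rw [← e]
  rfl

lemma evalGen_homEquivSec_symm_comp {X : TopCat.{u}} (U : Opens X) {F G : AbSh X}
    (s : F.obj.obj (op U)) (φ : F ⟶ G) :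
    evalGen U G ((homEquivSec U F).symm s ≫ φ) = φ.hom.app (op U) s :=
  (evalGen_comp _ _ _).trans (congrArg _ (evalGen_homEquivSec_symm U F s))

lemma appLE_bijective_of_isOpenImmersion {X Y : Scheme.{u}} (j : X ⟶ Y) [IsOpenImmersion j]
    {U : Y.Opens} {V : X.Opens} (hV : V = j ⁻¹ᵁ U) (hU : U ≤ j.opensRange) :
    Function.Bijective (j.appLE U V hV.le) := by
  subst hV
  have := j.isIso_app U hU
  rw [Scheme.Hom.appLE_eq_app]
  exact (ConcreteCategory.isIso_iff_bijective _).1 this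

lemma exists_glue₂ {X : Scheme.{u}} {U V W : X.Opens} (hU : U ≤ W) (hV : V ≤ W)
    (hW : W ≤ U ⊔ V) (s : Γ(X, U)) (t : Γ(X, V))
    (h : X.presheaf.map (homOfLE (inf_le_left : U ⊓ V ≤ U)).op s =
      X.presheaf.map (homOfLE (inf_le_right : U ⊓ V ≤ V)).op t) :
    ∃ r : Γ(X, W), X.presheaf.map (homOfLE hU).op r = s ∧ X.presheaf.map (homOfLE hV).op r = t := by
  let C : Bool → X.Opens := fun b => cond b U V
  obtain ⟨r, hr, -⟩ := X.sheaf.existsUnique_gluing' C W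
    (fun b => match b with
      | true => homOfLE hU
      | false => homOfLE hV)
    (hW.trans (sup_le (le_iSup C true) (le_iSup C false)))
    (fun b => match b with
      | true => s
      | false => t) (by
    rintro (_ | _) (_ | _)
    · rfl
    · have h' : X.presheaf.map (homOfLE (inf_le_left : V ⊓ U ≤ V)).op t =
          X.presheaf.map (homOfLE (inf_le_right : V ⊓ U ≤ U)).op s := by
        have := congrArg (X.presheaf.map (homOfLE (le_of_eq (inf_comm V U))).op) h
        rw [← CommRingCat.comp_apply, ← CommRingCat.comp_apply, ← Functor.map_comp,
          ← Functor.map_comp] at this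
        exact this.symm
      exact h'
    · exact h
    · rfl)
  exact ⟨r, hr true, hr false⟩

end AbSheaf

namespace IsTwoCover
open AbSheaf Abelian Opposite

variable {Z Z₁ Z₂ Z₁₂ : Scheme.{u}} {i₁ : Z₁₂ ⟶ Z₁} {i₂ : Z₁₂ ⟶ Z₂} {j₁ : Z₁ ⟶ Z} {j₂ : Z₂ ⟶ Z}

lemma le_range_sup (h : IsTwoCover i₁ i₂ j₁ j₂) (W : Z.Opens) :
    haveI := h.open₁; haveI := h.open₂
    W ≤ W ⊓ j₁.opensRange ⊔ W ⊓ j₂.opensRange := by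
  have := h.open₁; have := h.open₂
  rw [← inf_sup_left, h.cover, inf_top_eq]

lemma section_ext (h : IsTwoCover i₁ i₂ j₁ j₂) {W : Z.Opens} {s t : Γ(Z, W)}
    (h₁ : j₁.app W s = j₁.app W t) (h₂ : j₂.app W s = j₂.app W t) : s = t := by
  have := h.open₁; have := h.open₂
  have key {Z' : Scheme.{u}} (j : Z' ⟶ Z) [IsOpenImmersion j] (hj : j.app W s = j.app W t) :
      Z.presheaf.map (homOfLE (inf_le_left : W ⊓ j.opensRange ≤ W)).op s =
        Z.presheaf.map (homOfLE (inf_le_left : W ⊓ j.opensRange ≤ W)).op t := by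
    apply (appLE_bijective_of_isOpenImmersion j (U := W ⊓ j.opensRange) (V := j ⁻¹ᵁ W)
      (preimage_inf_opensRange _ _).symm inf_le_right).1
    rw [← CommRingCat.comp_apply, ← CommRingCat.comp_apply, Scheme.Hom.map_appLE,
      Scheme.Hom.appLE_eq_app]
    exact hj
  exact Z.sheaf.eq_of_locally_eq₂ (homOfLE inf_le_left) (homOfLE inf_le_left) (h.le_range_sup W) _ _
    (key j₁ h₁) (key j₂ h₂)

lemma opensRange_comp (h : IsTwoCover i₁ i₂ j₁ j₂) :
    haveI := h.open₁; haveI := h.open₂; haveI := h.isOpenImmersion₁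
    (i₁ ≫ j₁).opensRange = j₁.opensRange ⊓ j₂.opensRange := by
  have := h.open₁; have := h.open₂; have := h.isOpenImmersion₁
  rw [Scheme.Hom.opensRange_comp, ← h.preimage_opensRange,
    Scheme.Hom.image_preimage_eq_opensRange_inf]

lemma exists_section (h : IsTwoCover i₁ i₂ j₁ j₂) {W : Z.Opens} (s₁ : Γ(Z₁, j₁ ⁻¹ᵁ W))
    (s₂ : Γ(Z₂, j₂ ⁻¹ᵁ W))
    (hs : i₁.appLE (j₁ ⁻¹ᵁ W) ((i₁ ≫ j₁) ⁻¹ᵁ W) (preimage_le_of_comp_eq rfl W) s₁ =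
      i₂.appLE (j₂ ⁻¹ᵁ W) ((i₁ ≫ j₁) ⁻¹ᵁ W)
        (preimage_le_of_comp_eq h.isPullback.w.symm W) s₂) :
    ∃ s : Γ(Z, W), j₁.app W s = s₁ ∧ j₂.app W s = s₂ := by
  have := h.open₁; have := h.open₂; have := h.isOpenImmersion₁
  obtain ⟨t₁, ht₁⟩ := (appLE_bijective_of_isOpenImmersion j₁ (U := W ⊓ j₁.opensRange)
    (V := j₁ ⁻¹ᵁ W) (preimage_inf_opensRange _ _).symm inf_le_right).2 s₁
  obtain ⟨t₂, ht₂⟩ := (appLE_bijective_of_isOpenImmersion j₂ (U := W ⊓ j₂.opensRange)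
    (V := j₂ ⁻¹ᵁ W) (preimage_inf_opensRange _ _).symm inf_le_right).2 s₂
  have e₁ : (i₁ ≫ j₁) ⁻¹ᵁ W = (i₁ ≫ j₁) ⁻¹ᵁ (W ⊓ j₁.opensRange ⊓ (W ⊓ j₂.opensRange)) := by
    rw [← inf_inf_distrib_left, ← h.opensRange_comp, preimage_inf_opensRange]
  obtain ⟨s, hs₁, hs₂⟩ := exists_glue₂ (inf_le_left : W ⊓ j₁.opensRange ≤ W)
    (inf_le_left : W ⊓ j₂.opensRange ≤ W) (h.le_range_sup W) t₁ t₂ (by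
    apply (appLE_bijective_of_isOpenImmersion (i₁ ≫ j₁)
      (U := W ⊓ j₁.opensRange ⊓ (W ⊓ j₂.opensRange)) (V := (i₁ ≫ j₁) ⁻¹ᵁ W) e₁ (by
        rw [h.opensRange_comp]
        exact inf_le_inf inf_le_right inf_le_right)).1
    rw [← CommRingCat.comp_apply, ← CommRingCat.comp_apply, Scheme.Hom.map_appLE,
      Scheme.Hom.map_appLE]
    rw [← ht₁, ← ht₂, ← CommRingCat.comp_apply, ← CommRingCat.comp_apply,
      Scheme.Hom.appLE_comp_appLE, Scheme.Hom.appLE_comp_appLE] at hs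
    simp only [← h.isPullback.w] at hs
    exact hs)
  refine ⟨s, ?_, ?_⟩
  · rw [← ht₁, ← hs₁, ← CommRingCat.comp_apply, Scheme.Hom.map_appLE, Scheme.Hom.appLE_eq_app]
  · rw [← ht₂, ← hs₂, ← CommRingCat.comp_apply, Scheme.Hom.map_appLE, Scheme.Hom.appLE_eq_app]

/-- Restriction between direct images of structure sheaves. -/
def pushMap {A B : Scheme.{u}} (φ : A ⟶ B) (b : B ⟶ Z) (a : A ⟶ Z) (h : φ ≫ b = a) :
    (push b).obj (oSh B) ⟶ (push a).obj (oSh A) where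
  hom :=
    { app := fun U => AddCommGrpCat.ofHom (φ.appLE (b ⁻¹ᵁ U.unop) (a ⁻¹ᵁ U.unop)
        (preimage_le_of_comp_eq h _)).hom.toAddMonoidHom
      naturality := fun U V f => by
        ext s
        have := congr($(φ.map_appLE (preimage_le_of_comp_eq h V.unop)
          ((Opens.map b.base).map f.unop).op).hom s)
        refine this.trans ?_
        exact congr($(φ.appLE_map (preimage_le_of_comp_eq h U.unop)
          ((Opens.map a.base).map f.unop).op).hom s).symm }

/-- The Mayer-Vietoris sequence of sheaves attached to a cover by two open subschemes. -/
abbrev ses (h : IsTwoCover i₁ i₂ j₁ j₂) : ShortComplex (AbSh Z.carrier) :=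
  .mk (X₁ := oSh Z) (X₂ := (push j₁).obj (oSh Z₁) ⊞ (push j₂).obj (oSh Z₂))
    (X₃ := (push (i₁ ≫ j₁)).obj (oSh Z₁₂)) (biprod.lift (pullSh j₁) (pullSh j₂))
    (biprod.desc (pushMap i₁ j₁ _ rfl) (-pushMap i₂ j₂ _ h.isPullback.w.symm)) (by
      rw [biprod.lift_desc, Preadditive.comp_neg, ← sub_eq_add_neg, sub_eq_zero]
      refine oSh_hom_ext fun U s => ?_
      change i₁.appLE (j₁ ⁻¹ᵁ U) ((i₁ ≫ j₁) ⁻¹ᵁ U) (preimage_le_of_comp_eq rfl U) (j₁.app U s) =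
        i₂.appLE (j₂ ⁻¹ᵁ U) ((i₁ ≫ j₁) ⁻¹ᵁ U) (preimage_le_of_comp_eq h.isPullback.w.symm U)
          (j₂.app U s)
      rw [Scheme.Hom.app_eq_appLE, Scheme.Hom.app_eq_appLE, ← CommRingCat.comp_apply,
        ← CommRingCat.comp_apply, Scheme.Hom.appLE_comp_appLE, Scheme.Hom.appLE_comp_appLE]
      simp only [h.isPullback.w])

lemma ses_mono (h : IsTwoCover i₁ i₂ j₁ j₂) : Mono h.ses.f := by
  refine Preadditive.mono_of_cancel_zero _ fun {G} φ hφ => ?_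
  have h1 : φ ≫ pullSh j₁ = 0 := by
    have := congrArg (· ≫ biprod.fst) hφ
    simpa using this
  have h2 : φ ≫ pullSh j₂ = 0 := by
    have := congrArg (· ≫ biprod.snd) hφ
    simpa using this
  apply ObjectProperty.hom_ext
  ext U s
  refine h.section_ext (W := U.unop) ?_ ?_
  · refine (congr(($h1).hom.app U s)).trans (map_zero (j₁.app U.unop).hom).symm
  · refine (congr(($h2).hom.app U s)).trans (map_zero (j₂.app U.unop).hom).symm

lemma ses_exact (h : IsTwoCover i₁ i₂ j₁ j₂) : h.ses.Exact := by
  refine exact_of_basis _ (B := Set.univ)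
    (Opens.isBasis_iff_nbhd.2 fun hx => ⟨_, trivial, hx, le_rfl⟩) fun W _ x hx => ?_
  let x₁ := x ≫ biprod.fst
  let x₂ := x ≫ biprod.snd
  have h1 : x₁ ≫ pushMap i₁ j₁ _ rfl = x₂ ≫ pushMap i₂ j₂ _ h.isPullback.w.symm := by
    change x ≫ biprod.desc _ _ = 0 at hx
    rw [biprod.desc_eq, Preadditive.comp_neg, Preadditive.comp_add, Preadditive.comp_neg,
      ← sub_eq_add_neg, sub_eq_zero] at hx
    simpa [x₁, x₂] using hx
  obtain ⟨s, hs₁, hs₂⟩ := h.exists_section (W := W) (evalGen W _ x₁) (evalGen W _ x₂) (by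
    have := congrArg (evalGen W _) h1
    rw [evalGen_comp, evalGen_comp] at this
    exact this)
  refine ⟨(homEquivSec (X := Z.carrier) W (oSh Z)).symm s, ?_⟩
  apply biprod.hom_ext
  · apply (evalGen_bijective _ _).1
    have : (homEquivSec (X := Z.carrier) W (oSh Z)).symm s ≫ h.ses.f ≫ biprod.fst =
      (homEquivSec (X := Z.carrier) W (oSh Z)).symm s ≫ pullSh j₁ := by simp
    rw [Category.assoc, this]
    exact (evalGen_homEquivSec_symm_comp (X := Z.carrier) W _ _).trans hs₁
  · apply (evalGen_bijective _ _).1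
    have : (homEquivSec (X := Z.carrier) W (oSh Z)).symm s ≫ h.ses.f ≫ biprod.snd =
      (homEquivSec (X := Z.carrier) W (oSh Z)).symm s ≫ pullSh j₂ := by simp
    rw [Category.assoc, this]
    exact (evalGen_homEquivSec_symm_comp (X := Z.carrier) W _ _).trans hs₂

/-- Over an open contained in one chart, restriction from the other chart to the overlap is already
bijective; such opens form a basis. -/
lemma ses_epi (h : IsTwoCover i₁ i₂ j₁ j₂) : Epi h.ses.g := by
  have := h.open₁; have := h.open₂; have := h.isOpenImmersion₁; have := h.isOpenImmersion₂
  have hB : Opens.IsBasis {W : Z.Opens | W ≤ j₁.opensRange ∨ W ≤ j₂.opensRange} := by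
    rw [Opens.isBasis_iff_nbhd]
    intro U x hx
    have hx' : x ∈ j₁.opensRange ⊔ j₂.opensRange := h.cover ▸ trivial
    rcases hx' with hx' | hx'
    · exact ⟨U ⊓ j₁.opensRange, Or.inl inf_le_right, ⟨hx, hx'⟩, inf_le_left⟩
    · exact ⟨U ⊓ j₂.opensRange, Or.inr inf_le_right, ⟨hx, hx'⟩, inf_le_left⟩
  refine epi_of_basis _ hB fun W hW t => ?_
  rcases hW with hW | hW
  · obtain ⟨s, hs⟩ := (appLE_bijective_of_isOpenImmersion i₂ (U := j₂ ⁻¹ᵁ W)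
      (V := (i₁ ≫ j₁) ⁻¹ᵁ W) (by rw [h.isPullback.w]; rfl) (by
        rw [← h.symm.preimage_opensRange]
        exact j₂.preimage_mono hW)).2 t
    let y := (homEquivSec (X := Z.carrier) W ((push j₂).obj (oSh Z₂))).symm s
    refine ⟨evalGen W _ (-(y ≫ biprod.inr)), ?_⟩
    rw [← evalGen_comp]
    have : (-(y ≫ biprod.inr)) ≫ h.ses.g = y ≫ pushMap i₂ j₂ _ h.isPullback.w.symm := by simp
    rw [this]
    exact (evalGen_homEquivSec_symm_comp (X := Z.carrier) W _ _).trans hs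
  · obtain ⟨s, hs⟩ := (appLE_bijective_of_isOpenImmersion i₁ (U := j₁ ⁻¹ᵁ W)
      (V := (i₁ ≫ j₁) ⁻¹ᵁ W) rfl (by
        rw [← h.preimage_opensRange]
        exact j₁.preimage_mono hW)).2 t
    let y := (homEquivSec (X := Z.carrier) W ((push j₁).obj (oSh Z₁))).symm s
    refine ⟨evalGen W _ (y ≫ biprod.inl), ?_⟩
    rw [← evalGen_comp]
    have : (y ≫ biprod.inl) ≫ h.ses.g = y ≫ pushMap i₁ j₁ _ rfl := by simp
    rw [this]
    exact (evalGen_homEquivSec_symm_comp (X := Z.carrier) W _ _).trans hs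

lemma ses_shortExact (h : IsTwoCover i₁ i₂ j₁ j₂) : h.ses.ShortExact where
  exact := h.ses_exact
  mono_f := h.ses_mono
  epi_g := h.ses_epi

end IsTwoCover

end

/-! ### Linear algebra of a two-chart splitting. -/

noncomputable section

open scoped TensorProduct

/-- Linear algebra data on the rings of functions of a two-chart cover with constants `R`, whose
zeroth cohomology consists of the constants and whose first cohomology is generated by `e`. -/
structure ChartSplitting {R C D : Type u} [CommRing R] [CommRing C] [CommRing D] (ι : R →+* C)
    (κ : R →+* D) (ρ₁ ρ₂ : C →+* D) where
  (a₁ a₂ : D →+ C)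
  (ε c : D →+ R)
  e : D
  a₁_smul (r z) : a₁ (κ r * z) = ι r * a₁ z
  a₂_smul (r z) : a₂ (κ r * z) = ι r * a₂ z
  ε_smul (r z) : ε (κ r * z) = r * ε z
  c_smul (r z) : c (κ r * z) = r * c z
  decomp (z) : z = ρ₁ (a₁ z) + ρ₂ (a₂ z) + κ (ε z) + κ (c z) * e
  a₁_ρ₁ (x) : a₁ (ρ₁ x) = x - ι (ε (ρ₁ x))
  a₂_ρ₂ (x) : a₂ (ρ₂ x) = x - ι (ε (ρ₂ x))
  a₁_ρ₂ (x) : a₁ (ρ₂ x) = 0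
  a₂_ρ₁ (x) : a₂ (ρ₁ x) = 0
  ε_one : ε 1 = 1
  c_ρ₁ (x) : c (ρ₁ x) = 0
  c_ρ₂ (x) : c (ρ₂ x) = 0
  c_e : c e = 1
  ρ₁_ι (r) : ρ₁ (ι r) = κ r
  ρ₂_ι (r) : ρ₂ (ι r) = κ r

namespace ChartSplitting

variable {R C D : Type u} [CommRing R] [CommRing C] [CommRing D] {ι : R →+* C}
    {κ : R →+* D} {ρ₁ ρ₂ : C →+* D} (s : ChartSplitting ι κ ρ₁ ρ₂)
    (M : Type*) [AddCommGroup M] [Module R M]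

/-- The linear map induced by a ring homomorphism compatible with the constants. -/
def linMap {ρ : C →+* D} (h : ∀ r, ρ (ι r) = κ r) :
    letI := ι.toAlgebra; letI := κ.toAlgebra
    C →ₗ[R] D :=
  letI := ι.toAlgebra; letI := κ.toAlgebra
  { ρ with
    map_smul' r x := by
      change ρ (ι r * x) = κ r * ρ x
      rw [map_mul, h] }

/-- H⁰ with coefficients in M. Applying `a₁` to the equality kills the right side and leaves `t₁`
minus its constant part; `a₂` does the same for `t₂`. The splitting is linear, so no flatness of M
is needed. -/
lemma exists_of_eq :
    letI := ι.toAlgebra; letI := κ.toAlgebra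
    ∀ {t₁ t₂ : C ⊗[R] M}, (linMap s.ρ₁_ι).rTensor M t₁ = (linMap s.ρ₂_ι).rTensor M t₂ →
      ∃ n : M, t₁ = 1 ⊗ₜ n ∧ t₂ = 1 ⊗ₜ n := by
  let := ι.toAlgebra; let := κ.toAlgebra
  intro t₁ t₂ h
  let ε : D →ₗ[R] R := { s.ε with map_smul' := s.ε_smul }
  let a₁ : D →ₗ[R] C := { s.a₁ with map_smul' := s.a₁_smul }
  let a₂ : D →ₗ[R] C := { s.a₂ with map_smul' := s.a₂_smul }
  let r₁ := linMap s.ρ₁_ι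
  let r₂ := linMap s.ρ₂_ι
  let u : R →ₗ[R] C := Algebra.linearMap R C
  have h11 : a₁ ∘ₗ r₁ = LinearMap.id - u ∘ₗ ε ∘ₗ r₁ := LinearMap.ext s.a₁_ρ₁
  have h22 : a₂ ∘ₗ r₂ = LinearMap.id - u ∘ₗ ε ∘ₗ r₂ := LinearMap.ext s.a₂_ρ₂
  have h12 : a₁ ∘ₗ r₂ = 0 := LinearMap.ext s.a₁_ρ₂
  have h21 : a₂ ∘ₗ r₁ = 0 := LinearMap.ext s.a₂_ρ₁
  have key (x : R ⊗[R] M) : u.rTensor M x = 1 ⊗ₜ TensorProduct.lid R M x := by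
    induction x with
    | zero => simp
    | add x y hx hy => rw [map_add, map_add, hx, hy, TensorProduct.tmul_add]
    | tmul r m =>
      rw [LinearMap.rTensor_tmul, TensorProduct.lid_tmul, ← TensorProduct.smul_tmul]
      congr 1
      exact Algebra.algebraMap_eq_smul_one r
  have e₁ : t₁ = 1 ⊗ₜ TensorProduct.lid R M (ε.rTensor M (r₁.rTensor M t₁)) := by
    have h1 : (a₁ ∘ₗ r₁).rTensor M t₁ = 0 := by
      rw [LinearMap.rTensor_comp, LinearMap.comp_apply]
      refine (congrArg _ h).trans ?_
      rw [← LinearMap.comp_apply, ← LinearMap.rTensor_comp]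
      exact (congrArg (fun f : C →ₗ[R] C => f.rTensor M t₂) h12).trans (by simp)
    rw [h11, LinearMap.rTensor_sub, LinearMap.sub_apply, LinearMap.rTensor_id, LinearMap.id_apply,
      sub_eq_zero, LinearMap.rTensor_comp, LinearMap.rTensor_comp] at h1
    exact h1.trans (key _)
  have e₂ : t₂ = 1 ⊗ₜ TensorProduct.lid R M (ε.rTensor M (r₂.rTensor M t₂)) := by
    have h1 : (a₂ ∘ₗ r₂).rTensor M t₂ = 0 := by
      rw [LinearMap.rTensor_comp, LinearMap.comp_apply]
      refine (congrArg _ h.symm).trans ?_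
      rw [← LinearMap.comp_apply, ← LinearMap.rTensor_comp]
      exact (congrArg (fun f : C →ₗ[R] C => f.rTensor M t₁) h21).trans (by simp)
    rw [h22, LinearMap.rTensor_sub, LinearMap.sub_apply, LinearMap.rTensor_id, LinearMap.id_apply,
      sub_eq_zero, LinearMap.rTensor_comp, LinearMap.rTensor_comp] at h1
    exact h1.trans (key _)
  refine ⟨_, e₁, e₂.trans ?_⟩
  exact congrArg (fun x => (1 : C) ⊗ₜ TensorProduct.lid R M (ε.rTensor M x)) h.symm

/-- The coefficient of `e`. -/
def coeffE :
    letI := κ.toAlgebra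
    D ⊗[R] M →ₗ[R] M :=
  letI := κ.toAlgebra
  (TensorProduct.lid R M).toLinearMap ∘ₗ
    ({ s.c with map_smul' := s.c_smul } : D →ₗ[R] R).rTensor M

lemma coeffE_tmul (z : D) (m : M) :
    letI := κ.toAlgebra
    s.coeffE M (z ⊗ₜ[R] m) = s.c z • m := rfl

lemma coeffE_rTensor₁ :
    letI := ι.toAlgebra; letI := κ.toAlgebra
    ∀ (t : C ⊗[R] M), s.coeffE M ((linMap s.ρ₁_ι).rTensor M t) = 0 := by
  let := ι.toAlgebra; let := κ.toAlgebra
  intro t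
  induction t with
  | zero => simp
  | add x y hx hy => rw [map_add, map_add, hx, hy, add_zero]
  | tmul z m =>
    rw [LinearMap.rTensor_tmul, coeffE_tmul]
    exact (congrArg (· • m) (s.c_ρ₁ z)).trans (zero_smul _ _)

lemma coeffE_rTensor₂ :
    letI := ι.toAlgebra; letI := κ.toAlgebra
    ∀ (t : C ⊗[R] M), s.coeffE M ((linMap s.ρ₂_ι).rTensor M t) = 0 := by
  let := ι.toAlgebra; let := κ.toAlgebra
  intro t
  induction t with
  | zero => simp
  | add x y hx hy => rw [map_add, map_add, hx, hy, add_zero]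
  | tmul z m =>
    rw [LinearMap.rTensor_tmul, coeffE_tmul]
    exact (congrArg (· • m) (s.c_ρ₂ z)).trans (zero_smul _ _)

/-- H¹ with coefficients in M is generated by the multiples of e. The constants are assigned to the
first chart. -/
lemma exists_decomp :
    letI := ι.toAlgebra; letI := κ.toAlgebra
    ∀ (w : D ⊗[R] M), ∃ t₁ t₂ : C ⊗[R] M, w = (linMap s.ρ₁_ι).rTensor M t₁ +
      (linMap s.ρ₂_ι).rTensor M t₂ + s.e ⊗ₜ s.coeffE M w := by
  let := ι.toAlgebra; let := κ.toAlgebra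
  intro w
  induction w with
  | zero => exact ⟨0, 0, by simp⟩
  | add x y hx hy =>
    obtain ⟨t₁, t₂, h⟩ := hx
    obtain ⟨t₁', t₂', h'⟩ := hy
    refine ⟨t₁ + t₁', t₂ + t₂', ?_⟩
    rw [map_add, map_add, map_add, TensorProduct.tmul_add]
    nth_rewrite 1 [h, h']
    abel
  | tmul z m =>
    refine ⟨(s.a₁ z + ι (s.ε z)) ⊗ₜ m, s.a₂ z ⊗ₜ m, ?_⟩
    rw [LinearMap.rTensor_tmul, LinearMap.rTensor_tmul, coeffE_tmul, ← TensorProduct.smul_tmul,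
      ← TensorProduct.add_tmul, ← TensorProduct.add_tmul]
    congr 1
    change z = ρ₁ (s.a₁ z + ι (s.ε z)) + ρ₂ (s.a₂ z) + κ (s.c z) * s.e
    rw [map_add, s.ρ₁_ι]
    nth_rewrite 1 [s.decomp z]
    ring

/-- The constant term after restriction to the overlap is a retraction of the constants. -/
lemma one_tmul_eq_zero (s : ChartSplitting ι κ ρ₁ ρ₂) :
    letI := ι.toAlgebra
    ∀ {m : M}, (1 : C) ⊗ₜ[R] m = 0 → m = 0 := by
  let := ι.toAlgebra; let := κ.toAlgebra
  intro m hm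
  let ε : D →ₗ[R] R := { s.ε with map_smul' := s.ε_smul }
  have := congrArg (fun t => TensorProduct.lid R M (ε.rTensor M ((linMap s.ρ₁_ι).rTensor M t))) hm
  have h1 : ε (linMap s.ρ₁_ι 1) = 1 := (congrArg s.ε (map_one ρ₁)).trans s.ε_one
  simpa [h1] using this

end ChartSplitting

namespace Quartic

/-- The splitting for the curve `y² = x⁴ + 1`. -/
def chartSplitting (R : Type u) [CommRing R] :
    ChartSplitting (constC R) (algebraMap R (Overlap R)) (resX R) ((flip R).comp (resX R)) where
  a₁ := (chartPart R).toAddMonoidHom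
  a₂ := (chartPart R).toAddMonoidHom.comp (flip R).toAddMonoidHom
  ε := (constPart R).toAddMonoidHom
  c := (polarPart R).toAddMonoidHom
  e := yDivX R
  a₁_smul r z := by
    have := (chartPart R).map_smul r z
    rw [Algebra.smul_def, Algebra.smul_def] at this
    exact this
  a₂_smul r z := by
    have := (chartPart R).map_smul r (flip R z)
    rw [Algebra.smul_def, Algebra.smul_def] at this
    refine Eq.trans ?_ this
    change chartPart R (flip R _) = _
    rw [map_mul, flip_const (.of R)]
  ε_smul r z := by
    have := (constPart R).map_smul r z
    rwa [Algebra.smul_def, smul_eq_mul] at this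
  c_smul r z := by
    have := (polarPart R).map_smul r z
    rwa [Algebra.smul_def, smul_eq_mul] at this
  decomp z := by
    have := overlap_decomposition z
    rwa [Algebra.smul_def, Algebra.smul_def, mul_one] at this
  a₁_ρ₁ x := by
    have := chartPart_resX x
    rwa [Algebra.smul_def, mul_one] at this
  a₂_ρ₂ x := by
    have := chartPart_resX x
    rw [Algebra.smul_def, mul_one] at this
    change chartPart R (flip R (flip R (resX R x))) =
      x - constC R (constPart R (flip R (resX R x)))
    rw [flip_flip, constPart_flip, this]
    rfl
  a₁_ρ₂ := chartPart_flip_resX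
  a₂_ρ₁ := chartPart_flip_resX
  ε_one := constPart_one
  c_ρ₁ := polarPart_resX
  c_ρ₂ := polarPart_flip_resX
  c_e := polarPart_yDivX
  ρ₁_ι := resX_const (.of R)
  ρ₂_ι r := (congrArg _ (resX_const (.of R) r)).trans (flip_const (.of R) r)

end Quartic

end

/-! ### Cohomology of base changes of T and the action of Frobenius. -/

noncomputable section

namespace AbSheaf
open Abelian Opposite IsTwoCover
open scoped TensorProduct

lemma ext_comp_mk₀_mk₀ {Y : TopCat.{u}} {A F G H : AbSh Y} {n : ℕ}
    (m : Ext.{u} A F n) (a : F ⟶ G) (b : G ⟶ H) :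
    (m.comp (Ext.mk₀.{u} a) (add_zero n)).comp (Ext.mk₀.{u} b) (add_zero n) =
      m.comp (Ext.mk₀.{u} (a ≫ b)) (add_zero n) := by
  rw [Ext.comp_assoc_of_third_deg_zero, Ext.mk₀_comp_mk₀]

section Theta

variable {T Z Z' : Scheme.{u}} {R C : CommRingCat.{u}} {ι : R ⟶ C} {f : T ⟶ Spec R} {p : Z ⟶ T}
  {j : Z' ⟶ Z} {q : Z' ⟶ Spec C}

/-- The whole space as an inverse image. -/
abbrev topFree (p : Z ⟶ T) : AbSh Z.carrier :=
  freeSh (X := Z.carrier) ((Opens.map p.base).obj (⊤ : T.Opens))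

/-- The comparison map `C ⊗ Hⁿ(T, 𝒪) → Hⁿ(Z', 𝒪)` for the base change `Z'` of `T` to `C`,
with values in the cohomology of a direct image on an intermediate scheme `Z`. -/
def theta (H : IsPullback (j ≫ p) q f (Spec.map ι)) (n : ℕ) :
    letI := ι.hom.toAlgebra
    C ⊗[R] ExtMod.{u} (F := oSh T) (baseAct f) (freeSh (X := T.carrier) ⊤) n →+
      Ext.{u} (topFree p) ((push j).obj (oSh Z')) n :=
  letI := ι.hom.toAlgebra
  (leray p.base ((push j).obj (oSh Z')) ⊤ n).comp
    (extBC.{u} (F := oSh T) (G := (push (j ≫ p)).obj (oSh Z')) (baseAct f) (baseMap (j ≫ p) q)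
      (baseMap_smul H.toCommSq) (freeSh (X := T.carrier) ⊤) n)

lemma theta_tmul (H : IsPullback (j ≫ p) q f (Spec.map ι)) (n : ℕ) (c : C)
    (m : Ext.{u} (freeSh (X := T.carrier) ⊤) (oSh T) n) :
    letI := ι.hom.toAlgebra
    theta H n (c ⊗ₜ[R] (show ExtMod.{u} (F := oSh T) (baseAct f) (freeSh (X := T.carrier) ⊤) n
      from m)) = leray p.base ((push j).obj (oSh Z')) ⊤ n
        (m.comp (Ext.mk₀.{u} (baseMap (j ≫ p) q c)) (add_zero n)) := by
  let := ι.hom.toAlgebra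
  exact congrArg (leray p.base ((push j).obj (oSh Z')) ⊤ n) (extBC_tmul _ _ _ _ _ _ _)

/-- Flat base change along the affine composite, followed by Leray for the projection; the latter
applies because inverse images of affines of T are affine in the chart. -/
lemma theta_bijective [CompactSpace T] [QuasiSeparatedSpace T] [IsAffineHom j]
    (H : IsPullback (j ≫ p) q f (Spec.map ι)) (hι : ι.hom.Flat) (n : ℕ) :
    Function.Bijective (theta H n) := by
  let := ι.hom.toAlgebra
  have : IsAffineHom (j ≫ p) := MorphismProperty.of_isPullback H.flip inferInstance
  have h1 : ExtBCBijective.{u} (F := oSh T) (G := (push (j ≫ p)).obj (oSh Z')) (baseAct f)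
    (baseMap (j ≫ p) q) (baseMap_smul H.toCommSq) (freeSh (X := T.carrier) (⊤ : T.Opens)) :=
    flatBaseChange_bijective H hι (U := ⊤) isCompact_univ
  have h2 : Function.Bijective (leray p.base ((push j).obj (oSh Z')) ⊤ n) := by
    refine leray_bijective p.base ((push j).obj (oSh Z')) T.isBasis_affineOpens
      (fun W hW => ?_) ⊤ n
    refine (acyclic_pushforward_iff j.base (oSh Z') Z.isBasis_affineOpens (fun U hU => ?_) _).2 ?_
    · exact acyclic_of_isAffineOpen (IsAffineOpen.preimage hU j)
    · exact acyclic_of_isAffineOpen (IsAffineOpen.preimage hW (j ≫ p))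
  exact h2.comp (h1 n)

/-- Pullback of cohomology classes. -/
def pullClass (p : Z ⟶ T) (n : ℕ) (m : Ext.{u} (freeSh (X := T.carrier) ⊤) (oSh T) n) :
    Ext.{u} (topFree p) (oSh Z) n :=
  leray p.base (oSh Z) ⊤ n (m.comp (Ext.mk₀.{u} (pullSh p)) (add_zero n))

lemma pullClass_comp (H : IsPullback (j ≫ p) q f (Spec.map ι)) (n : ℕ)
    (m : Ext.{u} (freeSh (X := T.carrier) ⊤) (oSh T) n) :
    letI := ι.hom.toAlgebra
    (pullClass p n m).comp (Ext.mk₀.{u} (pullSh j)) (add_zero n) =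
      theta H n ((1 : C) ⊗ₜ[R] (show ExtMod.{u} (F := oSh T) (baseAct f)
        (freeSh (X := T.carrier) ⊤) n from m)) := by
  let := ι.hom.toAlgebra
  rw [theta_tmul]
  refine (leray_postcomp p.base (pullSh j) ⊤ n _).symm.trans ?_
  refine congrArg (leray p.base ((push j).obj (oSh Z')) ⊤ n) ?_
  rw [Ext.comp_assoc_of_third_deg_zero, Ext.mk₀_comp_mk₀]
  congr 2
  refine oSh_hom_ext fun U s => ?_
  change j.app _ (p.app _ s) = ((Scheme.ΓSpecIso C).inv ≫ q.appLE ⊤ ((j ≫ p) ⁻¹ᵁ U) le_top) 1 *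
    (j ≫ p).app U s
  rw [map_one, one_mul, Scheme.Hom.comp_app]
  rfl

end Theta

section Frobenius

variable {ℓ : ℕ} (hℓ : ℓ.Prime)

/-- Frobenius. -/
abbrev frob (X : Scheme.{u}) (hX : (ℓ : Γ(X, ⊤)) = 0) : oSh X ⟶ oSh X :=
  ConjB.frobeniusSheafHom X ℓ hℓ hX

lemma pullSh_frob {X Y : Scheme.{u}} (q : X ⟶ Y) (hX : (ℓ : Γ(X, ⊤)) = 0)
    (hY : (ℓ : Γ(Y, ⊤)) = 0) :
    pullSh q ≫ (push q).map (frob hℓ X hX) = frob hℓ Y hY ≫ pullSh q :=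
  oSh_hom_ext fun U s => by
    change (q.app U s) ^ ℓ = q.app U (s ^ ℓ)
    rw [map_pow]

lemma pushMap_frob {Z A B : Scheme.{u}} (φ : A ⟶ B) (b : B ⟶ Z) (a : A ⟶ Z) (h : φ ≫ b = a)
    (hA : (ℓ : Γ(A, ⊤)) = 0) (hB : (ℓ : Γ(B, ⊤)) = 0) :
    pushMap φ b a h ≫ (push a).map (frob hℓ A hA) =
      (push b).map (frob hℓ B hB) ≫ pushMap φ b a h := by
  apply ObjectProperty.hom_ext
  ext U s
  exact (map_pow (φ.appLE (b ⁻¹ᵁ U.unop) (a ⁻¹ᵁ U.unop) (preimage_le_of_comp_eq h _)).hom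
    (show Γ(B, b ⁻¹ᵁ U.unop) from s) ℓ).symm

variable {T Z Z' : Scheme.{u}} {R C : CommRingCat.{u}} {ι : R ⟶ C} {f : T ⟶ Spec R} {p : Z ⟶ T}
  {j : Z' ⟶ Z} {q : Z' ⟶ Spec C}

lemma baseMap_frob (g : Z' ⟶ T) (hZ' : (ℓ : Γ(Z', ⊤)) = 0) (hT : (ℓ : Γ(T, ⊤)) = 0) (c : C) :
    baseMap g q c ≫ (push g).map (frob hℓ Z' hZ') = frob hℓ T hT ≫ baseMap g q (c ^ ℓ) :=
  oSh_hom_ext fun U s => by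
    change (((Scheme.ΓSpecIso C).inv ≫ q.appLE ⊤ (g ⁻¹ᵁ U) le_top) c * g.app U s) ^ ℓ =
      ((Scheme.ΓSpecIso C).inv ≫ q.appLE ⊤ (g ⁻¹ᵁ U) le_top) (c ^ ℓ) * g.app U (s ^ ℓ)
    rw [mul_pow, map_pow, map_pow]

/-- Frobenius is multiplicative, so on c ⊗ m it acts by the ℓ-th power on the function and by
Frobenius on the class. -/
lemma theta_frob (H : IsPullback (j ≫ p) q f (Spec.map ι)) (n : ℕ) (hZ' : (ℓ : Γ(Z', ⊤)) = 0)
    (hT : (ℓ : Γ(T, ⊤)) = 0) (c : C) (m : Ext.{u} (freeSh (X := T.carrier) ⊤) (oSh T) n) :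
    letI := ι.hom.toAlgebra
    (theta H n (c ⊗ₜ[R] (show ExtMod.{u} (F := oSh T) (baseAct f) (freeSh (X := T.carrier) ⊤) n
      from m))).comp (Ext.mk₀.{u} ((push j).map (frob hℓ Z' hZ'))) (add_zero n) =
    theta H n ((c ^ ℓ) ⊗ₜ[R] (show ExtMod.{u} (F := oSh T) (baseAct f)
      (freeSh (X := T.carrier) ⊤) n from m.comp (Ext.mk₀.{u} (frob hℓ T hT)) (add_zero n))) := by
  let := ι.hom.toAlgebra
  rw [theta_tmul, theta_tmul]
  refine (leray_postcomp p.base ((push j).map (frob hℓ Z' hZ')) ⊤ n _).symm.trans ?_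
  refine congrArg (leray p.base ((push j).obj (oSh Z')) ⊤ n) ?_
  refine (ext_comp_mk₀_mk₀ m (baseMap (j ≫ p) q c) ((push (j ≫ p)).map (frob hℓ Z' hZ'))).trans ?_
  rw [baseMap_frob hℓ (j ≫ p) hZ' hT c]
  exact (ext_comp_mk₀_mk₀ m (frob hℓ T hT) (baseMap (j ≫ p) q (c ^ ℓ))).symm

lemma pullClass_frob (n : ℕ) (hZ : (ℓ : Γ(Z, ⊤)) = 0)
    (hT : (ℓ : Γ(T, ⊤)) = 0) (m : Ext.{u} (freeSh (X := T.carrier) ⊤) (oSh T) n) :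
    (pullClass p n m).comp (Ext.mk₀.{u} (frob hℓ Z hZ)) (add_zero n) =
      pullClass p n (m.comp (Ext.mk₀.{u} (frob hℓ T hT)) (add_zero n)) := by
  refine (leray_postcomp p.base (frob hℓ Z hZ) ⊤ n _).symm.trans ?_
  refine congrArg (leray p.base (oSh Z) ⊤ n) ?_
  rw [Ext.comp_assoc_of_third_deg_zero, Ext.comp_assoc_of_third_deg_zero, Ext.mk₀_comp_mk₀,
    Ext.mk₀_comp_mk₀, ← pullSh_frob hℓ p hZ hT]

end Frobenius

section Restriction

variable {T Z A B : Scheme.{u}} {R C D : CommRingCat.{u}} {ι : R ⟶ C} {κ : R ⟶ D} {ρ : C ⟶ D}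
  {f : T ⟶ Spec R} {p : Z ⟶ T} {φ : A ⟶ B} {b : B ⟶ Z} {a : A ⟶ Z}
  {q : B ⟶ Spec C} {q' : A ⟶ Spec D}

lemma specAppLE_comp (hq : φ ≫ q = q' ≫ Spec.map ρ) {V : B.Opens} {V' : A.Opens}
    (hV : V' ≤ φ ⁻¹ᵁ V) (h₁ : V ≤ q ⁻¹ᵁ ⊤) (h₂ : V' ≤ q' ⁻¹ᵁ ⊤) :
    ((Scheme.ΓSpecIso C).inv ≫ q.appLE ⊤ V h₁) ≫ φ.appLE V V' hV =
      ρ ≫ (Scheme.ΓSpecIso D).inv ≫ q'.appLE ⊤ V' h₂ := by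
  have h3 : V' ≤ (q' ≫ Spec.map ρ) ⁻¹ᵁ ⊤ := fun _ _ => trivial
  have h4 : q'.appLE ⊤ V' h₂ = q'.appTop ≫ A.presheaf.map (homOfLE le_top).op := rfl
  rw [Category.assoc, Scheme.Hom.appLE_comp_appLE]
  simp only [hq]
  rw [h4, Scheme.ΓSpecIso_inv_naturality_assoc, ← Scheme.Hom.comp_appTop_assoc]
  rfl

/-- Restriction from a chart to the overlap touches only the function factor of the tensor product.
-/
lemma theta_res (h : φ ≫ b = a) (H : IsPullback (b ≫ p) q f (Spec.map ι))
    (H' : IsPullback (a ≫ p) q' f (Spec.map κ)) (hq : φ ≫ q = q' ≫ Spec.map ρ)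
    (hρ : ∀ r, ρ.hom (ι.hom r) = κ.hom r) (n : ℕ) :
    letI := ι.hom.toAlgebra; letI := κ.hom.toAlgebra
    ∀ (t : C ⊗[R] ExtMod.{u} (F := oSh T) (baseAct f) (freeSh (X := T.carrier) ⊤) n),
    (theta H n t).comp (Ext.mk₀.{u} (pushMap φ b a h)) (add_zero n) =
      theta H' n ((ChartSplitting.linMap hρ).rTensor _ t) := by
  let := ι.hom.toAlgebra; let := κ.hom.toAlgebra
  intro t
  induction t with
  | zero => simp
  | add x y hx hy => rw [map_add, map_add, map_add, Ext.add_comp, hx, hy]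
  | tmul c m =>
    rw [LinearMap.rTensor_tmul]
    refine (congrArg (fun x : Ext.{u} (topFree p) ((push b).obj (oSh B)) n =>
      x.comp (Ext.mk₀.{u} (pushMap φ b a h)) (add_zero n)) (theta_tmul H n c m)).trans ?_
    refine Eq.trans ?_ (theta_tmul H' n (ρ c) m).symm
    refine (leray_postcomp p.base (pushMap φ b a h) ⊤ n _).symm.trans ?_
    refine congrArg (leray p.base ((push a).obj (oSh A)) ⊤ n) ?_
    refine (ext_comp_mk₀_mk₀ (Y := T.carrier) (F := oSh T) (G := (push (b ≫ p)).obj (oSh B))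
      (H := (push (a ≫ p)).obj (oSh A)) m (baseMap (b ≫ p) q c)
      ((push p).map (pushMap φ b a h))).trans ?_
    refine congrArg (fun x : oSh T ⟶ (push (a ≫ p)).obj (oSh A) =>
      Ext.comp (Y := oSh T) m (Ext.mk₀.{u} x) (add_zero n)) ?_
    refine oSh_hom_ext fun U s => ?_
    have hU : (a ≫ p) ⁻¹ᵁ U ≤ φ ⁻¹ᵁ (b ≫ p) ⁻¹ᵁ U := preimage_le_of_comp_eq h (p ⁻¹ᵁ U)
    change φ.appLE ((b ≫ p) ⁻¹ᵁ U) ((a ≫ p) ⁻¹ᵁ U) hU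
      (((Scheme.ΓSpecIso C).inv ≫ q.appLE ⊤ ((b ≫ p) ⁻¹ᵁ U) le_top) c * (b ≫ p).app U s) =
      ((Scheme.ΓSpecIso D).inv ≫ q'.appLE ⊤ ((a ≫ p) ⁻¹ᵁ U) le_top) (ρ c) * (a ≫ p).app U s
    rw [map_mul]
    congr 1
    · exact congrArg (fun x => x.hom c) (specAppLE_comp hq hU (fun _ _ => trivial)
        fun _ _ => trivial)
    · rw [Scheme.Hom.app_eq_appLE, Scheme.Hom.app_eq_appLE, ← CommRingCat.comp_apply,
        Scheme.Hom.appLE_comp_appLE]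
      congr 2
      simp only [← h, Category.assoc]

end Restriction

end AbSheaf

end

/-! ### Transfer of bijectivity of Frobenius to the base. -/

noncomputable section

open scoped TensorProduct

namespace ChartSplitting

/-- The Künneth argument, stripped of geometry. M and M' stand for the cohomology of the base in
degrees n and n + 1, H for that of the product in degree n + 1, δ for the Mayer–Vietoris coboundary,
`p₁` and `p₂` for restriction to the charts. The constant k is arbitrary and may act as zero. -/
lemma frobenius_transfer {R C D : Type u} [CommRing R] [CommRing C] [CommRing D] {ι : R →+* C}
    {κ : R →+* D} {ρ₁ ρ₂ : C →+* D} (s : ChartSplitting ι κ ρ₁ ρ₂) {ℓ : ℕ} {k : ℤ}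
    (hk : s.c (s.e ^ ℓ) = k)
    {M M' A₁ A₂ A₁₂ A₁' A₂' A₁₂' H : Type*} [AddCommGroup M] [AddCommGroup M'] [Module R M]
    [Module R M'] [AddCommGroup A₁] [AddCommGroup A₂] [AddCommGroup A₁₂] [AddCommGroup A₁']
    [AddCommGroup A₂'] [AddCommGroup A₁₂'] [AddCommGroup H] :
    letI := ι.toAlgebra; letI := κ.toAlgebra
    ∀ (θ₁ : C ⊗[R] M →+ A₁) (θ₂ : C ⊗[R] M →+ A₂) (θ₁₂ : D ⊗[R] M →+ A₁₂)
      (θ₁' : C ⊗[R] M' →+ A₁') (θ₂' : C ⊗[R] M' →+ A₂') (θ₁₂' : D ⊗[R] M' →+ A₁₂')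
      (_ : Function.Bijective θ₁) (_ : Function.Bijective θ₂) (_ : Function.Bijective θ₁₂)
      (_ : Function.Bijective θ₁') (_ : Function.Bijective θ₂') (_ : Function.Bijective θ₁₂')
      (r₁ : A₁ →+ A₁₂) (r₂ : A₂ →+ A₁₂) (r₁' : A₁' →+ A₁₂') (r₂' : A₂' →+ A₁₂')
      (_ : ∀ t, r₁ (θ₁ t) = θ₁₂ ((linMap s.ρ₁_ι).rTensor M t))
      (_ : ∀ t, r₂ (θ₂ t) = θ₁₂ ((linMap s.ρ₂_ι).rTensor M t))
      (_ : ∀ t, r₁' (θ₁' t) = θ₁₂' ((linMap s.ρ₁_ι).rTensor M' t))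
      (_ : ∀ t, r₂' (θ₂' t) = θ₁₂' ((linMap s.ρ₂_ι).rTensor M' t))
      (δ : A₁₂ →+ H) (_ : ∀ w, δ w = 0 → ∃ a₁ a₂, w = r₁ a₁ - r₂ a₂)
      (_ : ∀ a, δ (r₁ a) = 0) (_ : ∀ a, δ (r₂ a) = 0)
      (p₁ : H →+ A₁') (p₂ : H →+ A₂') (_ : ∀ x, p₁ x = 0 → p₂ x = 0 → ∃ w, δ w = x)
      (_ : ∀ w, p₁ (δ w) = 0) (_ : ∀ x, r₁' (p₁ x) = r₂' (p₂ x))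
      (F : H →+ H) (F₁₂ : A₁₂ →+ A₁₂) (φ : M →+ M) (φ' : M' → M')
      (_ : ∀ w, F (δ w) = δ (F₁₂ w))
      (_ : ∀ d m, F₁₂ (θ₁₂ (d ⊗ₜ m)) = θ₁₂ ((d ^ ℓ) ⊗ₜ φ m))
      (pull : M' →+ H) (_ : ∀ m, p₁ (pull m) = θ₁' (1 ⊗ₜ m)) (_ : ∀ m, p₂ (pull m) = θ₂' (1 ⊗ₜ m))
      (_ : ∀ m, F (pull m) = pull (φ' m)), Function.Bijective F → Function.Bijective φ := by
  let := ι.toAlgebra; let := κ.toAlgebra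
  intro θ₁ θ₂ θ₁₂ θ₁' θ₂' θ₁₂' b₁ b₂ b₁₂ b₁' b₂' b₁₂' r₁ r₂ r₁' r₂' hr₁ hr₂ hr₁' hr₂' δ hδ hδ₁ hδ₂
    p₁ p₂ hp hpδ hpr F F₁₂ φ φ' hF hF₁₂ pull hpull₁ hpull₂ hFpull bF
  -- Classes from the charts have zero coboundary, so only the coefficient of e matters.
  have hα (w : D ⊗[R] M) : δ (θ₁₂ w) = δ (θ₁₂ (s.e ⊗ₜ s.coeffE M w)) := by
    obtain ⟨t₁, t₂, h⟩ := s.exists_decomp M w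
    nth_rewrite 1 [h]
    rw [map_add, map_add, map_add, map_add, ← hr₁, ← hr₂, hδ₁, hδ₂, zero_add, zero_add]
  -- The e-coefficient of a difference of restrictions from the charts is zero.
  have hinj (m : M) (h : δ (θ₁₂ (s.e ⊗ₜ m)) = 0) : m = 0 := by
    obtain ⟨a₁, a₂, e⟩ := hδ _ h
    obtain ⟨t₁, rfl⟩ := b₁.2 a₁
    obtain ⟨t₂, rfl⟩ := b₂.2 a₂
    rw [hr₁, hr₂, ← map_sub] at e
    have := congrArg (s.coeffE M) (b₁₂.1 e)
    rwa [coeffE_tmul, map_sub, coeffE_rTensor₁, coeffE_rTensor₂, s.c_e, one_smul, sub_zero] at this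
  have hFα (m : M) : F (δ (θ₁₂ (s.e ⊗ₜ m))) = δ (θ₁₂ (s.e ⊗ₜ (k • φ m))) := by
    rw [hF, hF₁₂, hα, coeffE_tmul, hk, Int.cast_smul_eq_zsmul]
  refine ⟨(injective_iff_map_eq_zero φ).2 fun m hm => hinj m ?_, fun m => ?_⟩
  · refine (injective_iff_map_eq_zero F).1 bF.1 _ ?_
    rw [hFα, hm, smul_zero, TensorProduct.tmul_zero, map_zero, map_zero]
  · obtain ⟨h, hh⟩ := bF.2 (δ (θ₁₂ (s.e ⊗ₜ m)))
    obtain ⟨t₁, ht₁⟩ := b₁'.2 (p₁ h)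
    obtain ⟨t₂, ht₂⟩ := b₂'.2 (p₂ h)
    -- The chart restrictions of the preimage h agree on the overlap, hence come from one class n of
    -- the base; after subtracting its pullback only a coboundary remains.
    obtain ⟨n, rfl, rfl⟩ := s.exists_of_eq M' (t₁ := t₁) (t₂ := t₂)
      (b₁₂'.1 (by rw [← hr₁', ← hr₂', ht₁, ht₂, hpr]))
    obtain ⟨w, hw⟩ := hp (h - pull n) (by rw [map_sub, hpull₁, ht₁, sub_self])
      (by rw [map_sub, hpull₂, ht₂, sub_self])
    obtain ⟨w, rfl⟩ := b₁₂.2 w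
    rw [hα] at hw
    obtain rfl : h = δ (θ₁₂ (s.e ⊗ₜ s.coeffE M w)) + pull n := by rw [hw, sub_add_cancel]
    rw [map_add, hFα, hFpull] at hh
    -- The target is a coboundary and restricts to zero on the first chart, where the pulled-back
    -- part is still visible.
    have h1 : φ' n = 0 := by
      refine s.one_tmul_eq_zero M' (b₁'.1 ?_)
      have := congrArg p₁ hh
      rwa [map_add, hpδ, hpδ, hpull₁, zero_add, ← map_zero θ₁'] at this
    rw [h1, map_zero, add_zero, ← sub_eq_zero, ← map_sub, ← map_sub, ← TensorProduct.tmul_sub] at hh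
    -- The integer k commutes with the additive map φ, so it can be absorbed in the preimage.
    refine ⟨k • s.coeffE M w, ?_⟩
    rw [map_zsmul]
    exact sub_eq_zero.1 (hinj _ hh)

end ChartSplitting

namespace AbSheaf
open Abelian Opposite IsTwoCover

section Biprod

lemma biprod_comm {𝒞 : Type*} [Category 𝒞] [Abelian 𝒞] {O B₁ B₂ Q : 𝒞} {u₁ : O ⟶ B₁}
    {u₂ : O ⟶ B₂} {v₁ : B₁ ⟶ Q} {v₂ : B₂ ⟶ Q}
    (w : biprod.lift u₁ u₂ ≫ biprod.desc v₁ (-v₂) = 0) : u₁ ≫ v₁ = u₂ ≫ v₂ := by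
  rwa [biprod.lift_desc, Preadditive.comp_neg, ← sub_eq_add_neg, sub_eq_zero] at w

variable {𝒞 : Type*} [Category 𝒞] [Abelian 𝒞] [HasExt.{u} 𝒞] {O B₁ B₂ Q : 𝒞} {u₁ : O ⟶ B₁}
  {u₂ : O ⟶ B₂} {v₁ : B₁ ⟶ Q} {v₂ : B₂ ⟶ Q}
  {w : biprod.lift u₁ u₂ ≫ biprod.desc v₁ (-v₂) = 0}
  (hS : (ShortComplex.mk (biprod.lift u₁ u₂) (biprod.desc v₁ (-v₂)) w).ShortExact) {A : 𝒞} {n : ℕ}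

/-- The lemmas of this section read the long exact sequence of a sequence with biproduct middle term
in its two components, in the form wanted by the transfer lemma. -/
lemma biprod_exact₁ (x : Ext.{u} A O (n + 1)) (h₁ : x.comp (Ext.mk₀ u₁) (add_zero _) = 0)
    (h₂ : x.comp (Ext.mk₀ u₂) (add_zero _) = 0) :
    ∃ y : Ext.{u} A Q n, y.comp hS.extClass rfl = x := by
  refine Ext.covariant_sequence_exact₁ A hS x ?_ rfl
  have : biprod.lift u₁ u₂ = u₁ ≫ biprod.inl + u₂ ≫ biprod.inr := by
    apply biprod.hom_ext <;> simp
  refine (congrArg (fun t => x.comp (Ext.mk₀ t) (add_zero _)) this).trans ?_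
  rw [Ext.mk₀_add, Ext.comp_add, ← Ext.mk₀_comp_mk₀, ← Ext.mk₀_comp_mk₀,
    ← Ext.comp_assoc_of_third_deg_zero, ← Ext.comp_assoc_of_third_deg_zero, h₁, h₂, Ext.zero_comp,
    Ext.zero_comp, add_zero]

lemma biprod_exact₃ (y : Ext.{u} A Q n) (h : y.comp hS.extClass rfl = 0) :
    ∃ (a₁ : Ext.{u} A B₁ n) (a₂ : Ext.{u} A B₂ n),
      y = a₁.comp (Ext.mk₀ v₁) (add_zero n) - a₂.comp (Ext.mk₀ v₂) (add_zero n) := by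
  obtain ⟨z, hz⟩ := Ext.covariant_sequence_exact₃ A hS y rfl h
  refine ⟨z.comp (Ext.mk₀ biprod.fst) (add_zero n), z.comp (Ext.mk₀ biprod.snd) (add_zero n), ?_⟩
  have : biprod.desc v₁ (-v₂) = biprod.fst ≫ v₁ - biprod.snd ≫ v₂ := by
    apply biprod.hom_ext' <;> simp
  refine hz.symm.trans ((congrArg (fun t => Ext.comp z (Ext.mk₀ t) (add_zero _)) this).trans ?_)
  rw [sub_eq_add_neg, Ext.mk₀_add, Ext.comp_add, Ext.mk₀_neg, Ext.comp_neg,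
    ← sub_eq_add_neg, ← Ext.mk₀_comp_mk₀, ← Ext.mk₀_comp_mk₀,
    ← Ext.comp_assoc_of_third_deg_zero, ← Ext.comp_assoc_of_third_deg_zero]

lemma biprod_comp_extClass₁ (a : Ext.{u} A B₁ n) :
    (a.comp (Ext.mk₀ v₁) (add_zero n)).comp hS.extClass rfl = 0 := by
  have h : (Ext.mk₀ v₁).comp hS.extClass (zero_add 1) = 0 := by
    have e : v₁ = biprod.inl ≫ biprod.desc v₁ (-v₂) := (biprod.inl_desc _ _).symm
    refine (congrArg (fun t => (Ext.mk₀ t).comp hS.extClass (zero_add 1)) e).trans ?_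
    rw [← Ext.mk₀_comp_mk₀_assoc]
    exact (congrArg (fun t => (Ext.mk₀ biprod.inl).comp t (zero_add 1)) hS.comp_extClass).trans
      (Ext.comp_zero _ _ _ _ _)
  rw [Ext.comp_assoc _ _ _ (add_zero n) (zero_add 1) rfl, h, Ext.comp_zero]

lemma biprod_comp_extClass₂ (a : Ext.{u} A B₂ n) :
    (a.comp (Ext.mk₀ v₂) (add_zero n)).comp hS.extClass rfl = 0 := by
  have h : (Ext.mk₀ v₂).comp hS.extClass (zero_add 1) = 0 := by
    have e : v₂ = (-biprod.inr) ≫ biprod.desc v₁ (-v₂) := by simp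
    refine (congrArg (fun t => (Ext.mk₀ t).comp hS.extClass (zero_add 1)) e).trans ?_
    rw [← Ext.mk₀_comp_mk₀_assoc]
    exact (congrArg (fun t => (Ext.mk₀ (-biprod.inr)).comp t (zero_add 1)) hS.comp_extClass).trans
      (Ext.comp_zero _ _ _ _ _)
  rw [Ext.comp_assoc _ _ _ (add_zero n) (zero_add 1) rfl, h, Ext.comp_zero]

lemma biprod_extClass_comp₁ (y : Ext.{u} A Q n) :
    (y.comp hS.extClass rfl).comp (Ext.mk₀ u₁) (add_zero _) = 0 := by
  have h : hS.extClass.comp (Ext.mk₀ u₁) (add_zero 1) = 0 := by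
    have e : u₁ = biprod.lift u₁ u₂ ≫ biprod.fst := (biprod.lift_fst _ _).symm
    refine (congrArg (fun t => hS.extClass.comp (Ext.mk₀ t) (add_zero 1)) e).trans ?_
    rw [← Ext.mk₀_comp_mk₀, ← Ext.comp_assoc_of_third_deg_zero]
    exact (congrArg (fun t => t.comp (Ext.mk₀ biprod.fst) (add_zero 1)) hS.extClass_comp).trans
      (Ext.zero_comp _ _ _ _ _)
  rw [Ext.comp_assoc_of_third_deg_zero, h, Ext.comp_zero]

lemma biprod_extClass_naturality (FO : O ⟶ O) (F₁ : B₁ ⟶ B₁) (F₂ : B₂ ⟶ B₂) (FQ : Q ⟶ Q)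
    (h₁ : FO ≫ u₁ = u₁ ≫ F₁) (h₂ : FO ≫ u₂ = u₂ ≫ F₂) (k₁ : F₁ ≫ v₁ = v₁ ≫ FQ)
    (k₂ : F₂ ≫ v₂ = v₂ ≫ FQ) (y : Ext.{u} A Q n) :
    (y.comp hS.extClass rfl).comp (Ext.mk₀ FO) (add_zero _) =
      (y.comp (Ext.mk₀ FQ) (add_zero n)).comp hS.extClass rfl := by
  let S := ShortComplex.mk (biprod.lift u₁ u₂) (biprod.desc v₁ (-v₂)) w
  let φ : S ⟶ S :=
    { τ₁ := FO
      τ₂ := biprod.map F₁ F₂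
      τ₃ := FQ
      comm₁₂ := by apply biprod.hom_ext <;> simp [S, h₁, h₂]
      comm₂₃ := by apply biprod.hom_ext' <;> simp [S, k₁, k₂] }
  have := ShortComplex.ShortExact.extClass_naturality hS hS φ
  rw [Ext.comp_assoc_of_third_deg_zero, this,
    Ext.comp_assoc _ _ _ (add_zero n) (zero_add 1) rfl]

end Biprod

/-- On a two-chart genus one curve over a scheme, bijectivity of Frobenius on cohomology descends
to the base, with a shift by one. -/
theorem frobenius_bijective_of_chartSplitting {T Z Z₁ Z₂ Z₁₂ : Scheme.{u}} {R C D : CommRingCat.{u}}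
    {i₁ : Z₁₂ ⟶ Z₁} {i₂ : Z₁₂ ⟶ Z₂} {j₁ : Z₁ ⟶ Z} {j₂ : Z₂ ⟶ Z} (h : IsTwoCover i₁ i₂ j₁ j₂)
    {ι : R ⟶ C} {κ : R ⟶ D} {ρ₁ ρ₂ : C ⟶ D} {f : T ⟶ Spec R} {p : Z ⟶ T} [CompactSpace T]
    [QuasiSeparatedSpace T] {q₁ : Z₁ ⟶ Spec C} {q₂ : Z₂ ⟶ Spec C} {q₁₂ : Z₁₂ ⟶ Spec D}
    (H₁ : IsPullback (j₁ ≫ p) q₁ f (Spec.map ι)) (H₂ : IsPullback (j₂ ≫ p) q₂ f (Spec.map ι))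
    (H₁₂ : IsPullback ((i₁ ≫ j₁) ≫ p) q₁₂ f (Spec.map κ)) (hq₁ : i₁ ≫ q₁ = q₁₂ ≫ Spec.map ρ₁)
    (hq₂ : i₂ ≫ q₂ = q₁₂ ≫ Spec.map ρ₂) [IsAffineHom j₁] [IsAffineHom j₂] [IsAffineHom (i₁ ≫ j₁)]
    (hι : ι.hom.Flat) (hκ : κ.hom.Flat) (s : ChartSplitting ι.hom κ.hom ρ₁.hom ρ₂.hom) {ℓ : ℕ}
    (hℓ : ℓ.Prime) {k : ℤ} (hk : s.c (s.e ^ ℓ) = k) (hT : (ℓ : Γ(T, ⊤)) = 0)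
    (hZ : (ℓ : Γ(Z, ⊤)) = 0) (hZ₁ : (ℓ : Γ(Z₁, ⊤)) = 0) (hZ₂ : (ℓ : Γ(Z₂, ⊤)) = 0)
    (hZ₁₂ : (ℓ : Γ(Z₁₂, ⊤)) = 0) (n : ℕ)
    (hF : Function.Bijective fun x : Ext.{u} (topFree p) (oSh Z) (n + 1) =>
      x.comp (Ext.mk₀.{u} (frob hℓ Z hZ)) (add_zero _)) :
    Function.Bijective fun x : Ext.{u} (freeSh (X := T.carrier) ⊤) (oSh T) n =>
      x.comp (Ext.mk₀.{u} (frob hℓ T hT)) (add_zero _) := by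
  let := ι.hom.toAlgebra
  let := κ.hom.toAlgebra
  have hS := h.ses_shortExact
  refine s.frobenius_transfer hk
    (M := ExtMod.{u} (F := oSh T) (baseAct f) (freeSh (X := T.carrier) ⊤) n)
    (M' := ExtMod.{u} (F := oSh T) (baseAct f) (freeSh (X := T.carrier) ⊤) (n + 1))
    (theta H₁ n) (theta H₂ n) (theta H₁₂ n) (theta H₁ (n + 1)) (theta H₂ (n + 1))
    (theta H₁₂ (n + 1)) (theta_bijective H₁ hι n) (theta_bijective H₂ hι n)
    (theta_bijective H₁₂ hκ n) (theta_bijective H₁ hι _) (theta_bijective H₂ hι _)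
    (theta_bijective H₁₂ hκ _)
    ((Ext.mk₀.{u} (pushMap i₁ j₁ (i₁ ≫ j₁) rfl)).postcomp (topFree p) (add_zero n))
    ((Ext.mk₀.{u} (pushMap i₂ j₂ (i₁ ≫ j₁) h.isPullback.w.symm)).postcomp (topFree p) (add_zero n))
    ((Ext.mk₀.{u} (pushMap i₁ j₁ (i₁ ≫ j₁) rfl)).postcomp (topFree p) (add_zero _))
    ((Ext.mk₀.{u} (pushMap i₂ j₂ (i₁ ≫ j₁) h.isPullback.w.symm)).postcomp (topFree p) (add_zero _))
    (theta_res rfl H₁ H₁₂ hq₁ s.ρ₁_ι n) (theta_res _ H₂ H₁₂ hq₂ s.ρ₂_ι n)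
    (theta_res rfl H₁ H₁₂ hq₁ s.ρ₁_ι _) (theta_res _ H₂ H₁₂ hq₂ s.ρ₂_ι _)
    (hS.extClass.postcomp (topFree p) rfl) (biprod_exact₃ hS) (biprod_comp_extClass₁ hS)
    (biprod_comp_extClass₂ hS)
    ((Ext.mk₀.{u} (pullSh j₁)).postcomp (topFree p) (add_zero _))
    ((Ext.mk₀.{u} (pullSh j₂)).postcomp (topFree p) (add_zero _)) (biprod_exact₁ hS)
    (biprod_extClass_comp₁ hS) ?_
    ((Ext.mk₀.{u} (frob hℓ Z hZ)).postcomp (topFree p) (add_zero _))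
    ((Ext.mk₀.{u} ((push (i₁ ≫ j₁)).map (frob hℓ Z₁₂ hZ₁₂))).postcomp (topFree p) (add_zero n))
    ((Ext.mk₀.{u} (frob hℓ T hT)).postcomp (freeSh (X := T.carrier) ⊤) (add_zero n))
    (fun m => Ext.comp m (Ext.mk₀.{u} (frob hℓ T hT)) (add_zero _))
    (biprod_extClass_naturality hS _ ((push j₁).map (frob hℓ Z₁ hZ₁))
      ((push j₂).map (frob hℓ Z₂ hZ₂)) _ (pullSh_frob hℓ j₁ hZ₁ hZ).symm
      (pullSh_frob hℓ j₂ hZ₂ hZ).symm (pushMap_frob hℓ _ _ _ _ hZ₁₂ hZ₁).symm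
      (pushMap_frob hℓ _ _ _ _ hZ₁₂ hZ₂).symm)
    (theta_frob hℓ H₁₂ n hZ₁₂ hT) 
    ((leray p.base (oSh Z) ⊤ (n + 1)).comp
      ((Ext.mk₀.{u} (pullSh p)).postcomp (freeSh (X := T.carrier) ⊤) (add_zero _))) (pullClass_comp H₁ (n + 1)) (pullClass_comp H₂ (n + 1))
    (pullClass_frob hℓ (n + 1) hZ hT) hF
  intro x
  refine (ext_comp_mk₀_mk₀ x (pullSh j₁) (pushMap i₁ j₁ (i₁ ≫ j₁) rfl)).trans
    (Eq.trans ?_ (ext_comp_mk₀_mk₀ x (pullSh j₂)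
      (pushMap i₂ j₂ (i₁ ≫ j₁) h.isPullback.w.symm)).symm)
  rw [biprod_comm h.ses.zero]

end AbSheaf

end

/-! ### The fibre statement for the curve over the integers. -/

noncomputable section

namespace AbSheaf
open Abelian Opposite IsTwoCover

/-- Sheaf cohomology is Ext out of the constant sheaf ℤ, which is the free sheaf on the whole space.
-/
lemma H_map_bijective_iff {X : Scheme.{u}} {F : AbSh X.carrier} (φ : F ⟶ F) (n : ℕ) :
    Function.Bijective (Sheaf.H.map φ n) ↔
      Function.Bijective fun x : Ext.{u} (freeSh (X := X.carrier) ⊤) F n =>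
        x.comp (Ext.mk₀.{u} φ) (add_zero n) := by
  obtain ⟨e⟩ := nonempty_constantSheaf_iso X.carrier
  have h1 := @mk₀_precomp_bijective (AbSh X.carrier) _ _ _ _ _ e.hom e.isIso_hom F n
  have h2 : (Sheaf.H.map φ n) ∘ ((Ext.mk₀.{u} e.hom).precomp F (zero_add n)) =
      ((Ext.mk₀.{u} e.hom).precomp F (zero_add n)) ∘
      fun x : Ext.{u} (freeSh (X := X.carrier) ⊤) F n => x.comp (Ext.mk₀.{u} φ) (add_zero n) :=
    funext fun x => Ext.comp_assoc_of_third_deg_zero _ _ _ (zero_add n)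
  exact (Function.Bijective.of_comp_iff _ h1).symm.trans
    ((iff_of_eq (congrArg Function.Bijective h2)).trans (Function.Bijective.of_comp_iff' h1 _))

end AbSheaf

namespace Quartic
open Abelian Opposite AbSheaf

/-- Bijectivity of Frobenius on `Hⁿ⁺¹` of the product with the curve `y² = x⁴ + 1` implies
bijectivity on `Hⁿ` of the base. -/
theorem frobeniusAction_bijective_of_isPullback {T Z : Scheme.{u}} [CompactSpace T]
    [QuasiSeparatedSpace T] {f : T ⟶ Spec (.of (ULift.{u} ℤ))} {p : Z ⟶ T}
    {g : Z ⟶ curve (.of (ULift.{u} ℤ))} (H : IsPullback p g f (curveHom (.of (ULift.{u} ℤ))))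
    {ℓ : ℕ} (hℓ : ℓ.Prime) (hT : (ℓ : Γ(T, ⊤)) = 0) (hZ : (ℓ : Γ(Z, ⊤)) = 0) (n : ℕ)
    (hF : Function.Bijective (ConjB.frobeniusAction Z ℓ hℓ hZ (n + 1))) :
    Function.Bijective (ConjB.frobeniusAction T ℓ hℓ hT n) := by
  refine (H_map_bijective_iff (F := oSh T) _ n).2 ?_
  replace hF := (H_map_bijective_iff (F := oSh Z) _ (n + 1)).1 hF
  let R : CommRingCat.{u} := .of (ULift.{u} ℤ)
  have hcov := isTwoCover_curve R
  have H₁ : IsPullback (pullback.fst g (chart₁ R) ≫ p) (pullback.snd g (chart₁ R)) f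
      (Spec.map (CommRingCat.ofHom (constC R))) := by
    rw [← chart₁_curveHom]
    exact ((IsPullback.of_hasPullback g (chart₁ R)).flip.paste_vert H.flip).flip
  have H₂ : IsPullback (pullback.fst g (chart₂ R) ≫ p) (pullback.snd g (chart₂ R)) f
      (Spec.map (CommRingCat.ofHom (constC R))) := by
    rw [← chart₂_curveHom]
    exact ((IsPullback.of_hasPullback g (chart₂ R)).flip.paste_vert H.flip).flip
  have hκ : Spec.map (CommRingCat.ofHom (resX R)) ≫ Spec.map (CommRingCat.ofHom (constC R)) =
      Spec.map (CommRingCat.ofHom (algebraMap R (Overlap R))) := by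
    rw [← Spec.map_comp]
    congr 1
    ext1
    exact RingHom.ext (resX_const R)
  have H₁₂ := ((hcov.isPullback_overlapMap g).flip.paste_vert H₁.flip).flip
  rw [hκ, ← Category.assoc] at H₁₂
  have hzero {Z' : Scheme.{u}} (j : Z' ⟶ Z) : (ℓ : Γ(Z', ⊤)) = 0 := by
    rw [← map_natCast j.appTop.hom, hZ, map_zero]
  have : IsAffineHom (pullback.fst g (chart₁ R)) :=
    MorphismProperty.of_isPullback (IsPullback.of_hasPullback _ _).flip inferInstance
  have : IsAffineHom (pullback.fst g (chart₂ R)) :=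
    MorphismProperty.of_isPullback (IsPullback.of_hasPullback _ _).flip inferInstance
  have : IsAffineHom (pullback.fst (pullback.fst g (chart₁ R)) (pullback.fst g (chart₂ R))) :=
    MorphismProperty.of_isPullback (IsPullback.of_hasPullback _ _).flip inferInstance
  -- Working over ℤ makes the coefficient of y/x in (y/x)^ℓ an integer; its reduction is the Hasse
  -- invariant, whose value is irrelevant.
  refine frobenius_bijective_of_chartSplitting (hcov.baseChange g) H₁ H₂ H₁₂
    (ρ₁ := CommRingCat.ofHom (resX R)) (ρ₂ := CommRingCat.ofHom (resX' R))
    (hcov.isPullback_overlapMap g).w (hcov.isPullback.lift_snd _ _ _).symm ?_ ?_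
    (chartSplitting R) hℓ (k := ((chartSplitting R).c ((chartSplitting R).e ^ ℓ)).down) ?_ hT hZ
    (hzero (pullback.fst g (chart₁ R))) (hzero (pullback.fst g (chart₂ R)))
    (hzero (pullback.fst _ _ ≫ pullback.fst g (chart₁ R))) n hF
  · exact RingHom.flat_algebraMap_iff.2 (Module.Flat.trans R (Polynomial R) (Chart R))
  · exact RingHom.flat_algebraMap_iff.2 (Module.Flat.trans R (LaurentPolynomial R) (Overlap R))
  · apply ULift.ext
    simp

end Quartic

end

/-! ### The chart ring: domain, dimension, smoothness. -/

noncomputable section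

lemma Ideal.height_le_height_of_hasGoingDown {R S : Type*} [CommRing R] [CommRing S] [Algebra R S]
    [Algebra.HasGoingDown R S] (p : Ideal R) [p.IsPrime] (P : Ideal S) [P.IsPrime] [P.LiesOver p] :
    p.height ≤ P.height := by
  rw [PrimeSpectrum.height_eq_orderHeight ⟨p, inferInstance⟩,
    PrimeSpectrum.height_eq_orderHeight ⟨P, inferInstance⟩]
  refine Order.height_le fun l hl => ?_
  have : P.LiesOver l.last.asIdeal := by rw [hl]; infer_instance
  obtain ⟨L, h1, h2, -⟩ := Ideal.exists_ltSeries_of_hasGoingDown l P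
  rw [← h1, ← h2]
  exact Order.length_le_height_last

/-- Incomparability bounds the dimension of S above; lying over together with flat going down bounds
it below. -/
lemma Algebra.IsIntegral.ringKrullDim_eq_of_flat (R S : Type*) [CommRing R] [CommRing S]
    [Algebra R S] [Algebra.IsIntegral R S] [Module.Flat R S]
    (h : Function.Injective (algebraMap R S)) : ringKrullDim S = ringKrullDim R := by
  refine le_antisymm ?_ ?_
  · refine Order.krullDim_le_of_strictMono (PrimeSpectrum.comap (algebraMap R S)) fun P Q hPQ => ?_
    exact Ideal.IsIntegral.comap_lt_comap (show P.asIdeal < Q.asIdeal from hPQ)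
  · rw [ringKrullDim, Order.krullDim_eq_iSup_height, iSup_le_iff]
    intro p
    obtain ⟨Q, -, hQ, hQp⟩ := Ideal.exists_ideal_over_prime_of_isIntegral p.asIdeal (⊥ : Ideal S)
      (by rw [← RingHom.ker_eq_comap_bot, (RingHom.injective_iff_ker_eq_bot _).1 h]; exact bot_le)
    have : Q.LiesOver p.asIdeal := ⟨hQp.symm⟩
    have := Ideal.height_le_height_of_hasGoingDown p.asIdeal Q
    rw [← PrimeSpectrum.height_eq_orderHeight]
    exact (WithBot.coe_le_coe.2 this).trans Ideal.height_le_ringKrullDim_of_isPrime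

namespace Quartic
open Polynomial

/-- The norm a² - b²(x⁴ + 1) is multiplicative and vanishes only at zero, because x⁴ + 1 is not a
square in the fraction field of the polynomials. -/
lemma Chart.isDomain (A : Type u) [CommRing A] [IsDomain A] [CharZero A] : IsDomain (Chart A) := by
  have key (a b : A[X]) (h : a ^ 2 = b ^ 2 * (X ^ 4 + 1)) : b = 0 := by
    by_contra hb
    let L := AlgebraicClosure (FractionRing A)
    have hinj : Function.Injective (algebraMap A L) := by
      rw [IsScalarTower.algebraMap_eq A (FractionRing A) L]
      exact (algebraMap (FractionRing A) L).injective.comp (IsFractionRing.injective A _)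
    have : CharZero L := charZero_of_injective_algebraMap hinj
    let φ := mapRingHom (algebraMap A L)
    have h' : (φ a) ^ 2 = (φ b) ^ 2 * (X ^ 4 + 1) := by
      have := congrArg φ h
      simpa [φ] using this
    have hb' : φ b ≠ 0 := fun h0 => hb (map_injective _ hinj (h0.trans (map_zero φ).symm))
    obtain ⟨r, hr⟩ := IsAlgClosed.exists_pow_nat_eq (-1 : L) (n := 4) (by norm_num)
    have hq : (X ^ 4 + 1 : L[X]) ≠ 0 := by
      intro h0
      have := congrArg (eval 0) h0
      simp at this
    have ha' : φ a ≠ 0 := by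
      intro h0
      rw [h0, zero_pow two_ne_zero] at h'
      exact mul_ne_zero (pow_ne_zero 2 hb') hq h'.symm
    have hr0 : r ≠ 0 := by
      rintro rfl
      norm_num at hr
    -- In characteristic zero the root r is simple, so the two sides of a² = b²(x⁴ + 1) have
    -- multiplicities of opposite parity at r.
    have hm : rootMultiplicity r (X ^ 4 + 1 : L[X]) = 1 := by
      refine le_antisymm (not_lt.1 fun h1 => ?_) ?_
      · rw [one_lt_rootMultiplicity_iff_isRoot hq] at h1
        have := h1.2
        simp [hr0] at this
        norm_num at this
      · exact (rootMultiplicity_pos hq).2 (by simp [hr])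
    have := congrArg (rootMultiplicity r) h'
    rw [rootMultiplicity_mul (mul_ne_zero (pow_ne_zero 2 hb') hq), sq, sq,
      rootMultiplicity_mul (mul_ne_zero ha' ha'), rootMultiplicity_mul (mul_ne_zero hb' hb'),
      hm] at this
    omega
  have hnorm (z : Chart A) (hz : z.norm = 0) : z = 0 := by
    rw [QuadraticAlgebra.norm_def, zero_mul, zero_mul, add_zero, sub_eq_zero] at hz
    have him : z.im = 0 := key z.re z.im (by rw [sq, hz]; ring)
    rw [him, mul_zero, mul_self_eq_zero] at hz
    exact QuadraticAlgebra.ext hz him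
  have : Nontrivial (Chart A) := by
    refine ⟨0, 1, fun h => ?_⟩
    have := congrArg QuadraticAlgebra.re h
    exact zero_ne_one (α := A[X]) this
  have : NoZeroDivisors (Chart A) := by
    refine ⟨fun {z w} h => ?_⟩
    have := congrArg QuadraticAlgebra.norm h
    rw [map_mul, QuadraticAlgebra.norm_zero, mul_eq_zero] at this
    exact this.imp (hnorm z) (hnorm w)
  exact NoZeroDivisors.to_isDomain _

lemma Chart.ringKrullDim (A : Type u) [CommRing A] [IsNoetherianRing A] :
    _root_.ringKrullDim (Chart A) = _root_.ringKrullDim A + 1 := by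
  rw [← Polynomial.ringKrullDim_of_isNoetherianRing]
  refine Algebra.IsIntegral.ringKrullDim_eq_of_flat A[X] (Chart A) fun a b h => ?_
  exact congrArg QuadraticAlgebra.re h

/-- Infinitesimal lifting: any lifts of x and y satisfy the equation up to an error i of square
zero, which an explicit rescaling removes. -/
lemma Chart.smooth (A : Type u) [CommRing A] (h2 : IsUnit (2 : A)) : Algebra.Smooth A (Chart A) := by
  have hfp : Algebra.FinitePresentation A (Chart A) :=
    have : Module.FinitePresentation A[X] (Chart A) :=
      Module.finitePresentation_of_projective A[X] (Chart A)
    .trans A A[X] (Chart A)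
  refine ⟨.of_comp_surjective fun B _ _ I hI g => ?_, hfp⟩
  obtain ⟨h, hh⟩ : ∃ h : A, 2 * h = 1 := h2.exists_right_inv
  obtain ⟨x, hx⟩ := Ideal.Quotient.mk_surjective (g (xC A))
  obtain ⟨y, hy⟩ := Ideal.Quotient.mk_surjective (g (yC A))
  let i := y ^ 2 - x ^ 4 - 1
  let t := algebraMap A B h
  have ht : 2 * t = 1 := by
    have := congrArg (algebraMap A B) hh
    rwa [map_mul, map_one, map_ofNat] at this
  have hi : i ∈ I := by
    rw [← Ideal.Quotient.eq_zero_iff_mem]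
    simp only [i, map_sub, map_pow, map_one, hx, hy]
    rw [← map_pow, ← map_pow, yC_sq, map_add, map_one]
    ring
  have hi2 : i ^ 2 = 0 := by
    have := Ideal.pow_mem_pow hi 2
    rwa [hI] at this
  -- With t = 1/2 the factors 1 - i/2 and 1 - i/4 are a square root and a fourth root of 1 - i. The
  -- difference y² - x⁴ = 1 + i is thus multiplied by 1 - i and becomes 1 - i² = 1.
  have heq : (y - y * t * i) ^ 2 = (x - x * t ^ 2 * i) ^ 4 + 1 := by
    have h4 : 4 * t ^ 2 = 1 := by linear_combination (2 * t + 1) * ht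
    have e1 : (y - y * t * i) ^ 2 = y ^ 2 - y ^ 2 * i := by
      linear_combination y ^ 2 * t ^ 2 * hi2 - y ^ 2 * i * ht
    have e2 : (x - x * t ^ 2 * i) ^ 4 = x ^ 4 - x ^ 4 * i := by
      linear_combination x ^ 4 * (6 * t ^ 4 - 4 * t ^ 6 * i + t ^ 8 * i ^ 2) * hi2 - x ^ 4 * i * h4
    rw [e1, e2]
    have : i * i = 0 := by rw [← sq, hi2]
    have hi' : i = y ^ 2 - x ^ 4 - 1 := rfl
    linear_combination -this + i * (hi')-hi'
  let F := Chart.lift (algebraMap A B) (x - x * t ^ 2 * i) (y - y * t * i) heq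
  refine ⟨{ F with commutes' := fun a => Chart.lift_const (h := heq) .. }, ?_⟩
  apply AlgHom.coe_ringHom_injective
  have hmi : Ideal.Quotient.mk I i = 0 := Ideal.Quotient.eq_zero_iff_mem.2 hi
  refine Chart.hom_ext ?_ ?_ ?_
  · ext a
    exact (congrArg (Ideal.Quotient.mk I) (Chart.lift_const (h := heq) ..)).trans (g.commutes a).symm
  · refine (congrArg (Ideal.Quotient.mk I) (Chart.lift_x (h := heq) ..)).trans ?_
    rw [map_sub, map_mul, hmi, mul_zero, sub_zero]
    exact hx
  · refine (congrArg (Ideal.Quotient.mk I) (Chart.lift_y (h := heq) ..)).trans ?_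
    rw [map_sub, map_mul, hmi, mul_zero, sub_zero]
    exact hy

end Quartic

/-! ### Integrality and dimension from affine covers. -/

namespace AlgebraicGeometry

/-- A scheme covered by spectra of domains with a common point is integral. -/
lemma isIntegral_of_forall_mem_range {X : Scheme.{u}} {ι : Type*} (B : ι → CommRingCat.{u})
    [∀ i, IsDomain (B i)] (f : ∀ i, Spec (B i) ⟶ X) [∀ i, IsOpenImmersion (f i)]
    (hf : ∀ x, ∃ i, x ∈ (f i).opensRange) (w : X) (hw : ∀ i, w ∈ (f i).opensRange) :
    IsIntegral X := by
  have hpre : PreirreducibleSpace X := by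
    refine ⟨?_⟩
    rintro U V hU hV ⟨x, -, hx⟩ ⟨y, -, hy⟩
    have irr (i : ι) : IsPreirreducible (Set.range (f i)) := by
      rw [← Set.image_univ]
      exact (PreirreducibleSpace.isPreirreducible_univ (X := Spec (B i))).image _
        (f i).continuous.continuousOn
    obtain ⟨i, hi⟩ := hf x
    obtain ⟨j, hj⟩ := hf y
    obtain ⟨z, hz, hzU, hzj⟩ := irr i U (Set.range (f j)) hU (f j).isOpenEmbedding.isOpen_range
      ⟨x, hi, hx⟩ ⟨w, hw i, hw j⟩
    obtain ⟨t, -, ht⟩ := irr j U V hU hV ⟨z, hzj, hzU⟩ ⟨y, hj, hy⟩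
    exact ⟨t, trivial, ht⟩
  have : IrreducibleSpace X := { toNonempty := ⟨w⟩ }
  have : IsReduced X := by
    have (x : X) : _root_.IsReduced (X.presheaf.stalk x) := by
      obtain ⟨i, y, rfl⟩ := hf x
      exact isReduced_of_injective ((f i).stalkMap y).hom
        (ConcreteCategory.bijective_of_isIso ((f i).stalkMap y)).1
    exact isReduced_of_isReduced_stalk X
  exact isIntegral_of_irreducibleSpace_of_isReduced X

-- Points correspond to irreducible closed sets, and the dimension of the local ring is the coheight
-- in the specialization order.
attribute [local instance] specializationOrder in
lemma topologicalKrullDim_eq_iSup_stalk (X : Scheme.{u}) :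
    topologicalKrullDim X = ⨆ x : X, ringKrullDim (X.presheaf.stalk x) := by
  rw [topologicalKrullDim, Order.krullDim_eq_of_orderIso irreducibleSetEquivPoints,
    Order.krullDim_eq_iSup_coheight]
  exact iSup_congr fun x => (ringKrullDim_stalk_eq_coheight x).symm

lemma topologicalKrullDim_Spec (B : CommRingCat.{u}) :
    topologicalKrullDim (Spec B) = ringKrullDim B :=
  PrimeSpectrum.topologicalKrullDim_eq_ringKrullDim B

/-- The dimension of a scheme is the supremum of the dimensions of the members of an affine open
cover. -/
lemma topologicalKrullDim_eq_iSup {X : Scheme.{u}} {ι : Type*} (B : ι → CommRingCat.{u})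
    (f : ∀ i, Spec (B i) ⟶ X) [∀ i, IsOpenImmersion (f i)]
    (hf : ∀ x, ∃ i, x ∈ (f i).opensRange) :
    topologicalKrullDim X = ⨆ i, ringKrullDim (B i) := by
  refine le_antisymm ?_ (iSup_le fun i => ?_)
  · rw [topologicalKrullDim_eq_iSup_stalk]
    refine iSup_le fun x => ?_
    obtain ⟨i, y, rfl⟩ := hf x
    refine le_trans ?_ (le_iSup _ i)
    refine le_trans ?_ (topologicalKrullDim_Spec (B i)).le
    rw [topologicalKrullDim_eq_iSup_stalk]
    refine le_trans (le_of_eq ?_)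
      (le_iSup (fun y => ringKrullDim ((Spec (B i)).presheaf.stalk y)) y)
    exact ringKrullDim_eq_of_ringEquiv (asIso ((f i).stalkMap y)).commRingCatIsoToRingEquiv
  · rw [← topologicalKrullDim_Spec]
    exact (f i).isOpenEmbedding.isInducing.topologicalKrullDim_le

end AlgebraicGeometry

end

/-! ### Product charts; integrality, smoothness and dimension of the product. -/

noncomputable section

/-- Values below n are at most n - 1, or ⊥ when n = 0, so a supremum equal to n must be attained. -/
lemma WithBot.exists_eq_of_iSup_eq {ι : Type*} {d : ι → WithBot ℕ∞} {n : ℕ}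
    (h : ⨆ i, d i = n) : ∃ i, d i = n := by
  by_contra! hne
  have hlt (i) : d i < n := lt_of_le_of_ne (h ▸ le_iSup d i) (hne i)
  obtain _ | n := n
  · have : ⨆ i, d i ≤ ⊥ := iSup_le fun i => by
      have := hlt i
      generalize d i = x at this
      cases x with
      | bot => exact le_rfl
      | coe x => exact absurd this (by simp)
    rw [h] at this
    exact absurd this (by simp)
  · have : ⨆ i, d i ≤ n := iSup_le fun i => by
      have := hlt i
      generalize d i = x at this
      cases x with
      | bot => exact bot_le
      | coe x =>
        cases x with
        | top => exact absurd this (by simp)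
        | coe x =>
          norm_cast at this ⊢
          omega
    rw [h] at this
    norm_cast at this
    omega

namespace Quartic

/-- The two affine charts of the curve. -/
def chart (R : CommRingCat.{u}) : Bool → (Spec (.of (Chart R)) ⟶ curve R)
  | true => chart₁ R
  | false => chart₂ R

instance (R : CommRingCat.{u}) (b : Bool) : IsOpenImmersion (chart R b) := by
  cases b
  · exact inferInstanceAs (IsOpenImmersion (chart₂ R))
  · exact inferInstanceAs (IsOpenImmersion (chart₁ R))

lemma chart_curveHom (R : CommRingCat.{u}) (b : Bool) :
    chart R b ≫ curveHom R = Spec.map (CommRingCat.ofHom (constC R)) := by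
  cases b
  · exact chart₂_curveHom R
  · exact chart₁_curveHom R

lemma exists_mem_opensRange_chart (R : CommRingCat.{u}) (x : curve R) :
    ∃ b, x ∈ (chart R b).opensRange := by
  have : x ∈ (chart₁ R).opensRange ⊔ (chart₂ R).opensRange := (isTwoCover_curve R).cover ▸ trivial
  rcases this with h | h
  · exact ⟨true, h⟩
  · exact ⟨false, h⟩

/-- The overlap ring is free and nonzero, hence faithfully flat over R, so some point of the overlap
lies over s. -/
lemma exists_mem_opensRange (R : CommRingCat.{u}) (s : Spec R) :
    ∃ x : curve R, curveHom R x = s ∧ ∀ b, x ∈ (chart R b).opensRange := by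
  have : Module.Free R (Overlap R) := .trans (S := LaurentPolynomial R)
  have : Nontrivial R := by
    have := s.2
    exact ⟨0, 1, fun h => this.ne_top ((Ideal.eq_top_iff_one _).2 (h ▸ zero_mem s.asIdeal))⟩
  have : Nontrivial (Overlap R) := by
    refine ⟨0, 1, fun h => ?_⟩
    have := congrArg QuadraticAlgebra.re h
    exact zero_ne_one (α := LaurentPolynomial R) this
  obtain ⟨y, hy⟩ := PrimeSpectrum.comap_surjective_of_faithfullyFlat (A := R) (B := Overlap R) s
  let y' : Spec (.of (Overlap R)) := y
  have h12 := (isTwoCover_curve R).isPullback.w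
  refine ⟨chart₁ R (Spec.map (CommRingCat.ofHom (resX R)) y'), ?_, fun b => ?_⟩
  · rw [← Scheme.Hom.comp_apply, chart₁_curveHom, ← Scheme.Hom.comp_apply, ← Spec.map_comp]
    have : CommRingCat.ofHom (constC R) ≫ CommRingCat.ofHom (resX R) =
        CommRingCat.ofHom (algebraMap R (Overlap R)) := by
      ext1
      exact RingHom.ext (resX_const R)
    rw [this]
    exact hy
  · cases b
    · rw [← Scheme.Hom.comp_apply, h12, Scheme.Hom.comp_apply]
      exact ⟨_, rfl⟩
    · exact ⟨_, rfl⟩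

section Product

variable {R : CommRingCat.{u}} {T Z : Scheme.{u}} {f : T ⟶ Spec R} {p : Z ⟶ T} {g : Z ⟶ curve R}
  (H : IsPullback p g f (curveHom R)) {A : CommRingCat.{u}} (a : Spec A ⟶ T) (b : Bool)

/-- The product of a chart of the base with a chart of the curve. -/
def prodChart : Spec (.of (Chart A)) ⟶ Z :=
  H.lift (Spec.map (CommRingCat.ofHom (constC A)) ≫ a)
    (Spec.map (CommRingCat.ofHom (Chart.map (Spec.preimage (a ≫ f)).hom)) ≫ chart R b) (by
      rw [Category.assoc, Category.assoc, chart_curveHom, ← Spec.map_comp]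
      have := (Chart.isPushout (Spec.preimage (a ≫ f))).w
      rw [← this, Spec.map_comp, Spec.map_preimage])

@[simp]
lemma prodChart_fst : prodChart H a b ≫ p = Spec.map (CommRingCat.ofHom (constC A)) ≫ a :=
  H.lift_fst _ _ _

@[simp]
lemma prodChart_snd : prodChart H a b ≫ g =
    Spec.map (CommRingCat.ofHom (Chart.map (Spec.preimage (a ≫ f)).hom)) ≫ chart R b :=
  H.lift_snd _ _ _

/-- The lift of a product chart to the inverse image of a chart of the curve. -/
def prodChartLift : Spec (.of (Chart A)) ⟶ pullback g (chart R b) :=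
  pullback.lift (prodChart H a b) _ (prodChart_snd H a b)

/-- Pasting the pushout square of chart rings with the fibre product; it makes the product charts
open immersions with the expected image. -/
lemma isPullback_prodChartLift : IsPullback (prodChartLift H a b)
    (Spec.map (CommRingCat.ofHom (constC A))) (pullback.fst g (chart R b) ≫ p) a := by
  have h1 := ((IsPullback.of_hasPullback g (chart R b)).flip.paste_vert H.flip)
  rw [chart_curveHom] at h1
  have h2 := (Chart.isPushout (Spec.preimage (a ≫ f))).op.map Scheme.Spec
  have h3 : IsPullback (prodChartLift H a b ≫ pullback.snd g (chart R b))
      (Spec.map (CommRingCat.ofHom (constC A))) (Spec.map (CommRingCat.ofHom (constC R)))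
      (a ≫ f) := by
    rw [prodChartLift, pullback.lift_snd]
    have h3 : IsPullback (Spec.map (CommRingCat.ofHom (Chart.map (Spec.preimage (a ≫ f)).hom)))
      (Spec.map (CommRingCat.ofHom (constC A))) (Spec.map (CommRingCat.ofHom (constC R)))
      (Spec.map (Spec.preimage (a ≫ f))) := h2
    rwa [Spec.map_preimage] at h3
  refine IsPullback.of_right h3 ?_ h1
  rw [prodChartLift, pullback.lift_fst_assoc, prodChart_fst]

variable [IsOpenImmersion a]

instance : IsOpenImmersion (prodChart H a b) := by
  have : IsOpenImmersion (prodChartLift H a b) :=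
    MorphismProperty.of_isPullback (isPullback_prodChartLift H a b).flip inferInstance
  have h : prodChart H a b = prodChartLift H a b ≫ pullback.fst g (chart R b) :=
    (pullback.lift_fst _ _ _).symm
  rw [h]
  infer_instance

lemma opensRange_prodChart :
    (prodChart H a b).opensRange = p ⁻¹ᵁ a.opensRange ⊓ g ⁻¹ᵁ (chart R b).opensRange := by
  have : IsOpenImmersion (prodChartLift H a b) :=
    MorphismProperty.of_isPullback (isPullback_prodChartLift H a b).flip inferInstance
  have h1 : (prodChartLift H a b).opensRange = (pullback.fst g (chart R b) ≫ p) ⁻¹ᵁ a.opensRange := by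
    have := IsOpenImmersion.image_preimage_eq_preimage_image_of_isPullback
      (isPullback_prodChartLift H a b).flip ⊤
    rw [Scheme.Hom.image_top_eq_opensRange, Scheme.Hom.preimage_top,
      Scheme.Hom.image_top_eq_opensRange] at this
    exact this
  apply Opens.ext
  ext z
  constructor
  · rintro ⟨y, rfl⟩
    refine ⟨⟨Spec.map (CommRingCat.ofHom (constC A)) y, ?_⟩,
      ⟨Spec.map (CommRingCat.ofHom (Chart.map (Spec.preimage (a ≫ f)).hom)) y, ?_⟩⟩
    · exact congr($(prodChart_fst H a b) y).symm
    · exact congr($(prodChart_snd H a b) y).symm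
  · rintro ⟨h2, h3⟩
    have h3' : z ∈ (pullback.fst g (chart R b)).opensRange := by
      rwa [Scheme.Hom.opensRange_pullbackFst]
    obtain ⟨y, rfl⟩ := h3'
    have h4 : y ∈ (prodChartLift H a b).opensRange := by rw [h1]; exact h2
    obtain ⟨x, rfl⟩ := h4
    refine ⟨x, ?_⟩
    exact congr($((pullback.lift_fst (prodChart H a b) _ (prodChart_snd H a b)).symm) x)

end Product

section Cover

variable {R : CommRingCat.{u}} {T Z : Scheme.{u}} {f : T ⟶ Spec R} {p : Z ⟶ T} {g : Z ⟶ curve R}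
lemma exists_mem_opensRange_prodChart (H : IsPullback p g f (curveHom R)) {ι : Type*} (A : ι → CommRingCat.{u})
    (a : ∀ i, Spec (A i) ⟶ T) [∀ i, IsOpenImmersion (a i)] (ha : ∀ x, ∃ i, x ∈ Set.range (a i))
    (z : Z) : ∃ i : ι × Bool, z ∈ (prodChart H (a i.1) i.2).opensRange := by
  obtain ⟨i, hi⟩ := ha (p z)
  obtain ⟨b, hb⟩ := exists_mem_opensRange_chart R (g z)
  refine ⟨(i, b), ?_⟩
  rw [opensRange_prodChart]
  exact ⟨hi, hb⟩

lemma exists_mem_affineOpens (T : Scheme.{u}) (x : T) :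
    ∃ U : {U : T.affineOpens // Nonempty U}, x ∈ Set.range U.1.2.fromSpec := by
  obtain ⟨U, hU, hx, -⟩ := Opens.isBasis_iff_nbhd.1 T.isBasis_affineOpens (Opens.mem_top x)
  refine ⟨⟨⟨U, hU⟩, ⟨x, hx⟩⟩, ?_⟩
  exact hU.range_fromSpec.symm ▸ hx

/-- The product of an integral scheme of characteristic zero with the curve is integral. -/
lemma isIntegral_of_isPullback (H : IsPullback p g f (curveHom R)) [IsIntegral T] {k : Type u} [Field k] [CharZero k]
    (q : T ⟶ Spec (.of k)) : IsIntegral Z := by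
  -- A point over the generic point of T and over the overlap of the curve lies in every product
  -- chart, which makes the union of these spectra of domains irreducible.
  obtain ⟨x, hx, hx'⟩ := exists_mem_opensRange R (f (genericPoint T))
  obtain ⟨w, hw, hw'⟩ : ∃ w : Z, p w = genericPoint T ∧ g w = x := by
    obtain ⟨w, h1, h2⟩ := Scheme.Pullback.exists_preimage_pullback (f := f) (g := curveHom R)
      (genericPoint T) x hx.symm
    refine ⟨H.isoPullback.inv w, ?_, ?_⟩
    · rw [← Scheme.Hom.comp_apply, H.isoPullback_inv_fst, h1]
    · rw [← Scheme.Hom.comp_apply, H.isoPullback_inv_snd, h2]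
  let A (U : {U : T.affineOpens // Nonempty U}) : CommRingCat.{u} := Γ(T, U.1)
  let a (U : {U : T.affineOpens // Nonempty U}) : Spec (A U) ⟶ T := U.1.2.fromSpec
  have : ∀ U, IsOpenImmersion (a U) := fun U => U.1.2.isOpenImmersion_fromSpec
  have : ∀ U, IsDomain (A U) := fun U => by
    have := U.2
    exact inferInstanceAs (IsDomain Γ(T, U.1.1))
  have : ∀ U, CharZero (A U) := fun U =>
    charZero_of_injective_ringHom (Spec.preimage (a U ≫ q)).hom.injective
  have : ∀ U, IsDomain (Chart (A U)) := fun U => Chart.isDomain _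
  refine isIntegral_of_forall_mem_range
    (fun i : {U : T.affineOpens // Nonempty U} × Bool => .of (Chart (A i.1)))
    (fun i => prodChart H (a i.1) i.2)
    (exists_mem_opensRange_prodChart H A a (exists_mem_affineOpens T)) w fun i => ?_
  rw [opensRange_prodChart]
  refine ⟨?_, ?_⟩
  · have := i.1.2
    have hU : IsAffineOpen i.1.1.1 := i.1.1.2
    have h1 : p w ∈ i.1.1.1 := by
      rw [hw]
      exact (genericPoint_spec T).mem_open_set_iff i.1.1.1.2 |>.2 (by simpa using this)
    exact hU.opensRange_fromSpec.symm ▸ h1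
  · have h1 := hx' i.2
    rwa [← hw'] at h1

/-- The product of a scheme on which `2` is invertible with the curve is smooth over the scheme. -/
lemma smooth_of_isPullback (H : IsPullback p g f (curveHom R)) {k : Type u} [Field k] [CharZero k] (q : T ⟶ Spec (.of k)) :
    Smooth p := by
  let A (U : {U : T.affineOpens // Nonempty U}) : CommRingCat.{u} := Γ(T, U.1)
  let a (U : {U : T.affineOpens // Nonempty U}) : Spec (A U) ⟶ T := U.1.2.fromSpec
  have : ∀ U, IsOpenImmersion (a U) := fun U => U.1.2.isOpenImmersion_fromSpec
  let 𝒰 : Z.OpenCover := .mkOfCovers ({U : T.affineOpens // Nonempty U} × Bool)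
    (fun i => Spec (.of (Chart (A i.1)))) (fun i => prodChart H (a i.1) i.2)
    (exists_mem_opensRange_prodChart H A a (exists_mem_affineOpens T)) (fun i => inferInstance)
  have : IsZariskiLocalAtSource @Smooth.{u} := HasRingHomProperty.instIsZariskiLocalAtSource
  rw [IsZariskiLocalAtSource.iff_of_openCover (P := @Smooth) 𝒰]
  intro i
  change Smooth (prodChart H (a i.1) i.2 ≫ p)
  rw [prodChart_fst]
  have h2 : IsUnit (2 : A i.1) := by
    have := (IsUnit.mk0 (2 : k) two_ne_zero).map (Spec.preimage (a i.1 ≫ q)).hom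
    rwa [map_ofNat] at this
  have := Chart.smooth (A i.1) h2
  have : Smooth (Spec.map (CommRingCat.ofHom (constC (A i.1)))) := by
    rw [HasRingHomProperty.Spec_iff (P := @Smooth)]
    exact RingHom.smooth_algebraMap.2 this
  infer_instance

/-- The product with the curve has dimension one more. -/
lemma topologicalKrullDim_of_isPullback (H : IsPullback p g f (curveHom R)) [IsLocallyNoetherian T] {n : ℕ}
    (hn : topologicalKrullDim T = n) : topologicalKrullDim Z = (n + 1 : ℕ) := by
  let A (U : {U : T.affineOpens // Nonempty U}) : CommRingCat.{u} := Γ(T, U.1)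
  let a (U : {U : T.affineOpens // Nonempty U}) : Spec (A U) ⟶ T := U.1.2.fromSpec
  have : ∀ U, IsOpenImmersion (a U) := fun U => U.1.2.isOpenImmersion_fromSpec
  have : ∀ U, IsNoetherianRing (A U) := fun U => IsLocallyNoetherian.component_noetherian U.1
  rw [topologicalKrullDim_eq_iSup A a (exists_mem_affineOpens T)] at hn
  rw [topologicalKrullDim_eq_iSup
    (fun i : {U : T.affineOpens // Nonempty U} × Bool => .of (Chart (A i.1)))
    (fun i => prodChart H (a i.1) i.2)
    (exists_mem_opensRange_prodChart H A a (exists_mem_affineOpens T))]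
  push_cast
  refine le_antisymm (iSup_le fun i => ?_) ?_
  · refine (Chart.ringKrullDim (A i.1)).le.trans ?_
    gcongr
    exact hn ▸ le_iSup (fun U => ringKrullDim (A U)) i.1
  · obtain ⟨U, hU⟩ := WithBot.exists_eq_of_iSup_eq hn
    refine le_trans (le_of_eq ?_) (le_iSup _ (U, true))
    rw [← hU]
    exact (Chart.ringKrullDim (A U)).symm

end Cover

end Quartic

end

/-! ### Exterior powers and differentials of field extensions. -/

noncomputable section

open scoped TensorProduct

namespace MultilinearForms

lemma multilinear_mem_span {R M N : Type*} [CommRing R] [AddCommGroup M] [Module R M]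
    [AddCommGroup N] [Module R N] {n : ℕ} (f : MultilinearMap R (fun _ : Fin n => M) N) {s : Set M}
    {P : Submodule R N} (hf : ∀ v : Fin n → M, (∀ i, v i ∈ s) → f v ∈ P) (v : Fin n → M)
    (hv : ∀ i, v i ∈ Submodule.span R s) : f v ∈ P := by
  suffices H : ∀ (t : Finset (Fin n)) (v : Fin n → M), (∀ i ∈ t, v i ∈ Submodule.span R s) →
      (∀ i ∉ t, v i ∈ s) → f v ∈ P from
    H Finset.univ v (fun i _ => hv i) (fun i hi => absurd (Finset.mem_univ i) hi)
  intro t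
  induction t using Finset.induction_on with
  | empty => exact fun v _ h => hf v fun i => h i (by simp)
  | insert a t ha ih =>
    intro v h1 h2
    have key : ∀ m ∈ Submodule.span R s, f (Function.update v a m) ∈ P := by
      intro m hm
      induction hm using Submodule.span_induction with
      | mem m hm =>
        refine ih _ (fun i hi => ?_) fun i hi => ?_
        · rw [Function.update_of_ne (by rintro rfl; exact ha hi)]
          exact h1 i (Finset.mem_insert_of_mem hi)
        · by_cases h : i = a
          · subst h; rwa [Function.update_self]
          · rw [Function.update_of_ne h]
            exact h2 i (by simp [h, hi])
      | zero => rw [f.map_update_zero]; exact zero_mem _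
      | add x y _ _ hx hy => rw [f.map_update_add]; exact add_mem hx hy
      | smul r x _ hx => rw [f.map_update_smul]; exact P.smul_mem _ hx
    have := key (v a) (h1 a (Finset.mem_insert_self a t))
    rwa [Function.update_eq_self] at this

/-- The determinant in the basis v of its span, composed with a retraction of E onto the span, takes
the value 1 on v. -/
lemma ιMulti_ne_zero {K E : Type*} [Field K] [AddCommGroup E] [Module K E] {n : ℕ} {v : Fin n → E}
    (hv : LinearIndependent K v) : exteriorPower.ιMulti K n v ≠ 0 := by
  intro h0
  obtain ⟨g, hg⟩ := LinearMap.exists_leftInverse_of_injective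
    (Submodule.span K (Set.range v)).subtype (Submodule.ker_subtype _)
  let b := Module.Basis.span hv
  let d := b.det.compLinearMap g
  have h1 := exteriorPower.alternatingMapLinearEquiv_apply_ιMulti d v
  rw [h0, map_zero] at h1
  have h2 : (fun i => g (v i)) = b := funext fun i => by
    have : v i = (Submodule.span K (Set.range v)).subtype (b i) :=
      congrArg Subtype.val (Module.Basis.span_apply hv i).symm
    rw [this]
    exact congr($hg (b i))
  have h3 : d v = 1 := by
    change b.det (fun i => g (v i)) = 1
    rw [h2, Module.Basis.det_self]
  exact zero_ne_one (h1.trans h3)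

/-- Pulling an alternating K'-map back along h gives an alternating K-map, which factors through the
exterior power. It serves for pulling back forms and wedging with a fixed one. -/
lemma exists_extension {K K' M M' N : Type*} [Field K] [Field K'] [Algebra K K'] [AddCommGroup M]
    [Module K M] [AddCommGroup M'] [Module K' M'] [Module K M'] [IsScalarTower K K' M']
    [AddCommGroup N] [Module K' N] {n : ℕ} (g : M' [⋀^Fin n]→ₗ[K'] N) (h : M →ₗ[K] M') :
    ∃ F : ⋀[K]^n M →+ N, (∀ (c : K) m, F (c • m) = algebraMap K K' c • F m) ∧
      ∀ v, F (exteriorPower.ιMulti K n v) = g (h ∘ v) := by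
  let : Module K N := Module.compHom N (algebraMap K K')
  let a : M [⋀^Fin n]→ₗ[K] N :=
    { toFun v := g (h ∘ v)
      map_update_add' {inst} v i x y := by
        have : inst = instDecidableEqFin n := Subsingleton.elim _ _
        subst this
        simp only [Function.comp_update, map_add]
        exact g.map_update_add _ _ _ _
      map_update_smul' {inst} v i c x := by
        have : inst = instDecidableEqFin n := Subsingleton.elim _ _
        subst this
        simp only [Function.comp_update, map_smul]
        rw [← algebraMap_smul K' c (h x)]
        exact g.map_update_smul _ _ _ _
      map_eq_zero_of_eq' v i j hij hne := g.map_eq_zero_of_eq _ (congrArg h hij) hne }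
  refine ⟨(exteriorPower.alternatingMapLinearEquiv a).toAddMonoidHom, fun c m => ?_, fun v => ?_⟩
  · exact (exteriorPower.alternatingMapLinearEquiv a).map_smul c m
  · exact exteriorPower.alternatingMapLinearEquiv_apply_ιMulti a v

/-- If the `n`-th exterior power is spanned by one element and `n > 0`, then the next exterior power
is zero. -/
lemma ιMulti_succ_eq_zero {K E : Type*} [Field K] [AddCommGroup E] [Module K E] {n : ℕ}
    {ω : ⋀[K]^(n + 1) E} {s : Set E}
    (h : ∀ v : Fin (n + 1) → E, (∀ i, v i ∈ s) → ∃ c : K, exteriorPower.ιMulti K (n + 1) v = c • ω)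
    (v : Fin (n + 2) → E) (hv : ∀ i, v i ∈ s) : exteriorPower.ιMulti K (n + 2) v = 0 := by
  let L (e : E) : ⋀[K]^(n + 1) E →ₗ[K] ⋀[K]^(n + 2) E :=
    exteriorPower.alternatingMapLinearEquiv ((exteriorPower.ιMulti K (n + 2)).curryLeft e)
  have hL (e : E) (w) : L e (exteriorPower.ιMulti K (n + 1) w) =
      exteriorPower.ιMulti K (n + 2) (Fin.cons e w) :=
    exteriorPower.alternatingMapLinearEquiv_apply_ιMulti _ w
  let w : Fin n → E := fun i => v i.succ.succ
  have hv' : v = Fin.cons (v 0) (Fin.cons (v 1) w) := by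
    ext i
    refine Fin.cases rfl (fun i => ?_) i
    refine Fin.cases rfl (fun i => rfl) i
  have hmem (i : Fin (n + 2)) : ∀ j, (Fin.cons (v i) w : Fin (n + 1) → E) j ∈ s := by
    intro j
    refine Fin.cases (hv i) (fun j => hv _) j
  obtain ⟨a, ha⟩ := h (Fin.cons (v 1) w) (hmem 1)
  obtain ⟨b, hb⟩ := h (Fin.cons (v 0) w) (hmem 0)
  -- With w the remaining vectors, v₁ ∧ w = aω and v₀ ∧ w = bω. Then a v₁ ∧ ω = 0, while b v₁ ∧ ω =
  -- -a v₀ ∧ ω; either a = 0 or v₁ ∧ ω = 0, and both make a v₀ ∧ ω vanish.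
  have h0 : exteriorPower.ιMulti K (n + 2) v = a • L (v 0) ω := by
    rw [← map_smul, ← ha, hL, ← hv']
  have h1 : a • L (v 1) ω = 0 := by
    rw [← map_smul, ← ha, hL]
    exact AlternatingMap.map_eq_zero_of_eq _ _ (i := 0) (j := 1) rfl (by simp)
  have h2 : b • L (v 1) ω = -(a • L (v 0) ω) := by
    rw [← map_smul, ← hb, hL, ← h0]
    have := AlternatingMap.map_swap (exteriorPower.ιMulti K (n + 2)) v (i := 0) (j := 1) (by simp)
    rw [← this]
    congr 1
    ext i
    refine Fin.cases ?_ (fun i => ?_) i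
    · simp
    · refine Fin.cases ?_ (fun i => ?_) i
      · simp
      · simp only [Function.comp_apply]
        rw [Equiv.swap_apply_of_ne_of_ne (by simp [Fin.ext_iff]) (by simp [Fin.ext_iff])]
        rfl
  rw [h0]
  by_cases ha0 : a = 0
  · rw [ha0, zero_smul]
  · have h3 : L (v 1) ω = 0 := (smul_eq_zero.1 h1).resolve_left ha0
    rw [h3, smul_zero] at h2
    exact neg_eq_zero.1 h2.symm

end MultilinearForms

namespace KaehlerFields

variable (k K K' : Type u) [Field k] [Field K] [Field K'] [Algebra k K] [Algebra K K']
  [Algebra k K'] [IsScalarTower k K K']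

lemma linearIndependent_baseChange {E : Type*} [AddCommGroup E] [Module K E] {ι : Type*} {v : ι → E}
    (hv : LinearIndependent K v) : LinearIndependent K' fun i => (1 : K') ⊗ₜ[K] v i := by
  let b := Algebra.TensorProduct.basis K' (Module.Basis.extend hv.linearIndepOn_id)
  have h := b.linearIndependent.comp
    (fun i => (⟨v i, Module.Basis.subset_extend hv.linearIndepOn_id ⟨i, rfl⟩⟩ :
      (hv.linearIndepOn_id.extend (Set.subset_univ _))))
    (fun i j hij => hv.injective (congrArg Subtype.val hij))
  convert h using 1
  ext i
  simp [b]

variable {k K K'}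

/-- By formal smoothness K' ⊗ Ω_K embeds in Ω_K', with quotient Ω_{K'/K}. Vectors of the sub stay
independent, and η is nonzero in the quotient. -/
lemma linearIndependent_cons [CharZero K] [Algebra.FormallySmooth K K'] {n : ℕ}
    {v : Fin n → Ω[K⁄k]} (hv : LinearIndependent K v) {η : Ω[K'⁄k]}
    (hη : KaehlerDifferential.map k K K' K' η ≠ 0) :
    LinearIndependent K' (Fin.cons η (KaehlerDifferential.map k k K K' ∘ v) :
      Fin (n + 1) → Ω[K'⁄k]) := by
  have hinj : Function.Injective (KaehlerDifferential.mapBaseChange k K K') := by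
    refine (injective_iff_map_eq_zero _).2 fun x hx => ?_
    have : Subsingleton (Algebra.H1Cotangent K K') :=
      Algebra.FormallySmooth.subsingleton_h1Cotangent
    obtain ⟨y, rfl⟩ := (Algebra.H1Cotangent.exact_δ_mapBaseChange k K K' x).1 hx
    rw [Subsingleton.elim y 0, map_zero]
  refine linearIndependent_finCons.2 ⟨?_, fun hmem => hη ?_⟩
  · have := (linearIndependent_baseChange K K' hv).map' (KaehlerDifferential.mapBaseChange k K K')
      (LinearMap.ker_eq_bot.2 hinj)
    have e : KaehlerDifferential.map k k K K' ∘ v =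
        KaehlerDifferential.mapBaseChange k K K' ∘ fun i => (1 : K') ⊗ₜ[K] v i := by
      ext i
      simp
    exact e ▸ this
  · have hle : Submodule.span K' (Set.range (KaehlerDifferential.map k k K K' ∘ v)) ≤
        LinearMap.ker (KaehlerDifferential.map k K K' K') := by
      rw [Submodule.span_le]
      rintro _ ⟨i, rfl⟩
      refine (KaehlerDifferential.exact_mapBaseChange_map k K K' _).2 ⟨1 ⊗ₜ v i, ?_⟩
      simp
    exact hle hmem

end KaehlerFields

end

/-! ### The differential of the curve and lattices of regular forms. -/

noncomputable section

namespace KaehlerFields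
open MultilinearForms ConjB

variable {k K K' : Type u} [Field k] [Field K] [Field K'] [Algebra K K'] [Algebra k K']

variable (k) in
/-- The differential `dx / (2 y)` on the curve `y² = x⁴ + 1`. -/
def eta (x y : K') : Ω[K'⁄k] :=
  (y / 2) • KaehlerDifferential.D k K' x - (x / 4) • KaehlerDifferential.D k K' y

section Eta

variable {x y : K'}

lemma two_mul_smul_D (h : y ^ 2 = x ^ 4 + 1) :
    (2 * y) • KaehlerDifferential.D k K' y = (4 * x ^ 3) • KaehlerDifferential.D k K' x := by
  have := congrArg (KaehlerDifferential.D k K') h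
  rw [map_add, Derivation.leibniz_pow, Derivation.leibniz_pow, Derivation.map_one_eq_zero, add_zero]
    at this
  simp only [Nat.add_one_sub_one, pow_one, ← Nat.cast_smul_eq_nsmul K', smul_smul] at this
  exact_mod_cast this

variable [CharZero K']

/-- Written as (y/2)dx - (x/4)dy the form has regular coefficients even where y = 0; since dx = 2y η
and dy = 4x³ η, it generates the differentials of the whole chart. -/
lemma D_fst_eq (h : y ^ 2 = x ^ 4 + 1) :
    KaehlerDifferential.D k K' x = (2 * y) • eta k x y := by
  have h1 := two_mul_smul_D (k := k) h
  have e : (2 * y * (x / 4)) • KaehlerDifferential.D k K' y =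
      (x ^ 4) • KaehlerDifferential.D k K' x := by
    have : (2 * y * (x / 4)) = (x / 4) * (2 * y) := by ring
    rw [this, mul_smul, h1, smul_smul]
    congr 1
    field_simp
  rw [eta, smul_sub, smul_smul, smul_smul, e, ← sub_smul]
  have : 2 * y * (y / 2) - x ^ 4 = 1 := by field_simp; rw [h]; ring
  rw [this, one_smul]

lemma D_snd_eq (h : y ^ 2 = x ^ 4 + 1) :
    KaehlerDifferential.D k K' y = (4 * x ^ 3) • eta k x y := by
  have h1 := two_mul_smul_D (k := k) h
  have e : (4 * x ^ 3 * (y / 2)) • KaehlerDifferential.D k K' x =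
      (y ^ 2) • KaehlerDifferential.D k K' y := by
    have : (4 * x ^ 3 * (y / 2)) = (y / 2) * (4 * x ^ 3) := by ring
    rw [this, mul_smul, ← h1, smul_smul]
    congr 1
    field_simp
  rw [eta, smul_sub, smul_smul, smul_smul, e, ← sub_smul]
  have : y ^ 2 - 4 * x ^ 3 * (x / 4) = 1 := by field_simp; rw [h]; ring
  rw [this, one_smul]

/-- The differential in the coordinates at infinity. -/
lemma eta_inv (h : y ^ 2 = x ^ 4 + 1) (hx : x ≠ 0) : eta k x⁻¹ (y / x ^ 2) = - eta k x y := by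
  have h' : (y / x ^ 2) ^ 2 = x⁻¹ ^ 4 + 1 := by
    field_simp
    rw [h]; ring
  have hdx : KaehlerDifferential.D k K' x⁻¹ = - (x⁻¹ ^ 2) • KaehlerDifferential.D k K' x := by
    rw [Derivation.leibniz_inv, neg_smul]
  have hy : y / x ^ 2 = y * x⁻¹ ^ 2 := by rw [inv_pow, div_eq_mul_inv]
  have hdy : KaehlerDifferential.D k K' (y / x ^ 2) =
      (x⁻¹ ^ 2) • KaehlerDifferential.D k K' y - (2 * y * x⁻¹ ^ 3) • KaehlerDifferential.D k K' x := by
    rw [hy, Derivation.leibniz, Derivation.leibniz_pow, hdx, ← Nat.cast_smul_eq_nsmul K']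
    simp only [smul_smul, neg_smul, smul_neg]
    rw [sub_eq_neg_add]
    congr 3
    push_cast
    field_simp
  rw [eta, hdx, hdy, smul_sub, smul_smul, smul_smul, smul_smul]
  rw [D_fst_eq (k := k) h, D_snd_eq (k := k) h, smul_smul, smul_smul, smul_smul, ← sub_smul, ← sub_smul,
    ← neg_one_smul K' (eta k x y)]
  congr 1
  field_simp
  ring_nf

end Eta

section Lattice

variable {x y : K'} [CharZero K']

/-- R' consists of fractions of polynomials in x and y over R, so by the Leibniz and quotient rules
its differentials come from dx, dy, which are multiples of η, and from differentials of R. -/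
lemma D_mem_span (h : y ^ 2 = x ^ 4 + 1) (R : Subring K) (R' : Subring K')
    (hR : ∀ a ∈ R, algebraMap K K' a ∈ R') (hx : x ∈ R') (hy : y ∈ R')
    (hfrac : ∀ r ∈ R', ∃ a b, a ∈ Subring.closure (algebraMap K K' '' R ∪ {x, y}) ∧
      b ∈ Subring.closure (algebraMap K K' '' R ∪ {x, y}) ∧ b ≠ 0 ∧ b⁻¹ ∈ R' ∧ r = a * b⁻¹)
    (r : K') (hr : r ∈ R') : KaehlerDifferential.D k K' r ∈ Submodule.span R'
      ({eta k x y} ∪ (fun a => KaehlerDifferential.D k K' (algebraMap K K' a)) '' (R : Set K)) := by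
  set M := Submodule.span R'
    ({eta k x y} ∪ (fun a => KaehlerDifferential.D k K' (algebraMap K K' a)) '' (R : Set K)) with hM
  have smul_mem {c : K'} (hc : c ∈ R') {m} (hm : m ∈ M) : c • m ∈ M := M.smul_mem ⟨c, hc⟩ hm
  have hη : eta k x y ∈ M := Submodule.subset_span (Or.inl rfl)
  have two : (2 : K') ∈ R' := ofNat_mem R' 2
  have four : (4 : K') ∈ R' := ofNat_mem R' 4
  have hle : Subring.closure (algebraMap K K' '' R ∪ {x, y}) ≤ R' := by
    rw [Subring.closure_le]
    rintro _ (⟨a, ha, rfl⟩ | rfl | rfl)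
    · exact hR a ha
    · exact hx
    · exact hy
  have hpoly (a) (ha : a ∈ Subring.closure (algebraMap K K' '' R ∪ {x, y})) :
      KaehlerDifferential.D k K' a ∈ M := by
    induction ha using Subring.closure_induction with
    | mem a ha =>
      rcases ha with ⟨a, ha, rfl⟩ | rfl | rfl
      · exact Submodule.subset_span (Or.inr ⟨a, ha, rfl⟩)
      · rw [D_fst_eq h]
        exact smul_mem (R'.mul_mem two hy) hη
      · rw [D_snd_eq h]
        exact smul_mem (R'.mul_mem four (R'.pow_mem hx 3)) hη
    | zero => rw [map_zero]; exact zero_mem _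
    | one => rw [Derivation.map_one_eq_zero]; exact zero_mem _
    | add a b _ _ ha hb => rw [map_add]; exact add_mem ha hb
    | neg a _ ha => rw [map_neg]; exact neg_mem ha
    | mul a b ha' hb' ha hb =>
      rw [Derivation.leibniz]
      exact add_mem (smul_mem (hle ha') hb) (smul_mem (hle hb') ha)
  obtain ⟨a, b, ha, hb, -, hb', rfl⟩ := hfrac r hr
  rw [Derivation.leibniz, Derivation.leibniz_inv, neg_smul, smul_neg]
  exact add_mem (neg_mem (smul_mem (hle ha) (smul_mem (R'.pow_mem hb' 2) (hpoly b hb))))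
    (smul_mem hb' (hpoly a ha))

variable [Algebra k K] [IsScalarTower k K K'] {n : ℕ} (R : Subring K) (R' : Subring K') {ω : ⋀[K]^n (Ω[K⁄k])}
  (L : ⋀[K]^n (Ω[K⁄k]) →+ ⋀[K']^(n + 1) (Ω[K'⁄k]))

/-- Expand a product of n + 1 differentials in the generators η and da. Products without η are
pulled back from the vanishing (n + 1)-forms of K, those with two factors η are zero, and those with
one are η ∧ (n-form of R), a multiple of L ω. -/
theorem formLattice_eq_span (h : y ^ 2 = x ^ 4 + 1) 
    (hR : ∀ a ∈ R, algebraMap K K' a ∈ R') (hx : x ∈ R') (hy : y ∈ R') (h2 : (2 : K')⁻¹ ∈ R')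
    (hfrac : ∀ r ∈ R', ∃ a b, a ∈ Subring.closure (algebraMap K K' '' R ∪ {x, y}) ∧
      b ∈ Subring.closure (algebraMap K K' '' R ∪ {x, y}) ∧ b ≠ 0 ∧ b⁻¹ ∈ R' ∧ r = a * b⁻¹)
    (hω : formLattice k K R n = Submodule.span R {ω})
    (hvan : ∀ a : Fin (n + 1) → K,
      exteriorPower.ιMulti K (n + 1) (fun i => KaehlerDifferential.D k K (a i)) = 0)
    (hL : ∀ (c : K) m, L (c • m) = algebraMap K K' c • L m)
    (hL' : ∀ v, L (exteriorPower.ιMulti K n v) = exteriorPower.ιMulti K' (n + 1)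
      (Fin.cons (eta k x y) (KaehlerDifferential.map k k K K' ∘ v))) :
    formLattice k K' R' (n + 1) = Submodule.span R' {L ω} := by
  let S : Set (Ω[K'⁄k]) := {eta k x y} ∪
    (fun a => KaehlerDifferential.D k K' (algebraMap K K' a)) '' (R : Set K)
  let f : MultilinearMap R' (fun _ : Fin (n + 1) => Ω[K'⁄k]) (⋀[K']^(n + 1) (Ω[K'⁄k])) :=
    (exteriorPower.ιMulti K' (n + 1)).toMultilinearMap.restrictScalars R'
  have hDφ (a : K) : KaehlerDifferential.D k K' (algebraMap K K' a) =
      KaehlerDifferential.map k k K K' (KaehlerDifferential.D k K a) :=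
    (KaehlerDifferential.map_D k k K K' a).symm
  apply le_antisymm
  · rw [formLattice, Submodule.span_le]
    rintro _ ⟨r, rfl⟩
    refine multilinear_mem_span f (s := S) (fun v hv => ?_) _
      (fun i => D_mem_span h R R' hR hx hy hfrac _ (r i).2)
    by_cases hex : ∃ i, v i = eta k x y
    · obtain ⟨i, hi⟩ := hex
      have main (w : Fin (n + 1) → Ω[K'⁄k]) (hw : ∀ i, w i ∈ S) (h0 : w 0 = eta k x y) :
          exteriorPower.ιMulti K' (n + 1) w ∈ Submodule.span R' {L ω} := by
        by_cases hex' : ∃ j : Fin n, w j.succ = eta k x y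
        · obtain ⟨j, hj⟩ := hex'
          rw [AlternatingMap.map_eq_zero_of_eq _ _ (h0.trans hj.symm) (Fin.succ_ne_zero j).symm]
          exact zero_mem _
        · push Not at hex'
          have hw' (j : Fin n) : ∃ a ∈ R, KaehlerDifferential.D k K' (algebraMap K K' a) = w j.succ := by
            rcases hw j.succ with hj | ⟨a, ha, hj⟩
            · exact absurd hj (hex' j)
            · exact ⟨a, ha, hj⟩
          choose a ha hwa using hw'
          have e : w = Fin.cons (eta k x y)
              (KaehlerDifferential.map k k K K' ∘ fun j => KaehlerDifferential.D k K (a j)) := by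
            ext j
            refine Fin.cases h0 (fun j => ?_) j
            rw [Fin.cons_succ, Function.comp_apply, ← hDφ, hwa]
          rw [e, ← hL']
          have hmem : exteriorPower.ιMulti K n (fun j => KaehlerDifferential.D k K (a j)) ∈
              formLattice k K R n := Submodule.subset_span ⟨fun j => ⟨a j, ha j⟩, rfl⟩
          rw [hω] at hmem
          obtain ⟨c, hc⟩ := Submodule.mem_span_singleton.1 hmem
          rw [← hc]
          have : L (c • ω) = (⟨algebraMap K K' c, hR _ c.2⟩ : R') • L ω := hL c ω
          exact this ▸ Submodule.smul_mem _ _ (Submodule.mem_span_singleton_self _)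
      by_cases hi0 : i = 0
      · subst hi0
        exact main v hv hi
      · have h1 := main (v ∘ Equiv.swap 0 i) (fun j => hv _) (by simp [hi])
        rw [AlternatingMap.map_swap _ _ (Ne.symm hi0)] at h1
        exact (Submodule.neg_mem_iff _).1 h1
    · push Not at hex
      have hv' (j : Fin (n + 1)) :
          ∃ a ∈ R, KaehlerDifferential.D k K' (algebraMap K K' a) = v j := by
        rcases hv j with hj | ⟨a, ha, hj⟩
        · exact absurd hj (hex j)
        · exact ⟨a, ha, hj⟩
      choose a ha hva using hv'
      obtain ⟨F, -, hF⟩ := exists_extension (K := K) (exteriorPower.ιMulti K' (n + 1))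
        (KaehlerDifferential.map k k K K')
      have e : v = KaehlerDifferential.map k k K K' ∘ fun j => KaehlerDifferential.D k K (a j) := by
        ext j
        rw [Function.comp_apply, ← hDφ, hva]
      have : f v = 0 := by
        change exteriorPower.ιMulti K' (n + 1) v = 0
        rw [e, ← hF, hvan, map_zero]
      rw [this]
      exact zero_mem _
  -- Conversely ω is a combination of products da, and η is an R'-combination of dx and dy because
  -- 1/2 lies in R'.
  · rw [Submodule.span_le, Set.singleton_subset_iff]
    have hmem : ω ∈ formLattice k K R n := hω ▸ Submodule.mem_span_singleton_self ω
    refine Submodule.span_induction (p := fun m _ => L m ∈ formLattice k K' R' (n + 1))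
      ?_ ?_ (fun a b _ _ ha hb => ?_) (fun c m _ hm => ?_) hmem
    · rintro _ ⟨a, rfl⟩
      rw [hL']
      let w (z : R') : Fin (n + 1) → R' := Fin.cons z fun j => ⟨algebraMap K K' (a j), hR _ (a j).2⟩
      have hw (z : R') : (exteriorPower.ιMulti K' (n + 1) (Fin.cons (KaehlerDifferential.D k K' z)
          (KaehlerDifferential.map k k K K' ∘ fun j => KaehlerDifferential.D k K (a j)))) ∈
          formLattice k K' R' (n + 1) := by
        refine Submodule.subset_span ⟨w z, ?_⟩
        refine congrArg (exteriorPower.ιMulti K' (n + 1)) (funext fun j => ?_)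
        refine Fin.cases rfl (fun j => ?_) j
        exact hDφ _
      have two : (2 : K')⁻¹ ∈ R' := h2
      let c₁ : R' := ⟨y / 2, by rw [div_eq_mul_inv]; exact R'.mul_mem hy two⟩
      let c₂ : R' := ⟨x / 4, by
        have : x / 4 = x * (2⁻¹ * 2⁻¹) := by ring
        rw [this]; exact R'.mul_mem hx (R'.mul_mem two two)⟩
      let g : Ω[K'⁄k] →ₗ[K'] ⋀[K']^(n + 1) (Ω[K'⁄k]) :=
        { toFun e := exteriorPower.ιMulti K' (n + 1) (Fin.cons e
            (KaehlerDifferential.map k k K K' ∘ fun j => KaehlerDifferential.D k K (a j)))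
          map_add' e e' := MultilinearMap.cons_add
            (exteriorPower.ιMulti K' (n + 1)).toMultilinearMap _ e e'
          map_smul' c e := MultilinearMap.cons_smul
            (exteriorPower.ιMulti K' (n + 1)).toMultilinearMap _ c e }
      change g (eta k x y) ∈ _
      rw [eta, map_sub, map_smul, map_smul]
      exact sub_mem (Submodule.smul_mem _ c₁ (hw ⟨x, hx⟩)) (Submodule.smul_mem _ c₂ (hw ⟨y, hy⟩))
    · rw [map_zero]; exact zero_mem _
    · rw [map_add]; exact add_mem ha hb
    · have : L (c • m) = (⟨algebraMap K K' c, hR _ c.2⟩ : R') • L m := hL c m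
      exact this ▸ Submodule.smul_mem _ _ hm

end Lattice

end KaehlerFields

end

/-! ### Wedge product with the differential of the curve. -/

noncomputable section

namespace KaehlerFields
open MultilinearForms ConjB

section Transcendental

variable {K K' : Type u} [Field K] [Field K'] [Algebra K K'] [CharZero K]

/-- If dx were zero, all differentials would vanish, K' would be unramified and essentially of
finite type over K, hence finite, and x algebraic. -/
lemma D_ne_zero {x y : K'} (h : y ^ 2 = x ^ 4 + 1) (hx : Transcendental K x)
    (htop : IntermediateField.adjoin K {x, y} = ⊤) : KaehlerDifferential.D K K' x ≠ 0 := by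
  have : CharZero K' := charZero_of_injective_algebraMap (algebraMap K K').injective
  intro h0
  have hy0 : y ≠ 0 := by
    rintro rfl
    refine hx ⟨Polynomial.X ^ 4 + 1, ?_, ?_⟩
    · exact (Polynomial.monic_X_pow_add_C (1 : K) four_ne_zero).ne_zero
    · simp [← h]
  have hy : KaehlerDifferential.D K K' y = 0 := by
    have := two_mul_smul_D (k := K) h
    rw [h0, smul_zero] at this
    exact (smul_eq_zero.1 this).resolve_left (mul_ne_zero two_ne_zero hy0)
  have hall (a : K') : KaehlerDifferential.D K K' a = 0 := by
    have ha : a ∈ IntermediateField.adjoin K {x, y} := htop ▸ IntermediateField.mem_top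
    induction ha using IntermediateField.adjoin_induction with
    | mem a ha =>
      rcases ha with rfl | rfl
      · exact h0
      · exact hy
    | algebraMap a => exact Derivation.map_algebraMap _ _
    | add a b _ _ ha hb => rw [map_add, ha, hb, add_zero]
    | inv a _ ha => rw [Derivation.leibniz_inv, ha, smul_zero]
    | mul a b _ _ ha hb => rw [Derivation.leibniz, ha, hb, smul_zero, smul_zero, add_zero]
  have : Subsingleton (Ω[K'⁄K]) := by
    have : Submodule.span K' (Set.range (KaehlerDifferential.D K K')) ≤ ⊥ := by
      rw [Submodule.span_le]
      rintro _ ⟨a, rfl⟩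
      exact hall a
    rw [KaehlerDifferential.span_range_derivation] at this
    exact (Submodule.subsingleton_iff K').1 (subsingleton_of_bot_eq_top (le_bot_iff.1 this).symm)
  have : Algebra.FormallyUnramified K K' := ⟨this⟩
  have : Algebra.EssFiniteType K (⊤ : IntermediateField K K') :=
    IntermediateField.essFiniteType_iff.2 (htop ▸ IntermediateField.fg_adjoin_of_finite (by simp))
  have : Algebra.EssFiniteType K K' := .of_surjective
    (IntermediateField.topEquiv (F := K) (E := K')).toAlgHom
    IntermediateField.topEquiv.surjective
  have := Algebra.FormallyUnramified.finite_of_free K K'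
  exact hx (Algebra.IsAlgebraic.isAlgebraic x)

end Transcendental

variable {k K K' : Type u} [Field k] [Field K] [Field K'] [Algebra k K] [Algebra K K']
  [Algebra k K'] [IsScalarTower k K K']

lemma exists_ιMulti_D_ne_zero {n : ℕ} {ω : ⋀[K]^n (Ω[K⁄k])} (hω : ω ≠ 0) :
    ∃ a : Fin n → K, exteriorPower.ιMulti K n (fun i => KaehlerDifferential.D k K (a i)) ≠ 0 := by
  by_contra! hall
  apply hω
  have h1 := exteriorPower.ιMulti_span_of_span K n (Ω[K⁄k])
    (KaehlerDifferential.span_range_derivation k K)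
  have h2 : ω ∈ (⊤ : Submodule K (⋀[K]^n (Ω[K⁄k]))) := Submodule.mem_top
  rw [← h1] at h2
  refine (Submodule.mem_bot K).1 (Submodule.span_le.2 ?_ h2)
  rintro _ ⟨v, hv, rfl⟩
  choose a ha using fun i => hv ⟨i, rfl⟩
  exact (congrArg _ (funext fun i => (ha i).symm)).trans (hall a)

/-- The wedge product with `dx / (2 y)` sends a generator of the regular `n`-forms to a generator of
the regular `n + 1`-forms. -/
theorem exists_formLattice_eq_span [CharZero K] {x y : K'} (h : y ^ 2 = x ^ 4 + 1)
    (hx : Transcendental K x) (htop : IntermediateField.adjoin K {x, y} = ⊤) {n : ℕ}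
    {ω : ⋀[K]^n (Ω[K⁄k])} (hω0 : ω ≠ 0)
    (hspan : ∀ a : Fin n → K, ∃ c : K,
      exteriorPower.ιMulti K n (fun i => KaehlerDifferential.D k K (a i)) = c • ω)
    (hvan : ∀ a : Fin (n + 1) → K,
      exteriorPower.ιMulti K (n + 1) (fun i => KaehlerDifferential.D k K (a i)) = 0) :
    ∃ ω' : ⋀[K']^(n + 1) (Ω[K'⁄k]), ω' ≠ 0 ∧ ∀ (x' y' : K') (_ : y' ^ 2 = x' ^ 4 + 1)
      (_ : eta k x' y' = eta k x y ∨ eta k x' y' = - eta k x y) (R : Subring K) (R' : Subring K')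
      (_ : ∀ a ∈ R, algebraMap K K' a ∈ R') (_ : x' ∈ R') (_ : y' ∈ R') (_ : (2 : K')⁻¹ ∈ R')
      (_ : ∀ r ∈ R', ∃ a b, a ∈ Subring.closure (algebraMap K K' '' R ∪ {x', y'}) ∧
        b ∈ Subring.closure (algebraMap K K' '' R ∪ {x', y'}) ∧ b ≠ 0 ∧ b⁻¹ ∈ R' ∧ r = a * b⁻¹),
      formLattice k K R n = Submodule.span R {ω} →
      formLattice k K' R' (n + 1) = Submodule.span R' {ω'} := by
  have : CharZero K' := charZero_of_injective_algebraMap (algebraMap K K').injective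
  have : Algebra.EssFiniteType K (⊤ : IntermediateField K K') :=
    IntermediateField.essFiniteType_iff.2 (htop ▸ IntermediateField.fg_adjoin_of_finite (by simp))
  have : Algebra.EssFiniteType K K' := .of_surjective
    (IntermediateField.topEquiv (F := K) (E := K')).toAlgHom
    IntermediateField.topEquiv.surjective
  have : Algebra.FormallySmooth K K' := .of_perfectField
  let d (e : Ω[K'⁄k]) : (Ω[K'⁄k]) [⋀^Fin n]→ₗ[K'] ⋀[K']^(n + 1) (Ω[K'⁄k]) :=
    (exteriorPower.ιMulti K' (n + 1)).curryLeft e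
  have hd (e : Ω[K'⁄k]) (v : Fin n → Ω[K⁄k]) : d e (KaehlerDifferential.map k k K K' ∘ v) =
    exteriorPower.ιMulti K' (n + 1) (Fin.cons e (KaehlerDifferential.map k k K K' ∘ v)) := rfl
  obtain ⟨L, hL, hL'⟩ := exists_extension (d (eta k x y)) (KaehlerDifferential.map k k K K')
  refine ⟨L ω, ?_, fun x' y' h' hη R R' hR hx' hy' h2 hfrac hω => ?_⟩
  · obtain ⟨a, ha⟩ := exists_ιMulti_D_ne_zero hω0
    obtain ⟨c, hc⟩ := hspan a
    have hli : LinearIndependent K fun i => KaehlerDifferential.D k K (a i) := by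
      by_contra hli
      exact ha (AlternatingMap.map_linearDependent _ _ hli)
    have hη : KaehlerDifferential.map k K K' K' (eta k x y) ≠ 0 := by
      have e : KaehlerDifferential.map k K K' K' (eta k x y) = eta K x y := by
        simp [eta]
      intro h0
      refine D_ne_zero h hx htop ?_
      rw [D_fst_eq h, ← e, h0, smul_zero]
    have := ιMulti_ne_zero (linearIndependent_cons hli hη)
    rw [← hd, ← hL', hc, hL] at this
    exact right_ne_zero_of_smul this
  · rcases hη with hη | hη
    · exact formLattice_eq_span R R' L h' hR hx' hy' h2 hfrac hω hvan hL fun v => by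
        rw [hL', hη, hd]
    -- At infinity the differential changes sign; a generator and its negative span the same
    -- lattice.
    · have := formLattice_eq_span R R' (-L) h' hR hx' hy' h2 hfrac hω hvan
        (fun c m => by rw [AddMonoidHom.neg_apply, AddMonoidHom.neg_apply, hL, smul_neg])
        (fun v => by
          have := (exteriorPower.ιMulti K' (n + 1)).toMultilinearMap.cons_smul
            (KaehlerDifferential.map k k K K' ∘ v) (-1) (eta k x y)
          rw [neg_one_smul, neg_one_smul] at this
          rw [AddMonoidHom.neg_apply, hL', hη]
          exact this.symm)
      rw [this, AddMonoidHom.neg_apply, ← Set.neg_singleton]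
      exact Submodule.span_neg _

/-- By the quotient rule differentials of elements of R span Ω over K, so one local ring with
fraction field K suffices to show that ω spans all rational n-forms. -/
lemma exists_eq_smul_of_formLattice_eq_span {n : ℕ} {ω : ⋀[K]^n (Ω[K⁄k])} {R : Subring K}
    (hR : ∀ r : K, ∃ a b, a ∈ R ∧ b ∈ R ∧ r = a / b)
    (hω : formLattice k K R n = Submodule.span R {ω}) (a : Fin n → K) :
    ∃ c : K, exteriorPower.ιMulti K n (fun i => KaehlerDifferential.D k K (a i)) = c • ω := by
  suffices exteriorPower.ιMulti K n (fun i => KaehlerDifferential.D k K (a i)) ∈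
      Submodule.span K {ω} by
    obtain ⟨c, hc⟩ := Submodule.mem_span_singleton.1 this
    exact ⟨c, hc.symm⟩
  refine multilinear_mem_span (exteriorPower.ιMulti K n).toMultilinearMap
    (s := KaehlerDifferential.D k K '' R) (fun v hv => ?_) _ (fun i => ?_)
  · choose b hb hbv using hv
    have hmem : exteriorPower.ιMulti K n (fun j => KaehlerDifferential.D k K (b j)) ∈
        formLattice k K R n := Submodule.subset_span ⟨fun j => ⟨b j, hb j⟩, rfl⟩
    rw [hω] at hmem
    obtain ⟨c, hc⟩ := Submodule.mem_span_singleton.1 hmem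
    refine Submodule.mem_span_singleton.2 ⟨(c : K), ?_⟩
    exact hc.trans (congrArg _ (funext hbv))
  · obtain ⟨b, c, hb, hc, hr⟩ := hR (a i)
    rw [hr, Derivation.leibniz_div]
    have (e) (he : e ∈ R) : KaehlerDifferential.D k K e ∈
      Submodule.span K (KaehlerDifferential.D k K '' R) := Submodule.subset_span ⟨e, he, rfl⟩
    exact Submodule.smul_mem _ _ (sub_mem (Submodule.smul_mem _ _ (this b hb))
      (Submodule.smul_mem _ _ (this c hc)))

/-- The case of the generic point, where the local ring is the whole field. It is needed because a
codimension one point of the product may lie over the generic point. -/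
lemma formLattice_eq_span_of_forall_mem {n : ℕ} {ω : ⋀[K]^n (Ω[K⁄k])} (hω : ω ≠ 0)
    (hspan : ∀ a : Fin n → K, ∃ c : K,
      exteriorPower.ιMulti K n (fun i => KaehlerDifferential.D k K (a i)) = c • ω)
    {R : Subring K} (hR : ∀ r, r ∈ R) : formLattice k K R n = Submodule.span R {ω} := by
  apply le_antisymm
  · rw [formLattice, Submodule.span_le]
    rintro _ ⟨a, rfl⟩
    obtain ⟨c, hc⟩ := hspan fun i => a i
    exact Submodule.mem_span_singleton.2 ⟨⟨c, hR c⟩, hc.symm⟩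
  · rw [Submodule.span_le, Set.singleton_subset_iff]
    obtain ⟨a, ha⟩ := exists_ιMulti_D_ne_zero hω
    obtain ⟨c, hc⟩ := hspan a
    have hc0 : c ≠ 0 := by
      rintro rfl
      exact ha (hc.trans (zero_smul _ _))
    have hmem : exteriorPower.ιMulti K n (fun j => KaehlerDifferential.D k K (a j)) ∈
        formLattice k K R n := Submodule.subset_span ⟨fun j => ⟨a j, hR _⟩, rfl⟩
    have := Submodule.smul_mem _ (⟨c⁻¹, hR _⟩ : R) hmem
    rw [hc] at this
    have e : (⟨c⁻¹, hR _⟩ : R) • c • ω = ω := inv_smul_smul₀ hc0 ω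
    exact e ▸ this

/-- For n > 0 a one-dimensional n-th exterior power forces the next to vanish. For n = 0 it always
has dimension one, so K = k is needed instead. -/
lemma ιMulti_D_succ_eq_zero {n : ℕ} (hn : n = 0 → Function.Surjective (algebraMap k K))
    {ω : ⋀[K]^n (Ω[K⁄k])}
    (hspan : ∀ a : Fin n → K, ∃ c : K,
      exteriorPower.ιMulti K n (fun i => KaehlerDifferential.D k K (a i)) = c • ω)
    (a : Fin (n + 1) → K) :
    exteriorPower.ιMulti K (n + 1) (fun i => KaehlerDifferential.D k K (a i)) = 0 := by
  cases n with
  | zero =>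
    obtain ⟨b, hb⟩ := hn rfl (a 0)
    refine AlternatingMap.map_coord_zero _ 0 ?_
    rw [← hb, Derivation.map_algebraMap]
  | succ n =>
    refine ιMulti_succ_eq_zero (ω := ω) (s := Set.range (KaehlerDifferential.D k K))
      (fun v hv => ?_) _ fun i => ⟨a i, rfl⟩
    choose b hb using hv
    obtain ⟨c, hc⟩ := hspan b
    exact ⟨c, (congrArg _ (funext fun i => (hb i).symm)).trans hc⟩

end KaehlerFields
end

/-! ### Local rings and the function field in an affine chart. -/

noncomputable section

namespace AlgebraicGeometry

lemma isLocalization_comp_ringEquiv {R S S' : Type u} [CommRing R] [CommRing S] [CommRing S']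
    (τ : R →+* S) (e : S ≃+* S') (P : Ideal R) [P.IsPrime]
    (h : @IsLocalization.AtPrime R _ S _ τ.toAlgebra P _) :
    @IsLocalization.AtPrime R _ S' _ ((e : S →+* S').comp τ).toAlgebra P _ := by
  let := τ.toAlgebra
  let := ((e : S →+* S').comp τ).toAlgebra
  exact IsLocalization.isLocalization_of_algEquiv P.primeCompl (S := S)
    (AlgEquiv.ofRingEquiv (f := e) fun r => rfl)

variable {X : Scheme.{u}} {B : CommRingCat.{u}} (j : Spec B ⟶ X) [IsOpenImmersion j]

/-- The point x and the prime P are variables of their own so that the image of the zero ideal can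
be identified with the generic point. -/
lemma exists_stalk_isLocalization (y : Spec B) {x : X} (hx : j y = x) (P : Ideal B) [P.IsPrime]
    (hP : P = PrimeSpectrum.asIdeal y) :
    ∃ θ : B ⟶ X.presheaf.stalk x, Spec.map θ ≫ j = X.fromSpecStalk x ∧
      @IsLocalization.AtPrime B _ (X.presheaf.stalk x) _ θ.hom.toAlgebra P _ := by
  subst hx
  let e : X.presheaf.stalk (j y) ≅ (Spec B).presheaf.stalk y := asIso (j.stalkMap y)
  let τ : B ⟶ (Spec B).presheaf.stalk y := StructureSheaf.toStalk B y
  have hτ : Spec.map τ = (Spec B).fromSpecStalk y := (Spec.fromSpecStalk_eq' _ _).symm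
  have he : Spec.map e.hom ≫ X.fromSpecStalk (j y) = (Spec B).fromSpecStalk y ≫ j :=
    Scheme.SpecMap_stalkMap_fromSpecStalk j
  refine ⟨τ ≫ e.inv, ?_, ?_⟩
  · refine (congrArg (· ≫ j) (Spec.map_comp τ e.inv)).trans ?_
    refine (Category.assoc _ _ _).trans ?_
    rw [hτ, ← he, ← Spec.map_comp_assoc, e.hom_inv_id, Spec.map_id, Category.id_comp]
  · refine isLocalization_comp_ringEquiv τ.hom e.symm.commRingCatIsoToRingEquiv P ?_
    subst hP
    exact StructureSheaf.IsLocalization.to_stalk B y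

/-- The map from a local ring to the function field. -/
abbrev stalkToFunctionField (X : Scheme.{u}) [IsIntegral X] (x : X) :
    X.presheaf.stalk x ⟶ X.functionField :=
  X.presheaf.stalkSpecializes ((genericPoint_spec X).specializes trivial)

lemma SpecMap_stalkToFunctionField [IsIntegral X] (x : X) :
    Spec.map (stalkToFunctionField X x) ≫ X.fromSpecStalk x =
      X.fromSpecStalk (genericPoint X) :=
  Scheme.SpecMap_stalkSpecializes_fromSpecStalk _

section Localization

variable {R S K : Type u} [CommRing R] [CommRing S] [Field K] (θ : R →+* S) (P : Ideal R) [P.IsPrime]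

lemma exists_eq_div_of_isLocalization
    (h : @IsLocalization.AtPrime R _ S _ θ.toAlgebra P _) (ψ : S →+* K) (s : S) :
    ∃ a b, b ∉ P ∧ ψ s = ψ (θ a) / ψ (θ b) := by
  let := θ.toAlgebra
  obtain ⟨⟨a, b⟩, hab⟩ := IsLocalization.surj P.primeCompl s
  refine ⟨a, b, b.2, ?_⟩
  have hu : IsUnit (ψ (θ b)) := (IsLocalization.map_units S b).map ψ
  rw [eq_div_iff hu.ne_zero, ← map_mul]
  exact congrArg ψ hab

lemma exists_map_eq_div_of_isLocalization
    (h : @IsLocalization.AtPrime R _ S _ θ.toAlgebra P _) (ψ : S →+* K) (a b : R) (hb : b ∉ P) :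
    ∃ s, ψ s = ψ (θ a) / ψ (θ b) := by
  let := θ.toAlgebra
  let b' : P.primeCompl := ⟨b, hb⟩
  have hu : IsUnit (ψ (θ b)) := (IsLocalization.map_units S b').map ψ
  refine ⟨IsLocalization.mk' S a b', ?_⟩
  rw [eq_div_iff hu.ne_zero, ← map_mul]
  exact congrArg ψ (IsLocalization.mk'_spec S a b')

lemma injective_of_isLocalization_bot [IsDomain R]
    (h : @IsLocalization.AtPrime R _ S _ θ.toAlgebra ⊥ _) : Function.Injective θ := by
  let := θ.toAlgebra
  refine IsLocalization.injective S (M := (⊥ : Ideal R).primeCompl) fun b hb => ?_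
  exact mem_nonZeroDivisors_of_ne_zero fun h0 => hb (by rw [h0]; exact zero_mem _)

lemma ringKrullDim_of_isLocalization
    (h : @IsLocalization.AtPrime R _ S _ θ.toAlgebra P _) : ringKrullDim S = P.height := by
  let := θ.toAlgebra
  exact IsLocalization.AtPrime.ringKrullDim_eq_height P S

end Localization

/-- The coordinate ring of an affine chart inside the function field. -/
theorem exists_functionField_map [IsIntegral X] [IsDomain B] :
    ∃ ι : B ⟶ X.functionField, Spec.map ι ≫ j = X.fromSpecStalk (genericPoint X) ∧
      Function.Injective ι ∧ (∀ r, ∃ a b, b ≠ 0 ∧ r = ι a / ι b) ∧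
      ∀ (y : PrimeSpectrum B) (r : X.functionField), r ∈ ConjB.localSubring X (j y) ↔
        ∃ a b, b ∉ y.asIdeal ∧ r = ι a / ι b := by
  have hgen : j (⊥ : PrimeSpectrum B) = genericPoint X := by
    rw [← genericPoint_eq_bot_of_affine]
    exact genericPoint_eq_of_isOpenImmersion j
  obtain ⟨ι, hι, hloc⟩ := exists_stalk_isLocalization j (⊥ : PrimeSpectrum B) hgen ⊥ rfl
  refine ⟨ι, hι, injective_of_isLocalization_bot ι.hom hloc, fun r => ?_, fun y r => ?_⟩
  · obtain ⟨a, b, hb, hr⟩ := exists_eq_div_of_isLocalization ι.hom _ hloc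
      (RingHom.id X.functionField) r
    exact ⟨a, b, fun h0 => hb (by rw [h0]; exact zero_mem _), hr⟩
  · obtain ⟨θ, hθ, hloc'⟩ := exists_stalk_isLocalization j y rfl y.asIdeal rfl
    have hcomp : ι = θ ≫ stalkToFunctionField X (j y) := by
      apply Spec.map_injective
      rw [← cancel_mono j, hι]
      refine (SpecMap_stalkToFunctionField (j y)).symm.trans ?_
      rw [← hθ, ← Category.assoc]
      exact congrArg (· ≫ j) (Spec.map_comp _ _).symm
    have hcomp' (a : B) : ι a = (stalkToFunctionField X (j y)).hom (θ a) := congr($hcomp a)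
    simp only [hcomp']
    constructor
    · rintro ⟨r, rfl⟩
      exact exists_eq_div_of_isLocalization θ.hom _ hloc' (stalkToFunctionField X (j y)).hom r
    · rintro ⟨a, b, hb, rfl⟩
      exact exists_map_eq_div_of_isLocalization θ.hom _ hloc' (stalkToFunctionField X (j y)).hom a b hb

lemma ringKrullDim_stalk_eq_height (y : PrimeSpectrum B) :
    ringKrullDim (X.presheaf.stalk (j y)) = y.asIdeal.height := by
  obtain ⟨θ, -, hloc⟩ := exists_stalk_isLocalization j y rfl y.asIdeal rfl
  exact ringKrullDim_of_isLocalization θ.hom _ hloc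

/-- A positive-dimensional integral locally Noetherian scheme has a point of codimension one. -/
lemma exists_ringKrullDim_stalk_eq_one [IsIntegral X] [IsLocallyNoetherian X] {n : ℕ}
    (hn : topologicalKrullDim X = (n + 1 : ℕ)) :
    ∃ x : X, ringKrullDim (X.presheaf.stalk x) = 1 := by
  obtain ⟨x, hx⟩ : ∃ x : X, ringKrullDim (X.presheaf.stalk x) = (n + 1 : ℕ) :=
    WithBot.exists_eq_of_iSup_eq (by rw [← hn, topologicalKrullDim_eq_iSup_stalk])
  obtain ⟨B, j, y, hj, hB, hd, rfl⟩ : ∃ (B : CommRingCat.{u}) (j : Spec B ⟶ X) (y : PrimeSpectrum B),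
      IsOpenImmersion j ∧ IsNoetherianRing B ∧ IsDomain B ∧ j y = x := by
    obtain ⟨U, y, hy⟩ := Quartic.exists_mem_affineOpens X x
    have : Nonempty U.1.1 := U.2
    exact ⟨_, U.1.2.fromSpec, y, U.1.2.isOpenImmersion_fromSpec,
      IsLocallyNoetherian.component_noetherian U.1, inferInstance, hy⟩
  rw [ringKrullDim_stalk_eq_height j] at hx
  have hne : y.asIdeal ≠ ⊥ := by
    intro h0
    rw [h0, Ideal.height_bot] at hx
    exact absurd hx.symm (by exact_mod_cast Nat.succ_ne_zero n)
  -- A minimal prime over a nonzero element has height at most one by Krull's principal ideal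
  -- theorem, and not zero in a domain.
  obtain ⟨a, ha, ha0⟩ := Submodule.exists_mem_ne_zero_of_ne_bot hne
  obtain ⟨P, hP, -⟩ := Ideal.exists_minimalPrimes_le (J := y.asIdeal)
    ((Ideal.span_singleton_le_iff_mem _).2 ha)
  have hPp := hP.1.1
  let y' : PrimeSpectrum B := ⟨P, hPp⟩
  refine ⟨j y', ?_⟩
  rw [ringKrullDim_stalk_eq_height j]
  have h1 := Ideal.height_le_one_of_isPrincipal_of_mem_minimalPrimes (Ideal.span {a}) P hP
  have h2 : P.height ≠ 0 := by
    intro h0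
    rw [Ideal.height_eq_zero_iff_eq_bot] at h0
    have : a ∈ P := hP.1.2 (Ideal.mem_span_singleton_self a)
    rw [h0] at this
    exact ha0 this
  have : P.height = 1 := le_antisymm h1 (Order.one_le_iff_ne_zero.2 h2)
  change ((P.height : ℕ∞) : WithBot ℕ∞) = 1
  rw [this]
  rfl

/-- A zero-dimensional integral scheme of finite type over an algebraically closed field has function
field equal to the base field. -/
lemma surjective_of_topologicalKrullDim_eq_zero [IsIntegral X] {k : Type u} [Field k] [IsAlgClosed k]
    (q : X ⟶ Spec (.of k)) [LocallyOfFiniteType q] (h : topologicalKrullDim X = 0)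
    (c : k →+* X.functionField)
    (hc : Spec.map (CommRingCat.ofHom c) = X.fromSpecStalk (genericPoint X) ≫ q) :
    Function.Surjective c := by
  obtain ⟨U, y, hy⟩ := Quartic.exists_mem_affineOpens X (genericPoint X)
  have : IsOpenImmersion U.1.2.fromSpec := U.1.2.isOpenImmersion_fromSpec
  have : Nonempty U.1.1 := U.2
  have : IsDomain Γ(X, U.1) := inferInstance
  obtain ⟨ι, hι, hinj, hfrac, -⟩ := exists_functionField_map U.1.2.fromSpec
  let φ : CommRingCat.of k ⟶ Γ(X, U.1) := Spec.preimage (U.1.2.fromSpec ≫ q)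
  have hφ : Spec.map φ = U.1.2.fromSpec ≫ q := Spec.map_preimage _
  have hfin : φ.hom.FiniteType := by
    rw [← HasRingHomProperty.Spec_iff (P := @LocallyOfFiniteType), hφ]
    infer_instance
  have hdim : ringKrullDim Γ(X, U.1) ≤ 0 := by
    rw [← h, ← topologicalKrullDim_Spec]
    exact U.1.2.fromSpec.isOpenEmbedding.isInducing.topologicalKrullDim_le
  have : Ring.KrullDimLE 0 Γ(X, U.1) := Ring.krullDimLE_iff.2 hdim
  have hfield : IsField Γ(X, U.1) := Ring.KrullDimLE.isField_of_isDomain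
  let := hfield.toField
  algebraize [φ.hom]
  have : Module.Finite k Γ(X, U.1) := finite_of_finite_type_of_isJacobsonRing k Γ(X, U.1)
  have hs := (IsAlgClosed.algebraMap_bijective_of_isIntegral (k := k) (K := Γ(X, U.1))).2
  have hcι : CommRingCat.ofHom c = φ ≫ ι := by
    apply Spec.map_injective
    rw [hc, Spec.map_comp, hφ, ← hι, Category.assoc]
  intro r
  obtain ⟨a, b, -, rfl⟩ := hfrac r
  obtain ⟨a, rfl⟩ := hs a
  obtain ⟨b, rfl⟩ := hs b
  refine ⟨a / b, ?_⟩
  rw [map_div₀]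
  exact congrArg₂ _ congr($hcι a) congr($hcι b)

lemma SpecMap_functionFieldAlgebra [IsIntegral X] {k : Type u} [Field k] (q : X ⟶ Spec (.of k)) :
    Spec.map (CommRingCat.ofHom (@algebraMap _ _ _ _ (ConjB.functionFieldAlgebra q))) =
      X.fromSpecStalk (genericPoint X) ≫ q := by
  let φ : CommRingCat.of k ⟶ X.functionField :=
    (Scheme.ΓSpecIso (.of k)).inv ≫ q.appTop ≫ X.presheaf.germ ⊤ (genericPoint X) trivial
  change Spec.map φ = _
  rw [Spec.map_comp, Spec.map_comp, Category.assoc]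
  refine (congrArg (· ≫ _) (Scheme.fromSpecStalk_toSpecΓ X (genericPoint X)).symm).trans ?_
  rw [Category.assoc, ← Scheme.toSpecΓ_naturality_assoc, toSpecΓ_SpecMap_ΓSpecIso_inv,
    Category.comp_id]

/-- Flat extensions have going down, so the height of the maximal ideal cannot drop. It bounds by
one the codimension of the image of a codimension one point. -/
lemma ringKrullDim_le_of_flat_of_isLocalHom {R S : Type u} [CommRing R] [CommRing S] [IsLocalRing R]
    [IsLocalRing S] (φ : R →+* S) (hφ : φ.Flat) (hl : IsLocalHom φ) :
    ringKrullDim R ≤ ringKrullDim S := by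
  algebraize [φ]
  have : IsLocalHom (algebraMap R S) := hl
  rw [← IsLocalRing.maximalIdeal_height_eq_ringKrullDim,
    ← IsLocalRing.maximalIdeal_height_eq_ringKrullDim]
  exact_mod_cast Ideal.height_le_height_of_hasGoingDown
    (IsLocalRing.maximalIdeal R) (IsLocalRing.maximalIdeal S)

lemma ringKrullDim_stalk_le_of_flat {Y : Scheme.{u}} (p : Y ⟶ X) [Flat p] (w : Y) :
    ringKrullDim (X.presheaf.stalk (p w)) ≤ ringKrullDim (Y.presheaf.stalk w) :=
  ringKrullDim_le_of_flat_of_isLocalHom (p.stalkMap w).hom (Flat.stalkMap p w)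
    (inferInstanceAs (IsLocalHom (p.stalkMap w).hom))

end AlgebraicGeometry
end

/-! ### The function field of a product chart. -/

noncomputable section

namespace Quartic
open KaehlerFields ConjB

lemma Chart.map_mem {B K' : Type u} [CommRing B] [CommRing K'] (ι' : Chart B →+* K') (S : Subring K')
    (hc : ∀ b, ι' (constC B b) ∈ S) (hx : ι' (xC B) ∈ S) (hy : ι' (yC B) ∈ S) (c : Chart B) :
    ι' c ∈ S := by
  have hyx : (⟨_, hy⟩ : S) ^ 2 = (⟨_, hx⟩ : S) ^ 4 + 1 := by
    apply Subtype.ext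
    simpa using congrArg ι' (yC_sq (R := B))
  let ψ : Chart B →+* S := Chart.lift ((ι'.comp (constC B)).codRestrict S hc) ⟨_, hx⟩ ⟨_, hy⟩ hyx
  have : S.subtype.comp ψ = ι' := by
    apply Chart.hom_ext
    · ext b
      exact congrArg Subtype.val (Chart.lift_const _ _ _ hyx b)
    · exact congrArg Subtype.val (Chart.lift_x _ _ _ hyx)
    · exact congrArg Subtype.val (Chart.lift_y _ _ _ hyx)
  rw [← this]
  exact (ψ c).2

section FunctionField

variable {B K K' : Type u} [CommRing B] [Field K] [Field K'] [Algebra K K']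
  (ι : B →+* K) (ι' : Chart B →+* K') (hcomp : ∀ b, ι' (constC B b) = algebraMap K K' (ι b))

/-- Clearing denominators turns an algebraic relation into a polynomial over B that vanishes in the
chart ring, where B[x] embeds. -/
lemma transcendental_x (hcomp : ∀ b, ι' (constC B b) = algebraMap K K' (ι b))
    (hι : Function.Injective ι) (hι' : Function.Injective ι')
    (hfrac : ∀ r : K, ∃ a b, b ≠ 0 ∧ r = ι a / ι b) : Transcendental K (ι' (xC B)) := by
  let := ι.toAlgebra
  let := ((algebraMap K K').comp ι).toAlgebra
  have : IsScalarTower B K K' := .of_algebraMap_eq fun _ => rfl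
  have : FaithfulSMul B K := (faithfulSMul_iff_algebraMap_injective B K).2 hι
  have : IsDomain B := hι.isDomain
  have : IsFractionRing B K := .of_field B K fun r => by
    obtain ⟨a, b, -, h⟩ := hfrac r
    exact ⟨a, b, h⟩
  rintro halg
  obtain ⟨P, hP, hP0⟩ := (IsFractionRing.isAlgebraic_iff B K K').2 halg
  have h1 : (Polynomial.aeval (R := B) (ι' (xC B))).toRingHom =
      ι'.comp (algebraMap (Polynomial B) (Chart B)) := by
    apply Polynomial.ringHom_ext
    · intro b
      have : Polynomial.aeval (ι' (xC B)) (Polynomial.C b) = algebraMap K K' (ι b) :=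
        Polynomial.aeval_C _ _
      exact this.trans (hcomp b).symm
    · exact Polynomial.aeval_X _
  have h2 : ι' (algebraMap (Polynomial B) (Chart B) P) = 0 := congr($h1 P).symm.trans hP0
  have h3 := hι' (h2.trans (map_zero ι').symm)
  exact hP (congrArg QuadraticAlgebra.re h3)

lemma adjoin_eq_top (hcomp : ∀ b, ι' (constC B b) = algebraMap K K' (ι b))
    (hfrac : ∀ r : K', ∃ a b, b ≠ 0 ∧ r = ι' a / ι' b) :
    IntermediateField.adjoin K {ι' (xC B), ι' (yC B)} = ⊤ := by
  refine top_le_iff.1 fun r _ => ?_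
  have key := Chart.map_mem ι' (IntermediateField.adjoin K {ι' (xC B), ι' (yC B)}).toSubfield.toSubring
    (fun b => hcomp b ▸ IntermediateField.algebraMap_mem _ _)
    (IntermediateField.subset_adjoin _ _ (by simp)) (IntermediateField.subset_adjoin _ _ (by simp))
  obtain ⟨a, b, -, rfl⟩ := hfrac r
  exact div_mem (key a) (key b)

/-- Supplies the hypotheses of the lattice computation for the local ring of the product at P and
the local ring of the base at the contraction of P. -/
lemma local_conditions (hcomp : ∀ b, ι' (constC B b) = algebraMap K K' (ι b))
    (hι' : Function.Injective ι') (h2 : IsUnit (2 : B)) {P : Ideal (Chart B)} [P.IsPrime]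
    {R : Subring K} {R' : Subring K'}
    (hR : ∀ r, r ∈ R ↔ ∃ a b, b ∉ P.comap (constC B) ∧ r = ι a / ι b)
    (hR' : ∀ r, r ∈ R' ↔ ∃ a b, b ∉ P ∧ r = ι' a / ι' b) :
    (∀ a ∈ R, algebraMap K K' a ∈ R') ∧ ι' (xC B) ∈ R' ∧ ι' (yC B) ∈ R' ∧ (2 : K')⁻¹ ∈ R' ∧
    (∀ r ∈ R', ∃ a b,
      a ∈ Subring.closure (algebraMap K K' '' R ∪ {ι' (xC B), ι' (yC B)}) ∧
      b ∈ Subring.closure (algebraMap K K' '' R ∪ {ι' (xC B), ι' (yC B)}) ∧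
      b ≠ 0 ∧ b⁻¹ ∈ R' ∧ r = a * b⁻¹) := by
  have h1 : (1 : Chart B) ∉ P := (Ideal.ne_top_iff_one P).1 Ideal.IsPrime.ne_top'
  have hmem (c : Chart B) : ι' c ∈ R' := (hR' _).2 ⟨c, 1, h1, by simp⟩
  refine ⟨fun r hr => ?_, hmem _, hmem _, ?_, fun r hr => ?_⟩
  · obtain ⟨a, b, hb, rfl⟩ := (hR _).1 hr
    rw [map_div₀, ← hcomp, ← hcomp]
    exact (hR' _).2 ⟨_, _, hb, rfl⟩
  · refine (hR' _).2 ⟨1, constC B 2, fun h => ?_, by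
      rw [hcomp, map_one, one_div, map_ofNat, map_ofNat]⟩
    have : IsUnit (constC B 2) := h2.map (constC B)
    exact Ideal.IsPrime.ne_top' (Ideal.eq_top_of_isUnit_mem P h this)
  · have key := Chart.map_mem ι' (Subring.closure (algebraMap K K' '' R ∪ {ι' (xC B), ι' (yC B)}))
      (fun b => by
        rw [hcomp]
        refine Subring.subset_closure (Or.inl ⟨_, (hR _).2 ⟨b, 1, ?_, by simp⟩, rfl⟩)
        rwa [Ideal.mem_comap, map_one])
      (Subring.subset_closure (by simp)) (Subring.subset_closure (by simp))
    obtain ⟨a, b, hb, rfl⟩ := (hR' _).1 hr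
    refine ⟨ι' a, ι' b, key a, key b, ?_, (hR' _).2 ⟨1, b, hb, by simp⟩, div_eq_mul_inv _ _⟩
    intro h0
    rw [hι' (h0.trans (map_zero ι').symm)] at hb
    exact hb (zero_mem _)

end FunctionField

lemma resX'_x_mul_resX_x (R : CommRingCat.{u}) : resX' R (xC R) * resX R (xC R) = 1 := by
  have h : (LaurentPolynomial.T (-1) * LaurentPolynomial.T 1 : LaurentPolynomial R) = 1 := by
    rw [← LaurentPolynomial.T_add]
    simp
  apply QuadraticAlgebra.ext <;> simp [resX, xC, flip, h] <;> rfl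

lemma resX'_y (R : CommRingCat.{u}) :
    resX' R (yC R) = resX' R (xC R) ^ 2 * resX R (yC R) := by
  have h : (LaurentPolynomial.T (-1) * LaurentPolynomial.T (-1) : LaurentPolynomial R) =
      LaurentPolynomial.T (-2) := by
    rw [← LaurentPolynomial.T_add]
    simp
  apply QuadraticAlgebra.ext <;> simp [resX, xC, yC, flip, pow_two, h]

end Quartic
end

/-! ### Triviality of the canonical divisor of the product. -/

noncomputable section

namespace Quartic
open KaehlerFields ConjB

variable {R : CommRingCat.{u}} {T Z : Scheme.{u}} {p : Z ⟶ T} {g : Z ⟶ curve R} {f : T ⟶ Spec R}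

lemma surjective_of_isPullback (H : IsPullback p g f (curveHom R)) (t : T) : ∃ w : Z, p w = t := by
  obtain ⟨x, hx, -⟩ := exists_mem_opensRange R (f t)
  obtain ⟨w, h1, -⟩ := Scheme.Pullback.exists_preimage_pullback (f := f) (g := curveHom R) t x hx.symm
  refine ⟨H.isoPullback.inv w, ?_⟩
  rw [← Scheme.Hom.comp_apply, H.isoPullback_inv_fst, h1]

/-- The projection is surjective, and a specialization of the image of the generic point equals the
generic point of T. -/
lemma map_genericPoint (H : IsPullback p g f (curveHom R)) [IsIntegral T] [IsIntegral Z] :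
    p (genericPoint Z) = genericPoint T := by
  obtain ⟨w, hw⟩ := surjective_of_isPullback H (genericPoint T)
  have h1 : p (genericPoint Z) ⤳ p w := ((genericPoint_spec Z).specializes trivial).map p.continuous
  rw [hw] at h1
  exact (h1.antisymm ((genericPoint_spec T).specializes trivial)).eq

lemma exists_functionField_hom (H : IsPullback p g f (curveHom R)) [IsIntegral T] [IsIntegral Z] :
    ∃ φ : T.functionField ⟶ Z.functionField,
      Spec.map φ ≫ T.fromSpecStalk (genericPoint T) = Z.fromSpecStalk (genericPoint Z) ≫ p := by
  have : ∀ x (_ : p (genericPoint Z) = x), ∃ φ : T.presheaf.stalk x ⟶ Z.functionField,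
      Spec.map φ ≫ T.fromSpecStalk x = Z.fromSpecStalk (genericPoint Z) ≫ p := by
    rintro _ rfl
    exact ⟨p.stalkMap _, Scheme.SpecMap_stalkMap_fromSpecStalk p⟩
  exact this _ (map_genericPoint H)

/-- The coordinate functions of the curve as rational functions. -/
lemma exists_coordinates (K : CommRingCat.{u}) (h : Spec K ⟶ curve R)
    (χ : ∀ _ : Bool, CommRingCat.of (Chart R) ⟶ K)
    (hχ : ∀ b, Spec.map (χ b) ≫ chart R b = h) :
    (χ false).hom (xC R) * (χ true).hom (xC R) = 1 ∧
      (χ false).hom (yC R) = (χ false).hom (xC R) ^ 2 * (χ true).hom (yC R) := by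
  have h1 : Spec.map (χ true) ≫ chart₁ R = Spec.map (χ false) ≫ chart₂ R :=
    (hχ true).trans (hχ false).symm
  let μ := Spec.preimage ((isTwoCover_curve R).isPullback.lift _ _ h1)
  have hμ : Spec.map μ = (isTwoCover_curve R).isPullback.lift _ _ h1 := Spec.map_preimage _
  have e1 : χ true = CommRingCat.ofHom (resX R) ≫ μ := by
    apply Spec.map_injective
    rw [Spec.map_comp, hμ, IsPullback.lift_fst]
  have e2 : χ false = CommRingCat.ofHom (resX' R) ≫ μ := by
    apply Spec.map_injective
    rw [Spec.map_comp, hμ, IsPullback.lift_snd]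
  have e1' (z) : (χ true).hom z = μ.hom (resX R z) := congr($e1 z)
  have e2' (z) : (χ false).hom z = μ.hom (resX' R z) := congr($e2 z)
  rw [e1', e1', e2', e2']
  constructor
  · rw [← map_mul, resX'_x_mul_resX_x, map_one]
  · rw [← map_pow, ← map_mul, resX'_y]

lemma exists_functionField_map_prodChart (H : IsPullback p g f (curveHom R)) [IsIntegral T]
    [IsIntegral Z] {φ : T.functionField ⟶ Z.functionField}
    (hφ : Spec.map φ ≫ T.fromSpecStalk (genericPoint T) = Z.fromSpecStalk (genericPoint Z) ≫ p)
    {B : CommRingCat.{u}} (a : Spec B ⟶ T) [IsOpenImmersion a] [IsDomain B] [CharZero B] (b : Bool) :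
    ∃ (ι : B →+* T.functionField) (ι' : Chart B →+* Z.functionField),
      (∀ c, ι' (constC B c) = φ.hom (ι c)) ∧ Function.Injective ι ∧
      (∀ r, ∃ a b, b ≠ 0 ∧ r = ι a / ι b) ∧
      (∀ (y : PrimeSpectrum B) (r : T.functionField), r ∈ localSubring T (a y) ↔
        ∃ a b, b ∉ y.asIdeal ∧ r = ι a / ι b) ∧
      Function.Injective ι' ∧ (∀ r, ∃ a b, b ≠ 0 ∧ r = ι' a / ι' b) ∧
      (∀ (y : PrimeSpectrum (Chart B)) (r : Z.functionField), r ∈ localSubring Z (prodChart H a b y) ↔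
        ∃ a b, b ∉ y.asIdeal ∧ r = ι' a / ι' b) ∧
      Spec.map (CommRingCat.ofHom (ι'.comp (Chart.map (Spec.preimage (a ≫ f)).hom))) ≫ chart R b =
        Z.fromSpecStalk (genericPoint Z) ≫ g := by
  have := Chart.isDomain B
  obtain ⟨ι, h1, h2, h3, h4⟩ := exists_functionField_map a
  have : IsDomain (CommRingCat.of (Chart B)) := Chart.isDomain B
  obtain ⟨ι', h1', h2', h3', h4'⟩ := exists_functionField_map (prodChart H a b)
  refine ⟨ι.hom, ι'.hom, fun c => ?_, h2, h3, h4, h2', h3', h4', ?_⟩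
  · have : CommRingCat.ofHom (constC B) ≫ ι' = ι ≫ φ := by
      apply Spec.map_injective
      rw [← cancel_mono a, Spec.map_comp, Spec.map_comp, Category.assoc, Category.assoc, h1, hφ,
        ← prodChart_fst H a b, ← Category.assoc, h1']
    exact congr($this c)
  · have : CommRingCat.ofHom (ι'.hom.comp (Chart.map (Spec.preimage (a ≫ f)).hom)) =
        CommRingCat.ofHom (Chart.map (Spec.preimage (a ≫ f)).hom) ≫ ι' := rfl
    rw [this, Spec.map_comp, Category.assoc, ← prodChart_snd H a b, ← Category.assoc, h1']

lemma exists_affine_chart (T : Scheme.{u}) [IsIntegral T] (t : T) :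
    ∃ (B : CommRingCat.{u}) (a : Spec B ⟶ T) (_ : IsOpenImmersion a) (_ : IsDomain B),
      t ∈ a.opensRange := by
  obtain ⟨U, hU⟩ := exists_mem_affineOpens T t
  have : Nonempty U.1.1 := U.2
  have hU' : IsAffineOpen U.1.1 := U.1.2
  exact ⟨_, hU'.fromSpec, hU'.isOpenImmersion_fromSpec, inferInstance, hU⟩

lemma Chart.map_x {B : Type u} [CommRing B] (φ : R →+* B) : Chart.map φ (xC R) = xC B :=
  Chart.lift_x _ _ _ _

lemma Chart.map_y {B : Type u} [CommRing B] (φ : R →+* B) : Chart.map φ (yC R) = yC B :=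
  Chart.lift_y _ _ _ _

/-- The product of a variety with trivial canonical divisor and the curve has trivial canonical
divisor. -/
theorem isCanonicalTrivial_of_isPullback (H : IsPullback p g f (curveHom R)) [IsIntegral T]
    [IsIntegral Z] [IsLocallyNoetherian T] {k : Type u} [Field k] [IsAlgClosed k] [CharZero k]
    (q : T ⟶ Spec (.of k)) [LocallyOfFiniteType q] {n : ℕ} (hn : topologicalKrullDim T = n)
    (hT : IsCanonicalTrivial q n) : IsCanonicalTrivial (p ≫ q) (n + 1) := by
  let aK := functionFieldAlgebra q
  let aK' := functionFieldAlgebra (p ≫ q)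
  obtain ⟨ω, hω0, hω⟩ := hT
  obtain ⟨φ, hφ⟩ := exists_functionField_hom H
  let aKK' : Algebra T.functionField Z.functionField := φ.hom.toAlgebra
  have hk : Spec.map (CommRingCat.ofHom (algebraMap k T.functionField)) = _ :=
    SpecMap_functionFieldAlgebra q
  have hk' : Spec.map (CommRingCat.ofHom (algebraMap k Z.functionField)) = _ :=
    SpecMap_functionFieldAlgebra (p ≫ q)
  have tower : IsScalarTower k T.functionField Z.functionField := by
    have : CommRingCat.ofHom (algebraMap k Z.functionField) =
        CommRingCat.ofHom (algebraMap k T.functionField) ≫ φ := by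
      apply Spec.map_injective
      rw [hk', Spec.map_comp, hk, ← Category.assoc, ← hφ, Category.assoc]
    exact .of_algebraMap_eq fun c => congr($this c)
  have : CharZero T.functionField := charZero_of_injective_algebraMap (algebraMap k _).injective
  have hchar {B : CommRingCat.{u}} [IsDomain B] (a : Spec B ⟶ T) : CharZero B ∧ IsUnit (2 : B) := by
    let ψ := (Spec.preimage (a ≫ q)).hom
    refine ⟨charZero_of_injective_ringHom ψ.injective, ?_⟩
    have := (IsUnit.mk0 (2 : k) two_ne_zero).map ψ
    rwa [map_ofNat] at this
  -- One auxiliary chart fixes x and y as rational functions on the product; the coordinates of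
  -- every other chart are compared with these through the map to the curve.
  obtain ⟨B₀, a₀, _, _, -⟩ := exists_affine_chart T (genericPoint T)
  have := (hchar a₀).1
  have h₀ (b : Bool) := exists_functionField_map_prodChart H hφ a₀ b
  choose ι₀ ι₀' hc₀ hι₀ hfr₀ hloc₀ hι₀' hfr₀' hloc₀' hχ₀ using h₀
  let χ (b : Bool) : CommRingCat.of (Chart R) ⟶ Z.functionField :=
    CommRingCat.ofHom ((ι₀' b).comp (Chart.map (Spec.preimage (a₀ ≫ f)).hom))
  have hχx (b) : (χ b).hom (xC R) = ι₀' b (xC B₀) := congrArg (ι₀' b) (Chart.map_x _)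
  have hχy (b) : (χ b).hom (yC R) = ι₀' b (yC B₀) := congrArg (ι₀' b) (Chart.map_y _)
  obtain ⟨hxx, hyy⟩ := exists_coordinates _ _ χ hχ₀
  rw [hχx, hχx] at hxx
  rw [hχx, hχy, hχy] at hyy
  set x := ι₀' true (xC B₀) with hx
  set y := ι₀' true (yC B₀) with hy
  have heq (b) : ι₀' b (yC B₀) ^ 2 = ι₀' b (xC B₀) ^ 4 + 1 := by
    simpa using congrArg (ι₀' b) (yC_sq (R := B₀))
  have htr : Transcendental T.functionField x :=
    transcendental_x (ι₀ true) (ι₀' true) (hc₀ true) (hι₀ true) (hι₀' true) (hfr₀ true)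
  have htop : IntermediateField.adjoin T.functionField {x, y} = ⊤ :=
    adjoin_eq_top (ι₀ true) (ι₀' true) (hc₀ true) (hfr₀' true)
  have : CharZero Z.functionField := charZero_of_injective_algebraMap (algebraMap k _).injective
  have hη (b : Bool) : eta k (ι₀' b (xC B₀)) (ι₀' b (yC B₀)) = eta k x y ∨
      eta k (ι₀' b (xC B₀)) (ι₀' b (yC B₀)) = - eta k x y := by
    cases b
    · right
      have h1 : ι₀' false (xC B₀) = x⁻¹ := eq_inv_of_mul_eq_one_left hxx
      have h2 : ι₀' false (yC B₀) = y / x ^ 2 := by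
        rw [hyy, h1, div_eq_mul_inv, inv_pow, mul_comm]
      rw [h1, h2]
      exact eta_inv (heq true) (right_ne_zero_of_mul_eq_one hxx)
    · exact Or.inl rfl
  -- For n = 0 the exterior power is the field itself; for n > 0 a point of codimension one exists
  -- and its local generator spans the rational forms.
  have hspan : ∀ a : Fin n → T.functionField, ∃ c : T.functionField,
      exteriorPower.ιMulti T.functionField n (fun i => KaehlerDifferential.D k T.functionField (a i)) =
        c • ω := by
    cases n with
    | zero =>
      intro a
      let e := exteriorPower.zeroEquiv T.functionField (Ω[T.functionField⁄k])
      have he : e ω ≠ 0 := fun h => hω0 (e.map_eq_zero_iff.1 h)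
      refine ⟨(e ω)⁻¹, e.injective ?_⟩
      rw [map_smul, smul_eq_mul, inv_mul_cancel₀ he]
      exact exteriorPower.zeroEquiv_ιMulti _
    | succ n =>
      obtain ⟨t, ht⟩ := exists_ringKrullDim_stalk_eq_one hn
      refine exists_eq_smul_of_formLattice_eq_span (R := localSubring T t) (fun r => ?_) (hω t ht)
      obtain ⟨a, b, -, h⟩ := IsFractionRing.div_surjective (T.presheaf.stalk t) r
      exact ⟨_, _, ⟨a, rfl⟩, ⟨b, rfl⟩, h.symm⟩
  have hvan := ιMulti_D_succ_eq_zero (fun h0 => by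
    subst h0
    exact surjective_of_topologicalKrullDim_eq_zero q hn _ hk) hspan
  obtain ⟨ω', hω', key⟩ := exists_formLattice_eq_span (heq true) htr htop hω0 hspan hvan
  refine ⟨ω', hω', fun w hw => ?_⟩
  obtain ⟨B, a, _, _, ha⟩ := exists_affine_chart T (p w)
  obtain ⟨b, hb⟩ := exists_mem_opensRange_chart R (g w)
  obtain ⟨z, rfl⟩ : w ∈ (prodChart H a b).opensRange := by
    rw [opensRange_prodChart]
    exact ⟨ha, hb⟩
  obtain ⟨_, h2⟩ := hchar a
  obtain ⟨ι, ι', hc, hι, hfr, hloc, hι', hfr', hloc', hχ⟩ :=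
    exists_functionField_map_prodChart H hφ a b
  have hχe : CommRingCat.ofHom (ι'.comp (Chart.map (Spec.preimage (a ≫ f)).hom)) = χ b := by
    apply Spec.map_injective
    rw [← cancel_mono (chart R b), hχ]
    exact (hχ₀ b).symm
  have hxb : ι' (xC B) = ι₀' b (xC B₀) := by
    rw [← hχx, ← hχe]
    exact (congrArg ι' (Chart.map_x _)).symm
  have hyb : ι' (yC B) = ι₀' b (yC B₀) := by
    rw [← hχy, ← hχe]
    exact (congrArg ι' (Chart.map_y _)).symm
  let z' : PrimeSpectrum (Chart B) := z
  let s : PrimeSpectrum B := PrimeSpectrum.comap (constC B) z'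
  have hps : p (prodChart H a b z) = a s := by
    rw [← Scheme.Hom.comp_apply, prodChart_fst]
    rfl
  obtain ⟨c1, c2, c3, c4, c5⟩ := local_conditions ι ι' hc hι' h2 (P := z'.asIdeal)
    (R := localSubring T (a s)) (R' := localSubring Z (prodChart H a b z)) (hloc s) (hloc' z')
  refine key (ι' (xC B)) (ι' (yC B)) (by rw [hxb, hyb]; exact heq b) (by rw [hxb, hyb]; exact hη b)
    (localSubring T (a s)) _ c1 c2 c3 c4 c5 ?_
  have := smooth_of_isPullback H q
  -- The image of a codimension one point has codimension at most one: either it is generic, where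
  -- any nonzero form generates, or the hypothesis on T applies.
  have hdim := ringKrullDim_stalk_le_of_flat p (prodChart H a b z)
  rw [hw, hps, ringKrullDim_stalk_eq_height a s] at hdim
  have hle : s.asIdeal.height ≤ 1 := by exact_mod_cast hdim
  by_cases h0 : s.asIdeal.height = 0
  · refine formLattice_eq_span_of_forall_mem hω0 hspan fun r => (hloc s r).2 ?_
    rw [Ideal.height_eq_zero_iff_eq_bot.1 h0]
    exact hfr r
  · refine hω _ ?_
    rw [ringKrullDim_stalk_eq_height a s, le_antisymm hle (Order.one_le_iff_ne_zero.2 h0)]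
    rfl

end Quartic
end

/-! ### Rational singularities of the product. -/

noncomputable section

namespace Quartic
open ConjB AbSheaf

lemma isIso_morphismRestrict_of_isPullback {Y T Y' Z : Scheme.{u}} {π : Y ⟶ T} {p : Z ⟶ T}
    {pY : Y' ⟶ Y} {π' : Y' ⟶ Z} (H : IsPullback pY π' π p) (U : T.Opens) (h : IsIso (π ∣_ U)) :
    IsIso (π' ∣_ (p ⁻¹ᵁ U)) := by
  have h1 := (isPullback_morphismRestrict π' (p ⁻¹ᵁ U)).flip.paste_horiz H
  rw [← morphismRestrict_ι] at h1
  have h2 := (isPullback_morphismRestrict π U).flip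
  let l := h2.lift _ _ (h1.w.trans (Category.assoc _ _ _).symm)
  have h3 : IsPullback l (π' ∣_ (p ⁻¹ᵁ U)) (π ∣_ U) (p ∣_ U) := by
    refine IsPullback.of_right ?_ (h2.lift_snd _ _ _) h2
    rwa [h2.lift_fst]
  exact (MorphismProperty.isomorphisms _).of_isPullback h3 h

variable {R : CommRingCat.{u}} {T Z : Scheme.{u}} {p : Z ⟶ T} {g : Z ⟶ curve R} {f : T ⟶ Spec R}

/-- The product of a variety with rational singularities and the curve has rational singularities. -/
theorem hasRationalSingularities_of_isPullback (H : IsPullback p g f (curveHom R))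
    {k : Type u} [Field k] [CharZero k] (q : T ⟶ Spec (.of k)) (hT : HasRationalSingularities q) :
    HasRationalSingularities (p ≫ q) := by
  obtain ⟨Y, π, ⟨_, _, _, U, hU, hiso⟩, happ, hvan⟩ := hT
  have HY := IsPullback.of_hasPullback π p
  -- The base-changed resolution is itself the product of Y with the curve, so the results on
  -- integrality and smoothness of products apply to it.
  have HE : IsPullback (pullback.fst π p) (pullback.snd π p ≫ g) (π ≫ f) (curveHom R) :=
    (HY.flip.paste_horiz H.flip).flip
  have := smooth_of_isPullback H q
  have := smooth_of_isPullback HE (π ≫ q)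
  refine ⟨pullback π p, pullback.snd π p, ⟨isIntegral_of_isPullback HE (π ≫ q), ?_, inferInstance,
    p ⁻¹ᵁ U, ?_, isIso_morphismRestrict_of_isPullback HY U hiso⟩,
    isIso_app_of_isPullback_of_flat HY happ,
    isZero_higherDirectImageO_of_isPullback_of_flat HY happ hvan⟩
  · rw [← Category.assoc, ← HY.w, Category.assoc]
    infer_instance
  · obtain ⟨t, ht⟩ := hU
    obtain ⟨w, rfl⟩ := surjective_of_isPullback H t
    exact ⟨w, ht⟩

end Quartic
end

/-! ### Morphisms to projective space in homogeneous coordinates. -/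

noncomputable section

namespace ProjSpace
open ConjB HomogeneousLocalization MvPolynomial

attribute [local instance] MvPolynomial.gradedAlgebra

lemma map_eq_pow_mul {σ k C : Type*} [CommRing k] [CommRing C] {F F' : MvPolynomial σ k →+* C}
    {l : C} (hC : ∀ c, F' (MvPolynomial.C c) = F (MvPolynomial.C c)) (hX : ∀ e, F' (X e) = l * F (X e))
    {P : MvPolynomial σ k} {n : ℕ} (hP : P.IsHomogeneous n) : F' P = l ^ n * F P := by
  rw [P.as_sum, map_sum, map_sum, Finset.mul_sum]
  refine Finset.sum_congr rfl fun s hs => ?_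
  have hn : s.sum (fun _ e => e) = n := by
    have := hP (mem_support_iff.1 hs)
    simpa [Finsupp.weight_apply] using this
  rw [monomial_eq, map_mul, map_mul, hC, mul_left_comm]
  congr 1
  rw [Finsupp.prod, map_prod, map_prod, ← hn, Finsupp.sum, ← Finset.prod_pow_eq_pow_sum,
    ← Finset.prod_mul_distrib]
  refine Finset.prod_congr rfl fun e _ => ?_
  rw [map_pow, map_pow, hX, mul_pow]

variable {k : Type u} [Field k] {N : ℕ} {C : Type u} [CommRing C]

variable (k N) in
/-- The grading of the homogeneous coordinate ring of projective space. -/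
abbrev grading : ℕ → Submodule k (MvPolynomial (Fin (N + 1)) k) :=
  homogeneousSubmodule (Fin (N + 1)) k

/-- The evaluation of the homogeneous fractions with denominator a power of `t`. -/
def awayEval (t : MvPolynomial (Fin (N + 1)) k) (F : MvPolynomial (Fin (N + 1)) k →+* C)
    (hu : IsUnit (F t)) : Away (grading k N) t →+* C :=
  (IsLocalization.Away.lift (S := Localization.Away t) t hu).comp
    (algebraMap (Away (grading k N) t) (Localization.Away t))

variable {t t' : MvPolynomial (Fin (N + 1)) k} {F F' : MvPolynomial (Fin (N + 1)) k →+* C}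
  {d d' : ℕ} (ht : t ∈ grading k N d) (hd : 0 < d) (hu : IsUnit (F t))
  (ht' : t' ∈ grading k N d') (hd' : 0 < d') (hu' : IsUnit (F' t'))

lemma awayEval_mk_mul (n : ℕ) (a : MvPolynomial (Fin (N + 1)) k) (ha : a ∈ grading k N (n • d)) :
    awayEval t F hu (Away.mk _ ht n a ha) * F t ^ n = F a := by
  have h : (algebraMap (Away (grading k N) t) (Localization.Away t)) (Away.mk _ ht n a ha) *
      algebraMap _ _ t ^ n = algebraMap _ _ a := by
    rw [HomogeneousLocalization.algebraMap_apply, Away.val_mk, ← map_pow, ← Localization.mk_one_eq_algebraMap,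
      ← Localization.mk_one_eq_algebraMap, Localization.mk_mul, Localization.mk_eq_mk_iff,
      Localization.r_iff_exists]
    exact ⟨1, by simp [mul_comm]⟩
  have := congrArg (IsLocalization.Away.lift (S := Localization.Away t) t hu) h
  rwa [map_mul, map_pow, IsLocalization.Away.lift_eq, IsLocalization.Away.lift_eq] at this

lemma awayEval_mk (n : ℕ) (a : MvPolynomial (Fin (N + 1)) k) (ha : a ∈ grading k N (n • d))
    (h1 : F t = 1) : awayEval t F hu (Away.mk _ ht n a ha) = F a := by
  rw [← awayEval_mk_mul ht hu n a ha, h1, one_pow, mul_one]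

lemma awayEval_ext {φ : Away (grading k N) t →+* C} (ht : t ∈ grading k N d)
    (h : ∀ n a ha, φ (Away.mk _ ht n a ha) * F t ^ n = F a) : awayEval t F hu = φ := by
  ext z
  obtain ⟨n, a, ha, rfl⟩ := Away.mk_surjective _ ht z
  refine (hu.pow n).mul_right_cancel ?_
  rw [awayEval_mk_mul, h]

/-- The morphism to projective space with homogeneous coordinates `F (X i)`, if the value of the form
`t` of positive degree is a unit. -/
def projMap : Spec (.of C) ⟶ Proj (grading k N) :=
  Spec.map (CommRingCat.ofHom (awayEval t F hu)) ≫ Proj.awayι (grading k N) t ht hd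

lemma comp_awayEval {D : Type u} [CommRing D] (ψ : C →+* D) (ht : t ∈ grading k N d)
    (hψ : IsUnit ((ψ.comp F) t)) : ψ.comp (awayEval t F hu) = awayEval t (ψ.comp F) hψ := by
  refine (awayEval_ext _ ht fun n a ha => ?_).symm
  rw [RingHom.comp_apply, RingHom.comp_apply, ← map_pow, ← map_mul, awayEval_mk_mul]
  rfl

lemma map_comp_projMap {D : Type u} [CommRing D] (ψ : C →+* D) (hψ : IsUnit ((ψ.comp F) t)) :
    Spec.map (CommRingCat.ofHom ψ) ≫ projMap ht hd hu = projMap ht hd hψ := by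
  rw [projMap, projMap, ← Category.assoc, ← Spec.map_comp, ← CommRingCat.ofHom_comp,
    comp_awayEval hu ψ ht hψ]

lemma projMap_mul (ht' : t' ∈ grading k N d') (hut : IsUnit (F t')) {t2 : MvPolynomial (Fin (N + 1)) k}
    (h2 : t2 = t * t') (hu2 : IsUnit (F t2)) {d2 : ℕ}
    (ht2 : t2 ∈ grading k N d2) (hd2 : 0 < d2) (h3 : d2 = d + d') :
    projMap ht2 hd2 hu2 = projMap ht hd hu := by
  subst h3
  rw [projMap, projMap, ← Proj.SpecMap_awayMap_awayι (𝒜 := grading k N) ht hd ht' h2, ← Category.assoc,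
    ← Spec.map_comp, ← CommRingCat.ofHom_comp]
  congr 3
  refine (awayEval_ext _ ht fun n a ha => ?_).symm
  rw [RingHom.comp_apply, awayMap_mk]
  refine (hut.pow n).mul_right_cancel ?_
  have h3 : F t2 = F t * F t' := by rw [h2, map_mul]
  rw [mul_assoc, ← mul_pow, ← h3, awayEval_mk_mul, map_mul, map_pow]

/-- Both morphisms factor through the chart of the product t t'. -/
lemma projMap_eq_of_isUnit (hu' : IsUnit (F t')) : projMap ht hd hu = projMap ht' hd' hu' := by
  have hu2 : IsUnit (F (t * t')) := by rw [map_mul]; exact hu.mul hu'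
  have ht2 := SetLike.mul_mem_graded ht ht'
  rw [← projMap_mul ht hd hu ht' hu' rfl hu2 ht2 (Nat.add_pos_left hd _) rfl,
    ← projMap_mul ht' hd' hu' ht hu (mul_comm _ _) hu2 ht2 (Nat.add_pos_left hd _) (add_comm _ _)]

/-- Proportional homogeneous coordinates define the same morphism. -/
theorem projMap_eq {l : C} (hl : IsUnit l) (hC : ∀ c, F' (MvPolynomial.C c) = F (MvPolynomial.C c))
    (hX : ∀ e, F' (X e) = l * F (X e)) : projMap ht hd hu = projMap ht' hd' hu' := by
  have h1 {n} {P} (hP : P ∈ grading k N n) : F' P = l ^ n * F P := map_eq_pow_mul hC hX hP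
  have hu1 : IsUnit (F' t) := by rw [h1 ht]; exact (hl.pow d).mul hu
  rw [← projMap_eq_of_isUnit ht hd hu1 ht' hd' hu', projMap, projMap]
  congr 3
  refine awayEval_ext _ ht fun n a ha => ?_
  refine (hl.pow (n • d)).mul_left_cancel ?_
  rw [← h1 ha, ← awayEval_mk_mul ht hu1 n a ha, h1 ht, mul_pow, ← pow_mul, smul_eq_mul,
    mul_comm n d]
  ring

lemma projMap_preimage_basicOpen (ht' : t' ∈ grading k N d') (hd' : 0 < d') :
    projMap ht hd hu ⁻¹ᵁ Proj.basicOpen (grading k N) t' = PrimeSpectrum.basicOpen (F t') := by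
  rw [projMap, Scheme.Hom.comp_preimage, Proj.awayι_preimage_basicOpen _ ht hd ht' hd']
  have h : awayEval t F hu (Away.isLocalizationElem ht ht') * F t ^ d' = F t' ^ d := by
    rw [← map_pow F t' d]
    exact awayEval_mk_mul ht hu d' (t' ^ d) _
  refine TopologicalSpace.Opens.ext (Set.ext fun x => not_congr ?_)
  change awayEval t F hu (Away.isLocalizationElem ht ht') ∈ PrimeSpectrum.asIdeal x ↔
    F t' ∈ PrimeSpectrum.asIdeal x
  refine .trans ?_ ((PrimeSpectrum.isPrime x).pow_mem_iff_mem (r := F t') d hd)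
  rw [← h]
  exact (Ideal.mul_unit_mem_iff_mem _ (hu.pow d')).symm

lemma projMap_comp_projectiveSpaceHom :
    projMap ht hd hu ≫ (projectiveSpaceHom k N :) =
      Spec.map (CommRingCat.ofHom (F.comp MvPolynomial.C)) := by
  have := Proj.awayι_toSpecZero (grading k N) t ht hd
  refine (Category.assoc _ _ _).trans ?_
  refine (congrArg (Spec.map (CommRingCat.ofHom (awayEval t F hu)) ≫ ·)
    ((Category.assoc _ _ _).symm.trans (congrArg (· ≫ Spec.map (CommRingCat.ofHom
      (algebraMap k (grading k N 0)))) this))).trans ?_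
  rw [← Spec.map_comp, ← Spec.map_comp, ← CommRingCat.ofHom_comp, ← CommRingCat.ofHom_comp]
  congr 2
  ext c
  change IsLocalization.Away.lift (S := Localization.Away t) t hu _ = _
  exact IsLocalization.Away.lift_eq t hu (MvPolynomial.C c)

lemma isUnit_of_basicOpen_eq_top {R : Type*} [CommRing R] {x : R}
    (h : PrimeSpectrum.basicOpen x = ⊤) : IsUnit x := by
  by_contra hx
  obtain ⟨m, hm, hxm⟩ := exists_max_ideal_of_mem_nonunits hx
  have : (⟨m, hm.isPrime⟩ : PrimeSpectrum R) ∈ PrimeSpectrum.basicOpen x := h ▸ trivial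
  exact this hxm

/-- Homogeneous coordinates of a morphism to projective space are unique up to a factor. -/
lemma eq_of_projMap_eq {a a' : Fin (N + 1)} {F F' : MvPolynomial (Fin (N + 1)) k →+* C}
    (ha : X a ∈ grading k N 1) (ha' : X a' ∈ grading k N 1) (hu : F (X a) = 1) (hu' : F' (X a') = 1)
    (h : projMap ha one_pos (hu ▸ isUnit_one) = projMap ha' one_pos (hu' ▸ isUnit_one)) :
    IsUnit (F' (X a)) ∧ (∀ c, F' (MvPolynomial.C c) = F (MvPolynomial.C c)) ∧
      ∀ e, F' (X e) = F' (X a) * F (X e) := by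
  have h1 : IsUnit (F' (X a)) := by
    refine isUnit_of_basicOpen_eq_top ?_
    rw [← projMap_preimage_basicOpen ha' one_pos (hu' ▸ isUnit_one)
      ha one_pos, ← h, projMap_preimage_basicOpen ha one_pos _ ha one_pos, hu,
      PrimeSpectrum.basicOpen_one]
  rw [projMap_eq_of_isUnit ha' one_pos _ ha one_pos h1, projMap, projMap, cancel_mono] at h
  have h2 : awayEval (X a) F (hu ▸ isUnit_one) = awayEval (X a) F' h1 :=
    congrArg CommRingCat.Hom.hom (Spec.map_injective h)
  refine ⟨h1, fun c => ?_, fun e => ?_⟩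
  · have h3 := awayEval_mk_mul ha (F := F) (hu ▸ isUnit_one) 0 (MvPolynomial.C c)
      (isHomogeneous_C _ _)
    have h4 := awayEval_mk_mul ha h1 0 (MvPolynomial.C c) (isHomogeneous_C _ _)
    rw [pow_zero, mul_one] at h3 h4
    rw [← h3, ← h4, h2]
  · have he : X e ∈ grading k N (1 • 1) := isHomogeneous_X _ _
    have h3 := awayEval_mk_mul ha (F := F) (hu ▸ isUnit_one) 1 (X e) he
    have h4 := awayEval_mk_mul ha h1 1 (X e) he
    have h5 : F (X a) ^ 1 = 1 := by rw [hu, one_pow]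
    rw [h5, mul_one] at h3
    rw [← h3, ← h4, h2, pow_one, mul_comm]

/-- Every ring homomorphism on the homogeneous localization at a coordinate is an evaluation. -/
lemma exists_awayEval_eq (a : Fin (N + 1)) (s : Away (grading k N) (X a) →+* C) :
    ∃ (F : MvPolynomial (Fin (N + 1)) k →+* C) (hu : F (X a) = 1),
      awayEval (X a) F (hu ▸ isUnit_one) = s := by
  have ha : X a ∈ grading k N 1 := isHomogeneous_X _ _
  have hX (e) : X e ∈ grading k N (1 • 1) := isHomogeneous_X _ _
  let F₀ : MvPolynomial (Fin (N + 1)) k →+* Away (grading k N) (X a) :=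
    eval₂Hom ((fromZeroRingHom (grading k N) (Submonoid.powers (X a))).comp
      (algebraMap k (grading k N 0))) fun e => Away.mk _ ha 1 (X e) (hX e)
  have key (n : ℕ) (P) (hP : P ∈ grading k N (n • 1)) : Away.mk _ ha n P hP = F₀ P := by
    let α := algebraMap (Away (grading k N) (X a)) (Localization.Away (X a : MvPolynomial (Fin (N + 1)) k))
    let β := algebraMap (MvPolynomial (Fin (N + 1)) k) (Localization.Away (X a : MvPolynomial (Fin (N + 1)) k))
    have h (n : ℕ) (P) (hP : P ∈ grading k N (n • 1)) : β (X a) ^ n * α (Away.mk _ ha n P hP) = β P := by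
      rw [HomogeneousLocalization.algebraMap_apply, Away.val_mk, ← map_pow,
        ← Localization.mk_one_eq_algebraMap, ← Localization.mk_one_eq_algebraMap, Localization.mk_mul,
        Localization.mk_eq_mk_iff, Localization.r_iff_exists]
      exact ⟨1, by simp [mul_comm]⟩
    have h1 : β P = β (X a) ^ n * (α.comp F₀) P := by
      refine map_eq_pow_mul (fun c => ?_) (fun e => ?_) (n := n) (by simpa using hP)
      · rw [RingHom.comp_apply, eval₂Hom_C]
        rfl
      · rw [RingHom.comp_apply, eval₂Hom_X', ← h 1 (X e) (hX e), pow_one]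
    apply HomogeneousLocalization.val_injective
    refine ((IsLocalization.Away.algebraMap_isUnit (S := Localization.Away (X a : MvPolynomial (Fin (N + 1)) k))
      (X a)).pow n).mul_left_cancel ((h n P hP).trans h1)
  have hu : s (F₀ (X a)) = 1 := by
    rw [← key 1 (X a) (hX a), ← map_one s]
    congr 1
    apply HomogeneousLocalization.val_injective
    rw [Away.val_mk, HomogeneousLocalization.val_one, ← Localization.mk_one, Localization.mk_eq_mk_iff,
      Localization.r_iff_exists]
    exact ⟨1, by simp⟩
  refine ⟨s.comp F₀, hu, awayEval_ext _ ha fun n P hP => ?_⟩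
  rw [RingHom.comp_apply, hu, one_pow, mul_one, key n P hP]
  rfl

/-- Dehomogenization: with the distinguished coordinate equal to 1, every value of F is a value on
the degree zero fractions. -/
lemma awayEval_range (a : Fin (N + 1)) (hu : F (X a) = 1) (P : MvPolynomial (Fin (N + 1)) k) :
    F P ∈ (awayEval (X a) F (hu ▸ isUnit_one)).range := by
  have ha : X a ∈ grading k N 1 := isHomogeneous_X _ _
  induction P using MvPolynomial.induction_on with
  | C c => exact ⟨_, awayEval_mk ha _ 0 _ (isHomogeneous_C _ _) hu⟩
  | add p q hp hq => rw [map_add]; exact add_mem hp hq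
  | mul_X p e hp =>
    rw [map_mul]
    exact mul_mem hp ⟨_, awayEval_mk ha _ 1 _ (isHomogeneous_X _ _) hu⟩

end ProjSpace
end

/-! ### Affine charts of closed subschemes of projective space. -/

noncomputable section

namespace ProjSpace
open ConjB HomogeneousLocalization MvPolynomial

attribute [local instance] MvPolynomial.gradedAlgebra

variable {k : Type u} [Field k] {N : ℕ} {C : Type u} [CommRing C]

lemma X_mem (a : Fin (N + 1)) : X a ∈ grading k N 1 := isHomogeneous_X _ _

/-- The inverse image of an affine open subset under a closed immersion. -/
lemma exists_chart_of_isClosedImmersion {T P : Scheme.{u}} (i : T ⟶ P) [IsClosedImmersion i]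
    {B : CommRingCat.{u}} (w : Spec B ⟶ P) [IsOpenImmersion w] :
    ∃ (A : CommRingCat.{u}) (s : B ⟶ A) (j : Spec A ⟶ T) (_ : IsOpenImmersion j),
      Function.Surjective s.hom ∧ j ≫ i = Spec.map s ≫ w ∧
      j.opensRange = i ⁻¹ᵁ w.opensRange := by
  obtain ⟨I, e, he⟩ := IsClosedImmersion.Spec_iff.1
    (inferInstance : IsClosedImmersion (pullback.snd i w))
  refine ⟨.of (B ⧸ I), CommRingCat.ofHom (Ideal.Quotient.mk I), e.inv ≫ pullback.fst i w, inferInstance,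
    Ideal.Quotient.mk_surjective, ?_, ?_⟩
  · rw [Category.assoc, pullback.condition, he, Category.assoc, Iso.inv_hom_id_assoc]
  · rw [Scheme.Hom.opensRange_comp_of_isIso, Scheme.Hom.opensRange_pullbackFst]

/-- The standard affine chart of a closed subscheme of projective space. -/
lemma exists_chart {T : Scheme.{u}} (i : T ⟶ Proj (grading k N)) [IsClosedImmersion i]
    (a : Fin (N + 1)) : ∃ (A : CommRingCat.{u}) (j : Spec A ⟶ T) (_ : IsOpenImmersion j)
      (F : MvPolynomial (Fin (N + 1)) k →+* A) (hF : F (X a) = 1), Function.Surjective F ∧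
      j ≫ i = projMap (X_mem a) one_pos (hF ▸ isUnit_one) ∧
      j.opensRange = i ⁻¹ᵁ Proj.basicOpen (grading k N) (X a) := by
  obtain ⟨A, s, j, hj, hs, hi, hr⟩ := exists_chart_of_isClosedImmersion i
    (Proj.awayι (grading k N) (X a) (X_mem a) one_pos)
  obtain ⟨F, hF, hFs⟩ := exists_awayEval_eq a s.hom
  refine ⟨A, j, hj, F, hF, fun x => ?_, ?_, ?_⟩
  · obtain ⟨z, rfl⟩ := hs x
    obtain ⟨n, P, hP, rfl⟩ := Away.mk_surjective _ (X_mem a) z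
    exact ⟨P, by rw [← awayEval_mk (X_mem a) (hF ▸ isUnit_one) n P hP hF, hFs]⟩
  · rw [projMap, hFs]
    exact hi
  · rw [hr, Proj.opensRange_awayι]

/-- The closed immersion property can be checked on a chart. -/
lemma isClosedImmersion_morphismRestrict {Z P Z' P' : Scheme.{u}} {h : Z ⟶ P} {c : Z' ⟶ Z} {j : P' ⟶ P}
    {v : Z' ⟶ P'} [IsOpenImmersion c] [IsOpenImmersion j] [IsClosedImmersion v] (hc : c ≫ h = v ≫ j)
    (U : P.Opens) (hU : j.opensRange = U) (hr : h ⁻¹ᵁ U = c.opensRange) :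
    IsClosedImmersion (h ∣_ U) := by
  subst hU
  have H := (IsOpenImmersion.isPullback v c j h hc hr).flip
  have H' := (isPullback_morphismRestrict h j.opensRange).flip
  let e : j.opensRange.toScheme ⟶ P' := IsOpenImmersion.lift j j.opensRange.ι (by simp)
  have he : e ≫ j = j.opensRange.ι := IsOpenImmersion.lift_fac _ _ _
  rw [← he] at H'
  have h1 : (h ⁻¹ᵁ j.opensRange).ι ≫ h = (h ∣_ j.opensRange ≫ e) ≫ j := by
    rw [Category.assoc, H'.w]
  have h2 : IsPullback (H.lift _ _ h1) (h ∣_ j.opensRange) v e :=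
    IsPullback.of_right (by rwa [H.lift_fst]) (H.lift_snd _ _ _) H
  exact MorphismProperty.of_isPullback h2 inferInstance

end ProjSpace
end

/-! ### Segre coordinates on the product charts. -/

noncomputable section

namespace ProjSpace
open ConjB HomogeneousLocalization MvPolynomial Quartic

attribute [local instance] MvPolynomial.gradedAlgebra

variable {k : Type u} [Field k] {N : ℕ}

/-- The number of the homogeneous coordinates of the target of the Segre embedding. -/
def prodIndex (N : ℕ) : Fin (N + 1) × Fin 4 ≃ Fin (4 * N + 3 + 1) :=
  finProdFinEquiv.trans (finCongr (by ring))

/-- The values `(1, x, x², y)` and `(x², x, 1, y)` of the homogeneous coordinates of the curve in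
weighted degree two. -/
def curveCoord (A : Type u) [CommRing A] : Bool → Fin 4 → Chart A
  | true => ![1, xC A, xC A ^ 2, yC A]
  | false => ![xC A ^ 2, xC A, 1, yC A]

/-- The coordinate which is `1` on a chart. -/
def unitIndex : Bool → Fin 4
  | true => 0
  | false => 2

lemma curveCoord_unitIndex (A : Type u) [CommRing A] (b : Bool) : curveCoord A b (unitIndex b) = 1 := by
  cases b <;> rfl

lemma curveCoord_one (A : Type u) [CommRing A] (b : Bool) : curveCoord A b 1 = xC A := by
  cases b <;> rfl

lemma curveCoord_three (A : Type u) [CommRing A] (b : Bool) : curveCoord A b 3 = yC A := by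
  cases b <;> rfl

/-- This and the next identity are the two quadrics that cut the curve out of ℙ³. -/
lemma curveCoord_sq (A : Type u) [CommRing A] (b : Bool) :
    curveCoord A b 1 ^ 2 = curveCoord A b 0 * curveCoord A b 2 := by
  cases b <;> simp [curveCoord]

lemma curveCoord_three_sq (A : Type u) [CommRing A] (b : Bool) :
    curveCoord A b 3 ^ 2 = curveCoord A b 0 ^ 2 + curveCoord A b 2 ^ 2 := by
  have := yC_sq (R := A)
  cases b <;> simp [curveCoord, this] <;> ring

section Coordinates

variable {A : Type u} [CommRing A] (F : MvPolynomial (Fin (N + 1)) k →+* A) (b : Bool)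

/-- The homogeneous coordinates of a product chart. -/
def prodCoord : MvPolynomial (Fin (4 * N + 3 + 1)) k →+* Chart A :=
  eval₂Hom ((constC A).comp (F.comp MvPolynomial.C)) fun e =>
    constC A (F (X ((prodIndex N).symm e).1)) * curveCoord A b ((prodIndex N).symm e).2

lemma prodCoord_C (c : k) : prodCoord F b (MvPolynomial.C c) = constC A (F (MvPolynomial.C c)) :=
  eval₂Hom_C _ _ _

lemma prodCoord_X (e : Fin (N + 1)) (c : Fin 4) : prodCoord F b (X (prodIndex N (e, c))) =
    constC A (F (X e)) * curveCoord A b c := by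
  rw [prodCoord, eval₂Hom_X', Equiv.symm_apply_apply]

lemma prodCoord_unit {a : Fin (N + 1)} (hF : F (X a) = 1) :
    prodCoord F b (X (prodIndex N (a, unitIndex b))) = 1 := by
  rw [prodCoord_X, hF, curveCoord_unitIndex, map_one, mul_one]

/-- Because one curve coordinate is 1 and one base coordinate is 1, the Segre coordinates contain
those of each factor; x and y themselves occur among the curve coordinates. -/
lemma prodCoord_surjective {a : Fin (N + 1)} (hF : F (X a) = 1) (hs : Function.Surjective F) :
    Function.Surjective (prodCoord F b) := by
  intro z
  change z ∈ (prodCoord F b).range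
  refine Chart.map_mem (RingHom.id (Chart A)) _ (fun r => ?_) ?_ ?_ z
  · obtain ⟨P, rfl⟩ := hs r
    induction P using MvPolynomial.induction_on with
    | C c => exact ⟨_, prodCoord_C F b c⟩
    | add p q hp hq => rw [map_add, map_add]; exact add_mem hp hq
    | mul_X p e hp =>
      rw [map_mul, map_mul]
      refine mul_mem hp ⟨X (prodIndex N (e, unitIndex b)), ?_⟩
      rw [prodCoord_X, curveCoord_unitIndex, mul_one]
  · exact ⟨X (prodIndex N (a, 1)), by rw [prodCoord_X, hF, curveCoord_one, map_one, one_mul]; rfl⟩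
  · exact ⟨X (prodIndex N (a, 3)), by rw [prodCoord_X, hF, curveCoord_three, map_one, one_mul]; rfl⟩

end Coordinates

lemma opensRange_resX (R : CommRingCat.{u}) :
    (Spec.map (CommRingCat.ofHom (resX R))).opensRange = PrimeSpectrum.basicOpen (xC R ^ 2) := by
  let := (resX R).toAlgebra
  have : IsLocalization.Away (xC R) (Overlap R) := isLocalization_resX
  rw [PrimeSpectrum.basicOpen_pow _ _ two_pos]
  exact Opens.ext (PrimeSpectrum.localization_away_comap_range (Overlap R) (xC (R : Type u)))

lemma opensRange_resX' (R : CommRingCat.{u}) :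
    (Spec.map (CommRingCat.ofHom (resX' R))).opensRange = PrimeSpectrum.basicOpen (xC R ^ 2) := by
  have h : CommRingCat.ofHom (resX' R) = CommRingCat.ofHom (resX R) ≫ (flipIso R).hom := rfl
  have h' : Spec.map (CommRingCat.ofHom (resX' R)) =
      Spec.map (flipIso R).hom ≫ Spec.map (CommRingCat.ofHom (resX R)) := by rw [h, Spec.map_comp]
  rw [← opensRange_resX, ← Scheme.Hom.opensRange_comp_of_isIso (Spec.map (flipIso R).hom)
    (Spec.map (CommRingCat.ofHom (resX R)))]
  congr 1

/-- On the opposite chart the coordinate in question is x², which is invertible exactly on the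
overlap. -/
lemma chart_preimage_opensRange (R : CommRingCat.{u}) (b b' : Bool) :
    chart R b' ⁻¹ᵁ (chart R b).opensRange =
      PrimeSpectrum.basicOpen (curveCoord R b' (unitIndex b)) := by
  have h (b) : chart R b ⁻¹ᵁ (chart R b).opensRange =
      PrimeSpectrum.basicOpen (curveCoord R b (unitIndex b)) := by
    rw [curveCoord_unitIndex, PrimeSpectrum.basicOpen_one, Scheme.Hom.preimage_opensRange]
    rfl
  rcases b with _ | _ <;> rcases b' with _ | _
  · exact h _
  · exact (isTwoCover_curve R).preimage_opensRange.trans (opensRange_resX R)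
  · exact (isTwoCover_curve R).symm.preimage_opensRange.trans (opensRange_resX' R)
  · exact h _

end ProjSpace
end

/-! ### Proportionality of coordinates on overlaps. -/

noncomputable section

namespace ProjSpace
open ConjB HomogeneousLocalization MvPolynomial Quartic

attribute [local instance] MvPolynomial.gradedAlgebra

/-- With x' = 1/x and y' = y/x² the vectors (1, x, x², y) and (x'², x', 1, y') differ by the factor
x'². -/
lemma curveCoord_proportional {R C : CommRingCat.{u}} (h : Spec C ⟶ curve R) (b b' : Bool)
    (χ χ' : CommRingCat.of (Chart R) ⟶ C) (hχ : Spec.map χ ≫ chart R b = h)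
    (hχ' : Spec.map χ' ≫ chart R b' = h) :
    ∃ m, IsUnit m ∧ ∀ c, χ'.hom (curveCoord R b' c) = m * χ.hom (curveCoord R b c) := by
  by_cases hb : b = b'
  · subst hb
    rw [← hχ', cancel_mono] at hχ
    have := Spec.map_injective hχ
    subst this
    exact ⟨1, isUnit_one, fun c => (one_mul _).symm⟩
  · have key (b₁ : Bool) (χ₁ χ₂ : CommRingCat.of (Chart R) ⟶ C) (h₁ : Spec.map χ₁ ≫ chart R b₁ = h)
        (h₂ : Spec.map χ₂ ≫ chart R (!b₁) = h) : χ₁.hom (xC R) * χ₂.hom (xC R) = 1 ∧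
        χ₂.hom (yC R) = χ₂.hom (xC R) ^ 2 * χ₁.hom (yC R) := by
      cases b₁
      · obtain ⟨h1, h2⟩ := exists_coordinates C h (Bool.rec χ₁ χ₂) (by rintro (_ | _) <;> assumption)
        refine ⟨h1, ?_⟩
        change χ₁.hom (xC R) * χ₂.hom (xC R) = 1 at h1
        change χ₁.hom (yC R) = χ₁.hom (xC R) ^ 2 * χ₂.hom (yC R) at h2
        rw [h2]
        linear_combination (-χ₂.hom (yC R) * (1 + χ₁.hom (xC R) * χ₂.hom (xC R))) * h1
      · obtain ⟨h1, h2⟩ := exists_coordinates C h (Bool.rec χ₂ χ₁) (by rintro (_ | _) <;> assumption)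
        exact ⟨(mul_comm _ _).trans h1, h2⟩
    have hb' : b' = !b := by cases b <;> cases b' <;> simp_all
    subst hb'
    obtain ⟨h1, h2⟩ := key b χ χ' hχ hχ'
    refine ⟨χ'.hom (xC R) ^ 2, (IsUnit.of_mul_eq_one _ ((mul_comm _ _).trans h1)).pow 2, fun c => ?_⟩
    cases b <;> fin_cases c <;> simp [curveCoord, h2]
    all_goals first
      | linear_combination (-1 - χ.hom (xC R) * χ'.hom (xC R)) * h1
      | linear_combination (-χ'.hom (xC R)) * h1

variable {k : Type u} [Field k] {N : ℕ} {R : CommRingCat.{u}} {T Z : Scheme.{u}} {f : T ⟶ Spec R}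
  {p : Z ⟶ T} {g : Z ⟶ curve R} (H : IsPullback p g f (curveHom R))

lemma Chart.map_curveCoord {A B : Type u} [CommRing A] [CommRing B] (φ : A →+* B) (b : Bool) (c : Fin 4) :
    Chart.map φ (curveCoord A b c) = curveCoord B b c := by
  have hx : Chart.map φ (xC A) = xC B := Chart.lift_x _ _ _ _
  have hy : Chart.map φ (yC A) = yC B := Chart.lift_y _ _ _ _
  cases b <;> fin_cases c <;> simp [curveCoord, hx, hy]

section Overlap

variable {i : T ⟶ Proj (grading k N)} {A A' : CommRingCat.{u}} {j : Spec A ⟶ T} {j' : Spec A' ⟶ T}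
  {F : MvPolynomial (Fin (N + 1)) k →+* A} {F' : MvPolynomial (Fin (N + 1)) k →+* A'}
  {a a' : Fin (N + 1)} (hF : F (X a) = 1) (hF' : F' (X a') = 1)

/-- The homogeneous coordinates of product charts are proportional on overlaps. -/
lemma prodCoord_proportional
    (hj : j ≫ i = projMap (X_mem a) one_pos (hF ▸ isUnit_one))
    (hj' : j' ≫ i = projMap (X_mem a') one_pos (hF' ▸ isUnit_one)) (b b' : Bool) {C : CommRingCat.{u}}
    (ψ : CommRingCat.of (Chart A) ⟶ C) (ψ' : CommRingCat.of (Chart A') ⟶ C)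
    (h : Spec.map ψ ≫ prodChart H j b = Spec.map ψ' ≫ prodChart H j' b') :
    ∃ l, IsUnit l ∧
      (∀ c, (ψ'.hom.comp (prodCoord F' b')) (MvPolynomial.C c) =
        (ψ.hom.comp (prodCoord F b)) (MvPolynomial.C c)) ∧
      ∀ e, (ψ'.hom.comp (prodCoord F' b')) (X e) = l * (ψ.hom.comp (prodCoord F b)) (X e) := by
  obtain ⟨m, hm, hmc⟩ := curveCoord_proportional (R := R) (Spec.map ψ ≫ prodChart H j b ≫ g) b b'
    (CommRingCat.ofHom (Chart.map (Spec.preimage (j ≫ f)).hom) ≫ ψ)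
    (CommRingCat.ofHom (Chart.map (Spec.preimage (j' ≫ f)).hom) ≫ ψ')
    (by rw [Spec.map_comp, Category.assoc, prodChart_snd])
    (by rw [Spec.map_comp, Category.assoc, ← prodChart_snd H j' b', ← Category.assoc, ← h, Category.assoc])
  have h1 := congr($h ≫ p ≫ i)
  simp only [Category.assoc] at h1
  rw [← Category.assoc (prodChart _ _ _), ← Category.assoc (prodChart _ _ _), prodChart_fst, prodChart_fst,
    Category.assoc, Category.assoc, hj, hj', ← Category.assoc, ← Category.assoc, ← Spec.map_comp,
    ← Spec.map_comp] at h1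
  have h2 : projMap (F := (ψ.hom.comp (constC A)).comp F) (X_mem a) one_pos
      (by simp [hF]) = projMap (F := (ψ'.hom.comp (constC A')).comp F') (X_mem a') one_pos
      (by simp [hF']) := by
    rw [← map_comp_projMap, ← map_comp_projMap]
    exact h1
  obtain ⟨hl, hc, he⟩ := eq_of_projMap_eq (X_mem a) (X_mem a') (by simp [hF]) (by simp [hF']) h2
  refine ⟨_, hl.mul hm, fun c => ?_, fun e => ?_⟩
  · have := hc c
    rw [RingHom.comp_apply, RingHom.comp_apply, prodCoord_C, prodCoord_C]
    exact this
  · obtain ⟨⟨e, c⟩, rfl⟩ := (prodIndex N).surjective e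
    have h3 := hmc c
    have h4 := he e
    change ψ'.hom (prodCoord F' b' _) = _ * _ * ψ.hom (prodCoord F b _)
    rw [prodCoord_X, prodCoord_X, map_mul, map_mul]
    have h5 : ψ'.hom (curveCoord A' b' c) = m * ψ.hom (curveCoord A b c) := by
      rw [← Chart.map_curveCoord (Spec.preimage (j ≫ f)).hom b c, 
        ← Chart.map_curveCoord (Spec.preimage (j' ≫ f)).hom b' c]
      exact h3
    have h6 : ψ'.hom (constC A' (F' (X e))) = _ * ψ.hom (constC A (F (X e))) := h4
    rw [h5, h6]
    ring

end Overlap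

end ProjSpace
end

/-! ### Covering the target by coordinate charts and complements of quadrics. -/

noncomputable section

namespace ProjSpace
open ConjB HomogeneousLocalization MvPolynomial Quartic

attribute [local instance] MvPolynomial.gradedAlgebra

variable {k : Type u} [Field k] {N : ℕ} 

lemma exists_X_notMem (x : Proj (grading k N)) : ∃ a, x ∈ Proj.basicOpen (grading k N) (X a) := by
  have h : ⨆ a, Proj.basicOpen (grading k N) (X a) = ⊤ := by
    refine Proj.iSup_basicOpen_eq_top' _ _ (fun a => ⟨1, X_mem a⟩) ?_
    rw [eq_top_iff]
    rintro P -
    induction P using MvPolynomial.induction_on with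
    | C c => exact Subalgebra.algebraMap_mem _ (⟨MvPolynomial.C c, isHomogeneous_C _ _⟩ : grading k N 0)
    | add p q hp hq => exact add_mem hp hq
    | mul_X p e hp => exact mul_mem hp (Algebra.subset_adjoin ⟨e, rfl⟩)
  have : x ∈ ⨆ a, Proj.basicOpen (grading k N) (X a) := h ▸ trivial
  simpa using this

/-- The quadratic equations of the weighted curve. -/
def quadric (N : ℕ) (k : Type u) [Field k] (a : Fin (N + 1)) : Bool → MvPolynomial (Fin (4 * N + 3 + 1)) k
  | true => X (prodIndex N (a, 3)) ^ 2 - (X (prodIndex N (a, 0)) ^ 2 + X (prodIndex N (a, 2)) ^ 2)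
  | false => X (prodIndex N (a, 1)) ^ 2 - X (prodIndex N (a, 0)) * X (prodIndex N (a, 2))

lemma quadric_mem (a : Fin (N + 1)) (b : Bool) : quadric N k a b ∈ grading k (4 * N + 3) 2 := by
  have h (e) : (X e : MvPolynomial (Fin (4 * N + 3 + 1)) k) ^ 2 ∈ grading k (4 * N + 3) 2 :=
    (isHomogeneous_X _ e).pow 2
  have h' (e e') : (X e * X e' : MvPolynomial (Fin (4 * N + 3 + 1)) k) ∈ grading k (4 * N + 3) 2 :=
    (isHomogeneous_X _ e).mul (isHomogeneous_X _ e')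
  cases b
  · exact sub_mem (h _) (h' _ _)
  · exact sub_mem (h _) (add_mem (h _) (h _))

lemma prodCoord_quadric {A : Type u} [CommRing A] (F : MvPolynomial (Fin (N + 1)) k →+* A) (b : Bool)
    (a : Fin (N + 1)) (b' : Bool) : prodCoord F b (quadric N k a b') = 0 := by
  cases b'
  · simp only [quadric, map_sub, map_mul, map_pow, prodCoord_X]
    linear_combination (constC A (F (X a))) ^ 2 * curveCoord_sq A b
  · simp only [quadric, map_sub, map_add, map_pow, prodCoord_X]
    linear_combination (constC A (F (X a))) ^ 2 * curveCoord_three_sq A b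

/-- If the coordinates of index 0 and 2 and both quadrics vanish, then so do the squares of the
coordinates of index 1 and 3, leaving no nonzero coordinate. -/
lemma exists_mem_basicOpen (x : Proj (grading k (4 * N + 3))) :
    (∃ a b, x ∈ Proj.basicOpen (grading k (4 * N + 3)) (X (prodIndex N (a, unitIndex b)))) ∨
      ∃ a b, x ∈ Proj.basicOpen (grading k (4 * N + 3)) (quadric N k a b) := by
  by_contra! hx
  obtain ⟨e, he⟩ := exists_X_notMem x
  obtain ⟨⟨a, c⟩, rfl⟩ := (prodIndex N).surjective e
  refine he ?_
  let I := x.asHomogeneousIdeal.toIdeal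
  have hI : I.IsPrime := x.isPrime
  have h1 (b) : X (prodIndex N (a, unitIndex b)) ∈ I := not_not.1 (hx.1 a b)
  have h2 (b) : quadric N k a b ∈ I := not_not.1 (hx.2 a b)
  change X (prodIndex N (a, c)) ∈ I
  have h0 : X (prodIndex N (a, 0)) ∈ I := h1 true
  have h2' : X (prodIndex N (a, 2)) ∈ I := h1 false
  fin_cases c
  · exact h0
  · refine hI.mem_of_pow_mem 2 ?_
    have := add_mem (h2 false) (I.mul_mem_right (X (prodIndex N (a, 2))) h0)
    simpa [quadric] using this
  · exact h2'
  · refine hI.mem_of_pow_mem 2 ?_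
    have := add_mem (h2 true) (add_mem (I.pow_mem_of_mem h0 2 two_pos) (I.pow_mem_of_mem h2' 2 two_pos))
    simpa [quadric] using this

end ProjSpace
end

/-! ### The closed immersion of the product. -/

noncomputable section

namespace ProjSpace
open ConjB HomogeneousLocalization MvPolynomial Quartic

attribute [local instance] MvPolynomial.gradedAlgebra

/-- Morphisms on the members of an open cover can be glued if they agree on affine test schemes. -/
lemma exists_glue {Z P : Scheme.{u}} {ι : Type} {Y : ι → Scheme.{u}} (c : ∀ x, Y x ⟶ Z)
    [∀ x, IsOpenImmersion (c x)] (hc : ∀ z, ∃ x, z ∈ (c x).opensRange) (v : ∀ x, Y x ⟶ P)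
    (hv : ∀ (x y) (C : CommRingCat.{u}) (s : Spec C ⟶ Y x) (t : Spec C ⟶ Y y), s ≫ c x = t ≫ c y →
      s ≫ v x = t ≫ v y) : ∃ h : Z ⟶ P, ∀ x, c x ≫ h = v x := by
  let 𝒰 : Z.OpenCover := .mkOfCovers ι Y c hc (fun x => inferInstance)
  refine ⟨Scheme.Cover.glueMorphisms 𝒰 v fun x y => ?_, Scheme.Cover.ι_glueMorphisms 𝒰 _ _⟩
  refine Scheme.Cover.hom_ext (pullback (𝒰.f x) (𝒰.f y)).affineCover _ _ fun w => ?_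
  refine (Category.assoc _ _ _).symm.trans (.trans ?_ (Category.assoc _ _ _))
  refine hv x y _ _ _ ?_
  refine (Category.assoc _ _ _).trans (.trans ?_ (Category.assoc _ _ _).symm)
  exact congrArg (_ ≫ ·) pullback.condition

variable {k : Type u} [Field k] {N : ℕ} {R : CommRingCat.{u}} {T Z : Scheme.{u}} {f : T ⟶ Spec R}
  {p : Z ⟶ T} {g : Z ⟶ curve R} (H : IsPullback p g f (curveHom R))

lemma opens_ext_of_cover {Z : Scheme.{u}} {U V : Z.Opens} {ι : Type} {Y : ι → Scheme.{u}}
    (c : ∀ x, Y x ⟶ Z) [∀ x, IsOpenImmersion (c x)] (hc : ∀ z, ∃ x, z ∈ (c x).opensRange)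
    (h : ∀ x, c x ⁻¹ᵁ U = c x ⁻¹ᵁ V) : U = V := by
  ext z
  obtain ⟨x, y, rfl⟩ := hc z
  exact SetLike.ext_iff.1 (h x) y

/-- Shows that the inverse image of a standard affine of the target is exactly one product chart, so
that closedness can be tested there. -/
lemma preimage_opensRange_prodChart {i : T ⟶ Proj (grading k N)} {A A' : CommRingCat.{u}}
    {j : Spec A ⟶ T} {j' : Spec A' ⟶ T} [IsOpenImmersion j] [IsOpenImmersion j']
    {F' : MvPolynomial (Fin (N + 1)) k →+* A'} {a a' : Fin (N + 1)} (hF' : F' (X a') = 1)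
    (hj : j.opensRange = i ⁻¹ᵁ Proj.basicOpen (grading k N) (X a))
    (hj' : j' ≫ i = projMap (X_mem a') one_pos (hF' ▸ isUnit_one)) (b b' : Bool) :
    prodChart H j' b' ⁻¹ᵁ (prodChart H j b).opensRange =
      PrimeSpectrum.basicOpen (prodCoord F' b' (X (prodIndex N (a, unitIndex b)))) := by
  rw [opensRange_prodChart, prodCoord_X, PrimeSpectrum.basicOpen_mul, Scheme.Hom.preimage_inf,
    ← Scheme.Hom.comp_preimage, ← Scheme.Hom.comp_preimage, prodChart_fst, prodChart_snd,
    Scheme.Hom.comp_preimage, Scheme.Hom.comp_preimage, chart_preimage_opensRange, hj,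
    ← Scheme.Hom.comp_preimage j', hj', projMap_preimage_basicOpen _ _ _ (X_mem a) one_pos,
    ← Chart.map_curveCoord (Spec.preimage (j' ≫ f)).hom b' (unitIndex b)]
  rfl

/-- The product of a projective scheme with the curve of genus one is projective. -/
theorem exists_isClosedImmersion (H : IsPullback p g f (curveHom R)) (i : T ⟶ Proj (grading k N))
    [IsClosedImmersion i] : ∃ h : Z ⟶ Proj (grading k (4 * N + 3)), IsClosedImmersion h ∧
      h ≫ (projectiveSpaceHom k (4 * N + 3) :) = p ≫ i ≫ (projectiveSpaceHom k N :) := by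
  choose A j hj F hF hFs hji hjr using fun a => exists_chart i a
  let c (x : Fin (N + 1) × Bool) := prodChart H (j x.1) x.2
  have hc : ∀ z, ∃ x, z ∈ (c x).opensRange := by
    refine exists_mem_opensRange_prodChart H A j fun t => ?_
    obtain ⟨a, ha⟩ := exists_X_notMem (i t)
    refine ⟨a, ?_⟩
    change t ∈ (j a).opensRange
    rw [hjr]
    exact ha
  have hu (x : Fin (N + 1) × Bool) := (prodCoord_unit (F x.1) x.2 (hF x.1)).symm ▸ isUnit_one
  let v (x : Fin (N + 1) × Bool) : Spec (.of (Chart (A x.1))) ⟶ Proj (grading k (4 * N + 3)) :=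
    projMap (X_mem (prodIndex N (x.1, unitIndex x.2))) one_pos (hu x)
  obtain ⟨h, hh⟩ := exists_glue c hc v (by
    intro x y C s t hst
    obtain ⟨ψ, rfl⟩ := Spec.map_surjective s
    obtain ⟨ψ', rfl⟩ := Spec.map_surjective t
    obtain ⟨l, hl, h1, h2⟩ := prodCoord_proportional H (hF x.1) (hF y.1) (hji x.1) (hji y.1) x.2 y.2 ψ ψ' hst
    refine (map_comp_projMap _ _ (hu x) ψ.hom ((hu x).map ψ.hom)).trans (.trans ?_
      (map_comp_projMap _ _ (hu y) ψ'.hom ((hu y).map ψ'.hom)).symm)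
    exact projMap_eq _ _ _ _ _ _ hl h1 h2)
  have hpre (x : Fin (N + 1) × Bool) {t} {d : ℕ} (ht : t ∈ grading k (4 * N + 3) d) (hd : 0 < d) :
      c x ⁻¹ᵁ (h ⁻¹ᵁ Proj.basicOpen _ t) = PrimeSpectrum.basicOpen (prodCoord (F x.1) x.2 t) := by
    rw [← Scheme.Hom.comp_preimage, hh]
    exact projMap_preimage_basicOpen _ _ (hu x) ht hd
  refine ⟨h, ?_, ?_⟩
  -- Only the coordinates of index 0 and 2 have a product chart as inverse image. They do not cover
  -- the target, so complements of the quadrics are added; those do not meet the image.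
  · let U : (Fin (N + 1) × Bool) ⊕ (Fin (N + 1) × Bool) → (Proj (grading k (4 * N + 3))).Opens :=
      Sum.elim (fun x => Proj.basicOpen _ (X (prodIndex N (x.1, unitIndex x.2))))
        (fun x => Proj.basicOpen _ (quadric N k x.1 x.2))
    refine IsZariskiLocalAtTarget.of_iSup_eq_top (P := @IsClosedImmersion) U ?_ ?_
    · refine top_le_iff.1 fun x _ => Opens.mem_iSup.2 ?_
      rcases exists_mem_basicOpen x with ⟨a, b, hx⟩ | ⟨a, b, hx⟩
      · exact ⟨Sum.inl (a, b), hx⟩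
      · exact ⟨Sum.inr (a, b), hx⟩
    · rintro (x | x)
      · have hcl : IsClosedImmersion (Spec.map (CommRingCat.ofHom
            (awayEval _ (prodCoord (F x.1) x.2) (hu x)))) := by
          refine IsClosedImmersion.spec_of_surjective _ fun z => ?_
          obtain ⟨P, rfl⟩ := prodCoord_surjective (F x.1) x.2 (hF x.1) (hFs x.1) z
          exact awayEval_range _ (prodCoord_unit (F x.1) x.2 (hF x.1)) P
        refine isClosedImmersion_morphismRestrict (c := c x) (j := Proj.awayι _ _
          (X_mem (prodIndex N (x.1, unitIndex x.2))) one_pos)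
          (v := Spec.map (CommRingCat.ofHom (awayEval _ _ (hu x)))) (hh x) _
          (Proj.opensRange_awayι _ _ _ _) ?_
        refine opens_ext_of_cover c hc fun y => (hpre y (X_mem _) one_pos).trans ?_
        exact (preimage_opensRange_prodChart H (hF y.1) (hjr x.1) (hji y.1) x.2 y.2).symm
      · have h0 : h ⁻¹ᵁ Proj.basicOpen _ (quadric N k x.1 x.2) = ⊥ := by
          refine opens_ext_of_cover c hc fun y => (hpre y (quadric_mem _ _) two_pos).trans ?_
          rw [prodCoord_quadric, PrimeSpectrum.basicOpen_zero]
          rfl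
        have : IsEmpty (h ⁻¹ᵁ Proj.basicOpen _ (quadric N k x.1 x.2)).toScheme := by
          rw [h0]
          exact inferInstanceAs (IsEmpty (∅ : Set Z))
        exact (inferInstance : IsClosedImmersion (h ∣_ Proj.basicOpen _ (quadric N k x.1 x.2)))
  · let 𝒰 : Z.OpenCover := .mkOfCovers _ _ c hc (fun x => inferInstance)
    refine Scheme.Cover.hom_ext 𝒰 _ _ fun x => ?_
    refine (Category.assoc _ _ _).symm.trans ((congrArg (· ≫ _) (hh x)).trans ?_)
    refine (projMap_comp_projectiveSpaceHom _ _ (hu x)).trans ?_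
    refine .trans ?_ (Category.assoc _ _ _)
    refine .trans ?_ (congrArg (· ≫ _) (prodChart_fst H (j x.1) x.2)).symm
    refine .trans ?_ (Category.assoc _ _ _).symm
    refine .trans ?_ (congrArg (_ ≫ ·) (Category.assoc _ _ _))
    refine .trans ?_ (congrArg (fun m => _ ≫ m ≫ _) (hji x.1)).symm
    refine .trans ?_ (congrArg (_ ≫ ·) (projMap_comp_projectiveSpaceHom _ _ _)).symm
    rw [← Spec.map_comp, ← CommRingCat.ofHom_comp]
    congr 2
    exact RingHom.ext fun r => prodCoord_C _ _ r

end ProjSpace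
end

/-! ### The product variety, the product model and its fibres. -/

noncomputable section

namespace ProjSpace
open ConjB Quartic

attribute [local instance] MvPolynomial.gradedAlgebra

lemma surjective_algebraMap_zero (k : Type u) [Field k] (N : ℕ) :
    Function.Surjective (algebraMap k (grading k N 0)) := by
  rintro ⟨P, hP⟩
  have h := MvPolynomial.totalDegree_eq_zero_iff_eq_C.1
    ((MvPolynomial.totalDegree_zero_iff_isHomogeneous _).2 hP)
  exact ⟨_, Subtype.ext h.symm⟩

instance locallyOfFiniteType_projectiveSpaceHom (k : Type u) [Field k] (N : ℕ) :
    LocallyOfFiniteType (projectiveSpaceHom k N) := by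
  have : Algebra.FiniteType (grading k N 0) (MvPolynomial (Fin (N + 1)) k) :=
    have : IsScalarTower k (grading k N 0) (MvPolynomial (Fin (N + 1)) k) :=
      IsScalarTower.of_algebraMap_eq (R := k) (S := grading k N 0)
        (A := MvPolynomial (Fin (N + 1)) k) fun _ => rfl
    Algebra.FiniteType.of_restrictScalars_finiteType k _ _
  have h1 : LocallyOfFiniteType (Proj.toSpecZero (grading k N)) := inferInstance
  have h2 : LocallyOfFiniteType (Spec.map (CommRingCat.ofHom (algebraMap k (grading k N 0)))) := by
    rw [HasRingHomProperty.Spec_iff (P := @LocallyOfFiniteType)]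
    exact RingHom.FiniteType.of_surjective _ (surjective_algebraMap_zero k N)
  exact MorphismProperty.comp_mem (@LocallyOfFiniteType) _ _ h1 h2

end ProjSpace

namespace ConjB

lemma IsProjectiveVariety.locallyOfFiniteType {k : Type u} [Field k] {V : Scheme.{u}}
    {q : V ⟶ Spec (.of k)} {n : ℕ} (h : IsProjectiveVariety q n) : LocallyOfFiniteType q := by
  obtain ⟨N, i, hi, rfl⟩ := h.projective
  infer_instance

end ConjB

namespace Quartic
open ConjB

attribute [local instance] MvPolynomial.gradedAlgebra

lemma isProjectiveVariety_of_isPullback {R : CommRingCat.{u}} {T Z : Scheme.{u}} {f : T ⟶ Spec R}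
    {p : Z ⟶ T} {g : Z ⟶ curve R} (H : IsPullback p g f (curveHom R)) {k : Type u} [Field k] [CharZero k]
    {q : T ⟶ Spec (.of k)} {n : ℕ} (h : IsProjectiveVariety q n) :
    IsProjectiveVariety (p ≫ q) (n + 1) := by
  have := h.integral
  have := h.locallyOfFiniteType
  have : IsLocallyNoetherian T := LocallyOfFiniteType.isLocallyNoetherian q
  refine ⟨isIntegral_of_isPullback H q, ?_, topologicalKrullDim_of_isPullback H h.dim⟩
  obtain ⟨N, i, hi, hq⟩ := h.projective
  have hi' : @IsClosedImmersion T (Proj (ProjSpace.grading k N)) i := hi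
  obtain ⟨j, hj, hjp⟩ := ProjSpace.exists_isClosedImmersion H i
  exact ⟨_, j, hj, hjp.trans (congrArg (p ≫ ·) hq)⟩

/-- The morphism to the spectrum of the integers. -/
abbrev toInt (T : Scheme.{u}) : T ⟶ Spec (.of (ULift.{u} ℤ)) := specULiftZIsTerminal.from T

/-- The product of a scheme with the curve of genus one. -/
abbrev prodCurve (T : Scheme.{u}) : Scheme.{u} := pullback (toInt T) (curveHom (.of (ULift.{u} ℤ)))

/-- The projection to the first factor. -/
abbrev prodFst (T : Scheme.{u}) : prodCurve T ⟶ T := pullback.fst _ _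

/-- The functoriality of the product with the curve. -/
abbrev prodMap {S T : Scheme.{u}} (h : S ⟶ T) : prodCurve S ⟶ prodCurve T :=
  pullback.map _ _ _ _ h (𝟙 _) (𝟙 _) (specULiftZIsTerminal.hom_ext _ _) (by simp)

/-- Since the curve lives over ℤ, its product with any scheme is compatible with every base change,
in particular with passing from a model to its generic geometric fibre. -/
lemma isPullback_prodMap {S T : Scheme.{u}} (h : S ⟶ T) :
    IsPullback (prodMap h) (prodFst S) (prodFst T) h := by
  have h1 := IsPullback.of_hasPullback (toInt T) (curveHom (.of (ULift.{u} ℤ)))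
  have h2 := IsPullback.of_hasPullback (toInt S) (curveHom (.of (ULift.{u} ℤ)))
  refine IsPullback.of_right (h₁₂ := pullback.snd _ _) (h₂₂ := toInt T) (v₁₃ := curveHom _) ?_ ?_ h1.flip
  · rw [specULiftZIsTerminal.hom_ext (h ≫ toInt T) (toInt S)]
    have e : prodMap h ≫ pullback.snd (toInt T) _ = pullback.snd (toInt S) _ :=
      (pullback.lift_snd _ _ _).trans (Category.comp_id _)
    rw [e]
    exact h2.flip
  · exact pullback.lift_fst _ _ _

/-- The product of a model with the curve of genus one. -/
def prodModel {k : Type u} [Field k] {V : Scheme.{u}} {q : V ⟶ Spec (.of k)} {A : Subalgebra ℤ k}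
    (M : Model q A) : Model (prodFst V ≫ q) A where
  X := prodCurve M.X
  f := prodFst M.X ≫ M.f
  g := prodMap M.g
  locallyOfFiniteType := by
    have := M.locallyOfFiniteType
    infer_instance
  quasiCompact := by
    have := M.quasiCompact
    infer_instance
  flat := by
    have := M.flat
    infer_instance
  isPullback := (isPullback_prodMap M.g).flip.paste_horiz M.isPullback.flip |>.flip

/-- The bijectivity of Frobenius descends from the product with the curve of genus one. -/
lemma frobeniusBijectiveAt_of_prodCurve {X T : Scheme.{u}} (f : X ⟶ T) [LocallyOfFiniteType f]
    [QuasiCompact f] (s : T) (n : ℕ) (h : FrobeniusBijectiveAt (prodFst X ≫ f) s (n + 1)) :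
    FrobeniusBijectiveAt f s n := by
  obtain ⟨ℓ, hℓ, hc, hF⟩ := h
  refine ⟨ℓ, hℓ, hc, ?_⟩
  let p : (prodFst X ≫ f).fiber s ⟶ f.fiber s :=
    pullback.map _ _ _ _ (prodFst X) (𝟙 _) (𝟙 _) (by simp) (by simp)
  -- The fibre of the product is the product of the fibre with the curve.
  have H1 : IsPullback ((prodFst X ≫ f).fiberι s) p (prodFst X) (f.fiberι s) := by
    refine IsPullback.of_bot (v₂₁ := f.fiberToSpecResidueField s) ?_ ?_
      (IsPullback.of_hasPullback f (T.fromSpecResidueField s))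
    · have e : p ≫ f.fiberToSpecResidueField s = (prodFst X ≫ f).fiberToSpecResidueField s :=
        (pullback.lift_snd _ _ _).trans (Category.comp_id _)
      rw [e]
      exact IsPullback.of_hasPullback _ _
    · exact (pullback.lift_fst _ _ _).symm
  have H2 : IsPullback p ((prodFst X ≫ f).fiberι s ≫ pullback.snd _ _) (toInt _)
      (curveHom (.of (ULift.{u} ℤ))) := by
    have := H1.paste_horiz (IsPullback.of_hasPullback (toInt X) (curveHom (.of (ULift.{u} ℤ)))).flip
    rw [specULiftZIsTerminal.hom_ext (f.fiberι s ≫ toInt X) (toInt _)] at this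
    exact this.flip
  have : LocallyOfFiniteType (f.fiberToSpecResidueField s) :=
    inferInstanceAs (LocallyOfFiniteType (pullback.snd f (T.fromSpecResidueField s)))
  have : QuasiCompact (f.fiberToSpecResidueField s) :=
    inferInstanceAs (QuasiCompact (pullback.snd f (T.fromSpecResidueField s)))
  -- A fibre of finite type over a field is Noetherian, which provides the quasi-separatedness
  -- needed for flat base change without assuming the model separated.
  have : IsLocallyNoetherian (f.fiber s) := LocallyOfFiniteType.isLocallyNoetherian (f.fiberToSpecResidueField s)
  have : CompactSpace (f.fiber s) := QuasiCompact.compactSpace_of_compactSpace (f.fiberToSpecResidueField s)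
  exact frobeniusAction_bijective_of_isPullback H2 hℓ _ _ n hF

end Quartic

end

/-! ### The reduction to the product with the curve. -/

open ConjB Quartic in
theorem lemma3p3 (n : ℕ) (h : ConjB.ConjectureB.{u} (n + 1)) : ConjB.ConjectureB.{u} n := by
  intro k _ _ _ V _ q hV hrat hcan A hA M
  have H := IsPullback.of_hasPullback (toInt V) (curveHom (.of (ULift.{u} ℤ)))
  have hZ := isProjectiveVariety_of_isPullback H hV
  have := hZ.integral
  have := hV.locallyOfFiniteType
  have : IsLocallyNoetherian V := LocallyOfFiniteType.isLocallyNoetherian q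
  obtain ⟨S, hS, hd, hF⟩ := h k (prodCurve V) (prodFst V ≫ q) hZ
    (hasRationalSingularities_of_isPullback H q hrat)
    (isCanonicalTrivial_of_isPullback H q hV.dim hcan) A hA (prodModel M)
  have := M.locallyOfFiniteType
  have := M.quasiCompact
  exact ⟨S, hS, hd, fun s hs => frobeniusBijectiveAt_of_prodCurve M.f s n (hF s hs)⟩
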